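/- Let $M$ be a smooth manifold without boundary with an exact symplectic form $\Omega=d\vartheta$ ($\vartheta$ a smooth $1$-form, $\Omega$ non-degenerate), and let $\Phi$ be a smooth diffeomorphism of an open set $\Sigma\subseteq M$ onto an open set $\Phi(\Sigma)\subseteq M$ with $\Phi^*\Omega=\Omega$. Let $A\subset\Sigma$ be a compact embedded $C^2$ submanifold of $M$, possibly with boundary (for instance a cylinder $\mathbb S^1\times[0,1]$), with $\Phi(A)=A$, which is symmetrically normally hyperbolic: there are splittings $T_vM=N^s_v\oplus N^u_v\oplus T_vA$, $v\in A$, into three non-zero subspaces, continuous in $v$ and invariant under $\Phi'$, continuous norms on them, and constants $\alpha>1$, $0<\lambda<1$ with $\alpha^2\lambda<1$ such that for $v\in A$ $$\|\Phi'|_{T_vA}\|<\alpha,\quad \|(\Phi'|_{T_vA})^{-1}\|<\alpha,\quad \|\Phi'|_{N^s_v}\|<\lambda,\quad \|(\Phi'|_{N^u_v})^{-1}\|<\lambda .$$ Fix a Riemannian distance on $M$. For $x\in A$ let $E^{ss}(x)$ be the strong stable leaf of $x$, i.e. the set of points $y$ whose forward orbit is defined and satisfies $d(\Phi^m y,\Phi^m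 x)=O(\lambda^m)$ as $m\to+\infty$; let $E^{uu}(x)$ be the strong unstable leaf, defined in the same way by $\Phi^{-1}$; let $W^{s}(A)=\bigcup_{x\in A}E^{ss}(x)$ and $W^{u}(A)=\bigcup_{x\in A}E^{uu}(x)$. Assume that $W^u(A)\subseteq\Sigma$ and $W^s(A)\subseteq\Phi(\Sigma)$ (so that all iterates of $\Phi$ are defined on the leaves; this holds automatically if $\Phi$ is a diffeomorphism $M\to M$), or else that $\Phi$ is exact, i.e. $\oint_\gamma\vartheta=\oint_{\Phi(\gamma)}\vartheta$ for every $C^1$ closed curve $\gamma\subset\Sigma$. Let $B$ be a $C^1$ manifold without boundary, injectively immersed in the immersed manifolds $W^u(A)$ and $W^s(A)$, disjoint from $A$, all of whose points are strongly transverse homoclinic points: $T_yM=T_yE^{ss}\oplus T_yE^{uu}\oplus T_yB$ for every $y\in B$, where $E^{ss}$, $E^{uu}$ denote the leaves through $y$. Let $F_B=\pi^s_B\circ(\pi^u_B)^{-1}$ be the scattering map: $F_B(x)=z$ if some $y\in B$ lies in $E^{uu}(x)\cap E^{ss}(z)$ ($x,z\in A$). Let $A'\subseteq A$ be such that $F_B$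 is (single-valued and) a $C^1$ diffeomorphism $A'\to F_B(A')$ and, for each $x\in A'$, each of the leaves $E^{uu}(x)$ and $E^{ss}(F_B(x))$ intersects $B$ at exactly one point. Then $F_B$ is exact on $A'$: $$\oint_\gamma\vartheta=\oint_{F_B(\gamma)}\vartheta\qquad\text{for every } C^1 \text{ closed curve } \gamma\subset A'.$$ -/

import Mathlib

open Set Filter Topology Manifold
open scoped ContDiff Bundle

noncomputable section

namespace ScatteringMap

section Forms

variable {E : Type*} [NormedAddCommGroup E] [NormedSpace ℝ E]
  {M : Type*} [TopologicalSpace M] [ChartedSpace E M]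

/-- A field of covectors on `M` (a differential `1`-form, before any smoothness is asked). -/
abbrev OneForm (E : Type*) [NormedAddCommGroup E] [NormedSpace ℝ E]
    (M : Type*) [TopologicalSpace M] [ChartedSpace E M] : Type _ :=
  ∀ x : M, TangentSpace 𝓘(ℝ, E) x →L[ℝ] ℝ

/-- The `1`-form `θ` is `C^∞`: the fibrewise linear function `(x, w) ↦ θ_x(w)` is `C^∞` on the
tangent bundle. -/
def OneForm.IsSmooth [IsManifold 𝓘(ℝ, E) ∞ M] (θ : OneForm E M) : Prop :=
  ContMDiff 𝓘(ℝ, E).tangent 𝓘(ℝ, ℝ) ∞ (fun p : TangentBundle 𝓘(ℝ, E) M => θ p.1 p.2)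

/-- The expression of a `1`-form in the preferred chart at `x`, a map from the model space `E` to
its dual (meaningful on the target of the chart). -/
def OneForm.inChart (θ : OneForm E M) (x : M) (u : E) : E →L[ℝ] ℝ :=
  (θ ((extChartAt 𝓘(ℝ, E) x).symm u)).comp
    (mfderiv 𝓘(ℝ, E) 𝓘(ℝ, E) (extChartAt 𝓘(ℝ, E) x).symm u)

/-- The exterior derivative of a `1`-form, computed at `x` in the chart at `x`:
`(dθ)(v, w) = D_v θ (w) - D_w θ (v)`. -/
def OneForm.d (θ : OneForm E M) (x : M) (v w : TangentSpace 𝓘(ℝ, E) x) : ℝ :=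
  let φ := extChartAt 𝓘(ℝ, E) x
  let v' : E := mfderiv 𝓘(ℝ, E) 𝓘(ℝ, E) φ x v
  let w' : E := mfderiv 𝓘(ℝ, E) 𝓘(ℝ, E) φ x w
  fderiv ℝ (θ.inChart x) (φ x) v' w' - fderiv ℝ (θ.inChart x) (φ x) w' v'

/-- The `2`-form `dθ` is non-degenerate, i.e. `dθ` is an (exact) symplectic form. -/
def OneForm.IsSymplecticPotential (θ : OneForm E M) : Prop :=
  ∀ (x : M) (v : TangentSpace 𝓘(ℝ, E) x), (∀ w, θ.d x v w = 0) → v = 0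

/-- The integral of a `1`-form along a `1`-periodic curve, `∮_c θ`. -/
def OneForm.loopIntegral (θ : OneForm E M) (c : ℝ → M) : ℝ :=
  ∫ t in (0 : ℝ)..1, θ (c t) (mfderiv 𝓘(ℝ, ℝ) 𝓘(ℝ, E) c t (1 : ℝ))

/-- Let `N` be (parametrized by `ι : N → M`) a submanifold of `M`. The map `F` of `N` is exact on
the set `S ⊆ N` if `∮_γ θ = ∮_{F(γ)} θ` for every `C^1` closed curve `γ` in `S`. -/
def OneForm.IsExactOn {EN HN N : Type*} [NormedAddCommGroup EN] [NormedSpace ℝ EN]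
    [TopologicalSpace HN] (J : ModelWithCorners ℝ EN HN) [TopologicalSpace N] [ChartedSpace HN N]
    (θ : OneForm E M) (ι : N → M) (F : N → N) (S : Set N) : Prop :=
  ∀ γ : ℝ → N, ContMDiff 𝓘(ℝ, ℝ) J 1 γ → Function.Periodic γ 1 → (∀ t, γ t ∈ S) →
    θ.loopIntegral (fun t => ι (γ t)) = θ.loopIntegral (fun t => ι (F (γ t)))

end Forms

section PartialDiffeo

variable {E : Type*} [NormedAddCommGroup E] [NormedSpace ℝ E]
  {M : Type*} [TopologicalSpace M] [ChartedSpace E M] [IsManifold 𝓘(ℝ, E) ∞ M]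

/-- `Φ` is a `C^∞` diffeomorphism of the open set `Φ.source ⊆ M` onto the open set
`Φ.target ⊆ M`. -/
def IsSmoothDiffeo (Φ : OpenPartialHomeomorph M M) : Prop :=
  ContMDiffOn 𝓘(ℝ, E) 𝓘(ℝ, E) ∞ Φ Φ.source ∧ ContMDiffOn 𝓘(ℝ, E) 𝓘(ℝ, E) ∞ Φ.symm Φ.target

/-- `Φ` preserves the `2`-form `dθ` on its domain. -/
def Preserves (Φ : OpenPartialHomeomorph M M) (θ : OneForm E M) : Prop :=
  ∀ x ∈ Φ.source, ∀ v w : TangentSpace 𝓘(ℝ, E) x,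
    θ.d (Φ x) (mfderiv 𝓘(ℝ, E) 𝓘(ℝ, E) Φ x v) (mfderiv 𝓘(ℝ, E) 𝓘(ℝ, E) Φ x w) = θ.d x v w

/-- `V = P ⊕ Q ⊕ R`. -/
def IsDirectSum₃ {V : Type*} [AddCommGroup V] [Module ℝ V] (P Q R : Submodule ℝ V) : Prop :=
  Disjoint P Q ∧ IsCompl (P ⊔ Q) R

/-- The field of subspaces `N x ⊆ T_x M`, `x ∈ S`, depends continuously on `x`: it is the field of
ranges of a continuous field of linear projections. -/
def IsContinuousSubspaceField (S : Set M)
    (N : ∀ x : M, Submodule ℝ (TangentSpace 𝓘(ℝ, E) x)) : Prop :=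
  ∃ P : ∀ x : M, TangentSpace 𝓘(ℝ, E) x →L[ℝ] TangentSpace 𝓘(ℝ, E) x,
    ContinuousOn (fun p : TangentBundle 𝓘(ℝ, E) M => (⟨p.1, P p.1 p.2⟩ : TangentBundle 𝓘(ℝ, E) M))
      {p | p.1 ∈ S} ∧
    ∀ x ∈ S, (∀ w, P x w ∈ N x) ∧ ∀ w ∈ N x, P x w = w

/-- A continuous family of norms on the tangent spaces `T_x M`, `x ∈ S`. -/
def IsContinuousNormField (S : Set M)
    (ν : ∀ x : M, Seminorm ℝ (TangentSpace 𝓘(ℝ, E) x)) : Prop :=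
  ContinuousOn (fun p : TangentBundle 𝓘(ℝ, E) M => ν p.1 p.2) {p | p.1 ∈ S} ∧
    ∀ x ∈ S, ∀ w, ν x w = 0 → w = 0

variable {EA HA A : Type*} [NormedAddCommGroup EA] [NormedSpace ℝ EA] [TopologicalSpace HA]
  (J : ModelWithCorners ℝ EA HA) [TopologicalSpace A] [ChartedSpace HA A]

/-- The submanifold parametrized by the embedding `ι : A → M` is invariant under `Φ` and
symmetrically normally hyperbolic with exponents `α > 1` and `lam ∈ (0, 1)`, `α² lam < 1`.
Here `N^c` is the tangent space of the submanifold. A continuous choice of norms in each of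
`N^s`, `N^u`, `N^c` is the same as (the restrictions of) a continuous choice of norms `ν` in
`T M` along the submanifold. Strict bounds of operator norms are written out on non-zero
vectors. -/
def IsSymmetricallyNormallyHyperbolic (Φ : OpenPartialHomeomorph M M) (ι : A → M)
    (α lam : ℝ) : Prop :=
  1 < α ∧ 0 < lam ∧ lam < 1 ∧ α ^ 2 * lam < 1 ∧
  range ι ⊆ Φ.source ∧ Φ '' range ι = range ι ∧
  ∃ (Ns Nu : ∀ x : M, Submodule ℝ (TangentSpace 𝓘(ℝ, E) x))
    (ν : ∀ x : M, Seminorm ℝ (TangentSpace 𝓘(ℝ, E) x)),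
    IsContinuousSubspaceField (range ι) Ns ∧
    IsContinuousSubspaceField (range ι) Nu ∧
    IsContinuousNormField (range ι) ν ∧
    (∀ a : A, IsDirectSum₃ (Ns (ι a)) (Nu (ι a)) (mfderiv J 𝓘(ℝ, E) ι a).range ∧
      Ns (ι a) ≠ ⊥ ∧ Nu (ι a) ≠ ⊥ ∧ (mfderiv J 𝓘(ℝ, E) ι a).range ≠ ⊥) ∧
    (∀ x ∈ range ι,
      (Ns x).map (mfderiv 𝓘(ℝ, E) 𝓘(ℝ, E) Φ x).toLinearMap = Ns (Φ x) ∧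
      (Nu x).map (mfderiv 𝓘(ℝ, E) 𝓘(ℝ, E) Φ x).toLinearMap = Nu (Φ x)) ∧
    (∀ a : A, ∀ w ∈ (mfderiv J 𝓘(ℝ, E) ι a).range, w ≠ 0 →
      ν (Φ (ι a)) (mfderiv 𝓘(ℝ, E) 𝓘(ℝ, E) Φ (ι a) w) < α * ν (ι a) w ∧
      ν (ι a) w < α * ν (Φ (ι a)) (mfderiv 𝓘(ℝ, E) 𝓘(ℝ, E) Φ (ι a) w)) ∧
    (∀ x ∈ range ι, ∀ w ∈ Ns x, w ≠ 0 →
      ν (Φ x) (mfderiv 𝓘(ℝ, E) 𝓘(ℝ, E) Φ x w) < lam * ν x w) ∧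
    (∀ x ∈ range ι, ∀ w ∈ Nu x, w ≠ 0 →
      ν x w < lam * ν (Φ x) (mfderiv 𝓘(ℝ, E) 𝓘(ℝ, E) Φ x w))

end PartialDiffeo

section Leaves

variable {E : Type*} [NormedAddCommGroup E] [NormedSpace ℝ E]
  {M : Type*} [EMetricSpace M] [ChartedSpace E M]

/-- The points `y` whose forward `T`-orbit is defined and approaches that of `x` at the rate
`C lam ^ m`. For fixed `x` these sets, `C → ∞`, exhaust the strong stable leaf of `x`. -/
def leafPiece (T : OpenPartialHomeomorph M M) (lam C : ℝ) (x : M) : Set M :=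
  {y | ∀ m : ℕ, (T^[m]) y ∈ T.source ∧
    edist ((T^[m]) y) ((T^[m]) x) ≤ ENNReal.ofReal (C * lam ^ m)}

/-- The strong stable leaf of `x` for the map `T`: the points whose forward orbit is
asymptotic to that of `x` at the strong rate `O(lam ^ m)`. The strong unstable leaf for `T` is the
strong stable leaf for `T.symm`. -/
def leaf (T : OpenPartialHomeomorph M M) (lam : ℝ) (x : M) : Set M :=
  {y | ∃ C : ℝ, y ∈ leafPiece T lam C x}

/-- `E^{ss}(x)`. -/
abbrev Ess (Φ : OpenPartialHomeomorph M M) (lam : ℝ) (x : M) : Set M := leaf Φ lam x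

/-- `E^{uu}(x)`. -/
abbrev Euu (Φ : OpenPartialHomeomorph M M) (lam : ℝ) (x : M) : Set M := leaf Φ.symm lam x

/-- The tangent space at `y` of the leaf of `x`, spanned by the velocities of the `C^1` curves
through `y` in the leaf. A leaf is in general only an immersed submanifold and may accumulate on
itself in `M`; asking a curve to stay in one piece `leafPiece T lam C x` near `y` means that it is
a curve for the intrinsic topology of the leaf. -/
def leafTangent (T : OpenPartialHomeomorph M M) (lam : ℝ) (x y : M) :
    Submodule ℝ (TangentSpace 𝓘(ℝ, E) y) :=
  Submodule.span ℝ {w | ∃ c : ℝ → M, ContMDiffAt 𝓘(ℝ, ℝ) 𝓘(ℝ, E) 1 c 0 ∧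
    (⟨c 0, mfderiv 𝓘(ℝ, ℝ) 𝓘(ℝ, E) c 0 (1 : ℝ)⟩ : TangentBundle 𝓘(ℝ, E) M) = ⟨y, w⟩ ∧
    ∃ C : ℝ, ∀ᶠ t in 𝓝 (0 : ℝ), c t ∈ leafPiece T lam C x}

/-- `j : B → M` takes its values in the union of the strong stable leaves of the points of
`ι : A → M`, that is, in the stable manifold `W^s(A)`, and is continuous for the intrinsic
topology of this immersed manifold: locally in `B` one constant suffices. -/
def MapsIntoStable {A B : Type*} [TopologicalSpace B] (T : OpenPartialHomeomorph M M) (lam : ℝ)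
    (ι : A → M) (j : B → M) : Prop :=
  ∀ b : B, ∃ C : ℝ, ∀ᶠ b' in 𝓝 b, ∃ a : A, j b' ∈ leafPiece T lam C (ι a)

variable {EB HB B : Type*} [NormedAddCommGroup EB] [NormedSpace ℝ EB] [TopologicalSpace HB]
  (JB : ModelWithCorners ℝ EB HB) [TopologicalSpace B] [ChartedSpace HB B]

/-- `B` (parametrized by `j : B → M`) is a `C^1` submanifold of `W^u(A) ∩ W^s(A) \ A` consisting
of strongly transverse homoclinic points:
`T_y M = T_y E^{ss} ⊕ T_y E^{uu} ⊕ T_y B` at each point `y` of `B`. -/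
structure IsStronglyTransverseHomoclinic {A : Type*} (Φ : OpenPartialHomeomorph M M) (lam : ℝ)
    (ι : A → M) (j : B → M) : Prop where
  contMDiff : ContMDiff JB 𝓘(ℝ, E) 1 j
  injective : Function.Injective j
  immersion : ∀ b, Function.Injective (mfderiv JB 𝓘(ℝ, E) j b)
  stable : MapsIntoStable Φ lam ι j
  unstable : MapsIntoStable Φ.symm lam ι j
  homoclinic : ∀ b, j b ∉ range ι
  transverse : ∀ (b : B) (a₁ a₂ : A), j b ∈ Euu Φ lam (ι a₁) → j b ∈ Ess Φ lam (ι a₂) →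
    IsDirectSum₃ (leafTangent (E := E) Φ lam (ι a₂) (j b))
      (leafTangent (E := E) Φ.symm lam (ι a₁) (j b)) (mfderiv JB 𝓘(ℝ, E) j b).range

/-- `F` is the (single-valued) scattering map `F_B = π^s_B ∘ (π^u_B)⁻¹` on `A'`: for `a ∈ A'`, the
point `F a` is the one and only point `a₂` of `A` such that some point of `B` lies both in
`E^{uu}(a)` and in `E^{ss}(a₂)`. -/
def IsScatteringMapOn {A B : Type*} (Φ : OpenPartialHomeomorph M M) (lam : ℝ)
    (ι : A → M) (j : B → M) (F : A → A) (A' : Set A) : Prop :=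
  ∀ a ∈ A', ∀ a₂ : A,
    (∃ b : B, j b ∈ Euu Φ lam (ι a) ∧ j b ∈ Ess Φ lam (ι a₂)) ↔ a₂ = F a

end Leaves

/-- `F` is a `C^1` diffeomorphism of the set `S` onto `F(S)`. -/
def IsDiffeoOnto {EA HA A : Type*} [NormedAddCommGroup EA] [NormedSpace ℝ EA]
    [TopologicalSpace HA] (J : ModelWithCorners ℝ EA HA) [TopologicalSpace A] [ChartedSpace HA A]
    (F : A → A) (S : Set A) : Prop :=
  ContMDiffOn J J 1 F S ∧
    ∃ G : A → A, ContMDiffOn J J 1 G (F '' S) ∧ ∀ a ∈ S, G (F a) = a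

end ScatteringMap

end

/-!
The idea: let `γ` be a loop in `A'` and let `β` be the loop of the points of `B` in the leaves `E^uu
(γ t)`; its points also lie in the leaves `E^ss (F (γ t))`. The theorem follows from one statement
about one family of leaves, `HypSys.IsSmooth.loopIntegral_eq_of_section`: a loop in the invariant
manifold and the loop cut out in `B` by the stable leaves through it have the same integral of `θ`.
It is used for `Φ` and the loop `F ∘ γ`, and for `Φ⁻¹` and the loop `γ`.

*Equality of the integrals.* High iterates of the two loops, `x` in `A` and `y` in `B`, are so close
to `A` that they are joined within local leaves by a homotopy (`exists_leaf_homotopy`), which `Φ⁻¹`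
carries back to `x` and `y`. As `Φ^* θ - θ` is closed, `∮_y θ - ∮_x θ` is not changed by `Φ`
(`loopIntegral_comp_sub`); if `Φ` is exact, this holds without a homotopy. Under iteration the
distance of the two loops decays like `λ ^ m`, while their velocities grow at most like `α₁ ^ m`
with `α₁` slightly larger than `α`. After an integration by parts of the velocity of the difference,
the difference of the integrals is bounded by a product of one distance and one velocity, so it
tends to zero (`tendsto_integral_sub`, `loopIntegral_eq`).

*The loop in `B` is `C¹`.* Orbits that shadow an orbit of `A` are studied in linear coordinates, in
which `A` with its splitting becomes a `HypSys`. Cone estimates for differences of orbits show that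
two points of a leaf approach each other like `λ ^ m`, and points of different leaves no faster than
`α₁⁻¹ ^ m`. The same dichotomy for derivatives (`rateSpace`) bounds the dimensions of the spaces of
vectors with given rates. Hence the base point map from `B` to `A` is strictly differentiable, with
the expected derivative, and by transversality it is invertible; the curve `β` is its inverse
applied to a `C¹` curve (`contMDiff_section`).

*Dimensions.* Transversality of `B` to the leaves is used in the form that `B` has the dimension of
`A` and has no vector contracted at the strong rate (`IsSmooth.transverse`). This needs `dim N^s =
dim N^u`: since `α λ < 1`, the invariant form `Ω` vanishes on `N^s × (N^s ⊕ TA)` and on `N^u × (N^u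
⊕ TA)`, so `Ω` pairs `N^s` with `N^u` without kernel (`Splitting.two_mul_finrank_s`).

The linear coordinates are the charts of a finite cover of `A`, cut off by bump functions
(`ChartCover`), side by side; they make the four-point estimate behind the cones available although
`A` lies in no single chart. The tangent spaces of distinct points are then compared in one normed
space, in which the strong stable bundle is enlarged by the directions normal to the image.
-/

noncomputable section

namespace ScatteringMap

open Function (Injective Periodic LeftInverse iterate_succ_apply' iterate_succ_apply iterate_add_apply
  iterate_zero iterate_succ' comp_apply)
open ENNReal (ofReal ofReal_le_ofReal ofReal_pos ofReal_lt_ofReal_iff ofReal_toReal)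
open Metric (ball sphere closedBall eball ball_mem_nhds eball_mem_nhds mem_ball)
open ContinuousLinearMap (le_of_opNorm_le)
open LinearMap (ker_eq_bot)
open Module (finrank)
open Topology (IsEmbedding)

variable {M E V W G EA EB : Type*} [NormedAddCommGroup E] [NormedSpace ℝ E]
  [NormedAddCommGroup V] [NormedSpace ℝ V] [NormedAddCommGroup W] [NormedSpace ℝ W]
  [NormedAddCommGroup G] [NormedSpace ℝ G] [NormedAddCommGroup EA] [NormedSpace ℝ EA]
  [NormedAddCommGroup EB] [NormedSpace ℝ EB] [FiniteDimensional ℝ E] [FiniteDimensional ℝ V]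
  [FiniteDimensional ℝ G] [FiniteDimensional ℝ EA] [FiniteDimensional ℝ EB] {B : Type*}
  [TopologicalSpace B] [ChartedSpace EB B]

local notation:max "ℐ" E:max => modelWithCornersSelf ℝ E
local notation:max "Ξ" E:max => extChartAt (modelWithCornersSelf ℝ E)
variable [IsManifold ℐ EB 1 B]

/-! ### Approximate orbits of a normally hyperbolic system in linear coordinates -/

/-- A normally hyperbolic invariant compact set `K` of a map `T`, seen through a map `e` into a
normed space `V` which is a bi-Lipschitz `C²` immersion near `K`.  The linear maps `D x` are the
derivatives of `T` along `K` read in `V`; the seminorms `pk x`, `pc x`, `pe x` measure the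
components of a vector in the bundle contracted by `T` (to which the directions of `V` normal to
the image of `e` are added), in the centre bundle and in the bundle expanded by `T`; these
components are `qk x`, `qc x`, `qe x`, and `nn x` is the normal component. -/
structure HypSys (M V : Type*) [EMetricSpace M] [NormedAddCommGroup V] [NormedSpace ℝ V] where
  T : OpenPartialHomeomorph M M
  K : Set M
  e : M → V
  D : M → V →L[ℝ] V
  (pk pc pe : M → Seminorm ℝ V)
  (qk qc qe nn : M → V →L[ℝ] V)
  (lk lam α α₁ C r : ℝ)
  lk_pos : 0 < lk
  lk_lt : lk < lam
  one_lt_α : 1 < α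
  α_lt : α < α₁
  gap : α₁ ^ 2 * lam < 1
  one_le_C : 1 ≤ C
  r_pos : 0 < r
  isCompact_K : IsCompact K
  maps_K : ∀ x ∈ K, T x ∈ K
  near_source : ∀ x ∈ K, ∀ p, edist p x < ofReal r → p ∈ T.source
  norm_le : ∀ x ∈ K, ∀ v, ‖v‖ ≤ C * (pk x v + pc x v + pe x v)
  pk_le : ∀ x ∈ K, ∀ v, pk x v ≤ C * ‖v‖
  pc_le : ∀ x ∈ K, ∀ v, pc x v ≤ C * ‖v‖
  pe_le : ∀ x ∈ K, ∀ v, pe x v ≤ C * ‖v‖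
  norm_D_le : ∀ x ∈ K, ∀ v, ‖D x v‖ ≤ C * ‖v‖
  pk_D : ∀ x ∈ K, ∀ v, pk (T x) (D x v) ≤ lk * pk x v
  pc_D : ∀ x ∈ K, ∀ v, pc (T x) (D x v) ≤ α * pc x v
  pc_D' : ∀ x ∈ K, ∀ v, pc x v ≤ α * pc (T x) (D x v)
  pe_D : ∀ x ∈ K, ∀ v, pe x v ≤ lk * pe (T x) (D x v)
  edist_le : ∀ x ∈ K, ∀ p p', edist p x < ofReal r → edist p' x < ofReal r →
    edist p p' ≤ ofReal (C * ‖e p' - e p‖)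
  le_edist : ∀ x ∈ K, ∀ p p', edist p x < ofReal r → edist p' x < ofReal r →
    ∀ t, 0 ≤ t → edist p p' ≤ ofReal t → ‖e p' - e p‖ ≤ C * t
  unif : ∀ ε > 0, ∃ ρ > 0, ∀ x ∈ K, ∀ p, edist p x < ofReal ρ →
    edist (T p) (T x) < ofReal ε
  four : ∀ x ∈ K, ∀ p p' x', edist p x < ofReal r → edist p' x < ofReal r →
    edist x' x < ofReal r →
    ‖((e (T p') - e (T p)) - (e (T x') - e (T x))) - D x ((e p' - e p) - (e x' - e x))‖ ≤
      C * ‖e x' - e x‖ * ‖(e p' - e p) - (e x' - e x)‖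
        + C * (‖e p - e x‖ + ‖e p' - e x'‖) * ‖e p' - e p‖
  tangency : ∀ ε > 0, ∃ ρ > 0, ∀ x ∈ K, ∀ x' ∈ K, edist x' x < ofReal ρ →
    pk x (e x' - e x) ≤ ε * ‖e x' - e x‖ ∧ pe x (e x' - e x) ≤ ε * ‖e x' - e x‖
  normal : ∀ x ∈ K, ∀ p p', edist p x < ofReal r → edist p' x < ofReal r →
    ‖nn x (e p' - e p)‖ ≤ C * (‖e p - e x‖ + ‖e p' - e x‖) * ‖e p' - e p‖
  q_sum : ∀ x ∈ K, ∀ v, qk x v + qc x v + qe x v + nn x v = v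
  qk_apply : ∀ x ∈ K, ∀ a b c d, qk x (qk x a + qc x b + qe x c + nn x d) = qk x a
  qc_apply : ∀ x ∈ K, ∀ a b c d, qc x (qk x a + qc x b + qe x c + nn x d) = qc x b
  qe_apply : ∀ x ∈ K, ∀ a b c d, qe x (qk x a + qc x b + qe x c + nn x d) = qe x c
  qk_D : ∀ x ∈ K, ∀ v, qk (T x) (D x v) = D x (qk x v)
  norm_le_D : ∀ x ∈ K, ∀ v, ‖v‖ ≤ C * (‖D x v‖ + ‖nn x v‖)
  pk_le_q : ∀ x ∈ K, ∀ v, pk x v ≤ C * (‖qk x v‖ + ‖nn x v‖)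
  pc_le_q : ∀ x ∈ K, ∀ v, pc x v ≤ C * ‖qc x v‖
  pe_le_q : ∀ x ∈ K, ∀ v, pe x v ≤ C * ‖qe x v‖
  norm_qk_le : ∀ x ∈ K, ∀ v, ‖qk x v‖ ≤ C * ‖v‖
  norm_qc_le : ∀ x ∈ K, ∀ v, ‖qc x v‖ ≤ C * ‖v‖
  continuousOn_pk : ContinuousOn (fun p : M × V => pk p.1 p.2) (K ×ˢ univ)
  continuousOn_pc : ContinuousOn (fun p : M × V => pc p.1 p.2) (K ×ˢ univ)
  continuousOn_pe : ContinuousOn (fun p : M × V => pe p.1 p.2) (K ×ˢ univ)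
  continuousOn_qk : ContinuousOn qk K
  continuousOn_qc : ContinuousOn qc K
  unif_symm : ∀ ε > 0, ∃ ρ > 0, ∀ x ∈ K, ∀ p, edist p (T x) < ofReal ρ →
    p ∈ T.target ∧ edist (T.symm p) x < ofReal ε
  param : ∀ x ∈ K, ∀ v, nn x v = 0 → ‖v‖ ≤ r →
    ∃ p, edist p x ≤ ofReal (C * ‖v‖) ∧ (e p - e x) - nn x (e p - e x) = v
  near_compact : ∃ L : Set M, IsCompact L ∧ ∀ x ∈ K, ∀ p, edist p x < ofReal r → p ∈ L

namespace HypSys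
/-- The difference, read in `V`, of the `m`-th iterates of two points. -/
local notation:max "Δ[" S "," m "]" p:max q:max => e S ((T S)^[m] p) - e S ((T S)^[m] q)

variable [EMetricSpace M] (S : HypSys M V) {x x' : M}

/-- The centre-expanded size of a vector. -/
def cs (x : M) (v : V) : ℝ := S.pc x v + S.pe x v

/-- The adapted norm at a point of `K`. -/
def N (x : M) (v : V) : ℝ := S.pk x v + S.pc x v + S.pe x v

lemma pk_nonneg (x : M) (v : V) : 0 ≤ S.pk x v := apply_nonneg _ _
lemma pc_nonneg (x : M) (v : V) : 0 ≤ S.pc x v := apply_nonneg _ _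
lemma pe_nonneg (x : M) (v : V) : 0 ≤ S.pe x v := apply_nonneg _ _
lemma cs_nonneg (x : M) (v : V) : 0 ≤ S.cs x v := add_nonneg (S.pc_nonneg x v) (S.pe_nonneg x v)
lemma N_nonneg (x : M) (v : V) : 0 ≤ S.N x v :=
  add_nonneg (add_nonneg (S.pk_nonneg x v) (S.pc_nonneg x v)) (S.pe_nonneg x v)
lemma N_eq (x : M) (v : V) : S.N x v = S.pk x v + S.cs x v := by unfold N cs; ring
lemma C_pos : 0 < S.C := lt_of_lt_of_le one_pos S.one_le_C
lemma lam_pos : 0 < S.lam := S.lk_pos.trans S.lk_lt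
lemma one_lt_α₁ : 1 < S.α₁ := S.one_lt_α.trans S.α_lt
lemma lam_lt_one : S.lam < 1 := by
  nlinarith [S.gap, S.one_lt_α₁, mul_pos S.lam_pos (sub_pos.2 S.one_lt_α₁)]
lemma mul_pow_le {δ : ℝ} (hδ : 0 ≤ δ) (m : ℕ) : δ * S.lam ^ m ≤ δ :=
  mul_le_of_le_one_right hδ (pow_le_one₀ S.lam_pos.le S.lam_lt_one.le)

lemma α₁_pos : 0 < S.α₁ := one_pos.trans S.one_lt_α₁
lemma α₁_lam_lt_one : S.α₁ * S.lam < 1 := by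
  nlinarith [S.gap, S.one_lt_α₁, mul_pos S.α₁_pos S.lam_pos]

lemma norm_le_N (hx : x ∈ S.K) (v : V) : ‖v‖ ≤ S.C * S.N x v := S.norm_le x hx v

lemma N_le (hx : x ∈ S.K) (v : V) : S.N x v ≤ 3 * S.C * ‖v‖ := by
  have h1 := S.pk_le x hx v; have h2 := S.pc_le x hx v; have h3 := S.pe_le x hx v
  unfold N; linarith

lemma cs_le (hx : x ∈ S.K) (v : V) : S.cs x v ≤ 2 * S.C * ‖v‖ := by
  have h2 := S.pc_le x hx v; have h3 := S.pe_le x hx v; unfold cs; linarith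

lemma cs_sub_le (x : M) (v w : V) : S.cs x (v - w) ≤ S.cs x v + S.cs x w := by
  have h1 := map_sub_le_add (S.pc x) v w; have h2 := map_sub_le_add (S.pe x) v w
  unfold cs; linarith

lemma N_smul (x : M) (a : ℝ) (v : V) : S.N x (a • v) = |a| * S.N x v := by
  unfold N; simp only [map_smul_eq_mul, Real.norm_eq_abs]; ring

lemma cs_smul (x : M) (a : ℝ) (v : V) : S.cs x (a • v) = |a| * S.cs x v := by
  unfold cs; simp only [map_smul_eq_mul, Real.norm_eq_abs]; ring

/-- The perturbations of the linear cocycle `D` of relative size `ε` keep its cones and rates. -/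
structure Good (ε : ℝ) : Prop where
  pos : 0 < ε
  le_one : ε ≤ 1
  cs {x : M} (hx : x ∈ S.K) {v v' : V} (h : ‖v' - S.D x v‖ ≤ ε * S.N x v)
    (hc : S.pk x v ≤ S.cs x v) :
    S.pk (S.T x) v' ≤ S.cs (S.T x) v' ∧ S.cs x v ≤ S.α₁ * S.cs (S.T x) v'
  pe {x : M} (hx : x ∈ S.K) {v v' : V} (h : ‖v' - S.D x v‖ ≤ ε * S.N x v)
    (hc : S.pc x v + S.pk x v ≤ S.pe x v) :
    S.pc (S.T x) v' + S.pk (S.T x) v' ≤ S.pe (S.T x) v' ∧ S.pe x v ≤ S.lam * S.pe (S.T x) v'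
  ck {x : M} (hx : x ∈ S.K) {v v' : V} (h : ‖v' - S.D x v‖ ≤ ε * S.N x v)
    (hc : S.pe x v ≤ S.pc x v + S.pk x v) :
    S.pc (S.T x) v' + S.pk (S.T x) v' ≤ S.α₁ * (S.pc x v + S.pk x v)
  pk {x : M} (hx : x ∈ S.K) {v v' : V} (h : ‖v' - S.D x v‖ ≤ ε * S.N x v)
    (hc : S.cs x v ≤ S.pk x v) : S.pk (S.T x) v' ≤ S.lam * S.pk x v

lemma exists_small {f : ℝ → ℝ} {a b : ℝ} (hf : Continuous f) (h0 : f 0 = a) (h : a < b) :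
    ∀ᶠ η in 𝓝[>] (0 : ℝ), f η < b := by
  have : Tendsto f (𝓝[>] 0) (𝓝 a) := h0 ▸ (hf.tendsto 0).mono_left nhdsWithin_le_nhds
  exact this.eventually_lt_const h

section Cones

/- One step of the cocycle in terms of the three components `(k, c, e)` of a vector and the
components `(k', c', e')` of its approximate image; `δ` bounds the error of each of them. -/

variable {lk lam α α₁ η k c e k' c' e' n : ℝ}

lemma cone_cs (hα : 0 < α) (hα1 : 0 ≤ α₁) (hη : 0 ≤ η) (hl : 0 ≤ lk)
    (e1 : α * (1 + 4 * η * α₁) < α₁) (e2 : (lk + 2 * η) * α₁ < 1) (hn : n = k + c + e)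
    (hc' : 0 ≤ c') (he' : 0 ≤ e') (dk : k' ≤ lk * k + η * n) (dc : c ≤ α * (c' + η * n))
    (de : e ≤ α * (e' + η * n)) (h : k ≤ c + e) : k' ≤ c' + e' ∧ c + e ≤ α₁ * (c' + e') := by
  have hn2 : η * n ≤ η * (2 * (c + e)) := by gcongr; linarith
  have hs : 0 ≤ c' + e' := add_nonneg hc' he'
  have g2 : c + e ≤ α₁ * (c' + e') := by
    rcases le_total (c + e) 0 with h0 | h0
    · exact h0.trans (by positivity)
    · refine le_of_mul_le_mul_left ?_ hα
      linarith [mul_le_mul_of_nonneg_left hn2 (mul_nonneg hα1 hα.le),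
        mul_le_mul_of_nonneg_right e1.le h0, mul_le_mul_of_nonneg_left (add_le_add dc de) hα1]
  refine ⟨?_, g2⟩
  linarith [mul_le_mul_of_nonneg_left h hl, mul_le_mul_of_nonneg_right e2.le hs,
    mul_le_mul_of_nonneg_left g2 (by positivity : 0 ≤ lk + 2 * η)]

lemma cone_pe (hη : 0 ≤ η) (hl : 0 < lk) (hlam : 0 ≤ lam) (hα : 0 ≤ α)
    (e3 : (1 + 2 * η * lam) * lk < lam) (e4 : (α + 4 * η) * lam < 1) (hle : lk ≤ α)
    (hn : n = k + c + e) (hk : 0 ≤ k) (he : 0 ≤ e) (he' : 0 ≤ e') (dk : k' ≤ lk * k + η * n)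
    (dc : c' ≤ α * c + η * n) (de : e ≤ lk * (e' + η * n)) (h : c + k ≤ e) :
    c' + k' ≤ e' ∧ e ≤ lam * e' := by
  have hn2 : η * n ≤ η * (2 * e) := by gcongr; linarith
  have g2 : e ≤ lam * e' := by
    refine le_of_mul_le_mul_left ?_ hl
    linarith [mul_le_mul_of_nonneg_right e3.le he, mul_le_mul_of_nonneg_left de hlam,
      mul_le_mul_of_nonneg_left hn2 (mul_nonneg hlam hl.le)]
  refine ⟨?_, g2⟩
  linarith [mul_le_mul_of_nonneg_right hle hk, mul_le_mul_of_nonneg_left h hα,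
    mul_le_mul_of_nonneg_right e4.le he',
    mul_le_mul_of_nonneg_left g2 (by positivity : 0 ≤ α + 4 * η)]

lemma cone_ck (hη : 0 ≤ η) (e5 : α + 4 * η < α₁) (hle : lk ≤ α) (hn : n = k + c + e) (hk : 0 ≤ k)
    (hc : 0 ≤ c) (dk : k' ≤ lk * k + η * n) (dc : c' ≤ α * c + η * n) (h : e ≤ c + k) :
    c' + k' ≤ α₁ * (c + k) := by
  have hn2 : η * n ≤ η * (2 * (c + k)) := by gcongr; linarith
  have : lk * k ≤ α * k := by gcongr
  have : (α + 4 * η) * (c + k) ≤ α₁ * (c + k) := by gcongr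
  linarith

lemma cone_k (hη : 0 ≤ η) (e6 : lk + 2 * η < lam) (hn : n = k + c + e) (hk : 0 ≤ k)
    (dk : k' ≤ lk * k + η * n) (h : c + e ≤ k) : k' ≤ lam * k := by
  have hn2 : η * n ≤ η * (2 * k) := by gcongr; linarith
  have : (lk + 2 * η) * k ≤ lam * k := by gcongr
  linarith

end Cones

lemma exists_good : ∃ ε, S.Good ε := by
  have hα := S.one_lt_α; have hα1 := S.α_lt; have hl := S.lk_pos; have hlk := S.lk_lt
  have hlam := S.lam_pos; have hgap := S.gap; have h1 := S.lam_lt_one; have hC := S.C_pos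
  have hα10 := S.α₁_pos; have hal := S.α₁_lam_lt_one
  -- `η` bounds the relative error in each of the three seminorms
  have ev : ∀ᶠ η in 𝓝[>] (0 : ℝ), (0 < η ∧ η < 1) ∧ S.α * (1 + 4 * η * S.α₁) < S.α₁ ∧
      (S.lk + 2 * η) * S.α₁ < 1 ∧ (1 + 2 * η * S.lam) * S.lk < S.lam ∧
      (S.α + 4 * η) * S.lam < 1 ∧ S.α + 4 * η < S.α₁ ∧ S.lk + 2 * η < S.lam := by
    simp only [eventually_and]
    refine ⟨⟨eventually_mem_nhdsWithin, exists_small continuous_id rfl one_pos⟩,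
      ?_, ?_, ?_, ?_, ?_, ?_⟩
    · exact exists_small (a := S.α) (by fun_prop) (by ring) hα1
    · exact exists_small (a := S.lk * S.α₁) (by fun_prop) (by ring) (by nlinarith)
    · exact exists_small (a := S.lk) (by fun_prop) (by ring) hlk
    · exact exists_small (a := S.α * S.lam) (by fun_prop) (by ring) (by nlinarith)
    · exact exists_small (a := S.α) (by fun_prop) (by ring) hα1
    · exact exists_small (a := S.lk) (by fun_prop) (by ring) hlk
  obtain ⟨η, ⟨hη0, hη1⟩, e1, e2, e3, e4, e5, e6⟩ := ev.exists
  have key : ∀ {x}, x ∈ S.K → ∀ {v v' : V}, ‖v' - S.D x v‖ ≤ η / S.C * S.N x v →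
      S.pk (S.T x) v' ≤ S.lk * S.pk x v + η * S.N x v ∧
      S.pc (S.T x) v' ≤ S.α * S.pc x v + η * S.N x v ∧
      S.pc x v ≤ S.α * (S.pc (S.T x) v' + η * S.N x v) ∧
      S.pe x v ≤ S.lk * (S.pe (S.T x) v' + η * S.N x v) := by
    intro x hx v v' h; have hTx := S.maps_K x hx
    have herr : S.C * ‖v' - S.D x v‖ ≤ η * S.N x v := by
      calc S.C * ‖v' - S.D x v‖ ≤ S.C * (η / S.C * S.N x v) := by gcongr
        _ = η * S.N x v := by field_simp
    have key : ∀ p : Seminorm ℝ V, (∀ w, p w ≤ S.C * ‖w‖) →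
        p v' ≤ p (S.D x v) + η * S.N x v ∧ p (S.D x v) ≤ p v' + η * S.N x v := by
      intro p hp; have a1 := abs_le.1 (abs_sub_map_le_sub p v' (S.D x v))
      constructor <;> linarith [hp (v' - S.D x v), a1.1, a1.2]
    exact ⟨(key _ (S.pk_le _ hTx)).1.trans (add_le_add_left (S.pk_D x hx v) _),
      (key _ (S.pc_le _ hTx)).1.trans (add_le_add_left (S.pc_D x hx v) _),
      (S.pc_D' x hx v).trans (mul_le_mul_of_nonneg_left (key _ (S.pc_le _ hTx)).2 (by linarith)),
      (S.pe_D x hx v).trans (mul_le_mul_of_nonneg_left (key _ (S.pe_le _ hTx)).2 hl.le)⟩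
  have hle : S.lk ≤ S.α := by linarith
  have nk := S.pk_nonneg; have nc := S.pc_nonneg; have ne := S.pe_nonneg; have nn := S.N_nonneg
  refine ⟨η / S.C, by positivity, ?_, fun hx v v' h hc => ?_, fun hx v v' h hc => ?_,
    fun hx v v' h hc => ?_, fun hx v v' h hc => ?_⟩
  · rw [div_le_one hC]; linarith [S.one_le_C]
  all_goals obtain ⟨dk, dc, dc', de⟩ := key hx h
  · refine cone_cs (by linarith) hα10.le hη0.le hl.le e1 e2 rfl (nc _ _) (ne _ _) dk dc'
      (de.trans (mul_le_mul_of_nonneg_right hle ?_)) hc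
    exact add_nonneg (ne _ _) (mul_nonneg hη0.le (nn _ _))
  · exact cone_pe hη0.le hl hlam.le (by linarith) e3 e4 hle rfl (nk _ _) (ne _ _) (ne _ _) dk dc de hc
  · exact cone_ck hη0.le e5 hle rfl (nk _ _) (nc _ _) dk dc hc
  · exact cone_k hη0.le e6 rfl (nk _ _) dk hc

/-- A constant of relative error for which `Good` holds. -/
def ε₀ : ℝ := S.exists_good.choose

lemma good : S.Good S.ε₀ := S.exists_good.choose_spec
lemma ε₀_pos : 0 < S.ε₀ := S.good.pos

lemma mem_it (hx : x ∈ S.K) (m : ℕ) : S.T^[m] x ∈ S.K := by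
  induction m with
  | zero => exact hx
  | succ m ih => rw [iterate_succ_apply']; exact S.maps_K _ ih

/-- A quantity multiplied by at least `q⁻¹` in each step as long as an invariant `p` holds. -/
lemma growth_of_step {p : ℕ → Prop} {a : ℕ → ℝ} {q : ℝ} {n : ℕ} (hq : 0 ≤ q) (h0 : p 0)
    (h : ∀ m < n, p m → a 0 ≤ q ^ m * a m → p (m + 1) ∧ a m ≤ q * a (m + 1)) :
    ∀ m ≤ n, p m ∧ a 0 ≤ q ^ m * a m := by
  intro m; induction m with
  | zero => exact fun _ => ⟨h0, by simp⟩
  | succ m ih =>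
    intro hm; obtain ⟨i1, i2⟩ := ih (by omega); obtain ⟨s1, s2⟩ := h m hm i1 i2
    refine ⟨s1, i2.trans ?_⟩; rw [pow_succ, mul_assoc]; gcongr

lemma le_pow_mul_of_step {a : ℕ → ℝ} {q : ℝ} {n : ℕ} (hq : 0 ≤ q)
    (h : ∀ m < n, a (m + 1) ≤ q * a m) : ∀ m ≤ n, a m ≤ q ^ m * a 0 := by
  intro m; induction m with
  | zero => simp
  | succ m ih =>
    intro hm; rw [pow_succ', mul_assoc]
    exact (h m hm).trans (mul_le_mul_of_nonneg_left (ih (by omega)) hq)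

/-- `v` is a sequence of vectors over the orbit of `x` which follows the cocycle `D` up to a small
relative error, up to time `n`. -/
def Approx (x : M) (v : ℕ → V) (n : ℕ) : Prop :=
  ∀ m < n, ‖v (m + 1) - S.D (S.T^[m] x) (v m)‖ ≤ S.ε₀ * S.N (S.T^[m] x) (v m)

variable {S}

lemma Approx.cs_growth (hx : x ∈ S.K) {v : ℕ → V} {n : ℕ} (h : S.Approx x v n)
    (h0 : S.pk x (v 0) ≤ S.cs x (v 0)) : ∀ m ≤ n, S.pk (S.T^[m] x) (v m) ≤ S.cs (S.T^[m] x) (v m) ∧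
      S.cs x (v 0) ≤ S.α₁ ^ m * S.cs (S.T^[m] x) (v m) :=
  growth_of_step (p := fun m => S.pk (S.T^[m] x) (v m) ≤ S.cs (S.T^[m] x) (v m))
    (a := fun m => S.cs (S.T^[m] x) (v m)) S.α₁_pos.le h0 fun m hm i1 _ => by
    simp only [iterate_succ_apply']; exact S.good.cs (S.mem_it hx m) (h m hm) i1

lemma Approx.pe_growth (hx : x ∈ S.K) {v : ℕ → V} {n : ℕ} (h : S.Approx x v n)
    (h0 : S.pc x (v 0) + S.pk x (v 0) ≤ S.pe x (v 0)) : ∀ m ≤ n,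
      S.pc (S.T^[m] x) (v m) + S.pk (S.T^[m] x) (v m) ≤ S.pe (S.T^[m] x) (v m) ∧
      S.pe x (v 0) ≤ S.lam ^ m * S.pe (S.T^[m] x) (v m) :=
  growth_of_step (a := fun m => S.pe (S.T^[m] x) (v m))
    (p := fun m => S.pc (S.T^[m] x) (v m) + S.pk (S.T^[m] x) (v m) ≤ S.pe (S.T^[m] x) (v m))
    S.lam_pos.le h0 fun m hm i1 _ => by
    simp only [iterate_succ_apply']; exact S.good.pe (S.mem_it hx m) (h m hm) i1

lemma Approx.ck_bound (hx : x ∈ S.K) {v : ℕ → V} {n : ℕ} (h : S.Approx x v n)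
    (h0 : ∀ m < n, S.pe (S.T^[m] x) (v m) ≤ S.pc (S.T^[m] x) (v m) + S.pk (S.T^[m] x) (v m)) :
    ∀ m ≤ n, S.pc (S.T^[m] x) (v m) + S.pk (S.T^[m] x) (v m) ≤
      S.α₁ ^ m * (S.pc x (v 0) + S.pk x (v 0)) :=
  le_pow_mul_of_step (a := fun m => S.pc (S.T^[m] x) (v m) + S.pk (S.T^[m] x) (v m))
    S.α₁_pos.le fun m hm => by
    simp only [iterate_succ_apply']; exact S.good.ck (S.mem_it hx m) (h m hm) (h0 m hm)

lemma Approx.pk_decay (hx : x ∈ S.K) {v : ℕ → V} {n : ℕ} (h : S.Approx x v n)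
    (h0 : ∀ m < n, S.cs (S.T^[m] x) (v m) ≤ S.pk (S.T^[m] x) (v m)) :
    ∀ m ≤ n, S.pk (S.T^[m] x) (v m) ≤ S.lam ^ m * S.pk x (v 0) :=
  le_pow_mul_of_step (a := fun m => S.pk (S.T^[m] x) (v m)) S.lam_pos.le fun m hm => by
    simp only [iterate_succ_apply']; exact S.good.pk (S.mem_it hx m) (h m hm) (h0 m hm)

lemma Approx.shift {v : ℕ → V} {n : ℕ} (h : S.Approx x v n) (k : ℕ) :
    S.Approx (S.T^[k] x) (fun m => v (k + m)) (n - k) := by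
  intro m hm; have := h (k + m) (by omega); rw [← iterate_add_apply, add_comm m k]; exact this

lemma eq_zero_of_forall_le {a b q : ℝ} (ha : 0 ≤ a) (hq : q < 1) (hq0 : 0 ≤ q)
    (h : ∀ m : ℕ, a ≤ b * q ^ m) : a = 0 := by
  refine le_antisymm ?_ ha
  have : Tendsto (fun m : ℕ => b * q ^ m) atTop (𝓝 (b * 0)) :=
    (tendsto_pow_atTop_nhds_zero_of_lt_one hq0 hq).const_mul b
  rw [mul_zero] at this; exact ge_of_tendsto' this h

/-- An approximate orbit of the cocycle that decays at the strong rate has no dominating component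
in the centre-expanded direction. -/
lemma Approx.cs_lt (hx : x ∈ S.K) {v : ℕ → V} (h : ∀ n, S.Approx x v n) {b : ℝ}
    (hb : ∀ m, ‖v m‖ ≤ b * S.lam ^ m) (m : ℕ) :
    v m = 0 ∨ S.cs (S.T^[m] x) (v m) < S.pk (S.T^[m] x) (v m) := by
  by_contra! hcon
  obtain ⟨h0, h1⟩ := hcon; have hxm := S.mem_it hx m
  have hs : ∀ n, S.Approx (S.T^[m] x) (fun i => v (m + i)) n := by
    intro n; simpa using (h (m + n)).shift m
  have hz : S.cs (S.T^[m] x) (v m) = 0 := by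
    refine eq_zero_of_forall_le (b := 2 * S.C * b * S.lam ^ m) (q := S.α₁ * S.lam)
      (S.cs_nonneg _ _) S.α₁_lam_lt_one (by have := S.α₁_pos; have := S.lam_pos; positivity) ?_
    intro n; have := ((hs n).cs_growth hxm (by simpa using h1) n le_rfl).2; refine this.trans ?_
    have hC := S.C_pos; have := S.α₁_pos
    calc S.α₁ ^ n * S.cs (S.T^[n] (S.T^[m] x)) (v (m + n))
        ≤ S.α₁ ^ n * (2 * S.C * (b * S.lam ^ (m + n))) := by
          gcongr; exact (S.cs_le (S.mem_it hxm n) _).trans (by gcongr; exact hb _)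
      _ = _ := by rw [mul_pow, pow_add]; ring
  have h3 : S.pk (S.T^[m] x) (v m) = 0 := le_antisymm (h1.trans hz.le) (S.pk_nonneg _ _)
  simpa [S.N_eq, hz, h3, h0] using S.norm_le_N hxm (v m)

variable (S) {y y' p p' q : M}

/-- The local strong leaf of size `δ` at `x`. -/
abbrev piece (δ : ℝ) (x : M) : Set M := leafPiece S.T S.lam δ x

/-! ### Pairs of orbits that shadow orbits of the invariant set -/

lemma leafPiece_shift {T : OpenPartialHomeomorph M M} {lam δ : ℝ}
    (h : y ∈ leafPiece T lam δ x) (k : ℕ) : T^[k] y ∈ leafPiece T lam (δ * lam ^ k) (T^[k] x) := by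
  intro m; have := h (m + k); rw [iterate_add_apply, iterate_add_apply] at this
  refine ⟨this.1, this.2.trans (le_of_eq ?_)⟩; rw [pow_add]; congr 1; ring

lemma leafPiece_mono {T : OpenPartialHomeomorph M M} {lam δ δ' : ℝ}
    (hlam : 0 ≤ lam) (h : δ ≤ δ') : leafPiece T lam δ x ⊆ leafPiece T lam δ' x := by
  intro y hy m; refine ⟨(hy m).1, (hy m).2.trans (ofReal_le_ofReal ?_)⟩; gcongr

lemma exists_lam_pow_le (C₀ : ℝ) {ρ : ℝ} (hρ : 0 < ρ) : ∃ m₀ : ℕ, ∀ m ≥ m₀, C₀ * S.lam ^ m ≤ ρ := by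
  have : Tendsto (fun m : ℕ => C₀ * S.lam ^ m) atTop (𝓝 (C₀ * 0)) :=
    (tendsto_pow_atTop_nhds_zero_of_lt_one S.lam_pos.le S.lam_lt_one).const_mul C₀
  rw [mul_zero] at this; exact eventually_atTop.1 (this.eventually_le_const hρ)

/-- The radius on which the finite differences of `T` are `Approx`imated by `D`. -/
def ρ₀ : ℝ := min (S.r / 2) (S.ε₀ / (2 * S.C ^ 3))

lemma ρ₀_pos : 0 < S.ρ₀ := by
  have := S.r_pos; have := S.ε₀_pos; have := S.C_pos; unfold ρ₀; positivity

lemma ρ₀_lt : S.ρ₀ < S.r := by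
  have := S.r_pos; exact (min_le_left _ _).trans_lt (by linarith)

lemma near_of_le {ρ : ℝ} (h : ρ < S.r) (hpq : edist p q ≤ ofReal ρ) : edist p q < ofReal S.r :=
  hpq.trans_lt ((ofReal_lt_ofReal_iff S.r_pos).2 h)

lemma near_self (x : M) : edist x x < ofReal S.r := by rw [edist_self]; exact ofReal_pos.2 S.r_pos

lemma pair_error (hx : x ∈ S.K) {ρ ρ' : ℝ} (h0 : 0 ≤ ρ) (h0' : 0 ≤ ρ') (hρ : ρ < S.r)
    (hρ' : ρ' < S.r) (hp : edist p x ≤ ofReal ρ) (hp' : edist p' x ≤ ofReal ρ') :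
    ‖(S.e (S.T p') - S.e (S.T p)) - S.D x (S.e p' - S.e p)‖ ≤
      S.C ^ 2 * (ρ + ρ') * ‖S.e p' - S.e p‖ := by
  have hn := S.near_of_le hρ hp; have hn' := S.near_of_le hρ' hp'
  have h := S.four x hx p p' x hn hn' (S.near_self x)
  have l1 : ‖S.e p - S.e x‖ ≤ S.C * ρ :=
    S.le_edist x hx x p (S.near_self x) hn ρ h0 (by rwa [edist_comm])
  have l2 : ‖S.e p' - S.e x‖ ≤ S.C * ρ' :=
    S.le_edist x hx x p' (S.near_self x) hn' ρ' h0' (by rwa [edist_comm])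
  simp only [sub_self, norm_zero, mul_zero, zero_mul, zero_add, sub_zero] at h; refine h.trans ?_
  have := S.C_pos
  calc _ ≤ S.C * (S.C * ρ + S.C * ρ') * ‖S.e p' - S.e p‖ := by gcongr
    _ = _ := by ring

lemma pair_step (hx : x ∈ S.K) (hp : edist p x ≤ ofReal S.ρ₀) (hp' : edist p' x ≤ ofReal S.ρ₀) :
    ‖(S.e (S.T p') - S.e (S.T p)) - S.D x (S.e p' - S.e p)‖ ≤ S.ε₀ * S.N x (S.e p' - S.e p) := by
  refine (S.pair_error hx S.ρ₀_pos.le S.ρ₀_pos.le S.ρ₀_lt S.ρ₀_lt hp hp').trans ?_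
  have hC := S.C_pos; have : S.ρ₀ ≤ S.ε₀ / (2 * S.C ^ 3) := min_le_right _ _
  have := S.N_nonneg x (S.e p' - S.e p); have := S.ε₀_pos
  calc S.C ^ 2 * (S.ρ₀ + S.ρ₀) * ‖S.e p' - S.e p‖
      ≤ S.C ^ 2 * (S.ε₀ / (2 * S.C ^ 3) + S.ε₀ / (2 * S.C ^ 3)) *
        (S.C * S.N x (S.e p' - S.e p)) := by
        gcongr; exact S.norm_le_N hx _
    _ = _ := by field_simp; norm_num

variable {S}

lemma leafPiece_edist {δ : ℝ} (h : y ∈ S.piece δ x) (m : ℕ) :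
    edist (S.T^[m] y) (S.T^[m] x) ≤ ofReal (δ * S.lam ^ m) := (h m).2

lemma leafPiece_edist' {δ : ℝ} (hδ : 0 ≤ δ) (h : y ∈ S.piece δ x) (m : ℕ) :
    edist (S.T^[m] y) (S.T^[m] x) ≤ ofReal δ := by
  refine (h m).2.trans (ofReal_le_ofReal ?_); exact S.mul_pow_le hδ _

lemma leafPiece_norm {δ : ℝ} (hδ : 0 ≤ δ) (hδr : δ < S.r) (hx : x ∈ S.K) (h : y ∈ S.piece δ x)
    (m : ℕ) : ‖Δ[S, m] y x‖ ≤ S.C * (δ * S.lam ^ m) := by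
  refine S.le_edist _ (S.mem_it hx m) _ _ (S.near_self _)
    (S.near_of_le hδr (leafPiece_edist' hδ h m)) _ ?_ ?_
  · have := S.lam_pos; positivity
  · rw [edist_comm]; exact h.out m |>.2

lemma base_unique (hx : x ∈ S.K) (hx' : x' ∈ S.K) {C₀ : ℝ}
    (h : ∀ m, edist (S.T^[m] x') (S.T^[m] x) ≤ ofReal (C₀ * S.lam ^ m)) : x' = x := by
  have hC := S.C_pos; obtain ⟨ρ, hρ, ht⟩ := S.tangency (1 / (2 * S.C)) (by positivity)
  obtain ⟨m₀, hm₀⟩ := S.exists_lam_pow_le C₀ (lt_min S.ρ₀_pos (half_pos hρ))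
  have hd : ∀ m, edist (S.T^[m] (S.T^[m₀] x')) (S.T^[m] (S.T^[m₀] x)) ≤
      ofReal (min S.ρ₀ (ρ / 2)) := by
    intro m; rw [← iterate_add_apply, ← iterate_add_apply]
    exact (h _).trans (ofReal_le_ofReal (hm₀ _ (by omega)))
  have hxm := S.mem_it hx m₀; have hxm' := S.mem_it hx' m₀; set z := S.T^[m₀] x
  set z' := S.T^[m₀] x'
  have hd1 : ∀ m, edist (S.T^[m] z') (S.T^[m] z) ≤ ofReal S.ρ₀ := fun m =>
    (hd m).trans (ofReal_le_ofReal (min_le_left _ _))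
  have hA : ∀ n, S.Approx z (fun m => Δ[S, m] z' z) n := by
    intro n m _; simp only [iterate_succ_apply']
    exact S.pair_step (S.mem_it hxm m) (by simp) (hd1 m)
  have hdec : ∀ m, ‖Δ[S, m] z' z‖ ≤
      S.C * (|C₀| * S.lam ^ m₀) * S.lam ^ m := by
    intro m; rw [mul_assoc]; have hl := S.lam_pos
    refine S.le_edist _ (S.mem_it hxm m) _ _ (S.near_self _)
      (S.near_of_le S.ρ₀_lt (hd1 m)) _ (by positivity) ?_
    rw [edist_comm]; have := h (m + m₀); rw [iterate_add_apply, iterate_add_apply] at this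
    refine this.trans (ofReal_le_ofReal ?_); rw [pow_add, mul_assoc, mul_comm (S.lam ^ m)]
    exact mul_le_mul_of_nonneg_right (le_abs_self _) (by positivity)
  have hzz : z' = z := by
    rcases Approx.cs_lt hxm hA hdec 0 with h0 | h0
    · have : edist z z' ≤ 0 := by
        have := S.edist_le z hxm z z' (S.near_self _) (S.near_of_le S.ρ₀_lt (hd1 0))
        simp only [iterate_zero, id_eq] at h0; simpa [h0] using this
      exact (edist_le_zero.1 this).symm
    · exfalso; simp only [iterate_zero, id_eq] at h0
      have hr : edist z' z < ofReal ρ := (hd 0).trans_lt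
        ((ofReal_lt_ofReal_iff hρ).2 ((min_le_right _ _).trans_lt (by linarith)))
      have t1 := (ht z hxm z' hxm' hr).1; have t2 := S.norm_le_N hxm (S.e z' - S.e z)
      rw [S.N_eq] at t2
      have : 1 / (2 * S.C) * ‖S.e z' - S.e z‖ ≤
          1 / (2 * S.C) * (S.C * (S.pk z (S.e z' - S.e z) + S.cs z (S.e z' - S.e z))) := by gcongr
      have e : 1 / (2 * S.C) * (S.C * (S.pk z (S.e z' - S.e z) + S.cs z (S.e z' - S.e z)))
        = (S.pk z (S.e z' - S.e z) + S.cs z (S.e z' - S.e z)) / 2 := by field_simp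
      linarith
  -- `T` is injective on `K`
  have : ∀ m, S.T^[m] x' = S.T^[m] x → x' = x := by
    intro m; induction m with
    | zero => exact id
    | succ m ih =>
      intro hm; rw [iterate_succ_apply', iterate_succ_apply'] at hm; refine ih (S.T.injOn ?_ ?_ hm)
      · exact S.near_source _ (S.mem_it hx' m) _ (S.near_self _)
      · exact S.near_source _ (S.mem_it hx m) _ (S.near_self _)
  exact this _ hzz

/-- The base point of a leaf is determined by any of the points of the leaf. -/
lemma leaf_base_unique (hx : x ∈ S.K) (hx' : x' ∈ S.K) (h : y ∈ leaf S.T S.lam x)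
    (h' : y ∈ leaf S.T S.lam x') : x' = x := by
  obtain ⟨c, hc⟩ := h; obtain ⟨c', hc'⟩ := h'
  refine base_unique hx hx' (C₀ := |c'| + |c|) fun m => ?_; have hl := S.lam_pos
  calc edist (S.T^[m] x') (S.T^[m] x) ≤ edist (S.T^[m] x') (S.T^[m] y) +
        edist (S.T^[m] y) (S.T^[m] x) := edist_triangle _ _ _
    _ ≤ ofReal (|c'| * S.lam ^ m) + ofReal (|c| * S.lam ^ m) := by
        gcongr
        · rw [edist_comm]; refine (hc' m).2.trans (ofReal_le_ofReal ?_); gcongr; exact le_abs_self _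
        · refine (hc m).2.trans (ofReal_le_ofReal ?_); gcongr; exact le_abs_self _
    _ = _ := by rw [← ENNReal.ofReal_add (by positivity) (by positivity)]; congr 1; ring

lemma leafPiece_pair_approx (hx : x ∈ S.K) (hy : y ∈ S.piece S.ρ₀ x) (hy' : y' ∈ S.piece S.ρ₀ x)
    (n : ℕ) : S.Approx x (fun m => Δ[S, m] y' y) n := by
  intro m _; simp only [iterate_succ_apply']
  exact S.pair_step (S.mem_it hx m) (leafPiece_edist' S.ρ₀_pos.le hy m)
    (leafPiece_edist' S.ρ₀_pos.le hy' m)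

/-- The difference of two points of a local leaf lies in the cone around the contracted
directions. -/
lemma leafPiece_pair (hx : x ∈ S.K) (hy : y ∈ S.piece S.ρ₀ x) (hy' : y' ∈ S.piece S.ρ₀ x) (m : ℕ) :
    S.T^[m] y' = S.T^[m] y ∨ S.cs (S.T^[m] x) (Δ[S, m] y' y) <
      S.pk (S.T^[m] x) (Δ[S, m] y' y) := by
  have hdec : ∀ m, ‖Δ[S, m] y' y‖ ≤ (2 * S.C * S.ρ₀) * S.lam ^ m := by
    intro m; have h1 := leafPiece_norm S.ρ₀_pos.le S.ρ₀_lt hx hy m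
    have h2 := leafPiece_norm S.ρ₀_pos.le S.ρ₀_lt hx hy' m
    have := norm_sub_le (Δ[S, m] y' x) (Δ[S, m] y x); rw [sub_sub_sub_cancel_right] at this
    linarith
  refine (Approx.cs_lt hx (leafPiece_pair_approx hx hy hy') hdec m).imp_left fun h0 => ?_
  have := S.edist_le _ (S.mem_it hx m) _ _
    (S.near_of_le S.ρ₀_lt (leafPiece_edist' S.ρ₀_pos.le hy m))
    (S.near_of_le S.ρ₀_lt (leafPiece_edist' S.ρ₀_pos.le hy' m))
  rw [h0] at this; exact (edist_le_zero.1 (by simpa using this)).symm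

/-- Distances in a local leaf contract at the strong rate. -/
lemma leafPiece_pair_decay (hx : x ∈ S.K) (hy : y ∈ S.piece S.ρ₀ x) (hy' : y' ∈ S.piece S.ρ₀ x)
    (m : ℕ) :
    ‖Δ[S, m] y' y‖ ≤ 2 * S.C ^ 2 * S.lam ^ m * ‖S.e y' - S.e y‖ := by
  have hcs : ∀ i, S.cs (S.T^[i] x) (Δ[S, i] y' y) ≤
      S.pk (S.T^[i] x) (Δ[S, i] y' y) := by
    intro i; rcases leafPiece_pair hx hy hy' i with h | h
    · rw [h]; simp [cs]
    · exact h.le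
  have hk := (leafPiece_pair_approx hx hy hy' m).pk_decay hx (fun i _ => hcs i) m le_rfl
  simp only [iterate_zero, id_eq] at hk; have h1 := S.norm_le_N (S.mem_it hx m) (Δ[S, m] y' y)
  rw [S.N_eq] at h1; have h2 := hcs m; have h3 := S.pk_le x hx (S.e y' - S.e y)
  have hC := S.C_pos; have hl := S.lam_pos
  calc _ ≤ S.C * (2 * (S.lam ^ m * (S.C * ‖S.e y' - S.e y‖))) := by
        refine h1.trans ?_; gcongr
        have : S.lam ^ m * S.pk x (S.e y' - S.e y) ≤ S.lam ^ m * (S.C * ‖S.e y' - S.e y‖) := by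
          gcongr
        linarith
    _ = _ := by ring

lemma norm_step (hx : x ∈ S.K) (hp : edist p x ≤ ofReal S.ρ₀) (hp' : edist p' x ≤ ofReal S.ρ₀) :
    ‖S.e (S.T p') - S.e (S.T p)‖ ≤ 4 * S.C * ‖S.e p' - S.e p‖ := by
  have h := S.pair_step hx hp hp'; have h1 := S.norm_D_le x hx (S.e p' - S.e p)
  have h2 := S.N_le hx (S.e p' - S.e p)
  have h3 := norm_add_le ((S.e (S.T p') - S.e (S.T p)) - S.D x (S.e p' - S.e p))
    (S.D x (S.e p' - S.e p))
  rw [sub_add_cancel] at h3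
  have h4 : S.ε₀ * S.N x (S.e p' - S.e p) ≤ 1 * S.N x (S.e p' - S.e p) := by
    have := S.N_nonneg x (S.e p' - S.e p); gcongr; exact S.good.le_one
  linarith

lemma pair_near {δ ρ : ℝ} (hδ : 0 ≤ δ) (hρ : 0 ≤ ρ) (hy : edist y x ≤ ofReal δ)
    (h : edist y' y ≤ ofReal ρ) : edist y' x ≤ ofReal (ρ + δ) := by
  rw [ENNReal.ofReal_add hρ hδ]; exact (edist_triangle _ _ _).trans (add_le_add h hy)

lemma pair_diff_norm {δ : ℝ} (hδ : 0 ≤ δ) (hδr : δ < S.r) (hx : x ∈ S.K) (hx' : x' ∈ S.K)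
    (hy : y ∈ S.piece δ x) (hy' : y' ∈ S.piece δ x') (m : ℕ) :
    ‖(Δ[S, m] y' y) - (Δ[S, m] x' x)‖ ≤
      2 * S.C * (δ * S.lam ^ m) := by
  have h1 := leafPiece_norm hδ hδr hx hy m; have h2 := leafPiece_norm hδ hδr hx' hy' m
  have := norm_sub_le (Δ[S, m] y' x') (Δ[S, m] y x); rw [sub_sub_sub_comm] at this; linarith

lemma exists_pos_le {a b c : ℝ} (ha : 0 < a) (hb : 0 < b) (hc : 0 < c) :
    ∃ ρ > 0, ρ ≤ a ∧ ρ ≤ b ∧ ρ ≤ c :=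
  ⟨min a (min b c), by positivity, min_le_left _ _, (min_le_right _ _).trans (min_le_left _ _),
    (min_le_right _ _).trans (min_le_right _ _)⟩

/-- The orbit of a point `y'` close to a point `y` that shadows `x` stays close to the orbit of `y`
forever, or there is a first time at which it does not, and then it is still near the orbit of
`x`. -/
lemma exists_exit (S : HypSys M V) {σ : ℝ} (hσ : 0 < σ) (hσr : σ < S.r) :
    ∃ ρu > 0, ∀ x ∈ S.K, ∀ ρ δ y y', 0 ≤ ρ → 0 ≤ δ → δ < S.r → ρ + δ < ρu →
    (∀ i, edist (S.T^[i] y) (S.T^[i] x) ≤ ofReal δ) → edist y' y ≤ ofReal ρ →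
    (∀ i, edist (S.T^[i] y') (S.T^[i] y) ≤ ofReal ρ) ∨
    ∃ I, (∀ i < I + 1, edist (S.T^[i] y') (S.T^[i] y) ≤ ofReal ρ) ∧
      edist (S.T^[I + 1] y') (S.T^[I + 1] x) < ofReal σ ∧
      ρ < S.C * ‖Δ[S, I + 1] y' y‖ := by
  obtain ⟨ρu, hρu, hu⟩ := S.unif σ hσ
  refine ⟨ρu, hρu, fun x hx ρ δ y y' hρ hδ hδr h hY h0 => or_iff_not_imp_left.2 fun hall => ?_⟩
  push Not at hall
  classical
  have hJ1 := Nat.find_spec hall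
  have hJ2 := fun i => Nat.find_min hall (m := i)
  obtain ⟨I, hI⟩ := Nat.exists_eq_succ_of_ne_zero (n := Nat.find hall) fun h => by
    rw [h] at hJ1; exact hJ1.not_ge h0
  rw [hI] at hJ1 hJ2
  have n1 : edist (S.T^[I + 1] y') (S.T^[I + 1] x) < ofReal σ := by
    rw [iterate_succ_apply', iterate_succ_apply']
    exact hu _ (S.mem_it hx I) _ ((pair_near hδ hρ (hY I) (not_lt.1 (hJ2 I (by omega)))).trans_lt
      ((ofReal_lt_ofReal_iff hρu).2 h))
  refine ⟨I, fun i hi => not_lt.1 (hJ2 i hi), n1, (ENNReal.ofReal_lt_ofReal_iff'.1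
    (hJ1.trans_le ?_)).1⟩
  rw [edist_comm]
  exact S.edist_le _ (S.mem_it hx _) _ _ (S.near_of_le hδr (hY _)) (S.near_of_le hσr n1.le)

/-- Orbits of two points whose forward orbits shadow orbits of `K` do not separate in the expanded
direction: otherwise they would have to leave a neighbourhood of each other along a direction
transverse to `K`, while the orbits in `K` they shadow stay in `K`. -/
lemma exists_pe_le (S : HypSys M V) : ∃ ρ > 0, ρ ≤ S.ρ₀ / 2 ∧ ∃ δ > 0, δ ≤ S.ρ₀ / 2 ∧
    ∀ x ∈ S.K, ∀ x' ∈ S.K, ∀ y ∈ S.piece δ x, ∀ y' ∈ S.piece δ x', edist y' y ≤ ofReal ρ →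
    S.pe x (S.e y' - S.e y) ≤ S.pc x (S.e y' - S.e y) + S.pk x (S.e y' - S.e y) := by
  have hC := S.C_pos; have hC1 := S.one_le_C; have hρ₀ := S.ρ₀_pos; have hl := S.lam_pos
  have hr := S.ρ₀_lt; obtain ⟨ρt, hρt, ht⟩ := S.tangency (1 / (4 * S.C)) (by positivity)
  have hm1 := min_le_left (ρt / 4) (S.ρ₀ / 4); have hm2 := min_le_right (ρt / 4) (S.ρ₀ / 4)
  obtain ⟨ρu, hρu, hu⟩ := S.exists_exit (σ := min (ρt / 4) (S.ρ₀ / 4)) (by positivity) (by linarith)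
  obtain ⟨ρ, hρ, r1, r2, -⟩ := exists_pos_le (a := S.ρ₀ / 4) (b := ρu / 4) (by positivity)
    (by positivity) one_pos
  obtain ⟨δ, hδ, d1, d3, d4⟩ := exists_pos_le (b := ρt / 4) (c := ρ / (16 * S.C ^ 4)) hρ
    (by positivity) (by positivity)
  refine ⟨ρ, hρ, by linarith, δ, hδ, by linarith, fun x hx x' hx' y hy y' hy' hyy => ?_⟩
  by_contra! hcon
  set Y : ℕ → V := fun m => Δ[S, m] y' y with hY; have hYx := leafPiece_edist' hδ.le hy
  have hle : ∀ {a b : ℝ}, a ≤ b → ofReal a ≤ ofReal b := fun h => ofReal_le_ofReal h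
  have hgr : ∀ n, (∀ i < n, edist (S.T^[i] y') (S.T^[i] y) ≤ ofReal ρ) →
      S.pc (S.T^[n] x) (Y n) + S.pk (S.T^[n] x) (Y n) ≤ S.pe (S.T^[n] x) (Y n) ∧
      S.pe x (Y 0) ≤ S.lam ^ n * S.pe (S.T^[n] x) (Y n) := by
    refine fun n hn => Approx.pe_growth hx (fun i hi => ?_) hcon.le n le_rfl
    simp only [hY, iterate_succ_apply']
    exact S.pair_step (S.mem_it hx i) ((hYx i).trans (hle (by linarith)))
      ((pair_near hδ.le hρ.le (hYx i) (hn i hi)).trans (hle (by linarith)))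
  have hpos : 0 < S.pe x (Y 0) := (add_nonneg (S.pc_nonneg _ _) (S.pk_nonneg _ _)).trans_lt hcon
  rcases hu x hx ρ δ y y' hρ.le hδ.le (by linarith) (by linarith) hYx hyy with hall | ⟨I, hI, n1, w7⟩
  · refine hpos.ne' (eq_zero_of_forall_le (b := S.C * (S.C * ρ)) hpos.le S.lam_lt_one hl.le
      fun m => (hgr m fun i _ => hall i).2.trans ?_)
    rw [mul_comm]; gcongr; refine (S.pe_le _ (S.mem_it hx m) _).trans ?_; gcongr
    exact S.le_edist _ (S.mem_it hx m) _ _ (S.near_of_le (by linarith) (hYx m))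
      (S.near_of_le hr ((pair_near hδ.le hρ.le (hYx m) (hall m)).trans (hle (by linarith)))) _ hρ.le
      (by rw [edist_comm]; exact hall m)
  · obtain ⟨hg1, -⟩ := hgr _ hI; set J := I + 1; have hxJ := S.mem_it hx J
    have hX := (ht _ hxJ _ (S.mem_it hx' J) ((pair_near (by positivity) hδ.le n1.le
      (by rw [edist_comm]; exact leafPiece_edist' hδ.le hy' J)).trans_lt
      ((ofReal_lt_ofReal_iff hρt).2 (by linarith)))).2
    have w3 : ‖Y J - (Δ[S, J] x' x)‖ ≤ 2 * S.C * δ :=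
      (pair_diff_norm hδ.le (by linarith) hx hx' hy hy' J).trans (by
        gcongr; exact S.mul_pow_le hδ.le _)
    set X := Δ[S, J] x' x
    have w4 : S.pe (S.T^[J] x) (Y J) ≤ S.pe (S.T^[J] x) X + S.C * (2 * S.C * δ) := by
      have := map_add_le_add (S.pe (S.T^[J] x)) X (Y J - X); rw [add_sub_cancel] at this
      linarith [(S.pe_le _ hxJ (Y J - X)).trans (mul_le_mul_of_nonneg_left w3 hC.le)]
    have w5 : ‖X‖ ≤ ‖Y J‖ + 2 * S.C * δ := by
      have := norm_sub_le (Y J) (Y J - X); rw [sub_sub_cancel] at this; linarith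
    have w6 : ‖Y J‖ ≤ S.C * (2 * S.pe (S.T^[J] x) (Y J)) := by
      refine (S.norm_le_N hxJ (Y J)).trans ?_; gcongr; unfold N; linarith
    have w8 : S.pe (S.T^[J] x) (Y J) ≤ 1 / (4 * S.C) * (‖Y J‖ + 2 * S.C * δ) + S.C * (2 * S.C * δ) :=
      w4.trans (add_le_add_left (hX.trans (by gcongr)) _)
    have w9 : ‖Y J‖ ≤ ‖Y J‖ / 2 + (S.C * δ + 4 * S.C ^ 3 * δ) := by
      calc ‖Y J‖ ≤ S.C * (2 * (1 / (4 * S.C) * (‖Y J‖ + 2 * S.C * δ) + S.C * (2 * S.C * δ))) :=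
            w6.trans (by gcongr)
        _ = _ := by field_simp; ring
    have w10 : S.C * δ ≤ S.C ^ 3 * δ := by gcongr; exact le_self_pow₀ hC1 (by norm_num)
    have w11 : S.C * ‖Y J‖ ≤ S.C * (10 * S.C ^ 3 * δ) := by gcongr; linarith
    rw [le_div_iff₀ (by positivity)] at d4; linarith [show 0 < S.C ^ 4 * δ by positivity]

/-- Radius of separation for `exists_pe_le`. -/
def ρ₁ (S : HypSys M V) : ℝ := S.exists_pe_le.choose
/-- Size of the local leaves for `exists_pe_le`. -/
def δ₁ (S : HypSys M V) : ℝ := S.exists_pe_le.choose_spec.2.2.choose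

lemma ρ₁_pos (S : HypSys M V) : 0 < S.ρ₁ := S.exists_pe_le.choose_spec.1
lemma ρ₁_le (S : HypSys M V) : S.ρ₁ ≤ S.ρ₀ / 2 := S.exists_pe_le.choose_spec.2.1
lemma δ₁_pos (S : HypSys M V) : 0 < S.δ₁ := S.exists_pe_le.choose_spec.2.2.choose_spec.1
lemma δ₁_le (S : HypSys M V) : S.δ₁ ≤ S.ρ₀ / 2 := S.exists_pe_le.choose_spec.2.2.choose_spec.2.1
lemma pe_le_of_pair (hx : x ∈ S.K) (hx' : x' ∈ S.K) (hy : y ∈ S.piece S.δ₁ x)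
    (hy' : y' ∈ S.piece S.δ₁ x') (h : edist y' y ≤ ofReal S.ρ₁) :
    S.pe x (S.e y' - S.e y) ≤ S.pc x (S.e y' - S.e y) + S.pk x (S.e y' - S.e y) :=
  S.exists_pe_le.choose_spec.2.2.choose_spec.2.2 x hx x' hx' y hy y' hy' h

lemma shift_mem {δ : ℝ} (hδ : 0 ≤ δ) (hy : y ∈ S.piece δ x) (m : ℕ) :
    S.T^[m] y ∈ S.piece δ (S.T^[m] x) :=
  leafPiece_mono S.lam_pos.le
    (S.mul_pow_le hδ _) (leafPiece_shift hy m)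

lemma pair_approx (hx : x ∈ S.K) (hy : y ∈ S.piece S.δ₁ x) {n : ℕ}
    (h : ∀ i < n, edist (S.T^[i] y') (S.T^[i] y) ≤ ofReal S.ρ₁) :
    S.Approx x (fun i => Δ[S, i] y' y) n := by
  intro i hi; simp only [iterate_succ_apply']
  have h1 := S.δ₁_le; have h2 := S.ρ₁_le; have h3 := S.ρ₀_pos
  have hyi := leafPiece_edist' S.δ₁_pos.le hy i
  exact S.pair_step (S.mem_it hx i) (hyi.trans (ofReal_le_ofReal (by linarith)))
    ((pair_near S.δ₁_pos.le S.ρ₁_pos.le hyi (h i hi)).trans (ofReal_le_ofReal (by linarith)))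

/-- Two orbits shadowing orbits of `K` separate at most at the centre rate. -/
lemma pair_growth (hx : x ∈ S.K) (hx' : x' ∈ S.K) (hy : y ∈ S.piece S.δ₁ x)
    (hy' : y' ∈ S.piece S.δ₁ x') {n : ℕ} (h : ∀ i ≤ n, edist (S.T^[i] y') (S.T^[i] y) ≤ ofReal S.ρ₁) :
    S.N (S.T^[n] x) (Δ[S, n] y' y) ≤
      2 * S.α₁ ^ n * S.N x (S.e y' - S.e y) := by
  have hpe : ∀ i ≤ n, _ := fun i hi => pe_le_of_pair (S.mem_it hx i) (S.mem_it hx' i)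
    (shift_mem S.δ₁_pos.le hy i) (shift_mem S.δ₁_pos.le hy' i) (h i hi)
  have h1 := (pair_approx hx hy (fun i hi => h i (le_of_lt hi))).ck_bound hx
    (fun i hi => hpe i hi.le) n le_rfl
  have h2 := hpe n le_rfl; simp only [iterate_zero, id_eq] at h1
  have h3 : S.pc x (S.e y' - S.e y) + S.pk x (S.e y' - S.e y) ≤ S.N x (S.e y' - S.e y) := by
    unfold N; linarith [S.pe_nonneg x (S.e y' - S.e y)]
  have h4 := mul_le_mul_of_nonneg_left h3 (pow_nonneg S.α₁_pos.le n)
  have h5 : S.N (S.T^[n] x) (Δ[S, n] y' y) =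
    S.pk (S.T^[n] x) (Δ[S, n] y' y) +
    S.pc (S.T^[n] x) (Δ[S, n] y' y) +
    S.pe (S.T^[n] x) (Δ[S, n] y' y) := rfl
  linarith

/-- The difference `W` between the separation of two shadowing points and the separation of the
points of `K` they shadow is either much smaller than the separation itself, or contracted by `T`:
otherwise `W` would decay slower than the distance of the two orbits to `K`.  This is where the
second order estimate on `T` and the gap condition `α² λ < 1` enter. -/
lemma exists_dichotomy (S : HypSys M V) : ∃ K₀ ≥ 0, ∃ ρ > 0, ρ ≤ S.ρ₁ ∧ ∃ δ₂ > 0, δ₂ ≤ S.δ₁ ∧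
    ∀ x ∈ S.K, ∀ x' ∈ S.K, ∀ δ > 0, δ ≤ δ₂ →
    ∀ y ∈ S.piece δ x, ∀ y' ∈ S.piece δ x',
    edist y' y ≤ ofReal ρ →
    S.cs x ((S.e y' - S.e y) - (S.e x' - S.e x)) < S.pk x ((S.e y' - S.e y) - (S.e x' - S.e x)) ∨
    S.N x ((S.e y' - S.e y) - (S.e x' - S.e x)) ≤ K₀ * δ * S.N x (S.e y' - S.e y) := by
  have hC := S.C_pos; have hρ₀ := S.ρ₀_pos; have hl := S.lam_pos; have hρ₁ := S.ρ₁_pos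
  have hδ₁ := S.δ₁_pos; have hε := S.ε₀_pos; have hr := S.r_pos; have hα := S.α₁_pos
  have hgap := S.gap; have hρr := S.ρ₀_lt
  obtain ⟨ρu, hρu, hu⟩ := S.exists_exit (half_pos hr) (half_lt_self hr)
  obtain ⟨ρ', hρ', r1, r2, r3⟩ := exists_pos_le hρ₁ (b := S.ρ₀ / 4) (c := ρu / 4) (by positivity)
    (by positivity)
  obtain ⟨ρ, hρ, r0, r4, -⟩ := exists_pos_le hρ' (b := S.ε₀ / (6 * S.C ^ 3)) (by positivity) one_pos
  set K₀ := 16 * S.C ^ 3 / S.ε₀ + 64 * S.C ^ 5 / ρ with hK₀; have hK0 : 0 < K₀ := by positivity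
  refine ⟨K₀, hK0.le, ρ, hρ, r0.trans r1, min S.δ₁ ρ, by positivity, min_le_left _ _, ?_⟩
  intro x hx x' hx' δ hδ hδ2 y hy y' hy' hyy; have d1 : δ ≤ S.δ₁ := hδ2.trans (min_le_left _ _)
  have d2 : δ ≤ ρ := hδ2.trans (min_le_right _ _)
  by_contra! hcon
  obtain ⟨hc0, hbig⟩ := hcon; set Y : ℕ → V := fun m => Δ[S, m] y' y with hY
  set X : ℕ → V := fun m => Δ[S, m] x' x with hX; set W : ℕ → V := fun m => Y m - X m with hW
  have hle : ∀ {a b : ℝ}, a ≤ b → ofReal a ≤ ofReal b := fun h => ofReal_le_ofReal h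
  have hYx := leafPiece_edist' hδ.le hy
  have hnear : ∀ i, edist (S.T^[i] y') (S.T^[i] y) ≤ ofReal ρ →
      edist (S.T^[i] y') (S.T^[i] x) ≤ ofReal (ρ + δ) := fun i hi =>
    pair_near hδ.le hρ.le (hYx i) hi
  have hnear' : ∀ i, edist (S.T^[i] y') (S.T^[i] y) ≤ ofReal ρ →
      edist (S.T^[i] x') (S.T^[i] x) ≤ ofReal (3 * ρ) := fun i hi =>
    (pair_near (by positivity) hδ.le (hnear i hi)
      (by rw [edist_comm]; exact leafPiece_edist' hδ.le hy' i)).trans (hle (by linarith))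
  have hWn : ∀ m, ‖W m‖ ≤ 2 * S.C * (δ * S.lam ^ m) :=
    pair_diff_norm hδ.le (by linarith) hx hx' hy hy'
  have hcs0 : S.N x (W 0) ≤ 2 * S.cs x (W 0) := by
    rw [S.N_eq]; linarith [show S.pk x (W 0) ≤ S.cs x (W 0) from hc0]
  have hbig' : K₀ * δ * S.N x (Y 0) < S.N x (W 0) := hbig
  have hYg : ∀ n, (∀ i ≤ n, edist (S.T^[i] y') (S.T^[i] y) ≤ ofReal ρ) →
      S.N (S.T^[n] x) (Y n) ≤ 2 * S.α₁ ^ n * S.N x (Y 0) := fun n hn =>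
    pair_growth hx hx' (leafPiece_mono hl.le d1 hy) (leafPiece_mono hl.le d1 hy')
      fun i hi => (hn i hi).trans (hle (r0.trans r1))
  -- one step of the cocycle for `W`, as long as the two orbits are close
  have hstep : ∀ n, (∀ i ≤ n, edist (S.T^[i] y') (S.T^[i] y) ≤ ofReal ρ) →
      S.cs x (W 0) ≤ S.α₁ ^ n * S.cs (S.T^[n] x) (W n) →
      ‖W (n + 1) - S.D (S.T^[n] x) (W n)‖ ≤ S.ε₀ * S.N (S.T^[n] x) (W n) := by
    intro n hn hcs; have hxn := S.mem_it hx n; have hnn := hn n le_rfl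
    have e1 : edist (S.T^[n] y) (S.T^[n] x) < ofReal S.r := S.near_of_le (by linarith) (hYx n)
    have e2 : edist (S.T^[n] y') (S.T^[n] x) < ofReal S.r :=
      S.near_of_le (by linarith) (hnear n hnn)
    have e3 : edist (S.T^[n] x') (S.T^[n] x) < ofReal S.r :=
      S.near_of_le (by linarith) (hnear' n hnn)
    have h4 := S.four _ hxn _ _ _ e1 e2 e3
    have hXn : ‖X n‖ ≤ S.C * (3 * ρ) := S.le_edist _ hxn _ _ (S.near_self _) e3 _ (by positivity)
      (by rw [edist_comm]; exact hnear' n hnn)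
    have f1 := leafPiece_norm hδ.le (by linarith) hx hy n
    have f2 := leafPiece_norm hδ.le (by linarith) hx' hy' n; set w := S.N (S.T^[n] x) (W n) with hw
    have hw0 : 0 ≤ w := S.N_nonneg _ _
    have t1 : S.C * ‖X n‖ * ‖W n‖ ≤ S.ε₀ / 2 * w := by
      calc _ ≤ S.C * (S.C * (3 * (S.ε₀ / (6 * S.C ^ 3)))) * (S.C * w) := by
            gcongr
            · exact hXn.trans (by gcongr)
            · exact S.norm_le_N hxn _
        _ = _ := by field_simp; ring
    have t2 : S.C * (‖Δ[S, n] y x‖ + ‖Δ[S, n] y' x'‖)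
        * ‖Y n‖ ≤ S.ε₀ / 2 * w := by
      have hN0 : δ * S.N x (Y 0) ≤ 2 * S.cs x (W 0) / K₀ := by rw [le_div_iff₀ hK0]; linarith
      have hcsw : S.cs (S.T^[n] x) (W n) ≤ w := by
        rw [hw, S.N_eq]; linarith [S.pk_nonneg (S.T^[n] x) (W n)]
      have hq : (S.α₁ ^ 2 * S.lam) ^ n ≤ 1 := pow_le_one₀ (by positivity) hgap.le
      calc _ ≤ S.C * (S.C * (δ * S.lam ^ n) + S.C * (δ * S.lam ^ n)) *
            (S.C * (2 * S.α₁ ^ n * S.N x (Y 0))) := by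
            gcongr; exact (S.norm_le_N hxn _).trans (by gcongr; exact hYg n hn)
        _ = 4 * S.C ^ 3 * (S.lam ^ n * S.α₁ ^ n) * (δ * S.N x (Y 0)) := by ring
        _ ≤ 4 * S.C ^ 3 * (S.lam ^ n * S.α₁ ^ n) *
            (2 * (S.α₁ ^ n * S.cs (S.T^[n] x) (W n)) / K₀) := by
            gcongr; exact hN0.trans (by gcongr)
        _ = 8 * S.C ^ 3 / K₀ * ((S.α₁ ^ 2 * S.lam) ^ n * S.cs (S.T^[n] x) (W n)) := by
            rw [mul_pow, ← pow_mul, mul_comm 2 n, pow_mul]; ring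
        _ ≤ 8 * S.C ^ 3 / (16 * S.C ^ 3 / S.ε₀) * (1 * w) := by
            have : 16 * S.C ^ 3 / S.ε₀ ≤ K₀ := by
              rw [hK₀]; linarith [show 0 < 64 * S.C ^ 5 / ρ by positivity]
            have := S.cs_nonneg (S.T^[n] x) (W n); gcongr
        _ = _ := by field_simp; ring
    have e : W (n + 1) = ((S.e (S.T (S.T^[n] y')) - S.e (S.T (S.T^[n] y))) -
        (S.e (S.T (S.T^[n] x')) - S.e (S.T (S.T^[n] x)))) := by
      simp only [hW, hY, hX, iterate_succ_apply']
    rw [e]; refine h4.trans ?_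
    calc _ ≤ S.ε₀ / 2 * w + S.ε₀ / 2 * w := add_le_add t1 t2
      _ = _ := by ring
  have hgrow : ∀ n, (∀ i < n, edist (S.T^[i] y') (S.T^[i] y) ≤ ofReal ρ) →
      S.pk (S.T^[n] x) (W n) ≤ S.cs (S.T^[n] x) (W n) ∧
      S.cs x (W 0) ≤ S.α₁ ^ n * S.cs (S.T^[n] x) (W n) := fun n hn =>
    growth_of_step (p := fun m => S.pk (S.T^[m] x) (W m) ≤ S.cs (S.T^[m] x) (W m))
      (a := fun m => S.cs (S.T^[m] x) (W m)) hα.le hc0 (fun m hm i1 i2 => by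
        simp only [iterate_succ_apply']
        exact S.good.cs (S.mem_it hx m) (hstep m (fun i hi => hn i (by omega)) i2) i1) n le_rfl
  have hcsup : ∀ n, S.cs (S.T^[n] x) (W n) ≤ 4 * S.C ^ 2 * δ * S.lam ^ n := fun n =>
    calc _ ≤ 2 * S.C * (2 * S.C * (δ * S.lam ^ n)) :=
          (S.cs_le (S.mem_it hx n) _).trans (by gcongr; exact hWn n)
      _ = _ := by ring
  have hN0 := S.N_nonneg x (Y 0)
  have hpos : 0 < S.cs x (W 0) := by linarith [show 0 ≤ K₀ * δ * S.N x (Y 0) by positivity]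
  rcases hu x hx ρ δ y y' hρ.le hδ.le (by linarith) (by linarith) hYx hyy with hall | ⟨I, hJ2, -, e2⟩
  · refine hpos.ne' (eq_zero_of_forall_le (b := 4 * S.C ^ 2 * δ) (q := S.α₁ * S.lam)
      hpos.le S.α₁_lam_lt_one (by positivity) fun m => (hgrow m fun i _ => hall i).2.trans ?_)
    calc _ ≤ S.α₁ ^ m * (4 * S.C ^ 2 * δ * S.lam ^ m) := by gcongr; exact hcsup m
      _ = _ := by rw [mul_pow]; ring
  · have hxI := S.mem_it hx I; have hII := hJ2 I I.lt_succ_self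
    have e3 : ‖Y (I + 1)‖ ≤ 4 * S.C * ‖Y I‖ := by
      simp only [hY, iterate_succ_apply']
      exact norm_step hxI ((hYx I).trans (hle (by linarith)))
        ((hnear I hII).trans (hle (by linarith)))
    set J := I + 1
    have e4 : ‖Y I‖ ≤ S.C * (2 * S.α₁ ^ I * S.N x (Y 0)) :=
      (S.norm_le_N hxI _).trans (by gcongr; exact hYg I fun i hi => hJ2 i (by omega))
    have e5 : S.α₁ ^ I ≤ S.α₁ ^ J := pow_le_pow_right₀ S.one_lt_α₁.le (by omega)
    have e6 : ρ < 8 * S.C ^ 3 * S.α₁ ^ J * S.N x (Y 0) := by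
      calc ρ < S.C * ‖Y J‖ := e2
        _ ≤ S.C * (4 * S.C * (S.C * (2 * S.α₁ ^ I * S.N x (Y 0)))) := by
            gcongr; exact e3.trans (by gcongr)
        _ = 8 * S.C ^ 3 * S.α₁ ^ I * S.N x (Y 0) := by ring
        _ ≤ _ := by gcongr
    have e7 := (hgrow J hJ2).2.trans (mul_le_mul_of_nonneg_left (hcsup J) (by positivity))
    have e8 : K₀ * δ * S.N x (Y 0) < 8 * S.C ^ 2 * δ * (S.α₁ ^ J * S.lam ^ J) := by
      calc _ < S.N x (W 0) := hbig'
        _ ≤ 2 * (S.α₁ ^ J * (4 * S.C ^ 2 * δ * S.lam ^ J)) := by linarith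
        _ = _ := by ring
    have e9 : K₀ * S.N x (Y 0) < 8 * S.C ^ 2 * (S.α₁ ^ J * S.lam ^ J) := by
      have : δ * (K₀ * S.N x (Y 0)) < δ * (8 * S.C ^ 2 * (S.α₁ ^ J * S.lam ^ J)) := by linarith
      exact lt_of_mul_lt_mul_left this hδ.le
    have hq : (S.α₁ ^ 2 * S.lam) ^ J ≤ 1 := pow_le_one₀ (by positivity) hgap.le
    have e10 : K₀ * ρ < 64 * S.C ^ 5 := by
      calc K₀ * ρ < K₀ * (8 * S.C ^ 3 * S.α₁ ^ J * S.N x (Y 0)) := by gcongr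
        _ = 8 * S.C ^ 3 * S.α₁ ^ J * (K₀ * S.N x (Y 0)) := by ring
        _ ≤ 8 * S.C ^ 3 * S.α₁ ^ J * (8 * S.C ^ 2 * (S.α₁ ^ J * S.lam ^ J)) := by gcongr
        _ = 64 * S.C ^ 5 * (S.α₁ ^ 2 * S.lam) ^ J := by
            rw [mul_pow, ← pow_mul, mul_comm 2 J, pow_mul]; ring
        _ ≤ 64 * S.C ^ 5 * 1 := by gcongr
        _ = _ := mul_one _
    have e11 : 64 * S.C ^ 5 ≤ K₀ * ρ := by
      rw [hK₀, add_mul, div_mul_cancel₀ _ hρ.ne']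
      have : 0 ≤ 16 * S.C ^ 3 / S.ε₀ * ρ := by positivity
      linarith
    linarith

/-- The constant of `exists_dichotomy`. -/
def K₀ (S : HypSys M V) : ℝ := S.exists_dichotomy.choose
/-- Radius of separation for `exists_dichotomy`. -/
def ρ₂ (S : HypSys M V) : ℝ := S.exists_dichotomy.choose_spec.2.choose
/-- Size of the local leaves for `exists_dichotomy`. -/
def δ₂ (S : HypSys M V) : ℝ := S.exists_dichotomy.choose_spec.2.choose_spec.2.2.choose
lemma K₀_nonneg (S : HypSys M V) : 0 ≤ S.K₀ := S.exists_dichotomy.choose_spec.1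
lemma ρ₂_pos (S : HypSys M V) : 0 < S.ρ₂ := S.exists_dichotomy.choose_spec.2.choose_spec.1
lemma δ₂_pos (S : HypSys M V) : 0 < S.δ₂ :=
  S.exists_dichotomy.choose_spec.2.choose_spec.2.2.choose_spec.1
lemma δ₂_le (S : HypSys M V) : S.δ₂ ≤ S.δ₁ :=
  S.exists_dichotomy.choose_spec.2.choose_spec.2.2.choose_spec.2.1
lemma dichotomy {δ : ℝ} (hx : x ∈ S.K) (hx' : x' ∈ S.K) (hδ : 0 < δ) (hδ' : δ ≤ S.δ₂)
    (hy : y ∈ S.piece δ x) (hy' : y' ∈ S.piece δ x') (h : edist y' y ≤ ofReal S.ρ₂) :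
    S.cs x ((S.e y' - S.e y) - (S.e x' - S.e x)) < S.pk x ((S.e y' - S.e y) - (S.e x' - S.e x)) ∨
    S.N x ((S.e y' - S.e y) - (S.e x' - S.e x)) ≤ S.K₀ * δ * S.N x (S.e y' - S.e y) :=
  S.exists_dichotomy.choose_spec.2.choose_spec.2.2.choose_spec.2.2 x hx x' hx' δ hδ hδ' y hy y'
    hy' h

/-! ### Derivatives along shadowing orbits -/

lemma tendsto_slope {f : G → V} {f' : G →L[ℝ] V} {u : G}
    (hf : HasFDerivAt f f' u) (w : G) :
    Tendsto (fun t : ℝ => t⁻¹ • (f (u + t • w) - f u)) (𝓝[≠] 0) (𝓝 (f' w)) := by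
  have := (hf.hasLineDerivAt w).tendsto_slope_zero; simpa using this

lemma tendsto_line (u w : G) :
    Tendsto (fun t : ℝ => u + t • w) (𝓝[≠] 0) (𝓝 u) := by
  have : Tendsto (fun t : ℝ => u + t • w) (𝓝 0) (𝓝 (u + (0 : ℝ) • w)) := by
    apply Continuous.tendsto; fun_prop
  rw [zero_smul, add_zero] at this; exact this.mono_left nhdsWithin_le_nhds

/-- `Dm m` is the derivative at `u` of the `m`-th iterate of `T` along the parametrization `c`, read
in `V` through `e`. -/
structure IsJet (S : HypSys M V) (c : G → M) (u : G) (Dm : ℕ → G →L[ℝ] V) : Prop where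
  cont : ∀ m, ContinuousAt (fun v => S.T^[m] (c v)) u
  deriv : ∀ m, HasFDerivAt (fun v => S.e (S.T^[m] (c v))) (Dm m) u

lemma continuous_pk (hx : x ∈ S.K) : Continuous (S.pk x) := by
  refine Seminorm.continuous_of_continuousAt_zero ?_
  refine tendsto_of_tendsto_of_tendsto_of_le_of_le (g := fun _ => 0)
    (h := fun v => S.C * ‖v‖) ?_ ?_ (fun v => apply_nonneg _ _) (S.pk_le x hx)
  · simp [tendsto_const_nhds]
  · have : Continuous (fun v : V => S.C * ‖v‖) := by fun_prop
    simpa using this.tendsto 0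

lemma continuous_pc (hx : x ∈ S.K) : Continuous (S.pc x) := by
  refine Seminorm.continuous_of_continuousAt_zero ?_
  refine tendsto_of_tendsto_of_tendsto_of_le_of_le (g := fun _ => 0)
    (h := fun v => S.C * ‖v‖) ?_ ?_ (fun v => apply_nonneg _ _) (S.pc_le x hx)
  · simp [tendsto_const_nhds]
  · have : Continuous (fun v : V => S.C * ‖v‖) := by fun_prop
    simpa using this.tendsto 0

lemma continuous_pe (hx : x ∈ S.K) : Continuous (S.pe x) := by
  refine Seminorm.continuous_of_continuousAt_zero ?_
  refine tendsto_of_tendsto_of_tendsto_of_le_of_le (g := fun _ => 0)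
    (h := fun v => S.C * ‖v‖) ?_ ?_ (fun v => apply_nonneg _ _) (S.pe_le x hx)
  · simp [tendsto_const_nhds]
  · have : Continuous (fun v : V => S.C * ‖v‖) := by fun_prop
    simpa using this.tendsto 0

lemma continuous_cs (hx : x ∈ S.K) : Continuous (S.cs x) :=
  (continuous_pc hx).add (continuous_pe hx)

lemma continuous_N (hx : x ∈ S.K) : Continuous (S.N x) :=
  ((continuous_pk hx).add (continuous_pc hx)).add (continuous_pe hx)

lemma edist_eventually_le {X : Type*} {l : Filter X} {f : X → M} {δ η : ℝ} (hf : Tendsto f l (𝓝 p))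
    (hp : edist p q ≤ ofReal δ) (hδ : 0 ≤ δ) (hη : 0 < η) :
    ∀ᶠ t in l, edist (f t) q ≤ ofReal (δ + η) := by
  have : ∀ᶠ t in l, edist (f t) p < ofReal η := by
    have := EMetric.tendsto_nhds.1 hf (ofReal η) (ofReal_pos.2 hη); exact this
  filter_upwards [this] with t ht
  rw [add_comm, ENNReal.ofReal_add hη.le hδ]
  exact (edist_triangle _ _ _).trans (add_le_add ht.le hp)

variable {c : G → M} {u : G} {Dm : ℕ → G →L[ℝ] V}

lemma IsJet.tendsto_cont (h : S.IsJet c u Dm) (w : G) (m : ℕ) :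
    Tendsto (fun t : ℝ => S.T^[m] (c (u + t • w))) (𝓝[≠] 0) (𝓝 (S.T^[m] (c u))) :=
  (h.cont m).tendsto.comp (tendsto_line u w)

lemma IsJet.step (h : S.IsJet c u Dm) (hx : x ∈ S.K) {δ : ℝ} (hδ : 0 ≤ δ) (hδr : δ < S.r) {m : ℕ}
    (hy : edist (S.T^[m] (c u)) (S.T^[m] x) ≤ ofReal δ) (w : G) :
    ‖Dm (m + 1) w - S.D (S.T^[m] x) (Dm m w)‖ ≤ S.C ^ 2 * (2 * δ) * ‖Dm m w‖ := by
  have hxm := S.mem_it hx m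
  -- pass to the limit in `pair_error`
  have key : ∀ η > 0, δ + η < S.r → ‖Dm (m + 1) w - S.D (S.T^[m] x) (Dm m w)‖ ≤
      S.C ^ 2 * (δ + (δ + η)) * ‖Dm m w‖ := by
    intro η hη hηr; have t1 := tendsto_slope (h.deriv (m + 1)) w
    have t2 := tendsto_slope (h.deriv m) w
    refine le_of_tendsto_of_tendsto ((t1.sub
      (((S.D (S.T^[m] x)).continuous.tendsto _).comp t2)).norm) (t2.norm.const_mul _) ?_
    filter_upwards [edist_eventually_le (h.tendsto_cont w m) hy hδ hη] with t ht
    have := S.pair_error hxm hδ (by linarith) hδr hηr hy ht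
    simp only [comp_apply, iterate_succ_apply', map_smul, ← smul_sub, norm_smul]; rw [mul_left_comm]
    exact mul_le_mul_of_nonneg_left this (norm_nonneg _)
  have : Tendsto (fun η : ℝ => S.C ^ 2 * (δ + (δ + η)) * ‖Dm m w‖) (𝓝[>] 0)
      (𝓝 (S.C ^ 2 * (δ + (δ + 0)) * ‖Dm m w‖)) := by
    refine Tendsto.mono_left (Continuous.tendsto (by fun_prop) _) nhdsWithin_le_nhds
  rw [show S.C ^ 2 * (2 * δ) * ‖Dm m w‖ = S.C ^ 2 * (δ + (δ + 0)) * ‖Dm m w‖ by ring]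
  refine ge_of_tendsto this ?_
  filter_upwards [self_mem_nhdsWithin,
    exists_small (f := fun η => δ + η) (a := δ) (by fun_prop) (by ring) hδr] with η h1 h2
  exact key η h1 h2

lemma IsJet.approx_of_near (h : S.IsJet c u Dm) (hx : x ∈ S.K) {n : ℕ}
    (hy : ∀ m < n, edist (S.T^[m] (c u)) (S.T^[m] x) ≤ ofReal S.ρ₀) (w : G) :
    S.Approx x (fun m => Dm m w) n := by
  intro m hm; refine (h.step hx S.ρ₀_pos.le S.ρ₀_lt (hy m hm) w).trans ?_
  have hC := S.C_pos; have hε := S.ε₀_pos; have : S.ρ₀ ≤ S.ε₀ / (2 * S.C ^ 3) := min_le_right _ _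
  have := S.N_nonneg (S.T^[m] x) (Dm m w)
  calc _ ≤ S.C ^ 2 * (2 * (S.ε₀ / (2 * S.C ^ 3))) * (S.C * S.N (S.T^[m] x) (Dm m w)) := by
        gcongr; exact S.norm_le_N (S.mem_it hx m) _
    _ = _ := by field_simp

lemma IsJet.shift (h : S.IsJet c u Dm) (k : ℕ) :
    S.IsJet (fun v => S.T^[k] (c v)) u (fun m => Dm (m + k)) := by
  constructor
  · intro m; simp only [← iterate_add_apply]; exact h.cont _
  · intro m; simp only [← iterate_add_apply]; exact h.deriv _

lemma IsJet.approx (h : S.IsJet c u Dm) (hx : x ∈ S.K) (hy : c u ∈ S.piece S.ρ₀ x) (w : G) (n : ℕ) :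
    S.Approx x (fun m => Dm m w) n :=
  h.approx_of_near hx (fun m _ => leafPiece_edist' S.ρ₀_pos.le hy m) w

/-- The normal component of the derivative of a shadowing orbit is small. -/
lemma IsJet.normal (h : S.IsJet c u Dm) (hx : x ∈ S.K) {δ : ℝ} (hδ : 0 ≤ δ) (hδr : δ < S.r) {m : ℕ}
    (hy : edist (S.T^[m] (c u)) (S.T^[m] x) ≤ ofReal δ) (w : G) :
    ‖S.nn (S.T^[m] x) (Dm m w)‖ ≤ S.C ^ 2 * (2 * δ) * ‖Dm m w‖ := by
  have hxm := S.mem_it hx m; have hC := S.C_pos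
  have key : ∀ η > 0, δ + η < S.r → ‖S.nn (S.T^[m] x) (Dm m w)‖ ≤
      S.C ^ 2 * (δ + (δ + η)) * ‖Dm m w‖ := by
    intro η hη hηr; have t2 := tendsto_slope (h.deriv m) w
    refine le_of_tendsto_of_tendsto ((((S.nn (S.T^[m] x)).continuous.tendsto _).comp t2).norm)
      (t2.norm.const_mul _) ?_
    filter_upwards [edist_eventually_le (h.tendsto_cont w m) hy hδ hη] with t ht
    have n1 := S.near_of_le hδr hy; have n2 := S.near_of_le hηr ht; have := S.normal _ hxm _ _ n1 n2
    have l1 := S.le_edist _ hxm _ _ (S.near_self _) n1 _ hδ (by rwa [edist_comm])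
    have l2 := S.le_edist _ hxm _ _ (S.near_self _) n2 (δ + η) (by linarith) (by rwa [edist_comm])
    simp only [comp_apply, map_smul, norm_smul]; rw [mul_left_comm]
    refine mul_le_mul_of_nonneg_left (this.trans ?_) (norm_nonneg _)
    calc _ ≤ S.C * (S.C * δ + S.C * (δ + η)) *
          ‖Δ[S, m] (c (u + t • w)) (c u)‖ := by gcongr
      _ = _ := by ring
  have : Tendsto (fun η : ℝ => S.C ^ 2 * (δ + (δ + η)) * ‖Dm m w‖) (𝓝[>] 0)
      (𝓝 (S.C ^ 2 * (δ + (δ + 0)) * ‖Dm m w‖)) := by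
    refine Tendsto.mono_left (Continuous.tendsto (by fun_prop) _) nhdsWithin_le_nhds
  rw [show S.C ^ 2 * (2 * δ) * ‖Dm m w‖ = S.C ^ 2 * (δ + (δ + 0)) * ‖Dm m w‖ by ring]
  refine ge_of_tendsto this ?_
  filter_upwards [self_mem_nhdsWithin,
    exists_small (f := fun η => δ + η) (a := δ) (by fun_prop) (by ring) hδr] with η h1 h2
  exact key η h1 h2

/-- Derivatives of curves that stay in a local leaf decay at the strong rate. -/
lemma IsJet.decay (h : S.IsJet c u Dm) (hx : x ∈ S.K) {w : G} (hy : c u ∈ S.piece S.ρ₀ x)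
    (hy' : ∀ᶠ t in 𝓝[≠] (0 : ℝ), c (u + t • w) ∈ S.piece S.ρ₀ x) (m : ℕ) :
    ‖Dm m w‖ ≤ 2 * S.C ^ 2 * S.lam ^ m * ‖Dm 0 w‖ := by
  refine le_of_tendsto_of_tendsto (tendsto_slope (h.deriv m) w).norm
    ((tendsto_slope (h.deriv 0) w).norm.const_mul _) ?_
  filter_upwards [hy'] with t ht
  have := leafPiece_pair_decay hx hy ht m; simp only [norm_smul]; rw [mul_left_comm]
  exact mul_le_mul_of_nonneg_left this (norm_nonneg _)

/-- Derivatives of families of shadowing orbits grow at most at the centre rate. -/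
lemma IsJet.growth (h : S.IsJet c u Dm) (hx : x ∈ S.K) {w : G} (hy : c u ∈ S.piece S.δ₁ x)
    (hy' : ∀ᶠ t in 𝓝[≠] (0 : ℝ), ∃ x' ∈ S.K, c (u + t • w) ∈ S.piece S.δ₁ x') (m : ℕ) :
    S.N (S.T^[m] x) (Dm m w) ≤ 2 * S.α₁ ^ m * S.N x (Dm 0 w) := by
  have hxm := S.mem_it hx m
  refine le_of_tendsto_of_tendsto (((continuous_N hxm).tendsto _).comp (tendsto_slope (h.deriv m) w))
    ((((continuous_N hx).tendsto _).comp (tendsto_slope (h.deriv 0) w)).const_mul _) ?_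
  have hnear : ∀ᶠ t in 𝓝[≠] (0 : ℝ), ∀ i ∈ Finset.range (m + 1),
      edist (S.T^[i] (c (u + t • w))) (S.T^[i] (c u)) ≤ ofReal S.ρ₁ := by
    rw [Finset.eventually_all]; intro i _
    have := edist_eventually_le (h.tendsto_cont w i) (q := S.T^[i] (c u)) (δ := 0) (by simp) le_rfl
      S.ρ₁_pos
    simpa using this
  filter_upwards [hy', hnear] with t ⟨x', hx', ht⟩ hn
  have := pair_growth hx hx' hy ht (n := m) fun i hi => hn i (by simp; omega)
  simp only [comp_apply, N_smul]; rw [mul_left_comm]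
  exact mul_le_mul_of_nonneg_left this (abs_nonneg _)

/-- A vector whose images grow at most at the centre rate has no dominating expanded component. -/
lemma IsJet.pe_le (h : S.IsJet c u Dm) (hx : x ∈ S.K) {w : G} (hy : c u ∈ S.piece S.ρ₀ x) {b : ℝ}
    (hb : ∀ m, ‖Dm m w‖ ≤ b * S.α₁ ^ m) : S.pe x (Dm 0 w) ≤ S.pc x (Dm 0 w) + S.pk x (Dm 0 w) := by
  by_contra! hcon
  have hpos : 0 < S.pe x (Dm 0 w) :=
    lt_of_le_of_lt (add_nonneg (S.pc_nonneg _ _) (S.pk_nonneg _ _)) hcon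
  refine hpos.ne' (eq_zero_of_forall_le (b := S.C * b) hpos.le S.α₁_lam_lt_one
    (mul_nonneg S.α₁_pos.le S.lam_pos.le) fun m => ?_)
  refine ((h.approx hx hy w m).pe_growth hx hcon.le m le_rfl).2.trans ?_
  have hC := S.C_pos; have hl := S.lam_pos
  calc _ ≤ S.lam ^ m * (S.C * (b * S.α₁ ^ m)) := by
        gcongr; exact (S.pe_le _ (S.mem_it hx m) _).trans (by gcongr; exact hb m)
    _ = _ := by rw [mul_pow]; ring

/-- A vector whose images decay at the strong rate is dominated by its contracted component. -/
lemma IsJet.cs_le (h : S.IsJet c u Dm) (hx : x ∈ S.K) {w : G} (hy : c u ∈ S.piece S.ρ₀ x) {b : ℝ}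
    (hb : ∀ m, ‖Dm m w‖ ≤ b * S.lam ^ m) : S.cs x (Dm 0 w) ≤ S.pk x (Dm 0 w) := by
  rcases Approx.cs_lt hx (h.approx hx hy w) hb 0 with h0 | h0
  · rw [h0]; simp [cs]
  · exact h0.le

/-! ### Vectors of given growth, their dimension, and domination -/

/-- The vectors whose images under the maps `Dm m` are `O(q ^ m)`. -/
def rateSpace (Dm : ℕ → G →L[ℝ] V) (q : ℝ) : Submodule ℝ G where
  carrier := {w | ∃ b : ℝ, ∀ m, ‖Dm m w‖ ≤ b * q ^ m}
  zero_mem' := ⟨0, fun m => by simp⟩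
  add_mem' := by
    rintro v w ⟨b, hb⟩ ⟨b', hb'⟩; refine ⟨b + b', fun m => ?_⟩; rw [map_add, add_mul]
    exact (norm_add_le _ _).trans (add_le_add (hb m) (hb' m))
  smul_mem' := by
    rintro a v ⟨b, hb⟩; refine ⟨|a| * b, fun m => ?_⟩; rw [map_smul, norm_smul, mul_assoc]
    exact mul_le_mul_of_nonneg_left (hb m) (norm_nonneg _)

lemma rateSpace_shift {q : ℝ} {w : G} (h : w ∈ rateSpace Dm q) (k : ℕ) :
    w ∈ rateSpace (fun m => Dm (m + k)) q := by
  obtain ⟨b, hb⟩ := h; refine ⟨b * q ^ k, fun m => (hb (m + k)).trans (le_of_eq ?_)⟩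
  rw [pow_add]; ring

lemma rateSpace_of_shift {q : ℝ} (hq : 0 < q) {w : G} {k : ℕ}
    (h : w ∈ rateSpace (fun m => Dm (m + k)) q) : w ∈ rateSpace Dm q := by
  obtain ⟨b, hb⟩ := h; set b' := ∑ i ∈ Finset.range k, ‖Dm i w‖ / q ^ i
  have h0 : 0 ≤ b' := Finset.sum_nonneg fun i _ => by positivity
  have hb0 : 0 ≤ |b| / q ^ k := by positivity
  refine ⟨b' + |b| / q ^ k, fun m => ?_⟩; rcases lt_or_ge m k with hm | hm
  · have h1 : ‖Dm m w‖ / q ^ m ≤ b' :=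
      Finset.single_le_sum (f := fun i => ‖Dm i w‖ / q ^ i) (fun i _ => by positivity)
        (Finset.mem_range.2 hm)
    rw [div_le_iff₀ (by positivity)] at h1; refine h1.trans ?_; gcongr; linarith
  · obtain ⟨n, rfl⟩ := Nat.exists_eq_add_of_le' hm
    have h1 : b * q ^ n ≤ |b| * q ^ n := by gcongr; exact le_abs_self b
    calc _ ≤ |b| * q ^ n := (hb n).trans h1
      _ = |b| / q ^ k * q ^ (n + k) := by rw [pow_add]; field_simp
      _ ≤ _ := by gcongr; linarith

/-- The contracted component of vectors growing at most at the centre rate decays at a rate that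
beats the centre rate. -/
lemma IsJet.pk_bound (h : S.IsJet c u Dm) (hx : x ∈ S.K) {δ : ℝ} (hδ : 0 ≤ δ) (hδρ : δ ≤ S.ρ₀)
    (hy : c u ∈ S.piece δ x) {w : G} {b : ℝ} (hb : ∀ m, ‖Dm m w‖ ≤ b * S.α₁ ^ m) (m : ℕ) :
    S.pk (S.T^[m] x) (Dm m w) ≤
      (S.C * b + 2 * S.C ^ 3 * δ * b / (S.lam * S.α₁ - S.lk)) * (S.lam * S.α₁) ^ m := by
  have hC := S.C_pos; have hl := S.lam_pos; have hα := S.α₁_pos; have hlk := S.lk_pos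
  have hb0 : 0 ≤ b := by simpa using (norm_nonneg _).trans (hb 0)
  have hq : 0 < S.lam * S.α₁ - S.lk := by have := S.one_lt_α₁; have := S.lk_lt; nlinarith
  set B := S.C * b + 2 * S.C ^ 3 * δ * b / (S.lam * S.α₁ - S.lk) with hB
  have hB1 : 2 * S.C ^ 3 * δ * b ≤ B * (S.lam * S.α₁ - S.lk) := by
    rw [hB, add_mul, div_mul_cancel₀ _ hq.ne']
    have : 0 ≤ S.C * b * (S.lam * S.α₁ - S.lk) := by positivity
    linarith
  induction m with
  | zero =>
    have h1 := (S.pk_le x hx (Dm 0 w)).trans (mul_le_mul_of_nonneg_left (hb 0) hC.le)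
    have h2 : 0 ≤ 2 * S.C ^ 3 * δ * b / (S.lam * S.α₁ - S.lk) := by positivity
    simp only [iterate_zero, id_eq, pow_zero, mul_one] at h1 ⊢; linarith
  | succ m ih =>
    have hxm := S.mem_it hx m; have hdm : δ * S.lam ^ m ≤ δ := S.mul_pow_le hδ _
    have h1 := h.step hx (δ := δ * S.lam ^ m) (by positivity)
      (by linarith [S.ρ₀_lt]) (leafPiece_edist hy m) w
    have h2 := map_add_le_add (S.pk (S.T (S.T^[m] x))) (Dm (m + 1) w - S.D (S.T^[m] x) (Dm m w))
      (S.D (S.T^[m] x) (Dm m w))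
    rw [sub_add_cancel] at h2
    have h3 := S.pk_le _ (S.maps_K _ hxm) (Dm (m + 1) w - S.D (S.T^[m] x) (Dm m w))
    have h4 := S.pk_D _ hxm (Dm m w); rw [iterate_succ_apply']
    calc _ ≤ S.C * (S.C ^ 2 * (2 * (δ * S.lam ^ m)) * (b * S.α₁ ^ m)) +
          S.lk * (B * (S.lam * S.α₁) ^ m) := by
          refine h2.trans (add_le_add (h3.trans ?_) (h4.trans ?_))
          · gcongr; exact h1.trans (by gcongr; exact hb m)
          · gcongr
      _ = (2 * S.C ^ 3 * δ * b + S.lk * B) * (S.lam * S.α₁) ^ m := by rw [mul_pow]; ring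
      _ ≤ (B * (S.lam * S.α₁ - S.lk) + S.lk * B) * (S.lam * S.α₁) ^ m := by gcongr
      _ = _ := by ring

lemma IsJet.mem_rateSpace_of_cs_le (h : S.IsJet c u Dm) (hx : x ∈ S.K) (hy : c u ∈ S.piece S.ρ₀ x)
    {w : G} (hw : ∀ m, S.cs (S.T^[m] x) (Dm m w) ≤ S.pk (S.T^[m] x) (Dm m w)) :
    w ∈ rateSpace Dm S.lam := by
  refine ⟨S.C * (2 * S.pk x (Dm 0 w)), fun m => ?_⟩
  have h1 := (h.approx hx hy w m).pk_decay hx (fun i _ => hw i) m le_rfl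
  have h2 := S.norm_le_N (S.mem_it hx m) (Dm m w); rw [S.N_eq] at h2; have hC := S.C_pos
  calc _ ≤ S.C * (2 * (S.lam ^ m * S.pk x (Dm 0 w))) := by
        refine h2.trans ?_; gcongr; linarith [hw m]
    _ = _ := by ring

/-- If no vector is contracted at the strong rate, all vectors eventually enter the centre-expanded
cone, and are then contracted at most at the inverse of the centre rate. -/
lemma IsJet.exists_lower (h : S.IsJet c u Dm) (hx : x ∈ S.K)
    (hy : c u ∈ S.piece S.ρ₀ x) (hG : rateSpace Dm S.lam = ⊥) :
    ∃ m₁ : ℕ, ∃ c₀ > 0, ∀ m ≥ m₁, ∀ w, S.pk (S.T^[m] x) (Dm m w) ≤ S.cs (S.T^[m] x) (Dm m w) ∧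
      c₀ * ‖w‖ ≤ S.α₁ ^ m * S.cs (S.T^[m] x) (Dm m w) := by
  have hα := S.α₁_pos
  have hcont : ∀ m, Continuous fun w => S.cs (S.T^[m] x) (Dm m w) := fun m =>
    (continuous_cs (S.mem_it hx m)).comp (Dm m).continuous
  have hcontk : ∀ m, Continuous fun w => S.pk (S.T^[m] x) (Dm m w) := fun m =>
    (continuous_pk (S.mem_it hx m)).comp (Dm m).continuous
  have hpers : ∀ m n w, m ≤ n → S.pk (S.T^[m] x) (Dm m w) ≤ S.cs (S.T^[m] x) (Dm m w) →
      S.pk (S.T^[n] x) (Dm n w) ≤ S.cs (S.T^[n] x) (Dm n w) ∧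
      S.cs (S.T^[m] x) (Dm m w) ≤ S.α₁ ^ (n - m) * S.cs (S.T^[n] x) (Dm n w) := by
    intro m n w hmn hw; obtain ⟨k, rfl⟩ := Nat.exists_eq_add_of_le hmn
    have := ((h.approx hx hy w (m + k)).shift m).cs_growth (S.mem_it hx m)
      (by simpa using hw) k (by simp)
    rw [← iterate_add_apply, add_comm k m] at this; simpa using this
  have hex : ∀ w ∈ sphere (0 : G) 1, ∃ m, S.pk (S.T^[m] x) (Dm m w) <
      S.cs (S.T^[m] x) (Dm m w) := by
    intro w hw
    by_contra! hcon
    have : w ∈ rateSpace Dm S.lam := h.mem_rateSpace_of_cs_le hx hy hcon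
    rw [hG, Submodule.mem_bot] at this; rw [this] at hw; simp at hw
  choose! μ hμ using hex
  have hcpt : IsCompact (sphere (0 : G) 1) := isCompact_sphere _ _
  obtain ⟨s, hs, hsub⟩ := hcpt.elim_nhds_subcover
    (fun w => {w' | S.pk (S.T^[μ w] x) (Dm (μ w) w') < S.cs (S.T^[μ w] x) (Dm (μ w) w')})
    fun w hw => (isOpen_lt (hcontk _) (hcont _)).mem_nhds (hμ w hw)
  set m₁ := s.sup μ
  have hall : ∀ w ∈ sphere (0 : G) 1, S.pk (S.T^[m₁] x) (Dm m₁ w) ≤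
      S.cs (S.T^[m₁] x) (Dm m₁ w) ∧ 0 < S.cs (S.T^[m₁] x) (Dm m₁ w) := by
    intro w hw; obtain ⟨w', hw', hin⟩ := mem_iUnion₂.1 (hsub hw)
    have hin' : S.pk (S.T^[μ w'] x) (Dm (μ w') w) < S.cs (S.T^[μ w'] x) (Dm (μ w') w) := hin
    obtain ⟨h1, h2⟩ := hpers (μ w') m₁ w (Finset.le_sup hw') hin'.le; refine ⟨h1, ?_⟩
    by_contra hneg
    have h3 : S.cs (S.T^[m₁] x) (Dm m₁ w) = 0 := le_antisymm (not_lt.1 hneg) (S.cs_nonneg _ _)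
    rw [h3, mul_zero] at h2; linarith [S.pk_nonneg (S.T^[μ w'] x) (Dm (μ w') w)]
  have hc : ∃ c₀ > 0, ∀ w ∈ sphere (0 : G) 1, c₀ ≤ S.cs (S.T^[m₁] x) (Dm m₁ w) := by
    rcases (sphere (0 : G) 1).eq_empty_or_nonempty with he | hne
    · exact ⟨1, one_pos, by simp [he]⟩
    · obtain ⟨w₀, hw₀, hmin⟩ := hcpt.exists_isMinOn hne (hcont m₁).continuousOn
      exact ⟨_, (hall w₀ hw₀).2, fun w hw => hmin hw⟩
  obtain ⟨c₀, hc₀, hcle⟩ := hc; refine ⟨m₁, c₀, hc₀, fun m hm w => ?_⟩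
  rcases eq_or_ne w 0 with rfl | hw0
  · simp [cs]
  have hwn : 0 < ‖w‖ := norm_pos_iff.2 hw0
  have hmem : ‖w‖⁻¹ • w ∈ sphere (0 : G) 1 := by simp [norm_smul, hwn.ne']
  have hw1 := hall _ hmem; have hw2 := hcle _ hmem
  simp only [map_smul, cs_smul, map_smul_eq_mul, Real.norm_eq_abs, abs_inv, abs_norm] at hw1 hw2
  have h5 : S.pk (S.T^[m₁] x) (Dm m₁ w) ≤ S.cs (S.T^[m₁] x) (Dm m₁ w) :=
    le_of_mul_le_mul_left hw1.1 (inv_pos.2 hwn)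
  obtain ⟨h6, h7⟩ := hpers m₁ m w hm h5; refine ⟨h6, ?_⟩
  have h8 : c₀ * ‖w‖ ≤ S.cs (S.T^[m₁] x) (Dm m₁ w) := by
    rwa [← div_eq_inv_mul, le_div_iff₀ hwn] at hw2
  refine h8.trans (h7.trans ?_); have := S.cs_nonneg (S.T^[m] x) (Dm m w); gcongr
  · exact S.one_lt_α₁.le
  · omega

/-- A family of shadowing orbits without strongly contracted vectors becomes almost tangent to the
centre-expanded directions. -/
lemma IsJet.narrow (h : S.IsJet c u Dm) (hx : x ∈ S.K)
    (hy : c u ∈ S.piece S.ρ₀ x) (hG : rateSpace Dm S.lam = ⊥) {b : ℝ}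
    (hb : ∀ m w, ‖Dm m w‖ ≤ b * ‖w‖ * S.α₁ ^ m) {κ : ℝ} (hκ : 0 < κ) :
    ∃ m₂ : ℕ, ∀ m ≥ m₂, ∀ w, S.pk (S.T^[m] x) (Dm m w) ≤ κ * S.cs (S.T^[m] x) (Dm m w) := by
  obtain ⟨m₁, c₀, hc₀, hlow⟩ := h.exists_lower hx hy hG; have hl := S.lam_pos; have hα := S.α₁_pos
  set B := S.C * b + 2 * S.C ^ 3 * S.ρ₀ * b / (S.lam * S.α₁ - S.lk) with hB
  have hlim : Tendsto (fun m : ℕ => B / c₀ * (S.α₁ ^ 2 * S.lam) ^ m) atTop (𝓝 (B / c₀ * 0)) :=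
    (tendsto_pow_atTop_nhds_zero_of_lt_one (by positivity) S.gap).const_mul _
  rw [mul_zero] at hlim; obtain ⟨m₃, hm₃⟩ := eventually_atTop.1 (hlim.eventually_le_const hκ)
  refine ⟨max m₁ m₃, fun m hm w => ?_⟩
  have h1 := h.pk_bound hx S.ρ₀_pos.le le_rfl hy (fun m => hb m w) m
  have h2 := (hlow m (le_trans (le_max_left _ _) hm) w).2
  have h3 := hm₃ m (le_trans (le_max_right _ _) hm)
  have e : S.C * (b * ‖w‖) + 2 * S.C ^ 3 * S.ρ₀ * (b * ‖w‖) / (S.lam * S.α₁ - S.lk) = B * ‖w‖ := by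
    rw [hB]; ring
  rw [e] at h1; have hcs := S.cs_nonneg (S.T^[m] x) (Dm m w)
  have hpk := S.pk_nonneg (S.T^[m] x) (Dm m w); by_cases hB0 : 0 ≤ B
  · have h4 : ‖w‖ ≤ S.α₁ ^ m * S.cs (S.T^[m] x) (Dm m w) / c₀ := by rw [le_div_iff₀ hc₀]; linarith
    calc _ ≤ B * (S.α₁ ^ m * S.cs (S.T^[m] x) (Dm m w) / c₀) * (S.lam * S.α₁) ^ m :=
          h1.trans (by gcongr)
      _ = B / c₀ * (S.α₁ ^ 2 * S.lam) ^ m * S.cs (S.T^[m] x) (Dm m w) := by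
          rw [mul_pow, mul_pow, ← pow_mul, mul_comm 2 m, pow_mul]; ring
      _ ≤ _ := by gcongr
  · have : B * ‖w‖ * (S.lam * S.α₁) ^ m ≤ 0 := by
      have : 0 ≤ ‖w‖ * (S.lam * S.α₁) ^ m := by positivity
      nlinarith
    have : 0 ≤ κ * S.cs (S.T^[m] x) (Dm m w) := by positivity
    linarith

/-- The dimension of the space of strongly contracted vectors. -/
lemma IsJet.finrank_rateSpace_le
    (h : S.IsJet c u Dm) (hx : x ∈ S.K) {δ : ℝ} (hδ : 0 ≤ δ) (hδρ : δ ≤ S.ρ₀)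
    (hδ' : 8 * S.C ^ 4 * δ < 1) (hy : c u ∈ S.piece δ x) (hinj : Injective (Dm 0)) :
    finrank ℝ (rateSpace Dm S.lam) ≤ finrank ℝ (S.qk x).range := by
  set f : rateSpace Dm S.lam →ₗ[ℝ] (S.qk x).range :=
    ((S.qk x).toLinearMap.rangeRestrict ∘ₗ (Dm 0).toLinearMap) ∘ₗ (rateSpace Dm S.lam).subtype
  refine LinearMap.finrank_le_finrank_of_injective (f := f) ?_; rw [injective_iff_map_eq_zero]
  rintro ⟨w, hw⟩ hw0; have hq : S.qk x (Dm 0 w) = 0 := congrArg Subtype.val hw0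
  obtain ⟨b, hb⟩ := hw; have hC := S.C_pos
  have h1 := h.cs_le hx (leafPiece_mono S.lam_pos.le hδρ hy) hb
  have h2 := h.normal hx hδ (by linarith [S.ρ₀_lt]) (leafPiece_edist' hδ hy 0) w
  have h3 := S.pk_le_q x hx (Dm 0 w); have h4 := S.norm_le_N hx (Dm 0 w); rw [S.N_eq] at h4
  simp only [iterate_zero, id_eq] at h2; rw [hq, norm_zero, zero_add] at h3
  have hpk := S.pk_nonneg x (Dm 0 w)
  have h5 : S.pk x (Dm 0 w) ≤ 8 * S.C ^ 4 * δ * S.pk x (Dm 0 w) := by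
    calc _ ≤ S.C * (S.C ^ 2 * (2 * δ) * (S.C * (2 * S.pk x (Dm 0 w)))) := by
          refine h3.trans ?_; gcongr; refine h2.trans ?_; gcongr
          exact h4.trans (by gcongr; linarith)
      _ = 4 * S.C ^ 4 * δ * S.pk x (Dm 0 w) := by ring
      _ ≤ _ := by gcongr; norm_num
  have h6 : S.pk x (Dm 0 w) = 0 := by
    by_contra hne
    have : 0 < S.pk x (Dm 0 w) := lt_of_le_of_ne hpk (Ne.symm hne); nlinarith
  have h7 : Dm 0 w = 0 := by
    rw [← norm_le_zero_iff]; refine h4.trans (mul_nonpos_of_nonneg_of_nonpos hC.le (by linarith))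
  exact Subtype.ext (hinj (by simpa using h7))

/-- The dimension of the space of vectors growing at most at the centre rate. -/
lemma IsJet.finrank_rateSpace_α₁_le
    (h : S.IsJet c u Dm) (hx : x ∈ S.K) {δ : ℝ} (hδ : 0 ≤ δ) (hδρ : δ ≤ S.ρ₀)
    (hδ' : 8 * S.C ^ 4 * δ < 1) (hy : c u ∈ S.piece δ x) (hinj : Injective (Dm 0)) :
    finrank ℝ (rateSpace Dm S.α₁) ≤ finrank ℝ (S.qk x).range + finrank ℝ (S.qc x).range := by
  set f : rateSpace Dm S.α₁ →ₗ[ℝ] (S.qk x).range × (S.qc x).range :=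
    (((S.qk x).toLinearMap.rangeRestrict ∘ₗ (Dm 0).toLinearMap) ∘ₗ (rateSpace Dm S.α₁).subtype).prod
    (((S.qc x).toLinearMap.rangeRestrict ∘ₗ (Dm 0).toLinearMap) ∘ₗ
      (rateSpace Dm S.α₁).subtype) with hf
  rw [← Module.finrank_prod]; refine LinearMap.finrank_le_finrank_of_injective (f := f) ?_
  rw [injective_iff_map_eq_zero]; rintro ⟨w, hw⟩ hw0
  have hq : S.qk x (Dm 0 w) = 0 := congrArg Subtype.val (congrArg Prod.fst hw0)
  have hq' : S.qc x (Dm 0 w) = 0 := congrArg Subtype.val (congrArg Prod.snd hw0)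
  obtain ⟨b, hb⟩ := hw; have hC := S.C_pos
  have h1 := h.pe_le hx (leafPiece_mono S.lam_pos.le hδρ hy) hb
  have h2 := h.normal hx hδ (by linarith [S.ρ₀_lt]) (leafPiece_edist' hδ hy 0) w
  have h3 := S.pk_le_q x hx (Dm 0 w); have h3' := S.pc_le_q x hx (Dm 0 w)
  have h4 := S.norm_le_N hx (Dm 0 w); simp only [iterate_zero, id_eq] at h2
  rw [hq, norm_zero, zero_add] at h3; rw [hq', norm_zero, mul_zero] at h3'
  have hpk := S.pk_nonneg x (Dm 0 w)
  have hN : S.N x (Dm 0 w) ≤ 2 * S.pk x (Dm 0 w) := by unfold N; linarith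
  have h5 : S.pk x (Dm 0 w) ≤ 8 * S.C ^ 4 * δ * S.pk x (Dm 0 w) := by
    calc _ ≤ S.C * (S.C ^ 2 * (2 * δ) * (S.C * (2 * S.pk x (Dm 0 w)))) := by
          refine h3.trans ?_; gcongr; refine h2.trans ?_; gcongr; exact h4.trans (by gcongr)
      _ = 4 * S.C ^ 4 * δ * S.pk x (Dm 0 w) := by ring
      _ ≤ _ := by gcongr; norm_num
  have h6 : S.pk x (Dm 0 w) = 0 := by
    by_contra hne
    have : 0 < S.pk x (Dm 0 w) := lt_of_le_of_ne hpk (Ne.symm hne); nlinarith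
  have h7 : Dm 0 w = 0 := by
    rw [← norm_le_zero_iff]; refine h4.trans (mul_nonpos_of_nonneg_of_nonpos hC.le (by linarith))
  exact Subtype.ext (hinj (by simpa using h7))

variable {a : G → M} {δ : ℝ}

/-! ### The base point map of a transverse family of shadowing orbits -/

lemma tendsto_fst_nhds {X Y : Type*} [TopologicalSpace X] [TopologicalSpace Y]
    (u : X) (v : Y) : Tendsto (Prod.fst : X × Y → X) (𝓝 (u, v)) (𝓝 u) := continuous_fst.tendsto _

lemma tendsto_snd_nhds {X Y : Type*} [TopologicalSpace X] [TopologicalSpace Y]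
    (u : X) (v : Y) : Tendsto (Prod.snd : X × Y → Y) (𝓝 (u, v)) (𝓝 v) := continuous_snd.tendsto _

lemma seminorm_near {K : Set M} {s : M → Seminorm ℝ V}
    (hs : ContinuousOn (fun p : M × V => s p.1 p.2) (K ×ˢ univ)) {x₀ : M} (hx₀ : x₀ ∈ K) {ε : ℝ}
    (hε : 0 < ε) : ∀ᶠ x in 𝓝[K] x₀, ∀ v, |s x v - s x₀ v| ≤ ε * ‖v‖ := by
  have key : ∀ᶠ x in 𝓝 x₀, ∀ v ∈ sphere (0 : V) 1, x ∈ K → |s x v - s x₀ v| ≤ ε := by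
    refine (isCompact_sphere (0 : V) 1).eventually_forall_of_forall_eventually
      (P := fun x v => x ∈ K → |s x v - s x₀ v| ≤ ε) fun v _ => ?_
    have h1 := hs (x₀, v) ⟨hx₀, mem_univ _⟩
    have h1' := eventually_nhdsWithin_iff.1 (h1.eventually (ball_mem_nhds _ (half_pos hε)))
    have h2 : ContinuousOn (fun w : V => s x₀ w) univ := by
      have : ContinuousOn (fun w : V => ((x₀, w) : M × V)) univ := by fun_prop
      exact hs.comp this fun w _ => ⟨hx₀, mem_univ _⟩
    have h3 : ∀ᶠ z : M × V in 𝓝 (x₀, v), s x₀ z.2 ∈ ball (s x₀ v) (ε / 2) :=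
      (((continuousOn_univ.1 h2).tendsto v).comp (tendsto_snd_nhds x₀ v)).eventually
        (ball_mem_nhds _ (half_pos hε))
    filter_upwards [h1', h3] with z hz1 hz2 hzK
    have e1 := hz1 ⟨hzK, mem_univ _⟩; rw [mem_ball] at hz2; rw [Real.dist_eq] at e1 hz2
    have := abs_sub_le (s z.1 z.2) (s x₀ v) (s x₀ z.2); rw [abs_sub_comm (s x₀ v)] at this; linarith
  rw [eventually_nhdsWithin_iff]; filter_upwards [key] with x hx hxK v
  rcases eq_or_ne v 0 with rfl | hv
  · simp
  have hvn : 0 < ‖v‖ := norm_pos_iff.2 hv; have := hx (‖v‖⁻¹ • v) (by simp [norm_smul, hvn.ne']) hxK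
  simp only [map_smul_eq_mul, norm_inv, norm_norm, ← mul_sub, abs_mul, abs_inv, abs_norm] at this
  rwa [← div_eq_inv_mul, div_le_iff₀ hvn] at this

lemma continuousAt_iterate (hx : x ∈ S.K) (m : ℕ) : ContinuousAt (S.T^[m]) x := by
  induction m with
  | zero => exact continuousAt_id
  | succ m ih =>
    rw [iterate_succ']
    exact ContinuousAt.comp (S.T.continuousAt
      (S.near_source _ (S.mem_it hx m) _ (S.near_self _))) ih

lemma iterate_injOn (m : ℕ) : InjOn (S.T^[m]) S.K := by
  induction m with
  | zero => exact fun x _ y _ h => h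
  | succ m ih =>
    intro x hx y hy h; rw [iterate_succ_apply', iterate_succ_apply'] at h
    refine ih hx hy (S.T.injOn ?_ ?_ h)
    · exact S.near_source _ (S.mem_it hx m) _ (S.near_self _)
    · exact S.near_source _ (S.mem_it hy m) _ (S.near_self _)

/-- Base points of leaves depend continuously on the points of the leaves. -/
lemma tendsto_base {X : Type*} {l : Filter X} {c a : X → M} {x₀ y₀ : M} {C₀ : ℝ} (hx₀ : x₀ ∈ S.K)
    (hy₀ : y₀ ∈ leaf S.T S.lam x₀) (hc : ∀ m, Tendsto (fun v => S.T^[m] (c v)) l (𝓝 (S.T^[m] y₀)))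
    (hK : ∀ᶠ v in l, a v ∈ S.K) (h : ∀ᶠ v in l, c v ∈ S.piece C₀ (a v)) : Tendsto a l (𝓝 x₀) := by
  obtain ⟨C₁, hC₁⟩ := hy₀
  refine S.isCompact_K.tendsto_nhds_of_unique_mapClusterPt hK fun y hy hcl => ?_
  obtain ⟨U, hUl, hU⟩ := mapClusterPt_iff_ultrafilter.1 hcl
  refine base_unique hx₀ hy (C₀ := |C₀| + |C₁|) fun m => ?_; have hl := S.lam_pos
  have h1 : edist (S.T^[m] y₀) (S.T^[m] y) ≤ ofReal (C₀ * S.lam ^ m) := by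
    refine le_of_tendsto (((hc m).mono_left hUl).edist
      (((continuousAt_iterate hy m).tendsto.comp hU))) ?_
    filter_upwards [hUl h] with v hv
    exact (hv m).2
  calc edist (S.T^[m] y) (S.T^[m] x₀) ≤ edist (S.T^[m] y) (S.T^[m] y₀) +
        edist (S.T^[m] y₀) (S.T^[m] x₀) := edist_triangle _ _ _
    _ ≤ ofReal (|C₀| * S.lam ^ m) + ofReal (|C₁| * S.lam ^ m) := by
        gcongr
        · rw [edist_comm]; refine h1.trans (ofReal_le_ofReal ?_); gcongr; exact le_abs_self _
        · refine (hC₁ m).2.trans (ofReal_le_ofReal ?_); gcongr; exact le_abs_self _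
    _ = _ := by rw [← ENNReal.ofReal_add (by positivity) (by positivity)]; congr 1; ring

/-- A family `c` of points in local leaves with base points `a v ∈ K`, differentiable at `u`, none of
whose directions is strongly contracted, and of the same dimension as the centre directions. -/
structure ShadowFamily (S : HypSys M V) (c a : G → M) (u : G) (Dm : ℕ → G →L[ℝ] V) (δ : ℝ) :
    Prop where
  δ_pos : 0 < δ
  δ_le : δ ≤ S.δ₂
  cont : ∀ m, ContinuousAt (fun v => S.T^[m] (c v)) u
  deriv : ∀ m, HasStrictFDerivAt (fun v => S.e (S.T^[m] (c v))) (Dm m) u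
  mem : ∀ᶠ v in 𝓝 u, a v ∈ S.K ∧ c v ∈ S.piece δ (a v)
  rate : rateSpace Dm S.lam = ⊥
  finrank_eq : ∀ m, finrank ℝ G = finrank ℝ (S.qc (S.T^[m] (a u))).range

namespace ShadowFamily

lemma isJet (F : S.ShadowFamily c a u Dm δ) : S.IsJet c u Dm :=
  ⟨F.cont, fun m => (F.deriv m).hasFDerivAt⟩

lemma base_mem (F : S.ShadowFamily c a u Dm δ) : a u ∈ S.K := F.mem.self_of_nhds.1
lemma mem_leaf (F : S.ShadowFamily c a u Dm δ) : c u ∈ S.piece δ (a u) := F.mem.self_of_nhds.2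
lemma δ_le_δ₁ (F : S.ShadowFamily c a u Dm δ) : δ ≤ S.δ₁ := F.δ_le.trans S.δ₂_le
lemma δ_le_ρ₀ (F : S.ShadowFamily c a u Dm δ) : δ ≤ S.ρ₀ :=
  F.δ_le_δ₁.trans (S.δ₁_le.trans (by linarith [S.ρ₀_pos]))
lemma mem_leaf_ρ₀ (F : S.ShadowFamily c a u Dm δ) : c u ∈ S.piece S.ρ₀ (a u) :=
  leafPiece_mono S.lam_pos.le F.δ_le_ρ₀ F.mem_leaf

lemma growth (F : S.ShadowFamily c a u Dm δ) : ∃ b ≥ 0, ∀ m w, ‖Dm m w‖ ≤ b * ‖w‖ * S.α₁ ^ m := by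
  have hC := S.C_pos; have hα := S.α₁_pos
  refine ⟨6 * S.C ^ 2 * ‖Dm 0‖, by positivity, fun m w => ?_⟩
  have hev : ∀ᶠ t in 𝓝[≠] (0 : ℝ), ∃ x' ∈ S.K, c (u + t • w) ∈ S.piece S.δ₁ x' := by
    filter_upwards [(tendsto_line u w).eventually F.mem] with t ht
    exact ⟨_, ht.1, leafPiece_mono S.lam_pos.le F.δ_le_δ₁ ht.2⟩
  have h1 := F.isJet.growth F.base_mem (leafPiece_mono S.lam_pos.le F.δ_le_δ₁ F.mem_leaf) hev m
  have h2 := S.norm_le_N (S.mem_it F.base_mem m) (Dm m w); have h3 := S.N_le F.base_mem (Dm 0 w)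
  have h4 := (Dm 0).le_opNorm w
  calc _ ≤ S.C * (2 * S.α₁ ^ m * (3 * S.C * (‖Dm 0‖ * ‖w‖))) := by
        refine h2.trans ?_; gcongr; exact h1.trans (by gcongr; exact h3.trans (by gcongr))
    _ = _ := by ring

lemma tendsto_a (F : S.ShadowFamily c a u Dm δ) (m : ℕ) :
    Tendsto (fun v => S.T^[m] (a v)) (𝓝 u) (𝓝 (S.T^[m] (a u))) :=
  (continuousAt_iterate F.base_mem m).tendsto.comp
    (tendsto_base F.base_mem ⟨δ, F.mem_leaf⟩ F.cont (F.mem.mono fun _ h => h.1)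
      (F.mem.mono fun _ h => h.2))

lemma eventually_edist_pair {X : Type*} [TopologicalSpace X] {f : X → M}
    {u : X} (hf : Tendsto f (𝓝 u) (𝓝 (f u))) {ρ : ℝ} (hρ : 0 < ρ) :
    ∀ᶠ p : X × X in 𝓝 (u, u), edist (f p.1) (f p.2) < ofReal ρ := by
  have h1 : Tendsto (fun p : X × X => edist (f p.1) (f p.2)) (𝓝 (u, u)) (𝓝 (edist (f u) (f u))) :=
    (hf.comp (tendsto_fst_nhds u u)).edist (hf.comp (tendsto_snd_nhds u u))
  rw [edist_self] at h1; exact h1.eventually_lt_const (ofReal_pos.2 hρ)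

lemma mem_fst (F : S.ShadowFamily c a u Dm δ) :
    ∀ᶠ p : G × G in 𝓝 (u, u), a p.1 ∈ S.K ∧ c p.1 ∈ S.piece δ (a p.1) :=
  (tendsto_fst_nhds u u).eventually F.mem

lemma mem_snd (F : S.ShadowFamily c a u Dm δ) :
    ∀ᶠ p : G × G in 𝓝 (u, u), a p.2 ∈ S.K ∧ c p.2 ∈ S.piece δ (a p.2) :=
  (tendsto_snd_nhds u u).eventually F.mem

lemma lin (F : S.ShadowFamily c a u Dm δ) (m : ℕ) {τ : ℝ} (hτ : 0 < τ) :
    ∀ᶠ p : G × G in 𝓝 (u, u), ‖Δ[S, m] (c p.1) (c p.2) - Dm m (p.1 - p.2)‖ ≤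
      τ * ‖p.1 - p.2‖ := (F.deriv m).isLittleO.def hτ

lemma exists_lower_norm (F : S.ShadowFamily c a u Dm δ) :
    ∃ m₁ : ℕ, ∀ m ≥ m₁, ∃ cm > 0, ∀ w, cm * ‖w‖ ≤ ‖Dm m w‖ := by
  obtain ⟨m₁, c₀, hc₀, h⟩ := F.isJet.exists_lower F.base_mem F.mem_leaf_ρ₀ F.rate
  have hC := S.C_pos; have hα := S.α₁_pos
  refine ⟨m₁, fun m hm => ⟨c₀ / (S.α₁ ^ m * (2 * S.C)), by positivity, fun w => ?_⟩⟩
  rw [div_mul_eq_mul_div, div_le_iff₀ (by positivity)]; have h1 := (h m hm w).2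
  have h2 := S.cs_le (S.mem_it F.base_mem m) (Dm m w)
  calc _ ≤ S.α₁ ^ m * (2 * S.C * ‖Dm m w‖) := h1.trans (by gcongr)
    _ = _ := by ring

/-- At high iterates, the separation of two members of the family differs little from the separation
of their base points. -/
lemma small (F : S.ShadowFamily c a u Dm δ) {ε : ℝ}
    (hε : 0 < ε) : ∃ m₂ : ℕ, ∀ m ≥ m₂, ∀ᶠ p : G × G in 𝓝 (u, u),
      ‖(Δ[S, m] (c p.1) (c p.2)) -
        (Δ[S, m] (a p.1) (a p.2))‖ ≤
      ε * ‖Δ[S, m] (c p.1) (c p.2)‖ := by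
  have hC := S.C_pos; have hC1 := S.one_le_C; have hl := S.lam_pos; have hδ := F.δ_pos
  set κ := min (1 / (4 * S.C)) (ε / (32 * S.C ^ 2)); have hκ : 0 < κ := by positivity
  have hκ1 : κ ≤ 1 / (4 * S.C) := min_le_left _ _
  have hκ2 : κ ≤ ε / (32 * S.C ^ 2) := min_le_right _ _; rw [le_div_iff₀ (by positivity)] at hκ1 hκ2
  have hκ3 : κ ≤ 1 / 4 := by
    have : κ * 4 ≤ κ * (4 * S.C) := by gcongr; linarith
    linarith
  obtain ⟨b, hb0, hb⟩ := F.growth; obtain ⟨m₁, hm₁⟩ := F.exists_lower_norm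
  obtain ⟨m₃, hm₃⟩ := F.isJet.narrow F.base_mem F.mem_leaf_ρ₀ F.rate hb hκ
  obtain ⟨m₄, hm₄⟩ := S.exists_lam_pow_le (3 * S.C ^ 2 * S.K₀ * δ) hε
  obtain ⟨ρt, hρt, ht⟩ := S.tangency κ hκ; refine ⟨max m₁ (max m₃ m₄), fun m hm => ?_⟩
  have hm1 : m₁ ≤ m := (le_max_left _ _).trans hm
  have hm3 : m₃ ≤ m := ((le_max_left _ _).trans (le_max_right _ _)).trans hm
  have hm4 : m₄ ≤ m := ((le_max_right _ _).trans (le_max_right _ _)).trans hm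
  obtain ⟨cm, hcm, hlow⟩ := hm₁ m hm1; have hnar := hm₃ m hm3; have hsmall := hm₄ m hm4
  set x₀ := S.T^[m] (a u); have hx₀ : x₀ ∈ S.K := S.mem_it F.base_mem m
  have hbase : Tendsto (fun v => S.T^[m] (a v)) (𝓝 u) (𝓝[S.K] x₀) :=
    tendsto_nhdsWithin_iff.2 ⟨F.tendsto_a m, F.mem.mono fun v hv => S.mem_it hv.1 m⟩
  have hpk : ∀ᶠ p : G × G in 𝓝 (u, u), ∀ v, |S.pk (S.T^[m] (a p.2)) v - S.pk x₀ v| ≤ κ * ‖v‖ :=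
    (hbase.comp (tendsto_snd_nhds u u)).eventually (seminorm_near S.continuousOn_pk hx₀ hκ)
  filter_upwards [F.mem_fst, F.mem_snd, hpk, F.lin m (τ := κ * cm) (by positivity),
    eventually_edist_pair (F.tendsto_a m) hρt, eventually_edist_pair (F.cont m).tendsto S.ρ₂_pos]
    with p ⟨hK1, hl1⟩ ⟨hK2, hl2⟩ hpkp hlin hdx hdy
  set Y := Δ[S, m] (c p.1) (c p.2); set X := Δ[S, m] (a p.1) (a p.2); set w := p.1 - p.2
  have hx1 := S.mem_it hK1 m; have hx2 := S.mem_it hK2 m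
  have hδm : δ * S.lam ^ m ≤ δ := S.mul_pow_le hδ.le _
  rcases dichotomy hx2 hx1 (by positivity) (hδm.trans F.δ_le) (leafPiece_shift hl2 m) (leafPiece_shift hl1 m)
    hdy.le with h | h
  · have e0 : cm * ‖w‖ ≤ ‖Dm m w‖ := hlow w
    have e1 : ‖Y - Dm m w‖ ≤ κ * ‖Dm m w‖ := hlin.trans (by rw [mul_assoc]; gcongr)
    have e2 : ‖Dm m w‖ ≤ 2 * ‖Y‖ := by
      have := norm_sub_le Y (Y - Dm m w); rw [sub_sub_cancel] at this
      have h2 : κ * ‖Dm m w‖ ≤ 1 / 4 * ‖Dm m w‖ := by gcongr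
      linarith [norm_nonneg (Dm m w)]
    have e3 : S.pk x₀ Y ≤ 6 * S.C * κ * ‖Y‖ := by
      have h1 := map_add_le_add (S.pk x₀) (Y - Dm m w) (Dm m w); rw [sub_add_cancel] at h1
      have h2 := S.pk_le x₀ hx₀ (Y - Dm m w); have h3 := hnar w; have h4 := S.cs_le hx₀ (Dm m w)
      calc _ ≤ S.C * (κ * ‖Dm m w‖) + κ * (2 * S.C * ‖Dm m w‖) :=
            h1.trans (add_le_add (h2.trans (by gcongr)) (h3.trans (by gcongr)))
        _ = 3 * S.C * κ * ‖Dm m w‖ := by ring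
        _ ≤ 3 * S.C * κ * (2 * ‖Y‖) := by gcongr
        _ = _ := by ring
    have e4 : S.pk (S.T^[m] (a p.2)) Y ≤ 6 * S.C * κ * ‖Y‖ + κ * ‖Y‖ := by
      have := (abs_le.1 (hpkp Y)).2; linarith
    have e5 : S.pk (S.T^[m] (a p.2)) X ≤ κ * ‖X‖ := (ht _ hx2 _ hx1 hdx).1
    have e6 : ‖X‖ ≤ ‖Y‖ + ‖Y - X‖ := by
      have := norm_sub_le Y (Y - X); rwa [sub_sub_cancel] at this
    have e7 := map_sub_le_add (S.pk (S.T^[m] (a p.2))) Y X; have e8 := S.norm_le_N hx2 (Y - X)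
    rw [S.N_eq] at e8
    have e9 : ‖Y - X‖ ≤ S.C * (2 * (6 * S.C * κ * ‖Y‖ + κ * ‖Y‖ + κ * (‖Y‖ + ‖Y - X‖))) := by
      refine e8.trans ?_; gcongr; have : κ * ‖X‖ ≤ κ * (‖Y‖ + ‖Y - X‖) := by gcongr
      linarith
    have e10 : S.C * (2 * (κ * ‖Y - X‖)) ≤ 1 / 2 * ‖Y - X‖ := by
      have : κ * (4 * S.C) * ‖Y - X‖ ≤ 1 * ‖Y - X‖ := by gcongr
      linarith
    have e11 : S.C * (κ * ‖Y‖) ≤ S.C ^ 2 * (κ * ‖Y‖) := by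
      gcongr; exact le_self_pow₀ hC1 (by norm_num)
    have e12 : κ * (32 * S.C ^ 2) * ‖Y‖ ≤ ε * ‖Y‖ := by gcongr
    have e13 : S.C * (2 * (6 * S.C * κ * ‖Y‖ + κ * ‖Y‖ + κ * (‖Y‖ + ‖Y - X‖))) =
      12 * (S.C ^ 2 * (κ * ‖Y‖)) + 4 * (S.C * (κ * ‖Y‖)) + S.C * (2 * (κ * ‖Y - X‖)) := by ring
    have e14 : 0 ≤ S.C ^ 2 * (κ * ‖Y‖) := by positivity
    linarith
  · have h1 := S.norm_le_N hx2 (Y - X); have h2 := S.N_le hx2 Y; have hK₀ := S.K₀_nonneg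
    calc _ ≤ S.C * (S.K₀ * (δ * S.lam ^ m) * (3 * S.C * ‖Y‖)) := by
          refine h1.trans ?_; gcongr; exact h.trans (by gcongr)
      _ = 3 * S.C ^ 2 * S.K₀ * δ * S.lam ^ m * ‖Y‖ := by ring
      _ ≤ _ := by gcongr

/-- The centre component of the derivative of the family is non-degenerate at high iterates. -/
lemma center_lower (F : S.ShadowFamily c a u Dm δ) :
    ∃ m₂ : ℕ, ∀ m ≥ m₂, ∀ w, ‖Dm m w‖ ≤ 4 * S.C ^ 2 * ‖S.qc (S.T^[m] (a u)) (Dm m w)‖ := by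
  obtain ⟨b, hb0, hb⟩ := F.growth
  obtain ⟨m₃, hm₃⟩ := F.isJet.narrow F.base_mem F.mem_leaf_ρ₀ F.rate hb (κ := 1 / 4) (by norm_num)
  refine ⟨m₃, fun m hm w => ?_⟩; have hC := S.C_pos; have hx := S.mem_it F.base_mem m
  have h1 := hm₃ m hm w
  have h2 := (F.isJet.shift m).pe_le hx (shift_mem S.ρ₀_pos.le F.mem_leaf_ρ₀ m) (w := w)
    (b := b * ‖w‖ * S.α₁ ^ m) fun n => (hb (n + m) w).trans (le_of_eq (by rw [pow_add]; ring))
  simp only [Nat.zero_add] at h2; have h3 := S.norm_le_N hx (Dm m w)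
  have h4 := S.pc_le_q _ hx (Dm m w); have h5 := S.pc_nonneg (S.T^[m] (a u)) (Dm m w)
  have h6 : S.N (S.T^[m] (a u)) (Dm m w) ≤ 4 * S.pc (S.T^[m] (a u)) (Dm m w) := by
    unfold cs at h1; unfold N; linarith
  calc _ ≤ S.C * (4 * (S.C * ‖S.qc (S.T^[m] (a u)) (Dm m w)‖)) :=
        h3.trans (by gcongr; exact h6.trans (by gcongr))
    _ = _ := by ring

end ShadowFamily

/-- Points of `K` near `x₀` are determined by their centre coordinate. -/
lemma eventually_center_inj {x₀ : M} (hx₀ : x₀ ∈ S.K) :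
    ∃ ρ > 0, ∀ x ∈ S.K, ∀ x' ∈ S.K, edist x x₀ < ofReal ρ → edist x' x₀ < ofReal ρ →
      S.qc x₀ (S.e x') = S.qc x₀ (S.e x) → x' = x := by
  have hC := S.C_pos; have hr := S.r_pos; set η := 1 / (8 * S.C ^ 2) with hη
  have hη0 : 0 < η := by positivity
  obtain ⟨ρt, hρt, ht⟩ := S.tangency η hη0; have hq := S.continuousOn_qc x₀ hx₀
  have hq' := eventually_nhdsWithin_iff.1 (hq.eventually (Metric.closedBall_mem_nhds _ hη0))
  obtain ⟨ρq, hρq, hball⟩ := EMetric.mem_nhds_iff.1 hq'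
  obtain ⟨ρq', hρq', hle⟩ : ∃ ρ : ℝ, 0 < ρ ∧ ofReal ρ ≤ ρq := by
    rcases eq_or_ne ρq ⊤ with h | h
    · exact ⟨1, one_pos, by simp [h]⟩
    · exact ⟨ρq.toReal, ENNReal.toReal_pos hρq.ne' h, by rw [ofReal_toReal h]⟩
  refine ⟨min (min (S.r / 2) (ρt / 2)) ρq', by positivity, fun x hx x' hx' hd hd' heq => ?_⟩
  have hlt : ∀ {a b : ℝ}, a ≤ b → ofReal a ≤ ofReal b := fun h => ofReal_le_ofReal h
  have hm1 : min (min (S.r / 2) (ρt / 2)) ρq' ≤ S.r / 2 := (min_le_left _ _).trans (min_le_left _ _)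
  have hm2 : min (min (S.r / 2) (ρt / 2)) ρq' ≤ ρt / 2 := (min_le_left _ _).trans (min_le_right _ _)
  have hm3 : min (min (S.r / 2) (ρt / 2)) ρq' ≤ ρq' := min_le_right _ _
  have hxx : ∀ {ρ : ℝ}, 0 < ρ → min (min (S.r / 2) (ρt / 2)) ρq' ≤ ρ / 2 →
      edist x' x < ofReal ρ := by
    intro ρ hρ h
    calc edist x' x ≤ edist x' x₀ + edist x₀ x := edist_triangle _ _ _
      _ < ofReal (ρ / 2) + ofReal (ρ / 2) := by
          rw [edist_comm x₀]; exact ENNReal.add_lt_add (hd'.trans_le (hlt h)) (hd.trans_le (hlt h))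
      _ = ofReal ρ := by rw [← ENNReal.ofReal_add (by positivity) (by positivity)]; congr 1; ring
  set X := S.e x' - S.e x with hX; have h1 := ht x hx x' hx' (hxx hρt hm2)
  have hnorm : ‖S.qc x - S.qc x₀‖ ≤ η := by
    have := hball (show edist x x₀ < ρq from (hd.trans_le (hlt hm3)).trans_le hle) hx
    simpa [dist_eq_norm] using this
  have h2 : ‖S.qc x X‖ ≤ η * ‖X‖ := by
    have : S.qc x X = (S.qc x - S.qc x₀) X := by simp [hX, heq]
    rw [this]; exact ((S.qc x - S.qc x₀).le_opNorm X).trans (by gcongr)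
  have h3 := S.pc_le_q x hx X; have h4 := S.norm_le x hx X
  have h5 : ‖X‖ ≤ S.C * (η * ‖X‖ + S.C * (η * ‖X‖) + η * ‖X‖) := by
    refine h4.trans ?_; gcongr
    · exact h1.1
    · exact h3.trans (by gcongr)
    · exact h1.2
  have hC1 := S.one_le_C
  have h6 : S.C * (η * ‖X‖ + S.C * (η * ‖X‖) + η * ‖X‖) ≤ 3 / 8 * ‖X‖ := by
    have e : S.C * (η * ‖X‖) ≤ S.C ^ 2 * (η * ‖X‖) := by
      gcongr; exact le_self_pow₀ hC1 (by norm_num)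
    have e2 : S.C ^ 2 * (η * ‖X‖) = ‖X‖ / 8 := by rw [hη]; field_simp
    have e3 : S.C * (η * ‖X‖ + S.C * (η * ‖X‖) + η * ‖X‖) =
      2 * (S.C * (η * ‖X‖)) + S.C ^ 2 * (η * ‖X‖) := by ring
    linarith
  have h7 : ‖X‖ = 0 := by linarith [norm_nonneg X]
  have h8 := S.edist_le x hx x x' (S.near_self x) (hxx hr hm1)
  rw [← hX, h7, mul_zero, ENNReal.ofReal_zero] at h8; exact (edist_le_zero.1 h8).symm

/-- The filter of pairs of distinct points close to `t₀`. -/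
def offDiagNhds (t₀ : ℝ) : Filter (ℝ × ℝ) := 𝓝 (t₀, t₀) ⊓ 𝓟 {p | p.1 ≠ p.2}

lemma offDiagNhds_le (t₀ : ℝ) : offDiagNhds t₀ ≤ 𝓝 (t₀, t₀) := inf_le_left

lemma eventually_offDiagNhds_ne (t₀ : ℝ) : ∀ᶠ p in offDiagNhds t₀, p.1 ≠ p.2 :=
  mem_inf_of_right (mem_principal_self _)

/-- Strict differentiability in terms of difference quotients. -/
lemma hasStrictDerivAt_iff_slope {f : ℝ → V} {f' : V} {t₀ : ℝ} :
    HasStrictDerivAt f f' t₀ ↔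
      Tendsto (fun p : ℝ × ℝ => (p.1 - p.2)⁻¹ • (f p.1 - f p.2)) (offDiagNhds t₀) (𝓝 f') := by
  have hiff : HasStrictDerivAt f f' t₀ ↔ ∀ ⦃ε : ℝ⦄, 0 < ε → ∀ᶠ p : ℝ × ℝ in 𝓝 (t₀, t₀),
      ‖f p.1 - f p.2 - (p.1 - p.2) • f'‖ ≤ ε * ‖p.1 - p.2‖ := by
    rw [hasStrictDerivAt_iff_hasStrictFDerivAt, hasStrictFDerivAt_iff_isLittleO,
      Asymptotics.isLittleO_iff]
    simp
  have hq : ∀ p : ℝ × ℝ, p.1 ≠ p.2 → ‖(p.1 - p.2)⁻¹ • (f p.1 - f p.2) - f'‖ =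
      ‖p.1 - p.2‖⁻¹ * ‖f p.1 - f p.2 - (p.1 - p.2) • f'‖ := by
    intro p hp; have h0 : p.1 - p.2 ≠ 0 := sub_ne_zero.2 hp
    rw [← norm_inv, ← norm_smul, smul_sub _ (f p.1 - f p.2), smul_smul, inv_mul_cancel₀ h0, one_smul]
  rw [hiff, Metric.tendsto_nhds]; constructor
  · intro h ε hε
    filter_upwards [offDiagNhds_le t₀ (h (half_pos hε)), eventually_offDiagNhds_ne t₀] with p hp hne
    have h0 : 0 < ‖p.1 - p.2‖ := norm_sub_pos_iff.2 hne
    rw [dist_eq_norm, hq p hne, inv_mul_lt_iff₀ h0]; nlinarith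
  · intro h ε hε; have := h ε hε; rw [offDiagNhds, eventually_inf_principal] at this
    filter_upwards [this] with p hp
    by_cases hne : p.1 = p.2
    · simp [hne]
    have h0 : 0 < ‖p.1 - p.2‖ := norm_sub_pos_iff.2 hne; have := hp hne
    rw [dist_eq_norm, hq p hne, inv_mul_lt_iff₀ h0] at this; linarith

namespace ShadowFamily

/-- The base point map of the family is locally onto `K`, with a Lipschitz section along curves
in `K`. -/
lemma exists_lipschitz_section
    (F : S.ShadowFamily c a u Dm δ) {x : ℝ → M} {t₀ : ℝ} {x' : ℕ → V} (hxK : ∀ t, x t ∈ S.K)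
    (hx0 : x t₀ = a u) (hxc : ContinuousAt x t₀)
    (hxd : ∀ m, HasStrictDerivAt (fun t => S.e (S.T^[m] (x t))) (x' m) t₀) :
    ∃ U : ℝ → G, U t₀ = u ∧ (∀ᶠ t in 𝓝 t₀, a (U t) = x t) ∧
      ∃ Λ : ℝ, ∀ᶠ p : ℝ × ℝ in 𝓝 (t₀, t₀), ‖U p.1 - U p.2‖ ≤ Λ * ‖p.1 - p.2‖ := by
  have hC := S.C_pos; have hC1 := S.one_le_C; obtain ⟨m₁, h₁⟩ := F.exists_lower_norm
  obtain ⟨m₂, h₂⟩ := F.small (ε := 1 / (32 * S.C ^ 3)) (by positivity)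
  obtain ⟨m₃, h₃⟩ := F.center_lower; set m := max m₁ (max m₂ m₃)
  obtain ⟨cm, hcm, hlow⟩ := h₁ m (le_max_left _ _)
  have hsmall := h₂ m ((le_max_left _ _).trans (le_max_right _ _))
  have hcen := h₃ m ((le_max_right _ _).trans (le_max_right _ _)); clear h₁ h₂ h₃
  set x₀ := S.T^[m] (a u); have hx₀ : x₀ ∈ S.K := S.mem_it F.base_mem m
  obtain ⟨ρ, hρ, hinjK⟩ := eventually_center_inj hx₀; set q := S.qc x₀; set R := q.range
  set L : G →ₗ[ℝ] R := q.toLinearMap.rangeRestrict ∘ₗ (Dm m).toLinearMap with hL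
  have hLn : ∀ w, ‖Dm m w‖ ≤ 4 * S.C ^ 2 * ‖L w‖ := fun w => hcen w
  have hLinj : Injective L := (injective_iff_map_eq_zero L).2 fun w hw =>
    norm_le_zero_iff.1 (nonpos_of_mul_nonpos_right ((hlow w).trans ((hLn w).trans (by simp [hw]))) hcm)
  set L' : G ≃L[ℝ] R :=
    (LinearEquiv.ofInjectiveOfFinrankEq L hLinj (F.finrank_eq m)).toContinuousLinearEquiv
  have hL'a : ∀ w, L' w = L w := fun w => rfl
  set Z : M → R := fun p => ⟨q (S.e (S.T^[m] p)), q.toLinearMap.mem_range_self _⟩ with hZ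
  set g : R → R := fun z => Z (a (L'.symm z)) with hg
  -- the key estimate
  have hkey : ∀ᶠ p : G × G in 𝓝 (u, u),
      ‖Z (a p.1) - Z (a p.2) - L (p.1 - p.2)‖ ≤ 1 / 2 * ‖L (p.1 - p.2)‖ := by
    set τ := cm / (16 * S.C ^ 3) with hτ; have hτ0 : 0 < τ := by positivity
    filter_upwards [F.mem_fst, F.mem_snd, hsmall, F.lin m hτ0] with p _ _ hs hlin
    set Y := Δ[S, m] (c p.1) (c p.2); set X := Δ[S, m] (a p.1) (a p.2) with hX; set w := p.1 - p.2
    have e0 : ‖Z (a p.1) - Z (a p.2) - L w‖ = ‖q (Y - Dm m w) - q (Y - X)‖ := by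
      rw [← map_sub, sub_sub_sub_cancel_left, ← Submodule.norm_coe]; simp [hZ, hL, hX]
    have e1 : ‖Y - Dm m w‖ ≤ 1 / (16 * S.C ^ 3) * ‖Dm m w‖ := by
      refine hlin.trans ?_
      calc τ * ‖w‖ = 1 / (16 * S.C ^ 3) * (cm * ‖w‖) := by rw [hτ]; ring
        _ ≤ _ := by gcongr; exact hlow w
    have e2 : ‖Y‖ ≤ 2 * ‖Dm m w‖ := by
      have := norm_add_le (Y - Dm m w) (Dm m w); rw [sub_add_cancel] at this
      have h1 : 1 / (16 * S.C ^ 3) ≤ 1 := by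
        rw [div_le_one (by positivity)]; nlinarith [one_le_pow₀ hC1 (n := 3)]
      have h2 : 1 / (16 * S.C ^ 3) * ‖Dm m w‖ ≤ 1 * ‖Dm m w‖ := by gcongr
      linarith
    rw [e0]
    calc _ ≤ S.C * ‖Y - Dm m w‖ + S.C * ‖Y - X‖ :=
          (norm_sub_le _ _).trans (add_le_add (S.norm_qc_le _ hx₀ _) (S.norm_qc_le _ hx₀ _))
      _ ≤ S.C * (1 / (16 * S.C ^ 3) * ‖Dm m w‖) + S.C * (1 / (32 * S.C ^ 3) * (2 * ‖Dm m w‖)) := by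
          gcongr; exact hs.trans (by gcongr)
      _ = 1 / (8 * S.C ^ 2) * ‖Dm m w‖ := by field_simp; ring
      _ ≤ 1 / (8 * S.C ^ 2) * (4 * S.C ^ 2 * ‖L w‖) := by gcongr; exact hLn w
      _ = _ := by field_simp; ring
  have hnearK : ∀ᶠ p : G × G in 𝓝 (u, u), a p.1 ∈ S.K ∧ edist (S.T^[m] (a p.1)) x₀ < ofReal ρ := by
    refine (F.mem_fst.mono fun p hp => hp.1).and ?_
    exact ((F.tendsto_a m).comp (tendsto_fst_nhds u u)).eventually
      (eball_mem_nhds _ (ofReal_pos.2 hρ))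
  have hev := hkey.and hnearK; rw [nhds_prod_eq, eventually_prod_self_iff'] at hev
  obtain ⟨s, hs, hsP⟩ := hev
  have hs' : L'.symm ⁻¹' s ∈ 𝓝 (L' u) :=
    L'.symm.continuous.continuousAt.preimage_mem_nhds (by simpa using hs)
  obtain ⟨r₀, hr₀, hball⟩ := Metric.nhds_basis_closedBall.mem_iff.1 hs'
  have happ : ApproximatesLinearOn g (ContinuousLinearMap.id ℝ R) (closedBall (L' u) r₀)
      (1 / 2) := by
    intro z hz z' hz'; have := (hsP _ (hball hz) _ (hball hz')).1
    rw [← map_sub, ← hL'a, ContinuousLinearEquiv.apply_symm_apply] at this; simpa [hg] using this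
  let inv : (ContinuousLinearMap.id ℝ R).NonlinearRightInverse :=
    { toFun := id, nnnorm := 1, bound' := fun y => by simp, right_inv' := fun y => rfl }
  have hsurj := happ.surjOn_closedBall_of_nonlinearRightInverse inv hr₀.le subset_rfl
  have hrad : ((inv.nnnorm : ℝ)⁻¹ - ((1 / 2 : NNReal) : ℝ)) * r₀ = r₀ / 2 := by simp [inv]; ring
  rw [hrad] at hsurj; have hgu : g (L' u) = Z (x t₀) := by simp [hg, hx0]
  have hzc : ContinuousAt (fun t => Z (x t)) t₀ := by
    refine (Topology.IsInducing.subtypeVal.continuousAt_iff).2 ?_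
    exact q.continuous.continuousAt.comp (hxd m).hasDerivAt.continuousAt
  have hex : ∀ᶠ t in 𝓝 t₀, ∃ v, L' v ∈ closedBall (L' u) r₀ ∧ Z (a v) = Z (x t) := by
    filter_upwards [hzc.eventually (Metric.closedBall_mem_nhds (Z (x t₀)) (half_pos hr₀))] with t ht
    rw [← hgu] at ht; obtain ⟨z, hz, hzt⟩ := hsurj ht; exact ⟨L'.symm z, by simpa using hz, hzt⟩
  obtain ⟨U, hUs⟩ := hex.choice
  have hmemS : ∀ v, L' v ∈ closedBall (L' u) r₀ → v ∈ s := fun v hv => by simpa using hball hv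
  have hcontr : ∀ v v', L' v ∈ closedBall (L' u) r₀ → L' v' ∈ closedBall (L' u) r₀ →
      cm * ‖v - v'‖ ≤ 4 * S.C ^ 2 * (2 * ‖Z (a v) - Z (a v')‖) := by
    intro v v' hv hv'; have h1 := (hsP _ (hmemS v hv) _ (hmemS v' hv')).1
    have h2 := norm_sub_le (Z (a v) - Z (a v')) (Z (a v) - Z (a v') - L (v - v'))
    rw [sub_sub_cancel] at h2
    have h3 : ‖L (v - v')‖ ≤ 2 * ‖Z (a v) - Z (a v')‖ := by
      simp only at h1; linarith
    exact (hlow _).trans ((hLn _).trans (by gcongr))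
  refine ⟨U, ?_, ?_, ?_⟩
  · have h1 := hUs.self_of_nhds; have h2 := hcontr (U t₀) u h1.1 (Metric.mem_closedBall_self hr₀.le)
    rw [h1.2, hx0, sub_self, norm_zero, mul_zero, mul_zero] at h2
    exact sub_eq_zero.1 (norm_le_zero_iff.1 (nonpos_of_mul_nonpos_right h2 hcm))
  · have hxnear : ∀ᶠ t in 𝓝 t₀, edist (S.T^[m] (x t)) x₀ < ofReal ρ :=
      ((continuousAt_iterate F.base_mem m).tendsto.comp (hx0 ▸ hxc.tendsto :)).eventually
        (eball_mem_nhds _ (ofReal_pos.2 hρ))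
    filter_upwards [hUs, hxnear] with t ht hxt
    have h1 : a (U t) ∈ S.K ∧ _ := (hsP _ (hmemS _ ht.1) _ (hmemS _ ht.1)).2
    have h2 : q (S.e (S.T^[m] (a (U t)))) = q (S.e (S.T^[m] (x t))) := congrArg Subtype.val ht.2
    exact iterate_injOn m h1.1 (hxK t) (hinjK _ (S.mem_it (hxK t) m) _
      (S.mem_it h1.1 m) hxt h1.2 h2)
  · refine ⟨4 * S.C ^ 2 * (2 * (S.C * (‖x' m‖ + 1))) / cm, ?_⟩
    have hlin : ∀ᶠ p : ℝ × ℝ in 𝓝 (t₀, t₀),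
        ‖Δ[S, m] (x p.1) (x p.2)‖ ≤ (‖x' m‖ + 1) * ‖p.1 - p.2‖ := by
      filter_upwards [((hxd m).hasStrictFDerivAt.isLittleO).def one_pos] with p hp
      have h2 := norm_add_le (Δ[S, m] (x p.1) (x p.2) -
        (p.1 - p.2) • x' m) ((p.1 - p.2) • x' m)
      rw [sub_add_cancel, norm_smul] at h2
      simp only [ContinuousLinearMap.toSpanSingleton_apply] at hp; linarith
    filter_upwards [hlin, (tendsto_fst_nhds t₀ t₀).eventually hUs,
      (tendsto_snd_nhds t₀ t₀).eventually hUs] with p hp h1 h2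
    have h3 := hcontr _ _ h1.1 h2.1; rw [h1.2, h2.2] at h3
    have h4 : ‖Z (x p.1) - Z (x p.2)‖ ≤ S.C * ((‖x' m‖ + 1) * ‖p.1 - p.2‖) := by
      rw [← Submodule.norm_coe, Submodule.coe_sub, ← map_sub]
      exact (S.norm_qc_le _ hx₀ _).trans (by gcongr)
    rw [div_mul_eq_mul_div, le_div_iff₀ hcm]
    calc _ = cm * ‖U p.1 - U p.2‖ := mul_comm _ _
      _ ≤ 4 * S.C ^ 2 * (2 * (S.C * ((‖x' m‖ + 1) * ‖p.1 - p.2‖))) := h3.trans (by gcongr)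
      _ = _ := by ring

/-- A Lipschitz section of the base point map along a `C^1` curve is strictly differentiable: two
limits of its difference quotients differ by a vector which would be contracted too fast. -/
lemma exists_hasStrictDerivAt
    (F : S.ShadowFamily c a u Dm δ) {x : ℝ → M} {t₀ : ℝ} {x' : ℕ → V} (hxK : ∀ t, x t ∈ S.K)
    (hx0 : x t₀ = a u) (hxc : ContinuousAt x t₀)
    (hxd : ∀ m, HasStrictDerivAt (fun t => S.e (S.T^[m] (x t))) (x' m) t₀) {U : ℝ → G}
    (hU0 : U t₀ = u) (hUx : ∀ᶠ t in 𝓝 t₀, a (U t) = x t) {Λ : ℝ}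
    (hΛ : ∀ᶠ p : ℝ × ℝ in 𝓝 (t₀, t₀), ‖U p.1 - U p.2‖ ≤ Λ * ‖p.1 - p.2‖) :
    ∃ β, HasStrictDerivAt U β t₀ := by
  have hC := S.C_pos; have hl := S.lam_pos; have hα := S.α₁_pos; have hδ := F.δ_pos
  have hK0 := S.K₀_nonneg; set l := offDiagNhds t₀; have hlle : l ≤ 𝓝 (t₀, t₀) := offDiagNhds_le t₀
  have hne := eventually_offDiagNhds_ne t₀
  have hxt : Tendsto x (𝓝 t₀) (𝓝 (a u)) := hx0 ▸ hxc.tendsto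
  have hUc : Tendsto U (𝓝 t₀) (𝓝 u) := by
    have h1 : ∀ᶠ t in 𝓝 t₀, ‖U t - u‖ ≤ Λ * ‖t - t₀‖ := by
      simpa [hU0] using (Continuous.prodMk_left t₀).tendsto t₀ |>.eventually hΛ
    have : Continuous fun t : ℝ => Λ * ‖t - t₀‖ := by fun_prop
    exact tendsto_iff_norm_sub_tendsto_zero.2 (squeeze_zero' (.of_forall fun t => norm_nonneg _) h1
      (by simpa using this.tendsto t₀))
  have hUU : Tendsto (fun p : ℝ × ℝ => (U p.1, U p.2)) l (𝓝 (u, u)) := by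
    rw [nhds_prod_eq]
    exact ((hUc.comp (tendsto_fst_nhds t₀ t₀)).prodMk (hUc.comp (tendsto_snd_nhds t₀ t₀))).mono_left
      hlle
  have hx1 : ∀ᶠ p in l, a (U p.1) = x p.1 := hlle ((tendsto_fst_nhds t₀ t₀).eventually hUx)
  have hx2 : ∀ᶠ p in l, a (U p.2) = x p.2 := hlle ((tendsto_snd_nhds t₀ t₀).eventually hUx)
  set Q : ℝ × ℝ → G := fun p => (p.1 - p.2)⁻¹ • (U p.1 - U p.2) with hQ
  have hQb : ∀ᶠ p in l, Q p ∈ closedBall (0 : G) Λ := by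
    filter_upwards [hlle hΛ, hne] with p hp hpne
    have h0 : 0 < ‖p.1 - p.2‖ := norm_sub_pos_iff.2 hpne
    rw [mem_closedBall_zero_iff, hQ, norm_smul, norm_inv, inv_mul_le_iff₀ h0]; linarith
  -- the velocities of the curve in `K` have no contracted component
  have hpkx : ∀ m, S.pk (S.T^[m] (a u)) (x' m) = 0 := by
    intro m; have hxm0 := S.mem_it F.base_mem m; have hlim := (hxd m).hasDerivAt.tendsto_slope_zero
    have hcl : Tendsto (fun t : ℝ => S.T^[m] (x (t₀ + t))) (𝓝[≠] 0) (𝓝 (S.T^[m] (a u))) := by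
      have : Continuous fun t : ℝ => t₀ + t := by fun_prop
      exact (continuousAt_iterate F.base_mem m).tendsto.comp (hxt.comp
        (by simpa using (this.tendsto 0).mono_left (nhdsWithin_le_nhds (s := {0}ᶜ))))
    have hη : ∀ η > 0, S.pk (S.T^[m] (a u)) (x' m) ≤ η * ‖x' m‖ := by
      intro η hη; obtain ⟨ρt, hρt, ht⟩ := S.tangency η hη
      refine le_of_tendsto_of_tendsto (((continuous_pk hxm0).tendsto _).comp hlim)
        (hlim.norm.const_mul η) ?_
      filter_upwards [hcl.eventually (eball_mem_nhds _ (ofReal_pos.2 hρt))] with t h1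
      have := (ht _ hxm0 _ (S.mem_it (hxK (t₀ + t)) m) h1).1
      simp only [comp_apply, map_smul_eq_mul, norm_smul, hx0]; rw [mul_left_comm]
      exact mul_le_mul_of_nonneg_left this (norm_nonneg _)
    refine le_antisymm ?_ (S.pk_nonneg _ _)
    have : Tendsto (fun η : ℝ => η * ‖x' m‖) (𝓝[>] 0) (𝓝 (0 * ‖x' m‖)) :=
      (Continuous.tendsto (by fun_prop) _).mono_left nhdsWithin_le_nhds
    rw [zero_mul] at this; exact ge_of_tendsto this (eventually_mem_nhdsWithin.mono hη)
  obtain ⟨b, hb0, hb⟩ := F.growth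
  -- the estimate for one limit of difference quotients
  have hone : ∀ β, MapClusterPt β l Q → ∃ B : ℝ, ∀ m,
      S.cs (S.T^[m] (a u)) (Dm m β - x' m) ≤ B * (S.lam * S.α₁) ^ m := by
    intro β hβ
    refine ⟨S.C * (b * ‖β‖) + 2 * S.C ^ 3 * δ * (b * ‖β‖) / (S.lam * S.α₁ - S.lk) +
        S.K₀ * δ * (3 * S.C * (b * ‖β‖)), fun m => ?_⟩
    obtain ⟨𝒰, hUl, hUβ⟩ := mapClusterPt_iff_ultrafilter.1 hβ; have hxm0 := S.mem_it F.base_mem m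
    set Y : ℝ × ℝ → V := fun p =>
      (p.1 - p.2)⁻¹ • (Δ[S, m] (c (U p.1)) (c (U p.2))) with hYd
    set X : ℝ × ℝ → V := fun p =>
      (p.1 - p.2)⁻¹ • (Δ[S, m] (x p.1) (x p.2)) with hXd
    have hY : Tendsto Y 𝒰 (𝓝 (Dm m β)) := by
      have h1 := ((Dm m).continuous.tendsto β).comp hUβ
      have h2 : Tendsto (fun p : ℝ × ℝ => (p.1 - p.2)⁻¹ • (Δ[S, m] (c (U p.1)) (c (U p.2)) - Dm m (U p.1 - U p.2))) l (𝓝 0) := by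
        rw [Metric.tendsto_nhds]; intro ε hε; have hτ : 0 < ε / (2 * (|Λ| + 1)) := by positivity
        filter_upwards [hUU.eventually (F.lin m hτ), hlle hΛ, hne] with p h3 h4 h5
        have h0 : 0 < ‖p.1 - p.2‖ := norm_sub_pos_iff.2 h5
        rw [dist_zero_right, norm_smul, norm_inv, inv_mul_lt_iff₀ h0]
        calc _ ≤ ε / (2 * (|Λ| + 1)) * (Λ * ‖p.1 - p.2‖) := h3.trans (by gcongr)
          _ ≤ ε / (2 * (|Λ| + 1)) * ((|Λ| + 1) * ‖p.1 - p.2‖) := by gcongr; linarith [le_abs_self Λ]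
          _ = ‖p.1 - p.2‖ * (ε / 2) := by field_simp
          _ < _ := by gcongr; linarith
      have h3 := (h2.mono_left hUl).add h1; rw [zero_add] at h3; refine h3.congr fun p => ?_
      simp only [hQ, hYd, comp_apply, map_smul, ← smul_add, sub_add_cancel]
    have hW := hY.sub ((hasStrictDerivAt_iff_slope.1 (hxd m)).mono_left hUl : Tendsto X 𝒰 _)
    have hbase : Tendsto (fun p : ℝ × ℝ => S.T^[m] (x p.2)) 𝒰 (𝓝 (S.T^[m] (a u))) :=
      (((continuousAt_iterate F.base_mem m).tendsto.comp hxt).comp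
        (tendsto_snd_nhds t₀ t₀)).mono_left (hUl.trans hlle)
    have hcontk : ∀ (s : M → Seminorm ℝ V) (w : ℝ × ℝ → V) (w₀ : V),
        ContinuousOn (fun p : M × V => s p.1 p.2) (S.K ×ˢ univ) → Tendsto w 𝒰 (𝓝 w₀) →
        Tendsto (fun p : ℝ × ℝ => s (S.T^[m] (x p.2)) (w p)) 𝒰 (𝓝 (s (S.T^[m] (a u)) w₀)) := by
      intro s w w₀ hs hw
      refine (hs (S.T^[m] (a u), w₀) ⟨hxm0, trivial⟩).tendsto.comp
        (f := fun p : ℝ × ℝ => (S.T^[m] (x p.2), w p)) (tendsto_nhdsWithin_iff.2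
          ⟨?_, .of_forall fun p => ⟨S.mem_it (hxK _) m, trivial⟩⟩)
      rw [nhds_prod_eq]; exact hbase.prodMk hw
    have hpkY := F.isJet.pk_bound F.base_mem hδ.le F.δ_le_ρ₀ F.mem_leaf (w := β) (fun n => hb n β) m
    have hdy : ∀ᶠ p in l, edist (S.T^[m] (c (U p.1))) (S.T^[m] (c (U p.2))) < ofReal S.ρ₂ :=
      hUU.eventually (eventually_edist_pair (F.cont m).tendsto S.ρ₂_pos)
    have hdich : ∀ᶠ p in (𝒰 : Filter (ℝ × ℝ)),
        S.cs (S.T^[m] (x p.2)) (Y p - X p) ≤ S.pk (S.T^[m] (x p.2)) (Y p - X p) ∨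
        S.N (S.T^[m] (x p.2)) (Y p - X p) ≤
          S.K₀ * (δ * S.lam ^ m) * S.N (S.T^[m] (x p.2)) (Y p) := by
      filter_upwards [hUl (hUU.eventually F.mem_fst), hUl (hUU.eventually F.mem_snd), hUl hdy,
        hUl hx1, hUl hx2] with p h1 h2 h3 h4 h5
      rw [h4] at h1; rw [h5] at h2
      have hδm : δ * S.lam ^ m ≤ δ :=
        S.mul_pow_le hδ.le _
      have := dichotomy (S.mem_it h2.1 m) (S.mem_it h1.1 m) (by positivity)
        (hδm.trans F.δ_le) (leafPiece_shift h2.2 m) (leafPiece_shift h1.2 m) h3.le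
      simp only [hYd, hXd, ← smul_sub, cs_smul, N_smul, map_smul_eq_mul, Real.norm_eq_abs]
      refine this.imp (fun h => ?_) fun h => ?_
      · exact mul_le_mul_of_nonneg_left h.le (abs_nonneg _)
      · rw [mul_left_comm]; exact mul_le_mul_of_nonneg_left h (abs_nonneg _)
    have hpkW := hcontk S.pk _ _ S.continuousOn_pk hW
    have hcW := hcontk S.pc _ _ S.continuousOn_pc hW
    have heW := hcontk S.pe _ _ S.continuousOn_pe hW
    have hNY := ((hcontk S.pk _ _ S.continuousOn_pk hY).add
      (hcontk S.pc _ _ S.continuousOn_pc hY)).add (hcontk S.pe _ _ S.continuousOn_pe hY)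
    have hq : 0 < S.lam * S.α₁ - S.lk := by have := S.one_lt_α₁; have := S.lk_lt; nlinarith
    have hB1 : 0 ≤ (S.C * (b * ‖β‖) + 2 * S.C ^ 3 * δ * (b * ‖β‖) / (S.lam * S.α₁ - S.lk)) *
      (S.lam * S.α₁) ^ m := by positivity
    have hB2 : 0 ≤ S.K₀ * δ * (3 * S.C * (b * ‖β‖)) * (S.lam * S.α₁) ^ m := by positivity
    rw [add_mul _ (S.K₀ * δ * (3 * S.C * (b * ‖β‖)))]
    rcases Ultrafilter.eventually_or.1 hdich with h | h
    · have h1 : S.cs (S.T^[m] (a u)) (Dm m β - x' m) ≤ S.pk (S.T^[m] (a u)) (Dm m β - x' m) :=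
        le_of_tendsto_of_tendsto (hcW.add heW) hpkW h
      have h2 := map_sub_le_add (S.pk (S.T^[m] (a u))) (Dm m β) (x' m); rw [hpkx m] at h2; linarith
    · have h1 : S.N (S.T^[m] (a u)) (Dm m β - x' m) ≤
          S.K₀ * (δ * S.lam ^ m) * S.N (S.T^[m] (a u)) (Dm m β) :=
        le_of_tendsto_of_tendsto ((hpkW.add hcW).add heW) (hNY.const_mul _) h
      have h3 : S.N (S.T^[m] (a u)) (Dm m β - x' m) ≤
          S.K₀ * δ * (3 * S.C * (b * ‖β‖)) * (S.lam * S.α₁) ^ m := by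
        calc _ ≤ S.K₀ * (δ * S.lam ^ m) * (3 * S.C * (b * ‖β‖ * S.α₁ ^ m)) := by
              refine h1.trans ?_; gcongr
              exact (S.N_le hxm0 (Dm m β)).trans (by gcongr; exact hb m β)
          _ = _ := by rw [mul_pow]; ring
      have h4 : S.cs (S.T^[m] (a u)) (Dm m β - x' m) ≤ S.N (S.T^[m] (a u)) (Dm m β - x' m) := by
        rw [S.N_eq]; linarith [S.pk_nonneg (S.T^[m] (a u)) (Dm m β - x' m)]
      linarith
  have huniq : ∀ β, MapClusterPt β l Q → ∀ β', MapClusterPt β' l Q → β = β' := by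
    intro β hβ β' hβ'
    obtain ⟨m₁, c₀, hc₀, hlow⟩ := F.isJet.exists_lower F.base_mem F.mem_leaf_ρ₀ F.rate
    obtain ⟨B₁, hB₁⟩ := hone β hβ; obtain ⟨B₂, hB₂⟩ := hone β' hβ'
    have hB : ∀ m, S.cs (S.T^[m] (a u)) (Dm m (β - β')) ≤ (B₁ + B₂) * (S.lam * S.α₁) ^ m := by
      intro m; have h1 := S.cs_sub_le (S.T^[m] (a u)) (Dm m β - x' m) (Dm m β' - x' m)
      rw [sub_sub_sub_cancel_right, ← map_sub] at h1; rw [add_mul]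
      exact h1.trans (add_le_add (hB₁ m) (hB₂ m))
    generalize B₁ + B₂ = B at hB
    have h0 : c₀ * ‖β - β'‖ = 0 := by
      have hlim : Tendsto (fun m : ℕ => B * (S.α₁ ^ 2 * S.lam) ^ m) atTop (𝓝 (B * 0)) :=
        (tendsto_pow_atTop_nhds_zero_of_lt_one (by positivity) S.gap).const_mul _
      rw [mul_zero] at hlim; refine le_antisymm (ge_of_tendsto hlim ?_) (by positivity)
      filter_upwards [eventually_ge_atTop m₁] with m hm
      calc _ ≤ S.α₁ ^ m * (B * (S.lam * S.α₁) ^ m) := (hlow m hm _).2.trans (by gcongr; exact hB m)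
        _ = _ := by rw [mul_pow, mul_pow, ← pow_mul, mul_comm 2 m, pow_mul]; ring
    have := (mul_eq_zero.1 h0).resolve_left hc₀.ne'; exact sub_eq_zero.1 (norm_eq_zero.1 this)
  have hNe : l.NeBot := by
    change (𝓝[{p : ℝ × ℝ | p.1 ≠ p.2}] (t₀, t₀)).NeBot
    rw [← mem_closure_iff_nhdsWithin_neBot, Metric.mem_closure_iff]; intro ε hε
    refine ⟨(t₀ + ε / 2, t₀), by simp [hε.ne'], ?_⟩
    simp [Prod.dist_eq, Real.dist_eq, abs_of_pos hε, hε]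
  obtain ⟨β, -, hβ⟩ := (isCompact_closedBall (0 : G) Λ).exists_mapClusterPt_of_frequently
    hQb.frequently
  refine ⟨β, hasStrictDerivAt_iff_slope.2 ?_⟩
  exact (isCompact_closedBall (0 : G) Λ).tendsto_nhds_of_unique_mapClusterPt hQb
    fun β' _ hβ' => huniq β' hβ' β hβ

end ShadowFamily

/-! ### Existence of points in the local leaves -/

lemma qk_idem (hx : x ∈ S.K) (v : V) : S.qk x (S.qk x v) = S.qk x v := by
  simpa using S.qk_apply x hx v 0 0 0

lemma qc_of_qk (hx : x ∈ S.K) {v : V} (h : S.qk x v = v) : S.qc x v = 0 := by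
  simpa [h] using S.qc_apply x hx v 0 0 0

lemma qe_of_qk (hx : x ∈ S.K) {v : V} (h : S.qk x v = v) : S.qe x v = 0 := by
  simpa [h] using S.qe_apply x hx v 0 0 0

lemma nn_of_qk (hx : x ∈ S.K) {v : V} (h : S.qk x v = v) : S.nn x v = 0 := by
  have := S.q_sum x hx v
  rwa [h, qc_of_qk hx h, qe_of_qk hx h, add_zero, add_zero, add_eq_left] at this

lemma norm_le_of_qk (hx : x ∈ S.K) {v : V} (h : S.qk x v = v) : ‖v‖ ≤ S.C * S.pk x v := by
  have h2 : S.pc x v ≤ 0 := by simpa [qc_of_qk hx h] using S.pc_le_q x hx v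
  have h3 : S.pe x v ≤ 0 := by simpa [qe_of_qk hx h] using S.pe_le_q x hx v
  have hC := S.C_pos; exact (S.norm_le x hx v).trans (by gcongr; linarith)

/-- The size of the neighbourhoods in which leaf points are constructed. -/
def σ₀ (S : HypSys M V) : ℝ := min S.ρ₀ ((1 - S.lk) / (32 * S.C ^ 8))

lemma lk_lt_one (S : HypSys M V) : S.lk < 1 := S.lk_lt.trans S.lam_lt_one

lemma σ₀_pos (S : HypSys M V) : 0 < S.σ₀ := by
  have := S.ρ₀_pos; have := sub_pos.2 S.lk_lt_one; have := S.C_pos; unfold σ₀; positivity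

lemma σ₀_le (S : HypSys M V) : S.σ₀ ≤ S.ρ₀ := min_le_left _ _
lemma σ₀_lt (S : HypSys M V) : S.σ₀ < S.r := S.σ₀_le.trans_lt S.ρ₀_lt

lemma kappa_le (S : HypSys M V) : 16 * S.C ^ 6 * (S.C ^ 2 * (S.σ₀ + S.σ₀)) ≤ 1 - S.lk := by
  have h : S.σ₀ ≤ (1 - S.lk) / (32 * S.C ^ 8) := min_le_right _ _; have hC := S.C_pos
  rw [le_div_iff₀ (by positivity)] at h; linarith

/-- The orbit of `p` follows that of `x` up to time `n`, where it has no centre-expanded component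
relative to it; its contracted component at time `0` is `ξ`. -/
def Shoots (S : HypSys M V) (n : ℕ) (x : M) (ξ : V) (p : M) : Prop :=
  (∀ i ≤ n, edist (S.T^[i] p) (S.T^[i] x) ≤ ofReal S.σ₀) ∧
  S.qk x (S.e p - S.e x) = ξ ∧ S.cs (S.T^[n] x) (Δ[S, n] p x) = 0

lemma shoots_self (n : ℕ) : S.Shoots n x 0 x := by
  refine ⟨fun i _ => by simp, by simp, by simp [cs]⟩

lemma Shoots.near {n : ℕ} {ξ : V} (h : S.Shoots n x ξ p) {i : ℕ} (hi : i ≤ n) :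
    edist (S.T^[i] p) (S.T^[i] x) < ofReal S.r := S.near_of_le S.σ₀_lt (h.1 i hi)

lemma Shoots.approx {n : ℕ} (hx : x ∈ S.K) {ξ ξ' : V} (h : S.Shoots n x ξ p)
    (h' : S.Shoots n x ξ' p') : S.Approx x (fun i => Δ[S, i] p' p) n := by
  intro i hi; simp only [iterate_succ_apply']
  exact S.pair_step (S.mem_it hx i) ((h.1 i hi.le).trans (ofReal_le_ofReal S.σ₀_le))
    ((h'.1 i hi.le).trans (ofReal_le_ofReal S.σ₀_le))

lemma Shoots.cone {n : ℕ} (hx : x ∈ S.K) {ξ ξ' : V} (h : S.Shoots n x ξ p) (h' : S.Shoots n x ξ' p')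
    {i : ℕ} (hi : i ≤ n) : S.cs (S.T^[i] x) (Δ[S, i] p' p) ≤
      S.pk (S.T^[i] x) (Δ[S, i] p' p) := by
  by_contra! hcon
  obtain ⟨k, rfl⟩ := Nat.exists_eq_add_of_le hi
  have h1 := (((h.approx hx h').shift i).cs_growth (S.mem_it hx i) hcon.le k (by omega)).2
  simp only [add_zero] at h1; rw [← iterate_add_apply, add_comm k i] at h1
  have h2 := S.cs_sub_le (S.T^[i + k] x) (Δ[S, i + k] p' x)
    (Δ[S, i + k] p x)
  rw [h.2.2, h'.2.2, sub_sub_sub_cancel_right, add_zero] at h2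
  have h3 := le_antisymm h2 (S.cs_nonneg _ _); rw [h3, mul_zero] at h1
  linarith [S.pk_nonneg (S.T^[i] x) (Δ[S, i] p' p)]

lemma normal_le (hx : x ∈ S.K) (h : edist p x ≤ ofReal S.σ₀) (h' : edist p' x ≤ ofReal S.σ₀) :
    ‖S.nn x (S.e p' - S.e p)‖ ≤ S.C ^ 2 * (S.σ₀ + S.σ₀) * ‖S.e p' - S.e p‖ := by
  have n1 := S.near_of_le S.σ₀_lt h; have n2 := S.near_of_le S.σ₀_lt h'; have hC := S.C_pos
  have l1 := S.le_edist _ hx _ _ (S.near_self _) n1 S.σ₀ S.σ₀_pos.le (by rwa [edist_comm])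
  have l2 := S.le_edist _ hx _ _ (S.near_self _) n2 S.σ₀ S.σ₀_pos.le (by rwa [edist_comm])
  refine (S.normal x hx _ _ n1 n2).trans ?_
  calc _ ≤ S.C * (S.C * S.σ₀ + S.C * S.σ₀) * ‖S.e p' - S.e p‖ := by gcongr
    _ = _ := by ring

lemma Shoots.pk_le {n : ℕ} (hx : x ∈ S.K) {ξ ξ' : V} (h : S.Shoots n x ξ p)
    (h' : S.Shoots n x ξ' p') : S.pk x (S.e p' - S.e p) ≤ 2 * S.C * ‖ξ' - ξ‖ := by
  have hC := S.C_pos; have hC1 := S.one_le_C; have h1 := h.cone hx h' (Nat.zero_le _)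
  simp only [iterate_zero, id_eq] at h1; have h2 := S.pk_le_q x hx (S.e p' - S.e p)
  have h3 : S.qk x (S.e p' - S.e p) = ξ' - ξ := by
    rw [← h.2.1, ← h'.2.1, ← map_sub, sub_sub_sub_cancel_right]
  have h4 := normal_le hx (h.1 0 (Nat.zero_le _)) (h'.1 0 (Nat.zero_le _))
  have h5 := S.norm_le_N hx (S.e p' - S.e p); rw [S.N_eq] at h5; rw [h3] at h2
  have hk := S.kappa_le; have hlk := S.lk_pos; set k := S.C ^ 2 * (S.σ₀ + S.σ₀)
  have hk0 : 0 ≤ k := by have := S.σ₀_pos; positivity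
  have hpk := S.pk_nonneg x (S.e p' - S.e p)
  have h6 : S.C * (k * (S.C * (2 * S.pk x (S.e p' - S.e p)))) ≤ 1 / 2 * S.pk x (S.e p' - S.e p) := by
    have e2 : 16 * S.C ^ 2 * k ≤ 1 := by
      have : 16 * S.C ^ 2 * k ≤ 16 * S.C ^ 6 * k := by gcongr <;> norm_num
      linarith
    linarith [mul_le_mul_of_nonneg_right e2 hpk]
  have h7 : S.C * ‖S.nn x (S.e p' - S.e p)‖ ≤ S.C * (k * (S.C * (2 * S.pk x (S.e p' - S.e p)))) := by
    gcongr; refine h4.trans ?_; gcongr; exact h5.trans (by gcongr; linarith)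
  linarith

lemma Shoots.norm_le {n : ℕ} (hx : x ∈ S.K) {ξ ξ' : V} (h : S.Shoots n x ξ p)
    (h' : S.Shoots n x ξ' p') : ‖S.e p' - S.e p‖ ≤ 4 * S.C ^ 2 * ‖ξ' - ξ‖ := by
  have h1 := h.cone hx h' (Nat.zero_le _); simp only [iterate_zero, id_eq] at h1
  have h2 := h.pk_le hx h'; have h5 := S.norm_le_N hx (S.e p' - S.e p); rw [S.N_eq] at h5
  have hC := S.C_pos
  calc _ ≤ S.C * (2 * (2 * S.C * ‖ξ' - ξ‖)) := h5.trans (by gcongr; linarith)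
    _ = _ := by ring

lemma Shoots.unique {n : ℕ} (hx : x ∈ S.K) {ξ : V} (h : S.Shoots n x ξ p) (h' : S.Shoots n x ξ p') :
    p' = p := by
  have h1 := h.norm_le hx h'; rw [sub_self, norm_zero, mul_zero] at h1
  have h2 := S.edist_le x hx p p' (h.near (Nat.zero_le _)) (h'.near (Nat.zero_le _))
  rw [le_antisymm h1 (norm_nonneg _), mul_zero, ENNReal.ofReal_zero] at h2
  exact (edist_le_zero.1 h2).symm

/-- The points shooting at a given time exist: this is a graph transform, the contraction being in
the contracted coordinate of the first iterate. -/
lemma exists_shoots (S : HypSys M V) :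
    ∃ ρ > 0, ∀ n, ∀ x ∈ S.K, ∀ ξ, S.qk x ξ = ξ → S.pk x ξ ≤ ρ → ∃ p, S.Shoots n x ξ p := by
  have hC := S.C_pos; have hC1 := S.one_le_C; have hσ := S.σ₀_pos; have hr := S.r_pos
  obtain ⟨ρs, hρs, hsymm⟩ := S.unif_symm S.σ₀ hσ
  set ρ := min (min (S.σ₀ / S.C ^ 2) (S.r / S.C)) (ρs / (8 * S.C ^ 4))
  have hρ : 0 < ρ := by positivity
  have r1 : ρ ≤ S.σ₀ / S.C ^ 2 := (min_le_left _ _).trans (min_le_left _ _)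
  have r2 : ρ ≤ S.r / S.C := (min_le_left _ _).trans (min_le_right _ _)
  have r3 : ρ ≤ ρs / (8 * S.C ^ 4) := min_le_right _ _; rw [le_div_iff₀ (by positivity)] at r1 r2 r3
  refine ⟨ρ, hρ, fun n => ?_⟩; induction n with
  | zero =>
    intro x hx ξ hξ hξρ; have hn := norm_le_of_qk hx hξ
    have hn' : ‖ξ‖ ≤ S.C * ρ := hn.trans (by gcongr)
    obtain ⟨p, hp, hpv⟩ := S.param x hx ξ (nn_of_qk hx hξ) (by linarith); set v := S.e p - S.e x
    have hsum : S.qk x v + S.qc x v + S.qe x v + S.nn x 0 = ξ := by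
      rw [map_zero, add_zero, ← hpv, eq_sub_iff_add_eq]; exact S.q_sum x hx v
    have k1 := S.qk_apply x hx v v v 0; have k2 := S.qc_apply x hx v v v 0
    have k3 := S.qe_apply x hx v v v 0; rw [hsum] at k1 k2 k3; rw [qc_of_qk hx hξ] at k2
    rw [qe_of_qk hx hξ] at k3; refine ⟨p, fun i hi => ?_, k1.symm.trans hξ, ?_⟩
    · obtain rfl : i = 0 := by omega
      refine hp.trans (ofReal_le_ofReal ?_); have : S.C * ‖ξ‖ ≤ S.C * (S.C * ρ) := by gcongr
      linarith
    · have h2 : S.pc x v ≤ 0 := by simpa [← k2] using S.pc_le_q x hx v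
      have h3 : S.pe x v ≤ 0 := by simpa [← k3] using S.pe_le_q x hx v
      change S.pc x v + S.pe x v = 0; linarith [S.pc_nonneg x v, S.pe_nonneg x v]
  | succ n ih =>
    intro x hx ξ hξ hξρ; set z := S.T x with hz; have hzK : z ∈ S.K := S.maps_K x hx
    set B : Set V := {ξ' | S.qk z ξ' = ξ' ∧ S.pk z ξ' ≤ ρ} with hB
    have hBc : IsClosed B := (isClosed_eq (S.qk z).continuous continuous_id).inter
        (isClosed_le (continuous_pk hzK) continuous_const)
    have hB0 : (0 : V) ∈ B := by simp [hB, hρ.le]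
    have : Nonempty M := ⟨x⟩
    choose! P hP using fun ξ' (h : ξ' ∈ B) => ih z hzK ξ' h.1 h.2
    have hnear : ∀ ξ' ∈ B, P ξ' ∈ S.T.target ∧ edist (S.T.symm (P ξ')) x < ofReal S.σ₀ := by
      intro ξ' hξ'; refine hsymm x hx _ ?_; have h1 := (shoots_self n).norm_le hzK (hP ξ' hξ')
      rw [sub_zero] at h1
      have h2 := S.edist_le z hzK z _ (S.near_self z) ((hP ξ' hξ').near (Nat.zero_le _))
      have h3 := norm_le_of_qk hzK hξ'.1; rw [edist_comm]
      refine h2.trans_lt ((ofReal_lt_ofReal_iff hρs).2 ?_); simp only [iterate_zero, id_eq]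
      calc S.C * ‖S.e (P ξ') - S.e z‖ ≤ S.C * (4 * S.C ^ 2 * (S.C * ρ)) := by
            gcongr; exact h1.trans (by gcongr; exact h3.trans (by gcongr; exact hξ'.2))
        _ = 1 / 2 * (ρ * (8 * S.C ^ 4)) := by ring
        _ < ρs := by linarith
    set g : V → V := fun ξ' => ξ' + S.D x (ξ - S.qk x (S.e (S.T.symm (P ξ')) - S.e x)) with hg
    have hk := S.kappa_le; have hlk := S.lk_pos
    have hdiff : ∀ ξ₁ ∈ B, ∀ ξ₂ ∈ B, ‖g ξ₁ - g ξ₂‖ ≤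
        8 * S.C ^ 4 * (S.C ^ 2 * (S.σ₀ + S.σ₀)) * ‖ξ₁ - ξ₂‖ := by
      intro ξ₁ h₁ ξ₂ h₂; set k := S.C ^ 2 * (S.σ₀ + S.σ₀); have hk0 : 0 ≤ k := by positivity
      set Y' := S.e (P ξ₁) - S.e (P ξ₂)
      set Y := S.e (S.T.symm (P ξ₁)) - S.e (S.T.symm (P ξ₂)) with hY
      have hq : S.qk z Y' = ξ₁ - ξ₂ := by
        rw [← (hP ξ₁ h₁).2.1, ← (hP ξ₂ h₂).2.1, ← map_sub, sub_sub_sub_cancel_right]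
      have e1 : ‖Y' - S.D x Y‖ ≤ k * ‖Y‖ := by
        have := S.pair_error hx hσ.le hσ.le S.σ₀_lt S.σ₀_lt (hnear ξ₂ h₂).2.le (hnear ξ₁ h₁).2.le
        rwa [S.T.right_inv (hnear ξ₁ h₁).1, S.T.right_inv (hnear ξ₂ h₂).1] at this
      have e2 : ‖S.nn x Y‖ ≤ k * ‖Y‖ := normal_le hx (hnear ξ₂ h₂).2.le (hnear ξ₁ h₁).2.le
      have e3 := S.norm_le_D x hx Y
      have e4 : ‖S.D x Y‖ ≤ ‖Y'‖ + k * ‖Y‖ := (norm_le_insert Y' _).trans (by gcongr)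
      have e5 : ‖Y'‖ ≤ 4 * S.C ^ 2 * ‖ξ₁ - ξ₂‖ := (hP ξ₂ h₂).norm_le hzK (hP ξ₁ h₁)
      have e6 : ‖Y‖ ≤ 2 * S.C * ‖Y'‖ := by
        have a1 : ‖Y‖ ≤ S.C * (‖Y'‖ + k * ‖Y‖ + k * ‖Y‖) := e3.trans (by gcongr)
        have a2 : S.C ≤ S.C ^ 6 := le_self_pow₀ hC1 (by norm_num)
        have a3 : 16 * S.C * k ≤ 1 := by
          have : 16 * S.C * k ≤ 16 * S.C ^ 6 * k := by gcongr
          linarith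
        have a4 : 16 * S.C * k * ‖Y‖ ≤ 1 * ‖Y‖ := by gcongr
        have a6 : 0 ≤ S.C * ‖Y'‖ := by positivity
        linarith [norm_nonneg Y]
      have e7 : g ξ₁ - g ξ₂ = S.qk z (Y' - S.D x Y) := by
        rw [map_sub, hq, S.qk_D x hx]; simp only [hg, hY, map_sub]; abel
      rw [e7]
      calc _ ≤ S.C * (k * (2 * S.C * (4 * S.C ^ 2 * ‖ξ₁ - ξ₂‖))) := by
            refine (S.norm_qk_le z hzK _).trans ?_; gcongr; refine e1.trans ?_; gcongr
            exact e6.trans (by gcongr)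
        _ = _ := by ring
    have hg0 : g 0 = S.D x ξ := by
      have h0 : P 0 = z := (shoots_self n).unique hzK (hP 0 hB0); simp only [hg, h0, hz]
      simp [S.T.left_inv (S.near_source x hx x (S.near_self x))]
    have hmaps : MapsTo g B B := by
      intro ξ' hξ'; constructor
      · simp only [hg]; rw [map_add, hξ'.1, S.qk_D x hx, map_sub _ ξ, hξ, qk_idem hx]
      · have h1 := map_add_le_add (S.pk z) (g ξ' - g 0) (g 0); rw [sub_add_cancel] at h1
        have h2 := S.pk_le z hzK (g ξ' - g 0); have h3 := hdiff ξ' hξ' 0 hB0; rw [sub_zero] at h3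
        have h4 := norm_le_of_qk hzK hξ'.1
        have h5 : S.pk z (g 0) ≤ S.lk * ρ := by rw [hg0]; exact (S.pk_D x hx ξ).trans (by gcongr)
        have h6 : S.C * ‖g ξ' - g 0‖ ≤
            S.C * (8 * S.C ^ 4 * (S.C ^ 2 * (S.σ₀ + S.σ₀)) * (S.C * ρ)) := by
          gcongr; exact h3.trans (by gcongr; exact h4.trans (by gcongr; exact hξ'.2))
        have h7 : S.C * (8 * S.C ^ 4 * (S.C ^ 2 * (S.σ₀ + S.σ₀)) * (S.C * ρ)) ≤ (1 - S.lk) * ρ := by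
          linarith [mul_le_mul_of_nonneg_right hk hρ.le,
            mul_nonneg (sub_nonneg.2 S.lk_lt_one.le) hρ.le]
        linarith
    have hcontr : ContractingWith (1 / 2) (hmaps.restrict g B B) := by
      refine ⟨by norm_num, LipschitzWith.of_dist_le_mul fun ξ₁ ξ₂ => ?_⟩
      rw [Subtype.dist_eq, Subtype.dist_eq, dist_eq_norm, dist_eq_norm]
      refine (hdiff _ ξ₁.2 _ ξ₂.2).trans ?_; push_cast; gcongr
      have : 8 * S.C ^ 4 * (S.C ^ 2 * (S.σ₀ + S.σ₀)) ≤ 8 * S.C ^ 6 * (S.C ^ 2 * (S.σ₀ + S.σ₀)) := by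
        gcongr <;> norm_num
      linarith
    obtain ⟨ξ', hξ'B, hfix, -⟩ :=
      hcontr.exists_fixedPoint' hBc.isComplete hmaps hB0 (edist_ne_top _ _)
    set w := ξ - S.qk x (S.e (S.T.symm (P ξ')) - S.e x) with hw
    have hDw : S.D x w = 0 := add_eq_left.1 (show ξ' + S.D x w = ξ' from hfix)
    have hqw : S.qk x w = w := by rw [hw, map_sub, hξ, qk_idem hx]
    have hw0 : w = 0 := by
      have := S.norm_le_D x hx w; rw [hDw, nn_of_qk hx hqw, norm_zero, add_zero, mul_zero] at this
      exact norm_le_zero_iff.1 this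
    have hTp : S.T (S.T.symm (P ξ')) = P ξ' := S.T.right_inv (hnear ξ' hξ'B).1
    refine ⟨S.T.symm (P ξ'), ?_, (sub_eq_zero.1 hw0).symm, ?_⟩
    · intro i hi; rcases i with _ | i
      · exact (hnear ξ' hξ'B).2.le
      · rw [iterate_succ_apply, iterate_succ_apply, hTp]; exact (hP ξ' hξ'B).1 i (by omega)
    · rw [iterate_succ_apply, iterate_succ_apply, hTp]; exact (hP ξ' hξ'B).2.2

lemma continuousAt_e (hx : x ∈ S.K) (hp : edist p x < ofReal S.r) : ContinuousAt S.e p := by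
  have hC := S.C_pos; rw [ContinuousAt, Metric.tendsto_nhds]; intro ε hε
  have h1 : ∀ᶠ q in 𝓝 p, edist q x < ofReal S.r :=
    (continuous_id.edist continuous_const).continuousAt.eventually_lt_const hp
  have h2 : ∀ᶠ q in 𝓝 p, edist q p < ofReal (ε / (2 * S.C)) :=
    eball_mem_nhds p (ofReal_pos.2 (by positivity))
  filter_upwards [h1, h2] with q hq1 hq2
  have := S.le_edist x hx p q hp hq1 (ε / (2 * S.C)) (by positivity) (by rw [edist_comm]; exact hq2.le)
  rw [dist_eq_norm]; refine this.trans_lt ?_; rw [show S.C * (ε / (2 * S.C)) = ε / 2 by field_simp]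
  linarith

/-- Every small vector in the contracted directions at `x ∈ K` is the contracted component of a
point of the local leaf of `x`. -/
theorem exists_leaf_point (S : HypSys M V) {δ : ℝ} (hδ : 0 < δ) :
    ∃ ρ > 0, ∀ x ∈ S.K, ∀ ξ, S.qk x ξ = ξ → S.pk x ξ ≤ ρ →
      ∃ p ∈ S.piece δ x, S.qk x (S.e p - S.e x) = ξ := by
  have hC := S.C_pos; have hl := S.lam_pos; obtain ⟨ρ, hρ, h⟩ := S.exists_shoots
  refine ⟨min ρ (δ / (4 * S.C ^ 4)), by positivity, fun x hx ξ hξ hξρ => ?_⟩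
  choose p hp using fun n => h n x hx ξ hξ (hξρ.trans (min_le_left _ _))
  have hξ2 : ‖ξ‖ * (4 * S.C ^ 3) ≤ δ := by
    have h1 := norm_le_of_qk hx hξ; have h2 := hξρ.trans (min_le_right _ _)
    rw [le_div_iff₀ (by positivity)] at h2
    have : ‖ξ‖ * (4 * S.C ^ 3) ≤ S.C * S.pk x ξ * (4 * S.C ^ 3) := by gcongr
    linarith
  have hdec : ∀ n, ∀ i ≤ n, edist (S.T^[i] (p n)) (S.T^[i] x) ≤ ofReal (δ * S.lam ^ i) := by
    intro n i hi; have hxi := S.mem_it hx i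
    have h1 := ((shoots_self n).approx hx (hp n)).pk_decay hx
      (fun i hi => (shoots_self n).cone hx (hp n) hi.le) i hi
    have h2 := (shoots_self n).pk_le hx (hp n); have h3 := (shoots_self n).cone hx (hp n) hi
    have h4 := S.norm_le_N hxi (Δ[S, i] (p n) x); rw [S.N_eq] at h4; rw [sub_zero] at h2
    have h5 := S.edist_le _ hxi _ _ (S.near_self _) ((hp n).near hi); rw [edist_comm]
    refine h5.trans (ofReal_le_ofReal ?_); simp only [iterate_zero, id_eq] at h1
    calc _ ≤ S.C * (S.C * (2 * (S.lam ^ i * (2 * S.C * ‖ξ‖)))) := by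
          gcongr; refine h4.trans ?_; gcongr
          have : S.lam ^ i * S.pk x (S.e (p n) - S.e x) ≤ S.lam ^ i * (2 * S.C * ‖ξ‖) := by gcongr
          linarith
      _ = ‖ξ‖ * (4 * S.C ^ 3) * S.lam ^ i := by ring
      _ ≤ _ := by gcongr
  obtain ⟨L, hL, hLmem⟩ := S.near_compact
  obtain ⟨y, -, hy⟩ := hL.exists_mapClusterPt_of_frequently (l := atTop) (f := p)
    (Eventually.of_forall fun n => hLmem x hx (p n) ((hp n).near (Nat.zero_le _))).frequently
  obtain ⟨𝒰, h𝒰, hlim⟩ := mapClusterPt_iff_ultrafilter.1 hy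
  have hnear : ∀ i, Tendsto (fun n => S.T^[i] (p n)) 𝒰 (𝓝 (S.T^[i] y)) →
      edist (S.T^[i] y) (S.T^[i] x) ≤ ofReal (δ * S.lam ^ i) ∧
      edist (S.T^[i] y) (S.T^[i] x) ≤ ofReal S.σ₀ := by
    intro i hi; have ht := hi.edist (tendsto_const_nhds (x := S.T^[i] x))
    exact ⟨le_of_tendsto ht (h𝒰 ((eventually_ge_atTop i).mono fun n hn => hdec n i hn)),
      le_of_tendsto ht (h𝒰 ((eventually_ge_atTop i).mono fun n hn => (hp n).1 i hn))⟩
  have hsrc : ∀ i, Tendsto (fun n => S.T^[i] (p n)) 𝒰 (𝓝 (S.T^[i] y)) →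
      S.T^[i] y ∈ S.T.source := fun i hi =>
    S.near_source _ (S.mem_it hx i) _ (S.near_of_le S.σ₀_lt (hnear i hi).2)
  have htend : ∀ i, Tendsto (fun n => S.T^[i] (p n)) 𝒰 (𝓝 (S.T^[i] y)) := by
    intro i; induction i with
    | zero => exact hlim
    | succ i ih =>
      simp only [iterate_succ_apply']; exact (S.T.continuousAt (hsrc i ih)).tendsto.comp ih
  refine ⟨y, fun i => ⟨hsrc i (htend i), (hnear i (htend i)).1⟩, ?_⟩
  have he := (continuousAt_e hx (S.near_of_le S.σ₀_lt (hnear 0 (htend 0)).2)).tendsto.comp hlim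
  have : Tendsto (fun n => S.qk x (S.e (p n) - S.e x)) 𝒰 (𝓝 (S.qk x (S.e y - S.e x))) :=
    ((S.qk x).continuous.tendsto _).comp (he.sub_const _)
  refine tendsto_nhds_unique this ?_; simp only [(hp _).2.1]; exact tendsto_const_nhds

/-! ### Deformation of curves to their base points within local leaves -/

lemma tendsto_clm_apply {X : Type*} {l : Filter X} {f : X → V →L[ℝ] W}
    {f₀ : V →L[ℝ] W} {v : X → V} {v₀ : V} (hf : Tendsto f l (𝓝 f₀)) (hv : Tendsto v l (𝓝 v₀)) :
    Tendsto (fun t => f t (v t)) l (𝓝 (f₀ v₀)) :=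
  ((isBoundedBilinearMap_apply (𝕜 := ℝ) (E := V) (F := W)).continuous.tendsto (f₀, v₀)).comp
    (hf.prodMk_nhds hv)

lemma leafPiece_of_tendsto {X : Type*} {l : Filter X} [l.NeBot] {p x : X → M} {p₀ x₀ : M} {δ : ℝ}
    (hδ : 0 ≤ δ) (hδr : δ < S.r) (hx₀ : x₀ ∈ S.K) (hp : Tendsto p l (𝓝 p₀))
    (hx : Tendsto x l (𝓝 x₀)) (h : ∀ᶠ t in l, p t ∈ S.piece δ (x t)) : p₀ ∈ S.piece δ x₀ := by
  have hnear : ∀ i, Tendsto (fun t => S.T^[i] (p t)) l (𝓝 (S.T^[i] p₀)) →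
      edist (S.T^[i] p₀) (S.T^[i] x₀) ≤ ofReal (δ * S.lam ^ i) := by
    intro i hi; refine le_of_tendsto (hi.edist ((continuousAt_iterate hx₀ i).tendsto.comp hx)) ?_
    filter_upwards [h] with t ht
    exact (ht i).2
  have hsrc : ∀ i, Tendsto (fun t => S.T^[i] (p t)) l (𝓝 (S.T^[i] p₀)) →
      S.T^[i] p₀ ∈ S.T.source := fun i hi => by
    refine S.near_source _ (S.mem_it hx₀ i) _ (S.near_of_le hδr ((hnear i hi).trans ?_))
    exact ofReal_le_ofReal (S.mul_pow_le hδ _)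
  have htend : ∀ i, Tendsto (fun t => S.T^[i] (p t)) l (𝓝 (S.T^[i] p₀)) := by
    intro i; induction i with
    | zero => exact hp
    | succ i ih =>
      simp only [iterate_succ_apply']; exact (S.T.continuousAt (hsrc i ih)).tendsto.comp ih
  exact fun i => ⟨hsrc i (htend i), hnear i (htend i)⟩

/-- A point of a local leaf is determined by its contracted component. -/
lemma leafPiece_eq_of_qk (hx : x ∈ S.K) (h : p ∈ S.piece S.σ₀ x) (h' : p' ∈ S.piece S.σ₀ x)
    (hq : S.qk x (S.e p' - S.e x) = S.qk x (S.e p - S.e x)) : p' = p := by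
  have hC := S.C_pos; have hC1 := S.one_le_C
  rcases leafPiece_pair hx (leafPiece_mono S.lam_pos.le S.σ₀_le h)
    (leafPiece_mono S.lam_pos.le S.σ₀_le h') 0 with h0 | h0
  · exact h0
  exfalso; simp only [iterate_zero, id_eq] at h0; have h1 := leafPiece_edist' S.σ₀_pos.le h 0
  have h1' := leafPiece_edist' S.σ₀_pos.le h' 0; have h2 := S.pk_le_q x hx (S.e p' - S.e p)
  have h3 : S.qk x (S.e p' - S.e p) = 0 := by
    rw [← sub_sub_sub_cancel_right _ _ (S.e x), map_sub, hq, sub_self]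
  rw [h3, norm_zero, zero_add] at h2; have h4 := normal_le hx h1 h1'
  have h5 := S.norm_le_N hx (S.e p' - S.e p); rw [S.N_eq] at h5; have hk := S.kappa_le
  have hlk := S.lk_pos; set k := S.C ^ 2 * (S.σ₀ + S.σ₀)
  have hk0 : 0 ≤ k := by have := S.σ₀_pos; positivity
  have hpk := S.pk_nonneg x (S.e p' - S.e p); have hcs := S.cs_nonneg x (S.e p' - S.e p)
  have h6 : S.C * ‖S.nn x (S.e p' - S.e p)‖ ≤ S.C * (k * (S.C * (2 * S.pk x (S.e p' - S.e p)))) := by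
    gcongr; refine h4.trans ?_; gcongr; exact h5.trans (by gcongr; linarith)
  have e1 : S.C ^ 2 ≤ S.C ^ 6 := pow_le_pow_right₀ hC1 (by norm_num)
  have e2 : 16 * S.C ^ 2 * k ≤ 1 := by
    have : 16 * S.C ^ 2 * k ≤ 16 * S.C ^ 6 * k := by gcongr
    linarith
  have : 16 * S.C ^ 2 * k * S.pk x (S.e p' - S.e p) ≤ 1 * S.pk x (S.e p' - S.e p) := by gcongr
  have h7 : S.C * (k * (S.C * (2 * S.pk x (S.e p' - S.e p)))) =
    16 * S.C ^ 2 * k * S.pk x (S.e p' - S.e p) / 8 := by ring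
  linarith

/-- A curve in the local leaves of the points of a curve in `K` can be deformed to the latter
within the leaves. -/
theorem exists_leaf_homotopy (S : HypSys M V) : ∃ δ > 0, ∀ x y : ℝ → M,
    Continuous x → Continuous y → (∀ t, x t ∈ S.K) → (∀ t, y t ∈ S.piece δ (x t)) →
    ∃ H : ℝ → ℝ → M, ContinuousOn (fun p : ℝ × ℝ => H p.1 p.2) (Icc 0 1 ×ˢ univ) ∧
      (∀ t, H 0 t = x t) ∧ (∀ t, H 1 t = y t) ∧
      (∀ s ∈ Icc (0 : ℝ) 1, ∀ t, H s t ∈ S.piece S.σ₀ (x t)) ∧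
      ∀ s ∈ Icc (0 : ℝ) 1, ∀ t t', x t = x t' → y t = y t' → H s t = H s t' := by
  have hC := S.C_pos; have hσ := S.σ₀_pos; obtain ⟨ρ, hρ, hex⟩ := S.exists_leaf_point hσ
  set δ := min S.σ₀ (ρ / S.C ^ 3); have hδ : 0 < δ := by positivity
  refine ⟨δ, hδ, fun x y hxc hyc hxK hy => ?_⟩
  have hyσ : ∀ t, y t ∈ S.piece S.σ₀ (x t) := fun t =>
    leafPiece_mono S.lam_pos.le (min_le_left _ _) (hy t)
  set ξ : ℝ → V := fun t => S.qk (x t) (S.e (y t) - S.e (x t)) with hξ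
  have hpkξ : ∀ t, S.pk (x t) (ξ t) ≤ ρ := by
    intro t; have h1 := leafPiece_norm hδ.le ((min_le_left _ _).trans_lt S.σ₀_lt) (hxK t) (hy t) 0
    simp only [iterate_zero, id_eq, pow_zero, mul_one] at h1
    have h2 : δ * S.C ^ 3 ≤ ρ := by rw [← le_div_iff₀ (by positivity)]; exact min_le_right _ _
    calc _ ≤ S.C * (S.C * (S.C * δ)) := by
          refine (S.pk_le _ (hxK t) _).trans ?_; gcongr
          exact (S.norm_qk_le _ (hxK t) _).trans (by gcongr)
      _ = δ * S.C ^ 3 := by ring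
      _ ≤ _ := h2
  have hexH : ∀ s ∈ Icc (0 : ℝ) 1, ∀ t, ∃ p ∈ S.piece S.σ₀ (x t),
      S.qk (x t) (S.e p - S.e (x t)) = s • ξ t := by
    intro s hs t; refine hex _ (hxK t) _ (by rw [map_smul, hξ, qk_idem (hxK t)]) ?_
    rw [map_smul_eq_mul, Real.norm_eq_abs, abs_of_nonneg hs.1]
    exact (mul_le_of_le_one_left (S.pk_nonneg _ _) hs.2).trans (hpkξ t)
  have : Nonempty M := ⟨x 0⟩
  choose! H hH hHq using hexH
  have hxσ : ∀ t, x t ∈ S.piece S.σ₀ (x t) := fun t m => by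
    refine ⟨S.near_source _ (S.mem_it (hxK t) m) _ (S.near_self _), by simp⟩
  refine ⟨H, ?_, fun t => ?_, fun t => ?_, hH, fun s hs t t' h1 h2 => ?_⟩
  · obtain ⟨L, hL, hLmem⟩ := S.near_compact
    have hHL : ∀ s ∈ Icc (0 : ℝ) 1, ∀ t, H s t ∈ L := fun s hs t =>
      hLmem _ (hxK t) _ (S.near_of_le S.σ₀_lt (leafPiece_edist' hσ.le (hH s hs t) 0))
    rintro ⟨s₀, t₀⟩ ⟨hs₀, -⟩; refine hL.tendsto_nhds_of_unique_mapClusterPt ?_ fun p hp hcl => ?_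
    · filter_upwards [self_mem_nhdsWithin] with z hz
      exact hHL _ hz.1 _
    obtain ⟨𝒰, h𝒰, hlim⟩ := mapClusterPt_iff_ultrafilter.1 hcl
    have h𝒰n : (𝒰 : Filter (ℝ × ℝ)) ≤ 𝓝 (s₀, t₀) := h𝒰.trans nhdsWithin_le_nhds
    have hmem : ∀ᶠ z in (𝒰 : Filter (ℝ × ℝ)), z.1 ∈ Icc (0 : ℝ) 1 := by
      have : ∀ᶠ z in 𝓝[Icc (0 : ℝ) 1 ×ˢ (univ : Set ℝ)] (s₀, t₀), z.1 ∈ Icc (0 : ℝ) 1 := by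
        filter_upwards [self_mem_nhdsWithin] with z hz using hz.1
      exact h𝒰 this
    have ht : Tendsto (fun z : ℝ × ℝ => z.2) 𝒰 (𝓝 t₀) := (tendsto_snd_nhds s₀ t₀).mono_left h𝒰n
    have hs : Tendsto (fun z : ℝ × ℝ => z.1) 𝒰 (𝓝 s₀) := (tendsto_fst_nhds s₀ t₀).mono_left h𝒰n
    have hx' : Tendsto (fun z : ℝ × ℝ => x z.2) 𝒰 (𝓝 (x t₀)) := (hxc.tendsto t₀).comp ht
    have hy' : Tendsto (fun z : ℝ × ℝ => y z.2) 𝒰 (𝓝 (y t₀)) := (hyc.tendsto t₀).comp ht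
    have hpσ : p ∈ S.piece S.σ₀ (x t₀) :=
      leafPiece_of_tendsto hσ.le S.σ₀_lt (hxK t₀) hlim hx' (hmem.mono fun z hz => hH _ hz _)
    refine leafPiece_eq_of_qk (hxK t₀) (hH s₀ hs₀ t₀) hpσ ?_
    have hq : Tendsto (fun z : ℝ × ℝ => S.qk (x z.2)) 𝒰 (𝓝 (S.qk (x t₀))) :=
      (S.continuousOn_qk (x t₀) (hxK t₀)).tendsto.comp
        (tendsto_nhdsWithin_iff.2 ⟨hx', Eventually.of_forall fun z => hxK _⟩)
    have hex' : Tendsto (fun z : ℝ × ℝ => S.e (x z.2)) 𝒰 (𝓝 (S.e (x t₀))) :=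
      (continuousAt_e (hxK t₀) (S.near_self _)).tendsto.comp hx'
    have hey : Tendsto (fun z : ℝ × ℝ => S.e (y z.2)) 𝒰 (𝓝 (S.e (y t₀))) := (continuousAt_e (hxK t₀)
        (S.near_of_le S.σ₀_lt (leafPiece_edist' hσ.le (hyσ t₀) 0))).tendsto.comp hy'
    have hep : Tendsto (fun z : ℝ × ℝ => S.e (H z.1 z.2)) 𝒰 (𝓝 (S.e p)) := (continuousAt_e (hxK t₀)
        (S.near_of_le S.σ₀_lt (leafPiece_edist' hσ.le hpσ 0))).tendsto.comp hlim
    have l1 := tendsto_clm_apply hq (hep.sub hex')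
    have l2 := hs.smul (tendsto_clm_apply hq (hey.sub hex')); rw [hHq s₀ hs₀ t₀]
    refine tendsto_nhds_unique l1 (l2.congr' ?_); filter_upwards [hmem] with z hz
    exact (hHq _ hz _).symm
  · refine leafPiece_eq_of_qk (hxK t) (hxσ t) (hH 0 (by simp) t) ?_; rw [hHq 0 (by simp) t]; simp
  · refine leafPiece_eq_of_qk (hxK t) (hyσ t) (hH 1 (by simp) t) ?_
    rw [hHq 1 (by simp) t, one_smul]
  · have h3 := hH s hs t; rw [h1] at h3; refine leafPiece_eq_of_qk (hxK t') (hH s hs t') h3 ?_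
    rw [hHq s hs t']; have := hHq s hs t; simp only [hξ, h1, h2] at this ⊢; exact this

end HypSys

/-! ### Integrals of one-forms along closed curves -/

section Primitives

variable [TopologicalSpace M] [ChartedSpace E M]

/-- The function `f` is a primitive of the one-form `σ` on the open set `U`. -/
def IsPrimitive (σ : OneForm E M) (U : Set M) (f : M → ℝ) : Prop :=
  IsOpen U ∧ ∀ q ∈ U, HasMFDerivAt ℐ E ℐ ℝ f q (σ q)

variable [IsManifold ℐ E ∞ M]

lemma mdifferentiableAt_extChartAt_symm {q : M} {u : E} (hu : u ∈ (Ξ E q).target) :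
    MDiffAt (Ξ E q).symm u :=
  ((contMDiffOn_extChartAt_symm (n := ∞) q).contMDiffAt
    ((isOpen_extChartAt_target q).mem_nhds hu)).mdifferentiableAt (by simp)

lemma eventually_eq_of_hasMFDerivAt_zero {W : Set M} (hW : IsOpen W) {g : M → ℝ}
    (hg : ∀ q ∈ W, HasMFDerivAt ℐ E ℐ ℝ g q 0) {q : M} (hq : q ∈ W) :
    ∀ᶠ p in 𝓝 q, g p = g q := by
  set φ := Ξ E q with hφ
  have hO : IsOpen (φ.target ∩ φ.symm ⁻¹' W) :=
    (continuousOn_extChartAt_symm q).isOpen_inter_preimage (isOpen_extChartAt_target q) hW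
  have hmem : φ q ∈ φ.target ∩ φ.symm ⁻¹' W := ⟨mem_extChartAt_target q, by simpa [hφ] using hq⟩
  obtain ⟨r, hr, hball⟩ := Metric.isOpen_iff.1 hO _ hmem
  have key : ∀ u ∈ ball (φ q) r, HasFDerivAt (g ∘ φ.symm) (0 : E →L[ℝ] ℝ) u := by
    intro u hu
    have h1 := (hg _ (hball hu).2).comp u
      (mdifferentiableAt_extChartAt_symm (hball hu).1).hasMFDerivAt
    rw [ContinuousLinearMap.zero_comp] at h1; exact hasMFDerivAt_iff_hasFDerivAt.1 h1
  have hconst : ∀ u ∈ ball (φ q) r, (g ∘ φ.symm) u = (g ∘ φ.symm) (φ q) := by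
    intro u hu
    refine Metric.isOpen_ball.is_const_of_fderiv_eq_zero (convex_ball (φ q) r).isPreconnected
      (fun v hv => (key v hv).differentiableAt.differentiableWithinAt)
      (fun v hv => (key v hv).fderiv) hu (Metric.mem_ball_self hr)
  have hcont : ContinuousAt φ q := continuousAt_extChartAt q
  filter_upwards [hcont (ball_mem_nhds _ hr), extChartAt_source_mem_nhds (I := ℐ E) q] with p hp hps
  have := hconst _ hp; simp only [comp_apply] at this
  rw [φ.left_inv hps, φ.left_inv (mem_extChartAt_source q)] at this; exact this

/-- The increments of two primitives of a one-form along a path agree. -/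
lemma IsPrimitive.sub_eq_sub {σ : OneForm E M} {U U' : Set M} {f f' : M → ℝ} (h : IsPrimitive σ U f)
    (h' : IsPrimitive σ U' f') {c : ℝ → M} {a b : ℝ} (hab : a ≤ b) (hc : ContinuousOn c (Icc a b))
    (hU : ∀ t ∈ Icc a b, c t ∈ U) (hU' : ∀ t ∈ Icc a b, c t ∈ U') :
    f (c b) - f (c a) = f' (c b) - f' (c a) := by
  have hg : ∀ q ∈ U ∩ U', HasMFDerivAt ℐ E ℐ ℝ (f - f') q 0 := by
    intro q hq; have := (h.2 q hq.1).sub (h'.2 q hq.2); rwa [sub_self] at this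
  have loc := fun q (hq : q ∈ U ∩ U') => eventually_eq_of_hasMFDerivAt_zero (h.1.inter h'.1) hg hq
  have hev : ∀ t ∈ Icc a b, ∀ᶠ s in 𝓝[Icc a b] t, (f - f') (c s) = (f - f') (c t) :=
    fun t ht => (hc t ht).eventually (loc _ ⟨hU t ht, hU' t ht⟩)
  have := constant_of_has_deriv_right_zero (f := fun t => (f - f') (c t)) (a := a) (b := b)
    (fun t ht => continuousWithinAt_const.congr_of_eventuallyEq (hev t ht) rfl)
    (fun t ht => ?_) b (right_mem_Icc.2 hab)
  · simp only [Pi.sub_apply] at this; linarith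
  · have h1 : ∀ᶠ s in 𝓝[Ici t] t, (f - f') (c s) = (f - f') (c t) := by
      have h2 := hev t ⟨ht.1, ht.2.le⟩; have h3 : Icc t b ∈ 𝓝[Ici t] t := Icc_mem_nhdsGE ht.2
      have h4 : 𝓝[Ici t] t ≤ 𝓝[Icc a b] t :=
        le_inf inf_le_left (le_principal_iff.2 (mem_of_superset h3 (Icc_subset_Icc_left ht.1)))
      exact h4 h2
    exact (hasDerivWithinAt_const t _ ((f - f') (c t))).congr_of_eventuallyEq h1 rfl

/-- The integrand of the integral of `σ` along `c`. -/
def OneForm.along (σ : OneForm E M) (c : ℝ → M) (t : ℝ) : ℝ :=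
  σ (c t) (mfderiv% c t (1 : ℝ))

lemma IsPrimitive.hasDerivAt {σ : OneForm E M} {U : Set M} {f : M → ℝ} (h : IsPrimitive σ U f)
    {c : ℝ → M} {t : ℝ} (hc : MDiffAt c t) (ht : c t ∈ U) :
    HasDerivAt (fun s => f (c s)) (σ.along c t) t := by
  have h1 := (h.2 _ ht).comp t hc.hasMFDerivAt
  have h2 : HasFDerivAt (𝕜 := ℝ) (E := ℝ) (F := ℝ) (fun s => f (c s))
      ((σ (c t)).comp (mfderiv% c t) : ℝ →L[ℝ] ℝ) t :=
    hasMFDerivAt_iff_hasFDerivAt.1 h1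
  exact h2.hasDerivAt

lemma IsPrimitive.integral_eq {σ : OneForm E M} {U : Set M} {f : M → ℝ} (h : IsPrimitive σ U f)
    {c : ℝ → M} (hc : MDiff c) (hi : Continuous (σ.along c)) {a b : ℝ}
    (hab : a ≤ b) (hU : ∀ t ∈ Icc a b, c t ∈ U) : ∫ t in a..b, σ.along c t = f (c b) - f (c a) := by
  refine intervalIntegral.integral_eq_sub_of_hasDerivAt (f := fun s => f (c s)) (fun t ht => ?_)
    (hi.intervalIntegrable _ _)
  rw [uIcc_of_le hab] at ht; exact h.hasDerivAt (hc t) (hU t ht)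

lemma exists_grid {σ : OneForm E M} {h : ℝ × ℝ → M} (hh : Continuous h)
    (hprim : ∀ p, ∃ U f, h p ∈ U ∧ IsPrimitive σ U f) :
    ∃ N : ℕ, 0 < N ∧ ∃ (U : ℕ → ℕ → Set M) (f : ℕ → ℕ → M → ℝ), ∀ i k, i < N → k < N →
      IsPrimitive σ (U i k) (f i k) ∧
      ∀ s t, s ∈ Icc ((i : ℝ) / N) ((i + 1 : ℕ) / N) → t ∈ Icc ((k : ℝ) / N) ((k + 1 : ℕ) / N) →
        h (s, t) ∈ U i k := by
  choose U f hU hf using hprim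
  obtain ⟨δ, hδ, hleb⟩ := lebesgue_number_lemma_of_metric
    (s := Icc (0 : ℝ) 1 ×ˢ Icc (0 : ℝ) 1) (c := fun p => h ⁻¹' U p)
    (isCompact_Icc.prod isCompact_Icc) (fun p => (hf p).1.preimage hh)
    (fun p _ => mem_iUnion.2 ⟨p, hU p⟩)
  obtain ⟨N, hN⟩ := exists_nat_gt (1 / δ)
  have hN0 : (0 : ℝ) < N := (by positivity : (0 : ℝ) < 1 / δ).trans hN
  have hNδ : 1 / (N : ℝ) < δ := by rw [div_lt_iff₀ hN0]; rwa [div_lt_iff₀ hδ, mul_comm] at hN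
  have hcorner : ∀ i k : ℕ, i < N → k < N →
      ((i / N : ℝ), (k / N : ℝ)) ∈ Icc (0 : ℝ) 1 ×ˢ Icc (0 : ℝ) 1 := by
    intro i k hi hk
    refine ⟨⟨by positivity, ?_⟩, ⟨by positivity, ?_⟩⟩ <;> rw [div_le_one hN0] <;>
      exact_mod_cast Nat.le_of_lt ‹_›
  have hex : ∀ i k : ℕ, ∃ p, i < N → k < N → ball ((i / N : ℝ), (k / N : ℝ)) δ ⊆ h ⁻¹' U p := by
    intro i k; by_cases hik : i < N ∧ k < N
    · obtain ⟨p, hp⟩ := hleb _ (hcorner i k hik.1 hik.2); exact ⟨p, fun _ _ => hp⟩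
    · exact ⟨(0, 0), fun a b => absurd ⟨a, b⟩ hik⟩
  choose p hp using hex
  refine ⟨N, by exact_mod_cast hN0, fun i k => U (p i k), fun i k => f (p i k),
    fun i k hi hk => ⟨hf _, fun s t hs ht => hp i k hi hk ?_⟩⟩
  have aux : ∀ (j : ℕ) (s : ℝ), s ∈ Icc ((j : ℝ) / N) ((j + 1 : ℕ) / N) → dist s (j / N) < δ := by
    intro j s hs; have : ((j + 1 : ℕ) : ℝ) / N = j / N + 1 / N := by push_cast; ring
    rw [Real.dist_eq, abs_of_nonneg (by linarith [hs.1])]; linarith [hs.2]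
  rw [mem_ball, Prod.dist_eq]; exact max_lt (aux i s hs) (aux k t ht)

/-- A one-form with local primitives has the same integral along freely homotopic closed curves. -/
theorem loopIntegral_eq_of_homotopy {σ : OneForm E M} {h : ℝ × ℝ → M} (hh : Continuous h)
    (hprim : ∀ p, ∃ U f, h p ∈ U ∧ IsPrimitive σ U f) (hper : ∀ s, h (s, 0) = h (s, 1))
    (hd₀ : MDifferentiable ℐ ℝ ℐ E fun t => h (0, t))
    (hd₁ : MDifferentiable ℐ ℝ ℐ E fun t => h (1, t))
    (hi₀ : Continuous (σ.along fun t => h (0, t))) (hi₁ : Continuous (σ.along fun t => h (1, t))) :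
    σ.loopIntegral (fun t => h (0, t)) = σ.loopIntegral (fun t => h (1, t)) := by
  obtain ⟨N, hN, U, f, hUf⟩ := exists_grid hh hprim; have hN0 : (0 : ℝ) < N := by exact_mod_cast hN
  have hmono : ∀ i : ℕ, (i : ℝ) / N ≤ (i + 1 : ℕ) / N := by intro i; push_cast; gcongr; linarith
  set P : ℕ → ℕ → M := fun i k => h ((i : ℝ) / N, (k : ℝ) / N) with hP
  -- the increments of the primitives along the two horizontal edges of a row of the grid
  set b : ℕ → ℝ := fun i => ∑ k ∈ Finset.range N, (f i k (P i (k + 1)) - f i k (P i k)) with hb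
  set t : ℕ → ℝ := fun i => ∑ k ∈ Finset.range N,
    (f i k (P (i + 1) (k + 1)) - f i k (P (i + 1) k)) with ht
  have cs : ∀ τ : ℝ, Continuous fun s => h (s, τ) := fun τ => hh.comp (by fun_prop)
  have ct : ∀ s : ℝ, Continuous fun τ => h (s, τ) := fun s => hh.comp (by fun_prop)
  have hbt : ∀ i < N, t i = b i := by
    intro i hi; set D : ℕ → ℝ := fun k => f i (k % N) (P (i + 1) k) - f i (k % N) (P i k) with hD
    have hDk : ∀ k < N, f i k (P (i + 1) (k + 1)) - f i k (P i (k + 1)) = D (k + 1) := by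
      intro k hk; rcases Nat.lt_or_ge (k + 1) N with hk1 | hk1
      · simp only [hD, Nat.mod_eq_of_lt hk1]
        refine (hUf i k hi hk).1.sub_eq_sub (hUf i (k + 1) hi hk1).1
          (c := fun s => h (s, ((k + 1 : ℕ) : ℝ) / N)) (hmono i) (cs _).continuousOn
          (fun s hs => (hUf i k hi hk).2 s _ hs (right_mem_Icc.2 (hmono k)))
          (fun s hs => (hUf i (k + 1) hi hk1).2 s _ hs (left_mem_Icc.2 (hmono (k + 1))))
      · obtain rfl : N = k + 1 := by omega
        have hk2 : ((k + 1 : ℕ) : ℝ) / (k + 1 : ℕ) = 1 := div_self hN0.ne'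
        simp only [hD, Nat.mod_self, hP]
        refine (hUf i k hi hk).1.sub_eq_sub (hUf i 0 hi hN).1
          (c := fun s => h (s, ((k + 1 : ℕ) : ℝ) / (k + 1 : ℕ))) (hmono i) (cs _).continuousOn
          (fun s hs => (hUf i k hi hk).2 s _ hs (right_mem_Icc.2 (hmono k)))
          (fun s hs => ?_)
        have := (hUf i 0 hi hN).2 s 0 hs (by simpa using hmono 0); simpa only [hk2, hper] using this
    have : t i - b i = ∑ k ∈ Finset.range N, (D (k + 1) - D k) := by
      rw [ht, hb, ← Finset.sum_sub_distrib]; refine Finset.sum_congr rfl fun k hk => ?_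
      have hk' := Finset.mem_range.1 hk; rw [← hDk k hk']; simp only [hD, Nat.mod_eq_of_lt hk']
      ring
    rw [Finset.sum_range_sub] at this
    have hDN : D N = D 0 := by
      have e : ∀ i, P i N = P i 0 := fun i => by
        simp only [hP, div_self hN0.ne', Nat.cast_zero, zero_div]; exact (hper _).symm
      simp only [hD, Nat.mod_self, Nat.zero_mod, e]
    linarith
  have htb : ∀ i, i + 1 < N → t i = b (i + 1) := by
    intro i hi; refine Finset.sum_congr rfl fun k hk => ?_; have hk' := Finset.mem_range.1 hk
    exact (hUf i k (by omega) hk').1.sub_eq_sub (hUf (i + 1) k hi hk').1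
      (c := fun τ => h (((i + 1 : ℕ) : ℝ) / N, τ)) (hmono k) (ct _).continuousOn
      (fun τ hτ => (hUf i k (by omega) hk').2 _ τ (right_mem_Icc.2 (hmono i)) hτ)
      (fun τ hτ => (hUf (i + 1) k hi hk').2 _ τ (left_mem_Icc.2 (hmono (i + 1))) hτ)
  have hind : ∀ i, i < N → b i = b 0 := by
    intro i; induction i with
    | zero => intro _; rfl
    | succ i ih => intro hi; rw [← htb i hi, hbt i (by omega), ih (by omega)]
  have hsum : ∀ c : ℝ → M, Continuous (σ.along c) → σ.loopIntegral c =
      ∑ k ∈ Finset.range N, ∫ τ in ((k : ℝ) / N)..((k + 1 : ℕ) / N), σ.along c τ := by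
    intro c hc
    rw [intervalIntegral.sum_integral_adjacent_intervals (fun k _ => hc.intervalIntegrable _ _)]
    simp only [Nat.cast_zero, zero_div, div_self hN0.ne']
    rfl
  obtain ⟨n, rfl⟩ : ∃ n, N = n + 1 := ⟨N - 1, by omega⟩
  have e0 : σ.loopIntegral (fun t => h (0, t)) = b 0 := by
    rw [hsum _ hi₀]; refine Finset.sum_congr rfl fun k hk => ?_; have hk' := Finset.mem_range.1 hk
    rw [(hUf 0 k hN hk').1.integral_eq hd₀ hi₀ (hmono k)
      (fun τ hτ => (hUf 0 k hN hk').2 _ τ (by simpa using hmono 0) hτ)]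
    simp only [hP, Nat.cast_zero, zero_div]
  have e1 : σ.loopIntegral (fun t => h (1, t)) = t n := by
    rw [hsum _ hi₁]; refine Finset.sum_congr rfl fun k hk => ?_; have hk' := Finset.mem_range.1 hk
    have h1 : ((n + 1 : ℕ) : ℝ) / (n + 1 : ℕ) = 1 := div_self hN0.ne'
    rw [(hUf n k (by omega) hk').1.integral_eq hd₁ hi₁ (hmono k)
      (fun τ hτ => (hUf n k (by omega) hk').2 _ τ ?_ hτ)]
    · simp only [hP, h1]
    · have := right_mem_Icc.2 (hmono n); rwa [h1] at this ⊢
  rw [e0, e1, hbt n (by omega), hind n (by omega)]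

end Primitives

/-! ### Pull-backs of one-forms and their exterior derivatives -/

section Pullback

variable [TopologicalSpace M] [ChartedSpace E M] [IsManifold ℐ E ∞ M]

/-- The pull-back of `θ` under a map from a vector space. -/
def OneForm.pull (θ : OneForm E M) (ψ : E → M) (u : E) : E →L[ℝ] ℝ :=
  (θ (ψ u)).comp (mfderiv% ψ u)

lemma contDiffOn_pull {θ : OneForm E M} (hθ : θ.IsSmooth) {ψ : E → M} {W : Set E} (hW : IsOpen W)
    (hψ : CMDiff[W] ∞ ψ) : ContDiffOn ℝ ∞ (θ.pull ψ) W := by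
  rw [contDiffOn_clm_apply]; intro w
  have h1 := hψ.contMDiffOn_tangentMapWithin (m := ∞) (by simp) hW.uniqueMDiffOn
  have h2 : ContMDiffOn ℐ E (ℐ E).tangent ∞ (fun u : E => (⟨u, w⟩ : TangentBundle ℐ E E)) W := by
    intro u hu
    exact (contMDiffAt_vectorSpace_iff_contDiffAt (V := fun _ : E => w).2
      contDiffAt_const).contMDiffWithinAt
  have h3 := (hθ.comp_contMDiffOn (h1.comp h2 (fun u hu => hu)))
  refine (contMDiffOn_iff_contDiffOn.1 h3).congr fun u hu => ?_
  simp only [comp_apply, tangentMapWithin, mfderivWithin_of_isOpen hW hu]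
  rfl

/-- Pull-back commutes with the exterior derivative. -/
theorem fderiv_pull_sub {θ : OneForm E M} (hθ : θ.IsSmooth) {ψ : E → M} {W : Set E} (hW : IsOpen W)
    (hψ : CMDiff[W] ∞ ψ) {u : E} (hu : u ∈ W) (v w : E) :
    fderiv ℝ (θ.pull ψ) u v w - fderiv ℝ (θ.pull ψ) u w v =
      θ.d (ψ u) (mfderiv% ψ u v) (mfderiv% ψ u w) := by
  set χ := Ξ E (ψ u) with hχ; set O := W ∩ ψ ⁻¹' χ.source
  have hOo : IsOpen O := hψ.continuousOn.isOpen_inter_preimage hW (isOpen_extChartAt_source _)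
  have huO : u ∈ O := ⟨hu, mem_extChartAt_source _⟩; set g : E → E := χ ∘ ψ
  have hgs : ContDiffOn ℝ ∞ g O := by
    refine contMDiffOn_iff_contDiffOn.1 ?_
    have h1 : CMDiff[χ.source] ∞ χ := by
      rw [hχ, extChartAt_source]; exact contMDiffOn_extChartAt
    exact h1.comp (hψ.mono inter_subset_left) (fun a ha => ha.2)
  have hgt : ∀ a ∈ O, g a ∈ χ.target := fun a ha => χ.map_source ha.2
  have hgd : ∀ a ∈ O, HasFDerivAt g (fderiv ℝ g a) a := fun a ha =>
    ((hgs.contDiffAt (hOo.mem_nhds ha)).differentiableAt (by simp)).hasFDerivAt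
  have hψd : ∀ a ∈ O, mfderiv% ψ a = (mfderiv% χ.symm (g a)).comp (fderiv ℝ g a) := by
    intro a ha; have h1 : MDiffAt χ.symm (g a) := mdifferentiableAt_extChartAt_symm (hgt a ha)
    have h2 := h1.hasMFDerivAt.comp a (hasMFDerivAt_iff_hasFDerivAt.2 (hgd a ha))
    refine (h2.congr_of_eventuallyEq ?_).mfderiv; filter_upwards [hOo.mem_nhds ha] with b hb
    exact (χ.left_inv hb.2).symm
  have hgu : g u = χ (ψ u) := rfl; set A := θ.inChart (ψ u)
  have hpull : ∀ a ∈ O, θ.pull ψ a = (A (g a)).comp (fderiv ℝ g a) := by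
    intro a ha; have e : ∀ p q : M, p = q → ∀ z : E, θ p z = θ q z := by rintro p _ rfl z; rfl
    refine ContinuousLinearMap.ext fun z => ?_
    have h1 : mfderiv% ψ a z = mfderiv% χ.symm (g a) (fderiv ℝ g a z) :=
        congrArg (fun L : E →L[ℝ] E => L z) (hψd a ha)
    exact (congrArg (fun y : E => θ (ψ a) y) h1).trans (e _ _ (χ.left_inv ha.2).symm _)
  have hAd : HasFDerivAt A (fderiv ℝ A (g u)) (g u) := by
    have h1 : ContDiffOn ℝ ∞ A χ.target :=
      contDiffOn_pull hθ (isOpen_extChartAt_target _) (contMDiffOn_extChartAt_symm _)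
    exact ((h1.contDiffAt ((isOpen_extChartAt_target _).mem_nhds (hgt u huO))).differentiableAt
      (by simp)).hasFDerivAt
  have hg2 : HasFDerivAt (fderiv ℝ g) (fderiv ℝ (fderiv ℝ g) u) u := by
    have := (hgs.contDiffAt (hOo.mem_nhds huO)).fderiv_right (m := 1) (by norm_cast)
    exact (this.differentiableAt (by simp)).hasFDerivAt
  have hsymm : ∀ a b, fderiv ℝ (fderiv ℝ g) u a b = fderiv ℝ (fderiv ℝ g) u b a :=
    fun a b => (hgs.contDiffAt (hOo.mem_nhds huO)).isSymmSndFDerivAt (by simp only [minSmoothness_of_isRCLikeNormedField]; norm_cast) a b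
  have hder := (hAd.comp u (hgd u huO)).clm_comp hg2
  have hder' : HasFDerivAt (θ.pull ψ) _ u := hder.congr_of_eventuallyEq (by
    filter_upwards [hOo.mem_nhds huO] with a ha using hpull a ha)
  have hv : ∀ v : E, mfderiv% χ (ψ u) (mfderiv% ψ u v) = fderiv ℝ g u v := by
    intro v
    have h1 : MDiffAt χ (ψ u) :=
      mdifferentiableAt_extChartAt (mem_chart_source E (ψ u))
    have h2 : MDiffAt ψ u :=
      (hψ.contMDiffAt (hW.mem_nhds hu)).mdifferentiableAt (by simp)
    have h3 := (h1.hasMFDerivAt.comp u h2.hasMFDerivAt)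
    let L : E →L[ℝ] E := (mfderiv% χ (ψ u)).comp (mfderiv% ψ u)
    have h4 : HasFDerivAt g L u := hasMFDerivAt_iff_hasFDerivAt.1 h3
    have h5 : fderiv ℝ g u = L := h4.fderiv; exact (congrArg (fun L : E →L[ℝ] E => L v) h5).symm
  have hd : θ.d (ψ u) (mfderiv% ψ u v) (mfderiv% ψ u w) =
      fderiv ℝ A (g u) (fderiv ℝ g u v) (fderiv ℝ g u w) -
        fderiv ℝ A (g u) (fderiv ℝ g u w) (fderiv ℝ g u v) := by
    rw [← hv v, ← hv w]; rfl
  rw [hder'.fderiv, hd]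
  simp only [comp_apply, add_apply, ContinuousLinearMap.comp_apply,
    ContinuousLinearMap.compL_apply, ContinuousLinearMap.flip_apply, hsymm v w, hgu]
  ring

end Pullback

section Defect

variable [TopologicalSpace M] [ChartedSpace E M] [IsManifold ℐ E ∞ M]

/-- The closed one-form `T^* θ - θ`. -/
def OneForm.defect (θ : OneForm E M) (T : M → M) : OneForm E M := fun x =>
  (θ (T x)).comp (mfderiv% T x) - θ x

lemma pull_chart_apply (θ : OneForm E M) {T : M → M} {p : M} (hT : MDiffAt T p)
    {q : M} (hp : p ∈ (Ξ E q).source) (v : E) :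
    θ.pull (T ∘ (Ξ E q).symm) (Ξ E q p) (mfderiv% (Ξ E q) p v) =
      θ (T p) (mfderiv% T p v) := by
  set φ := Ξ E q; have e : ∀ p q : M, p = q → ∀ z : E, θ p z = θ q z := by rintro p _ rfl z; rfl
  have hpq : φ.symm (φ p) = p := φ.left_inv hp
  have h1 : MDiffAt φ p :=
    mdifferentiableAt_extChartAt (by rwa [extChartAt_source] at hp)
  have h2 : MDiffAt φ.symm (φ p) :=
    mdifferentiableAt_extChartAt_symm (φ.map_source hp)
  have h3 : MDiffAt (T ∘ φ.symm) (φ p) := MDifferentiableAt.comp _ (by rwa [hpq]) h2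
  have h4 := h3.hasMFDerivAt.comp p h1.hasMFDerivAt
  have h5 := (h4.congr_of_eventuallyEq (f₁ := T) (by
    filter_upwards [(isOpen_extChartAt_source q).mem_nhds hp] with a ha
    exact congrArg T (φ.left_inv ha).symm)).mfderiv
  have h6 : mfderiv% T p v = mfderiv% (T ∘ φ.symm) (φ p)
      (mfderiv% φ p v) := congrArg (fun L : E →L[ℝ] E => L v) h5
  exact (e _ _ (congrArg T hpq) _).trans (congrArg (fun y : E => θ (T p) y) h6.symm)

/-- For a symplectic map `T` the form `T^* θ - θ` has local primitives. -/
theorem exists_primitive_defect {θ : OneForm E M} (hθ : θ.IsSmooth) {T : OpenPartialHomeomorph M M}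
    (hT : CMDiff[T.source] ∞ T) (hTθ : Preserves T θ) {q : M} (hq : q ∈ T.source) :
    ∃ U f, q ∈ U ∧ IsPrimitive (θ.defect T) U f := by
  set φ := Ξ E q with hφ
  have hO : IsOpen (φ.target ∩ φ.symm ⁻¹' T.source) :=
    (continuousOn_extChartAt_symm q).isOpen_inter_preimage (isOpen_extChartAt_target q) T.open_source
  obtain ⟨r, hr, hball⟩ := Metric.isOpen_iff.1 hO (φ q)
    ⟨mem_extChartAt_target q, by simpa [hφ] using hq⟩
  have hb := Metric.isOpen_ball (x := φ q) (ε := r)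
  have s1 : ContMDiffOn ℐ E ℐ E ∞ φ.symm (ball (φ q) r) :=
    (contMDiffOn_extChartAt_symm q).mono fun u hu => (hball hu).1
  have s2 : ContMDiffOn ℐ E ℐ E ∞ (T ∘ φ.symm) (ball (φ q) r) := hT.comp s1 fun u hu => (hball hu).2
  have d1 := (contDiffOn_pull hθ hb s1).differentiableOn (by simp)
  have d2 := (contDiffOn_pull hθ hb s2).differentiableOn (by simp)
  set η : E → E →L[ℝ] ℝ := θ.pull (T ∘ φ.symm) - θ.pull φ.symm with hη
  have hfd : ∀ a ∈ ball (φ q) r, ∀ x y, fderiv ℝ η a x y =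
      fderiv ℝ (θ.pull (T ∘ φ.symm)) a x y - fderiv ℝ (θ.pull φ.symm) a x y := by
    intro a ha x y
    rw [hη, fderiv_sub (d2.differentiableAt (hb.mem_nhds ha)) (d1.differentiableAt (hb.mem_nhds ha))]
    rfl
  have hsym : ∀ a ∈ ball (φ q) r, ∀ x y, fderiv ℝ η a x y = fderiv ℝ η a y x := by
    intro a ha x y; have f1 := fderiv_pull_sub hθ hb s1 ha x y
    have f2 := fderiv_pull_sub hθ hb s2 ha x y
    have m1 : MDiffAt φ.symm a := mdifferentiableAt_extChartAt_symm (hball ha).1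
    have m2 : MDiffAt T (φ.symm a) :=
      (hT.contMDiffAt (T.open_source.mem_nhds (hball ha).2)).mdifferentiableAt (by simp)
    have hc : ∀ v : E, mfderiv% (T ∘ φ.symm) a v =
        mfderiv% T (φ.symm a) (mfderiv% φ.symm a v) :=
      fun v => congrArg (fun L : E →L[ℝ] E => L v) (mfderiv_comp a m2 m1)
    have f3 := hTθ _ (hball ha).2 (mfderiv% φ.symm a x) (mfderiv% φ.symm a y)
    have f4 : θ.d ((T ∘ φ.symm) a) (mfderiv% (T ∘ φ.symm) a x)
        (mfderiv% (T ∘ φ.symm) a y) =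
        θ.d (φ.symm a) (mfderiv% φ.symm a x) (mfderiv% φ.symm a y) := by
      rw [hc x, hc y]; exact f3
    rw [hfd a ha, hfd a ha]; linarith
  obtain ⟨f₀, hf₀⟩ := (convex_ball (φ q) r).exists_forall_hasFDerivAt_of_fderiv_symmetric hb
    (d2.sub d1) hsym
  refine ⟨φ.source ∩ φ ⁻¹' ball (φ q) r, f₀ ∘ φ, ⟨mem_extChartAt_source q, Metric.mem_ball_self hr⟩,
    (continuousOn_extChartAt q).isOpen_inter_preimage (isOpen_extChartAt_source q) hb, ?_⟩
  rintro p ⟨hp, hpb⟩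
  have h1 : MDiffAt φ p :=
    mdifferentiableAt_extChartAt (by rwa [hφ, extChartAt_source] at hp)
  have hTp : p ∈ T.source := by have := (hball hpb).2; rwa [mem_preimage, φ.left_inv hp] at this
  have m2 : MDiffAt T p :=
    (hT.contMDiffAt (T.open_source.mem_nhds hTp)).mdifferentiableAt (by simp)
  have h2 := (hasMFDerivAt_iff_hasFDerivAt.2 (hf₀ _ hpb)).comp p h1.hasMFDerivAt
  have e1 := pull_chart_apply θ m2 hp
  have e2 := pull_chart_apply θ (T := id) mdifferentiableAt_id hp; refine h2.congr_mfderiv ?_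
  refine ContinuousLinearMap.ext fun v => ?_; have e3 := e2 v; rw [mfderiv_id] at e3
  exact congrArg₂ (· - ·) (e1 v) e3

lemma continuous_along {θ : OneForm E M} (hθ : θ.IsSmooth) {c : ℝ → M}
    (hc : CMDiff 1 c) : Continuous (θ.along c) := by
  have h1 : Continuous (tangentMap ℐ ℝ ℐ E c) := hc.continuous_tangentMap (by simp)
  have h2 : Continuous (fun t : ℝ => (⟨t, (1 : ℝ)⟩ : TangentBundle ℐ ℝ ℝ)) := by
    refine ContMDiff.continuous (I := ℐ ℝ) (I' := (ℐ ℝ).tangent) (n := 1) fun t => ?_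
    exact contMDiffAt_vectorSpace_iff_contDiffAt (V := fun _ : ℝ => (1 : ℝ)).2 contDiffAt_const
  exact hθ.continuous.comp (h1.comp h2)

lemma along_defect {θ : OneForm E M} {T : M → M} {c : ℝ → M} {t : ℝ}
    (hc : MDiffAt c t) (hT : MDiffAt T (c t)) :
    (θ.defect T).along c t = θ.along (T ∘ c) t - θ.along c t := by
  have h := congrArg (fun L : ℝ →L[ℝ] E => θ (T (c t)) (L 1)) (mfderiv_comp t hT hc)
  exact congrArg (· - θ.along c t) h.symm

/-- The change under `T` of the integral along a loop only depends on the homotopy class of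
the loop in the domain of `T`, for a symplectic map `T`. -/
theorem loopIntegral_comp_sub {θ : OneForm E M} (hθ : θ.IsSmooth) {T : OpenPartialHomeomorph M M}
    (hT : CMDiff[T.source] ∞ T) (hTθ : Preserves T θ) {h : ℝ × ℝ → M} (hh : Continuous h)
    (hs : ∀ p, h p ∈ T.source) (hper : ∀ s, h (s, 0) = h (s, 1))
    (hd₀ : ContMDiff ℐ ℝ ℐ E 1 fun t => h (0, t))
    (hd₁ : ContMDiff ℐ ℝ ℐ E 1 fun t => h (1, t)) :
    θ.loopIntegral (fun t => T (h (0, t))) - θ.loopIntegral (fun t => h (0, t)) =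
      θ.loopIntegral (fun t => T (h (1, t))) - θ.loopIntegral (fun t => h (1, t)) := by
  have key : ∀ c : ℝ → M, CMDiff 1 c → (∀ t, c t ∈ T.source) →
      Continuous ((θ.defect T).along c) ∧ (θ.defect T).loopIntegral c =
        θ.loopIntegral (fun t => T (c t)) - θ.loopIntegral c := by
    intro c hc hcs
    have hTc : CMDiff 1 (T ∘ c) := fun t =>
      ((hT.contMDiffAt (T.open_source.mem_nhds (hcs t))).of_le (by norm_cast)).comp t (hc t)
    have e : (θ.defect T).along c = fun t => θ.along (T ∘ c) t - θ.along c t := funext fun t =>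
      along_defect ((hc t).mdifferentiableAt (by simp))
        ((hT.contMDiffAt (T.open_source.mem_nhds (hcs t))).mdifferentiableAt (by simp))
    have c1 := continuous_along hθ hTc; have c2 := continuous_along hθ hc
    refine ⟨e ▸ c1.sub c2, ?_⟩
    calc (θ.defect T).loopIntegral c = ∫ t in (0 : ℝ)..1, (θ.along (T ∘ c) t - θ.along c t) := by
          rw [← e]; rfl
      _ = _ := intervalIntegral.integral_sub (c1.intervalIntegrable _ _) (c2.intervalIntegrable _ _)
  obtain ⟨i0, k0⟩ := key _ hd₀ (fun t => hs _); obtain ⟨i1, k1⟩ := key _ hd₁ (fun t => hs _)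
  rw [← k0, ← k1]
  exact loopIntegral_eq_of_homotopy hh (fun p => exists_primitive_defect hθ hT hTθ (hs p)) hper
    (hd₀.mdifferentiable (by simp)) (hd₁.mdifferentiable (by simp)) i0 i1

end Defect

/-! ### Integrals along the iterates of shadowing loops -/

namespace HypSys

variable [EMetricSpace M] {S : HypSys M V} {x x' y y' p p' q : M}

/-- The velocities, read in `V`, of the iterates of a curve that shadows points of `K` grow at most
at the centre rate. -/
lemma exists_velocity_bound {x y : ℝ → M} {Y : ℕ → ℝ → V} (hx : ∀ t, x t ∈ S.K)
    (hy : ∀ t, y t ∈ S.piece S.δ₁ (x t)) (hc : ∀ m, Continuous fun t => S.T^[m] (y t))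
    (hY : ∀ m t, HasDerivAt (fun t => S.e (S.T^[m] (y t))) (Y m t) t) (hY0 : Continuous (Y 0)) :
    ∃ b, 0 ≤ b ∧ ∀ m, ∀ t ∈ Icc (0 : ℝ) 1, ‖Y m t‖ ≤ b * S.α₁ ^ m := by
  obtain ⟨b, hb⟩ := isCompact_Icc.exists_bound_of_continuousOn (s := Icc (0 : ℝ) 1) hY0.continuousOn
  have hb0 : 0 ≤ b := (norm_nonneg _).trans (hb 0 (by simp))
  have hC := S.C_pos; have hα := S.α₁_pos
  refine ⟨S.C * (2 * (3 * S.C * b)), by positivity, fun m t ht => ?_⟩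
  have hjet : S.IsJet y t (fun m => (ContinuousLinearMap.toSpanSingleton ℝ (Y m t))) :=
    ⟨fun m => (hc m).continuousAt, fun m => (hY m t).hasFDerivAt⟩
  have hg := hjet.growth (hx t) (w := (1 : ℝ)) (hy t) (Eventually.of_forall fun s => ⟨_, hx _, hy _⟩) m
  simp only [ContinuousLinearMap.toSpanSingleton_apply, one_smul] at hg
  have h1 := S.norm_le_N (S.mem_it (hx t) m) (Y m t); have h2 := S.N_le (hx t) (Y 0 t)
  calc ‖Y m t‖ ≤ S.C * (2 * S.α₁ ^ m * (3 * S.C * b)) := by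
        refine h1.trans ?_; gcongr; refine hg.trans ?_; gcongr
        exact h2.trans (by gcongr; exact hb t ht)
    _ = _ := by ring

lemma norm_deriv_le_of_lipschitz {f : ℝ → V} {g : ℝ → W} {f' : V} {g' : W} {t L : ℝ}
    (hf : HasDerivAt f f' t) (hg : HasDerivAt g g' t)
    (h : ∀ᶠ s in 𝓝 t, ‖g s - g t‖ ≤ L * ‖f s - f t‖) : ‖g'‖ ≤ L * ‖f'‖ := by
  refine le_of_tendsto_of_tendsto (hasDerivAt_iff_tendsto_slope.1 hg).norm
    ((hasDerivAt_iff_tendsto_slope.1 hf).norm.const_mul L) ?_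
  filter_upwards [h.filter_mono nhdsWithin_le_nhds] with s hs
  simp only [slope, vsub_eq_sub, norm_smul]; rw [mul_left_comm]
  exact mul_le_mul_of_nonneg_left hs (norm_nonneg _)

/-- The integrals of a one-form along the iterates of two loops, one of which shadows the other in
`K`, become equal in the limit: the distance of the loops decays like `λᵐ`, their velocities grow
at most like `α₁ᵐ`, and the difference of the velocities is integrated by parts. -/
theorem tendsto_integral_sub {a : M → V →L[ℝ] ℝ} {L r : ℝ} (hr : 0 < r)
    (ha : ∀ x ∈ S.K, ∀ p, edist p x < ofReal r → ‖a p - a x‖ ≤ L * ‖S.e p - S.e x‖) {x y : ℝ → M}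
    {X Y : ℕ → ℝ → V} {A : ℕ → ℝ → V →L[ℝ] ℝ} (hx : ∀ t, x t ∈ S.K)
    (hy : ∀ t, y t ∈ S.piece S.δ₁ (x t)) (hx1 : x 1 = x 0) (hy1 : y 1 = y 0)
    (hxc : ∀ m, Continuous fun t => S.T^[m] (x t)) (hyc : ∀ m, Continuous fun t => S.T^[m] (y t))
    (hX : ∀ m t, HasDerivAt (fun t => S.e (S.T^[m] (x t))) (X m t) t)
    (hY : ∀ m t, HasDerivAt (fun t => S.e (S.T^[m] (y t))) (Y m t) t) (hXc : ∀ m, Continuous (X m))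
    (hYc : ∀ m, Continuous (Y m)) (hA : ∀ m t, HasDerivAt (fun t => a (S.T^[m] (x t))) (A m t) t)
    (hAc : ∀ m, Continuous (A m)) (hay : ∀ᶠ m in atTop, Continuous fun t => a (S.T^[m] (y t))) :
    Tendsto (fun m => (∫ t in (0 : ℝ)..1, a (S.T^[m] (y t)) (Y m t)) -
      ∫ t in (0 : ℝ)..1, a (S.T^[m] (x t)) (X m t)) atTop (𝓝 0) := by
  have hC := S.C_pos; have hα := S.α₁_pos; have hlam := S.lam_pos
  have hδ1 : S.δ₁ < S.r := by have := S.δ₁_le; have := S.ρ₀_lt; have := S.ρ₀_pos; linarith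
  have hδ0 := S.δ₁_pos
  obtain ⟨bX, hbX0, hbX⟩ := exists_velocity_bound (S := S) (x := x) (y := x) hx
    (fun t m => ⟨S.near_source _ (S.mem_it (hx t) m) _ (S.near_self _), by simp⟩) hxc hX (hXc 0)
  obtain ⟨bY, hbY0, hbY⟩ := exists_velocity_bound hx hy hyc hY (hYc 0)
  have hL : ∀ p : M, p ∈ S.K → ∀ q, edist q p < ofReal r →
      ‖a q - a p‖ ≤ |L| * ‖S.e q - S.e p‖ := fun p hp q hq =>
    (ha p hp q hq).trans (by gcongr; exact le_abs_self L)
  have hA' : ∀ m t, ‖A m t‖ ≤ |L| * ‖X m t‖ := by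
    intro m t; refine norm_deriv_le_of_lipschitz (hX m t) (hA m t) ?_
    have : ∀ᶠ s in 𝓝 t, edist (S.T^[m] (x s)) (S.T^[m] (x t)) < ofReal r :=
      EMetric.tendsto_nhds.1 ((hxc m).tendsto t) _ (ofReal_pos.2 hr)
    filter_upwards [this] with s hs
    exact hL _ (S.mem_it (hx t) m) _ hs
  have hZ : ∀ m t, ‖S.e (S.T^[m] (y t)) - S.e (S.T^[m] (x t))‖ ≤ S.C * (S.δ₁ * S.lam ^ m) :=
    fun m t => leafPiece_norm hδ0.le hδ1 (hx t) (hy t) m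
  obtain ⟨m₀, hm₀⟩ := S.exists_lam_pow_le S.δ₁ (half_pos hr)
  set b : ℝ := |L| * (S.C * S.δ₁) * (bX + bY) with hb
  have hbound : ∀ᶠ m in atTop, ‖(∫ t in (0 : ℝ)..1, a (S.T^[m] (y t)) (Y m t)) -
      ∫ t in (0 : ℝ)..1, a (S.T^[m] (x t)) (X m t)‖ ≤ b * (S.α₁ * S.lam) ^ m := by
    filter_upwards [hay, eventually_ge_atTop m₀] with m hm hmm
    set ξ : ℝ → M := fun t => S.T^[m] (x t) with hξ; set ζ : ℝ → M := fun t => S.T^[m] (y t) with hζ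
    have hax : Continuous fun t => a (ξ t) :=
      continuous_iff_continuousAt.2 fun t => (hA m t).continuousAt
    have hex : Continuous fun t => S.e (ξ t) :=
      continuous_iff_continuousAt.2 fun t => (hX m t).continuousAt
    have hey : Continuous fun t => S.e (ζ t) :=
      continuous_iff_continuousAt.2 fun t => (hY m t).continuousAt
    have c1 := hm.clm_apply (hYc m); have c2 := hax.clm_apply (hXc m)
    have c3 := (hAc m).clm_apply (hey.sub hex); have c4 := hax.clm_apply ((hYc m).sub (hXc m))
    -- the boundary terms of the integration by parts cancel
    have parts : ∫ t in (0 : ℝ)..1, (A m t (S.e (ζ t) - S.e (ξ t)) + a (ξ t) (Y m t - X m t)) = 0 := by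
      rw [intervalIntegral.integral_eq_sub_of_hasDerivAt
        (f := fun t => a (ξ t) (S.e (ζ t) - S.e (ξ t)))
        (fun t _ => (hA m t).clm_apply ((hY m t).sub (hX m t)))
        ((c3.add c4).intervalIntegrable _ _)]
      simp [hξ, hζ, hx1, hy1]
    have hsplit : (∫ t in (0 : ℝ)..1, a (ζ t) (Y m t)) - ∫ t in (0 : ℝ)..1, a (ξ t) (X m t) =
        ∫ t in (0 : ℝ)..1, ((a (ζ t) - a (ξ t)) (Y m t) - A m t (S.e (ζ t) - S.e (ξ t))) := by
      have q1 := intervalIntegral.integral_sub (μ := MeasureTheory.volume)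
        (c1.intervalIntegrable 0 1) (c2.intervalIntegrable 0 1)
      have q2 := intervalIntegral.integral_sub (μ := MeasureTheory.volume)
        ((c1.sub c2).intervalIntegrable 0 1) ((c3.add c4).intervalIntegrable 0 1)
      refine q1.symm.trans (((sub_zero _).symm.trans
        (congrArg (_ - ·) parts.symm)).trans (q2.symm.trans ?_))
      congr 1; funext t; simp only [sub_apply, map_sub, Pi.sub_apply, Pi.add_apply, hζ]; ring
    rw [hsplit]
    have := intervalIntegral.norm_integral_le_of_norm_le_const (a := (0 : ℝ)) (b := 1)
      (f := fun t => (a (ζ t) - a (ξ t)) (Y m t) - A m t (S.e (ζ t) - S.e (ξ t)))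
      (C := b * (S.α₁ * S.lam) ^ m) ?_
    · simpa using this
    intro t ht
    have ht' : t ∈ Icc (0 : ℝ) 1 := by rw [uIoc_of_le zero_le_one] at ht; exact ⟨ht.1.le, ht.2⟩
    have hnear : edist (ζ t) (ξ t) < ofReal r := by
      refine (hy t m).2.trans_lt ((ofReal_lt_ofReal_iff hr).2 ?_); have := hm₀ m hmm; linarith
    have e1 := (hL _ (S.mem_it (hx t) m) _ hnear).trans
      (mul_le_mul_of_nonneg_left (hZ m t) (abs_nonneg L))
    calc _ ≤ ‖a (ζ t) - a (ξ t)‖ * ‖Y m t‖ + ‖A m t‖ * ‖S.e (ζ t) - S.e (ξ t)‖ :=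
          (norm_sub_le _ _).trans (add_le_add (ContinuousLinearMap.le_opNorm _ _)
            (ContinuousLinearMap.le_opNorm _ _))
      _ ≤ (|L| * (S.C * (S.δ₁ * S.lam ^ m))) * (bY * S.α₁ ^ m) +
          (|L| * (bX * S.α₁ ^ m)) * (S.C * (S.δ₁ * S.lam ^ m)) := by
          gcongr
          · exact hbY m t ht'
          · exact (hA' m t).trans (by gcongr; exact hbX m t ht')
          · exact hZ m t
      _ = _ := by rw [hb, mul_pow]; ring
  refine squeeze_zero_norm' hbound ?_
  have := (tendsto_pow_atTop_nhds_zero_of_lt_one (by positivity) S.α₁_lam_lt_one).const_mul b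
  rwa [mul_zero] at this

/-- Loops in the strong leaves of a loop in `K` are homotopic to it through loops along which the
inverse map can be iterated. -/
lemma exists_pullback_homotopy (S : HypSys M V)
    (hdom : ∀ x ∈ S.K, leaf S.T S.lam x ⊆ S.T.target) {C₀ : ℝ} {x y : ℝ → M} (hxK : ∀ t, x t ∈ S.K)
    (hy : ∀ t, y t ∈ S.piece C₀ (x t)) (hxc : ∀ m, Continuous fun t => S.T^[m] (x t))
    (hyc : ∀ m, Continuous fun t => S.T^[m] (y t)) (hx1 : x 0 = x 1) (hy1 : y 0 = y 1) (i : ℕ) :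
    ∃ h : ℝ × ℝ → M, Continuous h ∧ (∀ p, h p ∈ S.T.source) ∧ (∀ s, h (s, 0) = h (s, 1)) ∧
      (∀ t, h (0, t) = S.T^[i] (x t)) ∧ ∀ t, h (1, t) = S.T^[i] (y t) := by
  obtain ⟨δ, hδ, hH⟩ := S.exists_leaf_homotopy; obtain ⟨n, hn⟩ := S.exists_lam_pow_le C₀ hδ
  have hlam := S.lam_pos
  have hsrc : ∀ t m, S.T^[m] (x t) ∈ S.T.source := fun t m =>
    S.near_source _ (S.mem_it (hxK t) m) _ (S.near_self _)
  have key : ∀ k : ℕ, ∀ i, n ≤ i + k → ∃ G : ℝ → ℝ → M,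
      ContinuousOn (fun p : ℝ × ℝ => G p.1 p.2) (Icc 0 1 ×ˢ univ) ∧
      (∀ t, G 0 t = S.T^[i] (x t)) ∧ (∀ t, G 1 t = S.T^[i] (y t)) ∧
      (∀ s ∈ Icc (0 : ℝ) 1, ∀ t, G s t ∈ leaf S.T S.lam (S.T^[i] (x t))) ∧
      ∀ s ∈ Icc (0 : ℝ) 1, G s 0 = G s 1 := by
    intro k; induction k with
    | zero =>
      intro i hi
      obtain ⟨H, h1, h2, h3, h4, h5⟩ := hH (fun t => S.T^[i] (x t)) (fun t => S.T^[i] (y t))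
        (hxc i) (hyc i) (fun t => S.mem_it (hxK t) i)
        (fun t => leafPiece_mono hlam.le (hn i (by omega)) (leafPiece_shift (hy t) i))
      exact ⟨H, h1, h2, h3, fun s hs t => ⟨_, h4 s hs t⟩,
        fun s hs => h5 s hs 0 1 (by simp only [hx1]) (by simp only [hy1])⟩
    | succ k ih =>
      intro i hi; obtain ⟨G, g1, g2, g3, g4, g5⟩ := ih (i + 1) (by omega)
      have htgt : ∀ s ∈ Icc (0 : ℝ) 1, ∀ t, G s t ∈ S.T.target := fun s hs t =>
        hdom _ (S.mem_it (hxK t) _) (g4 s hs t)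
      have hcont : ContinuousOn (fun p : ℝ × ℝ => S.T.symm (G p.1 p.2)) (Icc 0 1 ×ˢ univ) :=
        S.T.continuousOn_symm.comp g1 fun p hp => htgt _ hp.1 _
      have e0 : ∀ t, S.T.symm (G 0 t) = S.T^[i] (x t) := fun t => by
        rw [g2, iterate_succ_apply', S.T.left_inv (hsrc t i)]
      refine ⟨fun s t => S.T.symm (G s t), hcont, e0, fun t => ?_, fun s hs t => ?_, fun s hs => ?_⟩
      · simp only; rw [g3, iterate_succ_apply', S.T.left_inv (hy t i).1]
      · obtain ⟨c, hc⟩ := g4 s hs t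
        -- the points of the curve `s ↦ G s t` have finite distance from `x t`
        have hfin : edist (S.T.symm (G s t)) (S.T^[i] (x t)) < ⊤ := by
          have h1 : ContinuousOn (fun s => S.T.symm (G s t)) (Icc 0 1) :=
            hcont.comp (f := fun s => (s, t)) (by fun_prop) fun s hs => ⟨hs, mem_univ _⟩
          have h2 := (isPreconnected_Icc.image _ h1).subset_isClopen
            (t := eball (S.T^[i] (x t)) ⊤) ?_
            ⟨S.T^[i] (x t), ⟨0, by simp, e0 t⟩, by simp⟩
          · exact h2 ⟨s, hs, rfl⟩
          · exact ⟨Metric.isClosed_eball_top, Metric.isOpen_eball⟩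
        refine ⟨max (c / S.lam) (edist (S.T.symm (G s t)) (S.T^[i] (x t))).toReal, fun m => ?_⟩
        rcases m with _ | m
        · refine ⟨S.T.map_target (htgt s hs t), ?_⟩; simp only [iterate_zero, id, pow_zero, mul_one]
          rw [← ofReal_toReal hfin.ne]
          exact ofReal_le_ofReal (by rw [ofReal_toReal hfin.ne]; exact le_max_right _ _)
        · have := hc m
          rw [iterate_succ_apply, iterate_succ_apply, S.T.right_inv (htgt s hs t),
            ← iterate_succ_apply' S.T i]
          refine ⟨this.1, this.2.trans (ofReal_le_ofReal ?_)⟩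
          calc c * S.lam ^ m = c / S.lam * S.lam ^ (m + 1) := by field_simp; ring
            _ ≤ _ := by gcongr; exact le_max_left _ _
      · simp only [g5 s hs]
  obtain ⟨G, g1, g2, g3, g4, g5⟩ := key n i (by omega)
  have hp : ∀ s : ℝ, (projIcc 0 1 zero_le_one s : ℝ) ∈ Icc (0 : ℝ) 1 := fun s => Subtype.prop _
  refine ⟨fun p => G (projIcc 0 1 zero_le_one p.1) p.2, ?_, fun p => ?_, fun s => g5 _ (hp s), ?_, ?_⟩
  · exact g1.comp_continuous (f := fun p : ℝ × ℝ => ((projIcc 0 1 zero_le_one p.1 : ℝ), p.2))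
      (by fun_prop) fun p => ⟨hp _, mem_univ _⟩
  · obtain ⟨c, hc⟩ := g4 _ (hp p.1) p.2; exact (hc 0).1
  · intro t; simpa using g2 t
  · intro t; simpa using g3 t

end HypSys

namespace HypSys

variable [EMetricSpace M] [ChartedSpace E M] [IsManifold ℐ E ∞ M]

/-- The one-form `θ` is `∑ aᵢ deᵢ` near `K`, with coefficients that are Lipschitz along `K`. -/
structure Represents (S : HypSys M V) (θ : OneForm E M) (a : M → V →L[ℝ] ℝ) : Prop where
  contMDiff_e : CMDiff 1 S.e
  near : ∃ L r : ℝ, 0 < r ∧ ∀ x ∈ S.K, ∀ p, edist p x < ofReal r →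
    CMDiffAt 1 a p ∧
    (∀ w : TangentSpace ℐ E p, θ p w = a p (mfderiv% S.e p w)) ∧
    ‖a p - a x‖ ≤ L * ‖S.e p - S.e x‖

variable {S : HypSys M V}

lemma contMDiff_iterate {T : OpenPartialHomeomorph M M} (hT : CMDiff[T.source] ∞ T)
    {c : ℝ → M} (hc : CMDiff 1 c) (hs : ∀ m t, T^[m] (c t) ∈ T.source) (m : ℕ) :
    ContMDiff ℐ ℝ ℐ E 1 fun t => T^[m] (c t) := by
  induction m with
  | zero => exact hc
  | succ m ih =>
    simp only [iterate_succ_apply']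
    exact fun t => ContMDiffAt.comp t
      ((hT.contMDiffAt (T.open_source.mem_nhds (hs m t))).of_le (by norm_cast)) (ih t)

lemma hasDerivAt_e {e : M → V} (he : CMDiff 1 e) {c : ℝ → M}
    (hc : CMDiff 1 c) (t : ℝ) :
    HasDerivAt (fun t => e (c t)) (mfderiv% e (c t)
      (mfderiv% c t (1 : ℝ)) : V) t := by
  let L : ℝ →L[ℝ] V := (mfderiv% e (c t)).comp (mfderiv% c t)
  have h3 : HasFDerivAt (fun t => e (c t)) L t := hasMFDerivAt_iff_hasFDerivAt.1
    ((he.mdifferentiable (by simp) (c t)).hasMFDerivAt.comp t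
      (hc.mdifferentiable (by simp) t).hasMFDerivAt)
  exact h3.hasDerivAt

/-- A `C¹` loop in the strong leaves of a `C¹` loop in `K` has the same integral. -/
theorem loopIntegral_eq {θ : OneForm E M}
    (hθ : θ.IsSmooth) {a : M → V →L[ℝ] ℝ} (hrep : S.Represents θ a)
    (hT : CMDiff[S.T.source] ∞ S.T) (hTθ : Preserves S.T θ)
    (hdom : (∀ x ∈ S.K, leaf S.T S.lam x ⊆ S.T.target) ∨
      ∀ c : ℝ → M, CMDiff 1 c → Periodic c 1 → (∀ t, c t ∈ S.T.source) →
      θ.loopIntegral c = θ.loopIntegral fun t => S.T (c t))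
    {x y : ℝ → M} (hx : CMDiff 1 x) (hy : CMDiff 1 y)
    (hx1 : Periodic x 1) (hy1 : Periodic y 1) (hxK : ∀ t, x t ∈ S.K) {C₀ : ℝ}
    (hyx : ∀ t, y t ∈ S.piece C₀ (x t)) : θ.loopIntegral x = θ.loopIntegral y := by
  have hsx : ∀ m t, S.T^[m] (x t) ∈ S.T.source := fun m t =>
    S.near_source _ (S.mem_it (hxK t) m) _ (S.near_self _)
  have hsy : ∀ m t, S.T^[m] (y t) ∈ S.T.source := fun m t => (hyx t m).1
  have hxm := contMDiff_iterate hT hx hsx; have hym := contMDiff_iterate hT hy hsy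
  have px : x 0 = x 1 := by simpa using (hx1 0).symm
  have py : y 0 = y 1 := by simpa using (hy1 0).symm
  -- the difference of the integrals is the same for all iterates
  have hstep : ∀ m, θ.loopIntegral (fun t => S.T^[m] (y t)) - θ.loopIntegral (fun t => S.T^[m] (x t)) =
      θ.loopIntegral y - θ.loopIntegral x := by
    intro m; induction m with
    | zero => rfl
    | succ m ih =>
      rw [← ih]; simp only [iterate_succ_apply']; rcases hdom with hdom | hdom
      · obtain ⟨h, h1, h2, h3, h4, h5⟩ := S.exists_pullback_homotopy hdom hxK hyx
          (fun m => (hxm m).continuous) (fun m => (hym m).continuous) px py m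
        have h4' : (fun t => h (0, t)) = fun t => S.T^[m] (x t) := funext h4
        have h5' : (fun t => h (1, t)) = fun t => S.T^[m] (y t) := funext h5
        have := loopIntegral_comp_sub hθ hT hTθ h1 h2 h3 (h4' ▸ hxm m) (h5' ▸ hym m)
        simp only [h4, h5] at this; linarith
      · have e1 := hdom _ (hxm m) (fun t => by simp only [hx1 t]) (hsx m)
        have e2 := hdom _ (hym m) (fun t => by simp only [hy1 t]) (hsy m); rw [← e1, ← e2]
  obtain ⟨L, r, hr, hnear⟩ := hrep.near; have he := hrep.contMDiff_e
  obtain ⟨k, hk⟩ := S.exists_lam_pow_le C₀ S.δ₁_pos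
  obtain ⟨n, hn⟩ := S.exists_lam_pow_le C₀ (half_pos hr)
  have hae : ∀ {c : ℝ → M}, CMDiff 1 c →
      (∀ t, ∃ p ∈ S.K, edist (c t) p < ofReal r) → ContDiff ℝ 1 fun t => a (c t) := by
    intro c hc hp; refine contMDiff_iff_contDiff.1 fun t => ?_; obtain ⟨p, hpK, hp⟩ := hp t
    exact (hnear p hpK _ hp).1.comp t (hc t)
  have hxr : ∀ m t, ∃ p ∈ S.K, edist (S.T^[m] (x t)) p < ofReal r := fun m t =>
    ⟨_, S.mem_it (hxK t) m, by rw [edist_self]; exact ofReal_pos.2 hr⟩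
  have hyr : ∀ m ≥ n, ∀ t, ∃ p ∈ S.K, edist (S.T^[m] (y t)) p < ofReal r := by
    intro m hm t
    refine ⟨_, S.mem_it (hxK t) m, (hyx t m).2.trans_lt ((ofReal_lt_ofReal_iff hr).2 ?_)⟩
    have := hn m hm; linarith
  have hder : ∀ {c : ℝ → M}, CMDiff 1 c →
      Continuous (deriv fun t => S.e (c t)) := fun {c} hc =>
    (contMDiff_iff_contDiff.1 (he.comp hc)).continuous_deriv (by simp)
  have hint : ∀ {c : ℝ → M}, CMDiff 1 c → (∀ t, ∃ p ∈ S.K, edist (c t) p < ofReal r) →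
      θ.loopIntegral c = ∫ t in (0 : ℝ)..1, a (c t) (deriv (fun t => S.e (c t)) t) := by
    intro c hc hp; unfold OneForm.loopIntegral; congr 1; funext t; obtain ⟨p, hpK, hp⟩ := hp t
    rw [(hasDerivAt_e he hc t).deriv]; exact (hnear p hpK _ hp).2.1 _
  have hlim := tendsto_integral_sub (S := S) hr (fun x hx p hp => (hnear x hx p hp).2.2)
    (x := fun t => S.T^[k] (x t)) (y := fun t => S.T^[k] (y t))
    (X := fun m => deriv fun t => S.e (S.T^[m] (S.T^[k] (x t))))
    (Y := fun m => deriv fun t => S.e (S.T^[m] (S.T^[k] (y t))))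
    (A := fun m => deriv fun t => a (S.T^[m] (S.T^[k] (x t))))
    (fun t => S.mem_it (hxK t) k)
    (fun t => leafPiece_mono S.lam_pos.le (hk k le_rfl) (leafPiece_shift (hyx t) k))
    (by simp only [px]) (by simp only [py])
    (fun m => by simp only [← iterate_add_apply]; exact (hxm _).continuous)
    (fun m => by simp only [← iterate_add_apply]; exact (hym _).continuous)
    (fun m t => by
      simp only [← iterate_add_apply]
      exact (hasDerivAt_e he (hxm _) t).differentiableAt.hasDerivAt)
    (fun m t => by
      simp only [← iterate_add_apply]
      exact (hasDerivAt_e he (hym _) t).differentiableAt.hasDerivAt)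
    (fun m => by simp only [← iterate_add_apply]; exact hder (hxm _))
    (fun m => by simp only [← iterate_add_apply]; exact hder (hym _))
    (fun m t => by
      simp only [← iterate_add_apply]
      exact ((hae (hxm (m + k)) (hxr _)).differentiable (by simp) t).hasDerivAt)
    (fun m => by
      simp only [← iterate_add_apply]
      exact (hae (hxm (m + k)) (hxr _)).continuous_deriv (by simp))
    (by
      filter_upwards [eventually_ge_atTop n] with m hm
      simp only [← iterate_add_apply]
      exact (hae (hym (m + k)) (hyr _ (by omega))).continuous)
  have hconst : ∀ᶠ m in atTop, (∫ t in (0 : ℝ)..1, a (S.T^[m] (S.T^[k] (y t)))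
      (deriv (fun t => S.e (S.T^[m] (S.T^[k] (y t)))) t)) - (∫ t in (0 : ℝ)..1,
        a (S.T^[m] (S.T^[k] (x t))) (deriv (fun t => S.e (S.T^[m] (S.T^[k] (x t)))) t)) =
      θ.loopIntegral y - θ.loopIntegral x := by
    filter_upwards [eventually_ge_atTop n] with m hm
    simp only [← iterate_add_apply]
    rw [← hint (hym (m + k)) (hyr _ (by omega)), ← hint (hxm (m + k)) (hxr _), hstep]
  have := tendsto_nhds_unique (hlim.congr' hconst) tendsto_const_nhds; linarith

end HypSys

/-! ### Tangent spaces of the leaves -/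

lemma hasMFDerivAt_extChartAt_symm [TopologicalSpace M] [ChartedSpace E M] [IsManifold ℐ E 1 M]
    (y : M) :
    HasMFDerivAt ℐ E ℐ E (Ξ E y).symm (Ξ E y y) (ContinuousLinearMap.id ℝ E) := by
  have h1 := (((contMDiffOn_extChartAt_symm (I := ℐ E) (n := 1) y).contMDiffAt
    (extChartAt_target_mem_nhds _)).mdifferentiableAt
      (by simp)).hasMFDerivAt
  have h2 := mfderivWithin_range_extChartAt_symm (I := ℐ E) (x := y)
  rw [ModelWithCorners.range_eq_univ, mfderivWithin_univ] at h2; exact h1.congr_mfderiv h2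

namespace HypSys

variable [EMetricSpace M] [ChartedSpace E M] [IsManifold ℐ E ∞ M]

variable (E) in
/-- The map `T` is a smooth diffeomorphism, `e` is a `C¹` immersion near `K`, and the contracted and
the centre bundle have constant dimensions `n` and `k`. -/
structure IsSmooth (S : HypSys M V) (n k : ℕ) : Prop where
  diffeo : IsSmoothDiffeo (E := E) S.T
  contMDiff_e : CMDiff 1 S.e
  immersion : ∀ x ∈ S.K, ∀ p, edist p x < ofReal S.r →
    Injective (mfderiv% S.e p)
  finrank_qk : ∀ x ∈ S.K, finrank ℝ (S.qk x).range = n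
  finrank_qc : ∀ x ∈ S.K, finrank ℝ (S.qc x).range = k

variable (E) in
/-- The derivatives at `y` of the iterates of `T`, read in `V`. -/
def orbitDeriv (S : HypSys M V) (y : M) (m : ℕ) : E →L[ℝ] V :=
  mfderiv% (fun p => S.e (S.T^[m] p)) y

variable {S : HypSys M V} {n k : ℕ}

namespace IsSmooth

lemma contMDiffAt_iterate (h : S.IsSmooth E n k) {y : M} (hy : ∀ m, S.T^[m] y ∈ S.T.source)
    (m : ℕ) :
    CMDiffAt 1 (S.T^[m]) y := by
  induction m with
  | zero => exact contMDiffAt_id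
  | succ m ih =>
    rw [iterate_succ']
    exact ((h.diffeo.1.contMDiffAt (S.T.open_source.mem_nhds (hy m))).of_le (by norm_cast)).comp y ih

lemma contMDiffAt_e_iterate (h : S.IsSmooth E n k) {y : M} (hy : ∀ m, S.T^[m] y ∈ S.T.source)
    (m : ℕ) : CMDiffAt 1 (fun p => S.e (S.T^[m] p)) y :=
  (h.contMDiff_e _).comp y (h.contMDiffAt_iterate hy m)

lemma injective_mfderiv_T (h : S.IsSmooth E n k) {p : M} (hp : p ∈ S.T.source) :
    Injective (mfderiv% S.T p) := by
  have h1 : MDiffAt S.T p :=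
    (h.diffeo.1.contMDiffAt (S.T.open_source.mem_nhds hp)).mdifferentiableAt (by simp)
  have h2 : MDiffAt S.T.symm (S.T p) :=
    (h.diffeo.2.contMDiffAt (S.T.open_target.mem_nhds (S.T.map_source hp))).mdifferentiableAt
      (by simp)
  have h3 := (h2.hasMFDerivAt.comp p h1.hasMFDerivAt).congr_of_eventuallyEq (f₁ := id) (by
    filter_upwards [S.T.open_source.mem_nhds hp] with q hq using (S.T.left_inv hq).symm)
  have h4 := hasMFDerivAt_unique h3 (hasMFDerivAt_id p)
  refine LeftInverse.injective (g := (mfderiv% S.T.symm (S.T p) : E → E)) fun v => ?_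
  exact congrArg (fun L : E →L[ℝ] E => L v) h4

lemma injective_orbitDeriv (h : S.IsSmooth E n k) {y : M} (hy : ∀ m, S.T^[m] y ∈ S.T.source) {m : ℕ}
    {x : M} (hx : x ∈ S.K) (hm : edist (S.T^[m] y) x < ofReal S.r) :
    Injective (S.orbitDeriv E y m) := by
  have h1 : ∀ m, Injective (mfderiv% (S.T^[m]) y) := by
    intro m; induction m with
    | zero =>
      have : mfderiv% (S.T^[0]) y = ContinuousLinearMap.id ℝ _ := mfderiv_id
      rw [this]; exact fun _ _ h => h
    | succ m ih =>
      have e1 := mfderiv_comp y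
        ((h.diffeo.1.contMDiffAt (S.T.open_source.mem_nhds (hy m))).mdifferentiableAt (by simp))
        ((h.contMDiffAt_iterate hy m).mdifferentiableAt (by simp))
      rw [← iterate_succ'] at e1; rw [e1]; exact (h.injective_mfderiv_T (hy m)).comp ih
  have e2 := mfderiv_comp y (h.contMDiff_e.mdifferentiableAt (by simp))
    ((h.contMDiffAt_iterate hy m).mdifferentiableAt (by simp))
  have e3 : Injective (mfderiv% (S.e ∘ S.T^[m]) y) := by
    rw [e2]; exact (h.immersion x hx _ hm).comp (h1 m)
  exact e3

lemma isJet (h : S.IsSmooth E n k) {c : G → M} {u : G} (hy : ∀ m, S.T^[m] (c u) ∈ S.T.source)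
    {L : G →L[ℝ] E} (hc : HasMFDerivAt ℐ G ℐ E c u L) :
    S.IsJet c u (fun m => (S.orbitDeriv E (c u) m).comp L) := by
  refine ⟨fun m => ContinuousAt.comp (h.contMDiffAt_iterate hy m).continuousAt hc.continuousAt,
    fun m => ?_⟩
  exact hasMFDerivAt_iff_hasFDerivAt.1
    (((h.contMDiffAt_e_iterate hy m).mdifferentiableAt (by simp)).hasMFDerivAt.comp u hc)

lemma mem_rateSpace_lam (h : S.IsSmooth E n k) {x : M} (hx : x ∈ S.K) {c : G → M} {u : G}
    {L : G →L[ℝ] E} (hc : HasMFDerivAt ℐ G ℐ E c u L) {C₀ : ℝ}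
    (hmem : ∀ᶠ v in 𝓝 u, c v ∈ S.piece C₀ x) (w : G) :
    L w ∈ rateSpace (S.orbitDeriv E (c u)) S.lam := by
  obtain ⟨m₀, hm₀⟩ := S.exists_lam_pow_le C₀ S.ρ₀_pos
  have hsh : ∀ v, c v ∈ S.piece C₀ x → S.T^[m₀] (c v) ∈ S.piece S.ρ₀ (S.T^[m₀] x) := fun v hv =>
    leafPiece_mono S.lam_pos.le (hm₀ m₀ le_rfl) (leafPiece_shift hv m₀)
  have hjet := (h.isJet (fun m => (hmem.self_of_nhds m).1) hc).shift m₀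
  have hdec := hjet.decay (S.mem_it hx m₀) (w := w) (hsh _ hmem.self_of_nhds)
    ((tendsto_line u w).eventually (hmem.mono hsh))
  refine rateSpace_of_shift S.lam_pos (k := m₀)
    ⟨2 * S.C ^ 2 * ‖S.orbitDeriv E (c u) (0 + m₀) (L w)‖, fun m => (hdec m).trans (le_of_eq ?_)⟩
  simp only [ContinuousLinearMap.comp_apply]; ring

lemma mem_rateSpace_α₁ (h : S.IsSmooth E n k) {c : G → M} {u : G} {L : G →L[ℝ] E}
    (hc : HasMFDerivAt ℐ G ℐ E c u L) {C₀ : ℝ}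
    (hmem : ∀ᶠ v in 𝓝 u, ∃ x ∈ S.K, c v ∈ S.piece C₀ x) (w : G) :
    L w ∈ rateSpace (S.orbitDeriv E (c u)) S.α₁ := by
  obtain ⟨m₀, hm₀⟩ := S.exists_lam_pow_le C₀ S.δ₁_pos
  have hsh : ∀ v, (∃ x ∈ S.K, c v ∈ S.piece C₀ x) →
      ∃ x ∈ S.K, S.T^[m₀] (c v) ∈ S.piece S.δ₁ x := fun v ⟨x, hx, hv⟩ =>
    ⟨_, S.mem_it hx m₀, leafPiece_mono S.lam_pos.le (hm₀ m₀ le_rfl) (leafPiece_shift hv m₀)⟩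
  obtain ⟨x', -, hx''⟩ := hmem.self_of_nhds
  have hjet := (h.isJet (fun m => (hx'' m).1) hc).shift m₀
  obtain ⟨x, hx, hxu⟩ := hsh _ hmem.self_of_nhds
  have hgr := hjet.growth hx (w := w) hxu ((tendsto_line u w).eventually (hmem.mono hsh))
  refine rateSpace_of_shift S.α₁_pos (k := m₀)
    ⟨S.C * (2 * S.N x (S.orbitDeriv E (c u) (0 + m₀) (L w))), fun m => ?_⟩
  have hC := S.C_pos; refine (S.norm_le_N (S.mem_it hx m) _).trans ?_
  calc _ ≤ S.C * (2 * S.α₁ ^ m * S.N x (S.orbitDeriv E (c u) (0 + m₀) (L w))) := by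
        gcongr; exact hgr m
    _ = _ := by ring

lemma leafTangent_le (h : S.IsSmooth E n k) {x y : M} (hx : x ∈ S.K) {w : TangentSpace ℐ E y}
    (hw : w ∈ leafTangent (E := E) S.T S.lam x y) :
    (w : E) ∈ rateSpace (S.orbitDeriv E y) S.lam := by
  have : leafTangent (E := E) S.T S.lam x y ≤ (rateSpace (S.orbitDeriv E y) S.lam :) := by
    refine Submodule.span_le.2 ?_; rintro w ⟨c, hc, hcw, C₀, hmem⟩
    obtain ⟨h1, h2⟩ := Bundle.TotalSpace.mk.inj hcw; subst h1; have h3 := eq_of_heq h2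
    have h4 := h.mem_rateSpace_lam hx (hc.mdifferentiableAt (by simp)).hasMFDerivAt hmem 1
    exact h3 ▸ h4
  exact this hw

/-- The vectors at a point of a leaf contracted at the strong rate, and those that grow at most at
the centre rate, form spaces of at most the expected dimensions. -/
lemma finrank_rateSpace_le (h : S.IsSmooth E n k)
    {x y : M} (hx : x ∈ S.K) (hy : y ∈ leaf S.T S.lam x) :
    finrank ℝ (rateSpace (S.orbitDeriv E y) S.lam) ≤ n ∧
      finrank ℝ (rateSpace (S.orbitDeriv E y) S.α₁) ≤ n + k := by
  haveI : IsManifold ℐ E 1 M := IsManifold.of_le (n := ∞) (by norm_cast); obtain ⟨C₀, hC₀⟩ := hy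
  have hC := S.C_pos; have hr := S.ρ₀_pos; set δ := min S.ρ₀ (1 / (16 * S.C ^ 4))
  have hδ0 : 0 < δ := by positivity
  have hδ1 : 8 * S.C ^ 4 * δ < 1 := by
    calc 8 * S.C ^ 4 * δ ≤ 8 * S.C ^ 4 * (1 / (16 * S.C ^ 4)) := by gcongr; exact min_le_right _ _
      _ = 1 / 2 := by field_simp; norm_num
      _ < 1 := by norm_num
  obtain ⟨m₀, hm₀⟩ := S.exists_lam_pow_le C₀ hδ0
  have hsrc : ∀ m, S.T^[m] y ∈ S.T.source := fun m => (hC₀ m).1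
  have hyy := (Ξ E y).left_inv (mem_extChartAt_source y)
  have hsh : S.T^[m₀] y ∈ S.piece δ (S.T^[m₀] x) :=
    leafPiece_mono S.lam_pos.le (hm₀ m₀ le_rfl) (leafPiece_shift hC₀ m₀)
  have hjet := (h.isJet (c := (Ξ E y).symm) (by rwa [hyy])
    (hasMFDerivAt_extChartAt_symm y)).shift m₀
  simp only [ContinuousLinearMap.comp_id] at hjet; rw [hyy] at hjet
  have hinj : Injective (S.orbitDeriv E y (0 + m₀)) := by
    rw [zero_add]
    refine h.injective_orbitDeriv hsrc (S.mem_it hx m₀)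
      (S.near_of_le ((min_le_left _ _).trans_lt S.ρ₀_lt) (leafPiece_edist' hδ0.le hsh 0))
  have hxm := S.mem_it hx m₀
  have e1 := hjet.finrank_rateSpace_le hxm hδ0.le (min_le_left _ _) hδ1 (by simpa only [hyy] using hsh) hinj
  have e2 := hjet.finrank_rateSpace_α₁_le hxm hδ0.le (min_le_left _ _) hδ1 (by simpa only [hyy] using hsh) hinj
  rw [h.finrank_qk _ hxm] at e1 e2; rw [h.finrank_qc _ hxm] at e2
  exact ⟨(Submodule.finrank_mono fun w hw => rateSpace_shift hw m₀).trans e1,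
    (Submodule.finrank_mono fun w hw => rateSpace_shift hw m₀).trans e2⟩

end IsSmooth
end HypSys

/-- The dimension count for strongly transverse homoclinic points. -/
lemma finrank_eq_of_isDirectSum₃ {W : Type*} [AddCommGroup W] [Module ℝ W] [FiniteDimensional ℝ W]
    {P Q R Rs Ru Rsc Ruc : Submodule ℝ W} {n k : ℕ} (h : IsDirectSum₃ P Q R) (hP : P ≤ Rs)
    (hQ : Q ≤ Ru) (hPR : P ⊔ R ≤ Rsc) (hQR : Q ⊔ R ≤ Ruc) (ns : finrank ℝ Rs ≤ n)
    (nu : finrank ℝ Ru ≤ n) (nsc : finrank ℝ Rsc ≤ n + k) (nuc : finrank ℝ Ruc ≤ n + k)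
    (hW : finrank ℝ W = 2 * n + k) : finrank ℝ R = k ∧ Disjoint R Rs ∧ Disjoint R Ru := by
  have h1 := Submodule.finrank_sup_add_finrank_inf_eq P Q
  have h2 := Submodule.finrank_add_eq_of_isCompl h.2
  have dPR : Disjoint P R := h.2.disjoint.mono_left le_sup_left
  have dQR : Disjoint Q R := h.2.disjoint.mono_left le_sup_right
  have h3 := Submodule.finrank_sup_add_finrank_inf_eq P R
  have h4 := Submodule.finrank_sup_add_finrank_inf_eq Q R; rw [h.1.eq_bot, finrank_bot] at h1
  rw [dPR.eq_bot, finrank_bot] at h3; rw [dQR.eq_bot, finrank_bot] at h4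
  have f1 := Submodule.finrank_mono hP; have f2 := Submodule.finrank_mono hQ
  have f3 := Submodule.finrank_mono hPR; have f4 := Submodule.finrank_mono hQR
  have e1 : P = Rs := Submodule.eq_of_le_of_finrank_le hP (by omega)
  have e2 : Q = Ru := Submodule.eq_of_le_of_finrank_le hQ (by omega)
  exact ⟨by omega, e1 ▸ dPR.symm, e2 ▸ dQR.symm⟩

/-! ### Loops of homoclinic points -/

lemma continuousAt_of_hasStrictDerivAt {f f' : ℝ → G} {t₀ : ℝ} (h0 : HasStrictDerivAt f (f' t₀) t₀)
    (h : ∀ᶠ t in 𝓝 t₀, HasDerivAt f (f' t) t) : ContinuousAt f' t₀ := by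
  rw [ContinuousAt, Metric.tendsto_nhds]; intro ε hε
  have h1 := (hasStrictFDerivAt_iff_isLittleO.1 h0.hasStrictFDerivAt).def (half_pos hε)
  rw [nhds_prod_eq] at h1
  obtain ⟨U, hU, h2⟩ := (eventually_prod_self_iff (r := fun s t => ‖f s - f t -
    (ContinuousLinearMap.toSpanSingleton ℝ (f' t₀)) (s - t)‖ ≤ ε / 2 * ‖s - t‖)).1 h1
  filter_upwards [h, eventually_eventually_nhds.2 hU] with t ht hUt
  have h3 : HasDerivAt (fun s => f s - s • f' t₀) (f' t - f' t₀) t := by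
    exact (ht.sub ((hasDerivAt_id t).smul_const (f' t₀))).congr_deriv (by simp)
  have h4 : ‖f' t - f' t₀‖ ≤ ε / 2 := by
    refine le_of_tendsto (hasDerivAt_iff_tendsto_slope.1 h3).norm ?_
    filter_upwards [hUt.filter_mono nhdsWithin_le_nhds, self_mem_nhdsWithin] with s hs hst
    have h6 := h2 s hs t hUt.self_of_nhds
    simp only [ContinuousLinearMap.toSpanSingleton_apply] at h6
    rw [slope_def_module, norm_smul, norm_inv, ← div_eq_inv_mul, div_le_iff₀
      (norm_sub_pos_iff.2 hst)]
    refine le_trans (le_of_eq ?_) h6; congr 1; simp only [sub_smul]; abel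
  rw [dist_eq_norm]; linarith

lemma contDiffAt_one_of_hasStrictDerivAt {f : ℝ → G} {t₀ : ℝ}
    (h : ∀ᶠ t in 𝓝 t₀, ∃ f', HasStrictDerivAt f f' t) : ContDiffAt ℝ 1 f t₀ := by
  have hd : ∀ᶠ t in 𝓝 t₀, HasStrictDerivAt f (deriv f t) t := by
    filter_upwards [h] with t ⟨f', ht⟩
    rwa [ht.hasDerivAt.deriv]
  rw [contDiffAt_one_iff]
  refine ⟨fun t => ContinuousLinearMap.toSpanSingleton ℝ (deriv f t), _,
    eventually_eventually_nhds.2 hd, fun t ht => ?_, fun t ht => ?_⟩ <;>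
    replace ht : ∀ᶠ s in 𝓝 t, HasStrictDerivAt f (deriv f s) s := ht
  · have := continuousAt_of_hasStrictDerivAt (f' := deriv f) ht.self_of_nhds
      (ht.mono fun s hs => hs.hasDerivAt)
    exact ((ContinuousLinearMap.toSpanSingletonCLE (𝕜 := ℝ) (E := G)).continuous.continuousAt.comp
      this).continuousWithinAt
  · exact ht.self_of_nhds.hasDerivAt.hasFDerivAt

lemma contMDiff_one_of_hasStrictDerivAt {β : ℝ → B} (hc : Continuous β)
    (h : ∀ t, ∃ f', HasStrictDerivAt (fun s => extChartAt ℐ EB (β t) (β s)) f' t) :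
    CMDiff 1 β := by
  intro t₀; rw [contMDiffAt_iff_target]
  refine ⟨hc.continuousAt, contMDiffAt_iff_contDiffAt.2 (contDiffAt_one_of_hasStrictDerivAt ?_)⟩
  have hs : ∀ᶠ t in 𝓝 t₀, β t ∈ (extChartAt ℐ EB (β t₀)).source :=
    hc.continuousAt (extChartAt_source_mem_nhds (I := ℐ EB) (β t₀))
  filter_upwards [hs] with t ht
  obtain ⟨f', hf'⟩ := h t; set φ := extChartAt ℐ EB (β t); set ψ := extChartAt ℐ EB (β t₀) with hψ
  -- change of charts
  have h1 : CMDiffAt 1 (ψ ∘ φ.symm) (φ (β t)) := by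
    have e : φ.symm (φ (β t)) = β t := φ.left_inv (mem_extChartAt_source _)
    refine ContMDiffAt.comp _ (I' := ℐ EB) ?_ ((contMDiffOn_extChartAt_symm (β t)).contMDiffAt
      (extChartAt_target_mem_nhds _))
    rw [e]; exact contMDiffAt_extChartAt' (by rwa [hψ, extChartAt_source] at ht)
  have h2 := ((contMDiffAt_iff_contDiffAt.1 h1).hasStrictFDerivAt (by simp)).comp_hasStrictDerivAt
    (f := fun s => φ (β s)) t hf'
  refine ⟨_, h2.congr_of_eventuallyEq ?_⟩
  filter_upwards [hc.continuousAt (extChartAt_source_mem_nhds (I := ℐ EB) (β t))] with s hs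
  simp only [comp_apply]; rw [φ.left_inv hs]

lemma exists_uniform_piece [EMetricSpace M] {T : OpenPartialHomeomorph M M} {lam : ℝ}
    (hlam : 0 ≤ lam) {x y : ℝ → M} (hx : Periodic x 1) (hy : Periodic y 1)
    (h : ∀ t, ∃ C, ∀ᶠ s in 𝓝 t, y s ∈ leafPiece T lam C (x s)) :
    ∃ C, ∀ t, y t ∈ leafPiece T lam C (x t) := by
  have h1 : ∃ C, ∀ t ∈ Icc (0 : ℝ) 1, y t ∈ leafPiece T lam C (x t) := by
    refine isCompact_Icc.induction_on (p := fun s => ∃ C, ∀ t ∈ s, y t ∈ leafPiece T lam C (x t))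
      ⟨0, by simp⟩ (fun s t hst ⟨C, hC⟩ => ⟨C, fun a ha => hC a (hst ha)⟩) ?_ ?_
    · rintro s t ⟨C, hC⟩ ⟨C', hC'⟩
      exact ⟨max C C', fun a ha => ha.elim (fun ha => HypSys.leafPiece_mono hlam (le_max_left _ _) (hC a ha))
        fun ha => HypSys.leafPiece_mono hlam (le_max_right _ _) (hC' a ha)⟩
    · intro t _; obtain ⟨C, hC⟩ := h t; exact ⟨_, mem_nhdsWithin_of_mem_nhds hC, C, fun a ha => ha⟩
  obtain ⟨C, hC⟩ := h1; refine ⟨C, fun t => ?_⟩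
  have e : ∀ {f : ℝ → M}, Periodic f 1 → f t = f (Int.fract t) := fun {f} hf => by
    simpa using (hf.sub_int_mul_eq (x := t) ⌊t⌋).symm
  rw [e hx, e hy]; exact hC _ ⟨Int.fract_nonneg t, (Int.fract_lt_one t).le⟩

namespace HypSys

variable [EMetricSpace M] [ChartedSpace E M] [IsManifold ℐ E ∞ M] {S : HypSys M V} {n k : ℕ}

/-- Along a `C¹` curve in `K`, the points of `B` in the leaves of the points of the curve, if
unique, form a `C¹` curve. -/
theorem contMDiff_section (h : S.IsSmooth E n k)
    {j : B → M} (hj : CMDiff 1 j) (himm : ∀ b, Injective (mfderiv% j b))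
    (hst : ∀ b, ∃ C, ∀ᶠ b' in 𝓝 b, ∃ x ∈ S.K, j b' ∈ S.piece C x) (hdim : finrank ℝ EB = k)
    (hrate : ∀ b, ∀ w, (mfderiv% j b w : E) ∈ rateSpace (S.orbitDeriv E (j b)) S.lam → w = 0)
    {x : ℝ → M} (hx : CMDiff 1 x) (hxK : ∀ t, x t ∈ S.K) {β : ℝ → B}
    (hβ : ∀ t, j (β t) ∈ leaf S.T S.lam (x t)) (huniq : ∀ t b, j b ∈ leaf S.T S.lam (x t) → b = β t) :
    CMDiff 1 β ∧ ∀ t, ∃ C, ∀ᶠ s in 𝓝 t, j (β s) ∈ S.piece C (x s) := by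
  have main : ∀ t₀, ContinuousAt β t₀ ∧
      (∃ f', HasStrictDerivAt (fun s => extChartAt ℐ EB (β t₀) (β s)) f' t₀) ∧
      ∃ C, ∀ᶠ s in 𝓝 t₀, j (β s) ∈ S.piece C (x s) := by
    intro t₀; set b₀ := β t₀; set φ := extChartAt ℐ EB b₀; set u := φ b₀
    have hub : φ.symm u = b₀ := φ.left_inv (mem_extChartAt_source _); obtain ⟨C, hC⟩ := hst b₀
    have hφc : ContinuousAt φ.symm u := continuousAt_extChartAt_symm b₀
    have hmem : ∀ᶠ v in 𝓝 u, ∃ p ∈ S.K, j (φ.symm v) ∈ S.piece C p := hφc.eventually (hub.symm ▸ hC)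
    obtain ⟨a, haK⟩ := hmem.choice; obtain ⟨hau, hauC⟩ := haK.self_of_nhds
    have haux : a u = x t₀ := leaf_base_unique (hxK t₀) hau (by rw [hub]; exact hβ t₀) ⟨C, hauC⟩
    obtain ⟨m₀, hm₀⟩ := S.exists_lam_pow_le C S.δ₂_pos
    have hsrc : ∀ m, S.T^[m] (j (φ.symm u)) ∈ S.T.source := fun m => (hauC m).1
    have hcu : CMDiffAt 1 (fun v => j (φ.symm v)) u :=
      (hj _).comp u ((contMDiffOn_extChartAt_symm b₀).contMDiffAt (extChartAt_target_mem_nhds _))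
    let L : EB →L[ℝ] E := mfderiv% j (φ.symm u)
    have hL : HasMFDerivAt ℐ EB ℐ E (fun v => j (φ.symm v)) u L :=
      (hj.mdifferentiable (by simp) (φ.symm u)).hasMFDerivAt.comp u (hasMFDerivAt_extChartAt_symm b₀)
    have hjet := h.isJet (c := fun v => j (φ.symm v)) hsrc hL
    have hsm : ∀ m, ContDiffAt ℝ 1 (fun v => S.e (S.T^[m] (j (φ.symm v)))) u := fun m =>
      contMDiffAt_iff_contDiffAt.1 (ContMDiffAt.comp (g := fun p => S.e (S.T^[m] p)) u
      (h.contMDiffAt_e_iterate hsrc m) hcu)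
    set Dm : ℕ → EB →L[ℝ] V := fun m => (S.orbitDeriv E (j (φ.symm u)) m).comp L
    have hrate0 : rateSpace Dm S.lam = ⊥ := by
      rw [eq_bot_iff]; rintro w ⟨c, hc⟩; exact hrate (φ.symm u) w ⟨c, hc⟩
    have F : S.ShadowFamily (fun v => S.T^[m₀] (j (φ.symm v))) (fun v => S.T^[m₀] (a v)) u
        (fun m => Dm (m + m₀)) S.δ₂ := by
      refine ⟨S.δ₂_pos, le_rfl, fun m => ?_, fun m => ?_, ?_, ?_, fun m => ?_⟩
      · exact (hjet.shift m₀).cont m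
      · have := (hsm (m + m₀)).hasStrictFDerivAt (by simp)
        rw [(hjet.deriv (m + m₀)).fderiv] at this; simpa only [iterate_add_apply] using this
      · exact haK.mono fun v h => ⟨S.mem_it h.1 _,
          leafPiece_mono S.lam_pos.le (hm₀ m₀ le_rfl) (leafPiece_shift h.2 m₀)⟩
      · rw [eq_bot_iff, ← hrate0]; exact fun w hw => rateSpace_of_shift S.lam_pos hw
      · rw [hdim, h.finrank_qc _ (S.mem_it (S.mem_it hau _) _)]
    have hsx : ∀ m, S.T^[m] (x t₀) ∈ S.T.source := fun m =>
      S.near_source _ (S.mem_it (hxK t₀) m) _ (S.near_self _)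
    have hxsm : ∀ m, ContDiffAt ℝ 1 (fun t => S.e (S.T^[m] (x t))) t₀ := fun m =>
      contMDiffAt_iff_contDiffAt.1 ((h.contMDiffAt_e_iterate hsx m).comp t₀ (hx t₀))
    have hxd : ∀ m, HasStrictDerivAt (fun t => S.e (S.T^[m] (S.T^[m₀] (x t))))
        (deriv (fun t => S.e (S.T^[m + m₀] (x t))) t₀) t₀ := fun m => by
      simpa only [iterate_add_apply] using (hxsm (m + m₀)).hasStrictDerivAt (by simp)
    have hxc : ContinuousAt (fun t => S.T^[m₀] (x t)) t₀ :=
      ContinuousAt.comp (continuousAt_iterate (hxK t₀) m₀) hx.continuous.continuousAt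
    have hxK' : ∀ t, S.T^[m₀] (x t) ∈ S.K := fun t => S.mem_it (hxK t) _
    have hx0 : S.T^[m₀] (x t₀) = S.T^[m₀] (a u) := by rw [haux]
    obtain ⟨U, hU0, hUa, Λ, hΛ⟩ := F.exists_lipschitz_section hxK' hx0 hxc hxd
    obtain ⟨f', hf'⟩ := F.exists_hasStrictDerivAt hxK' hx0 hxc hxd hU0 hUa hΛ
    have hUc : Tendsto U (𝓝 t₀) (𝓝 u) := hU0 ▸ hf'.hasDerivAt.continuousAt.tendsto
    have hUx : ∀ᶠ t in 𝓝 t₀, j (φ.symm (U t)) ∈ S.piece C (x t) := by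
      filter_upwards [hUa, hUc.eventually haK] with t h1 h2
      rw [← iterate_injOn m₀ h2.1 (hxK t) h1]; exact h2.2
    have hUβ : ∀ᶠ t in 𝓝 t₀, φ.symm (U t) = β t := hUx.mono fun t ht => huniq t _ ⟨C, ht⟩
    refine ⟨?_, ⟨f', ?_⟩, C, ?_⟩
    · exact (hub ▸ hφc.tendsto.comp hUc : Tendsto _ _ (𝓝 b₀)).congr' hUβ
    · refine hf'.congr_of_eventuallyEq ?_
      filter_upwards [hUβ, hUc.eventually (extChartAt_target_mem_nhds b₀)] with t h1 h2
      rw [← h1, φ.right_inv h2]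
    · filter_upwards [hUx, hUβ] with t h1 h2 using h2 ▸ h1
  exact ⟨contMDiff_one_of_hasStrictDerivAt
    (continuous_iff_continuousAt.2 fun t => (main t).1) fun t => (main t).2.1, fun t => (main t).2.2⟩

end HypSys

/-! ### Coordinates near a compact set -/

/-- Finitely many charts covering a neighbourhood of the compact set `K`.  The functions `f c` are
used to extend the charts to `M`, the functions `b c` to glue local constructions. -/
structure ChartCover (E : Type*) [NormedAddCommGroup E] [NormedSpace ℝ E]
    [FiniteDimensional ℝ E] {M : Type*} [TopologicalSpace M] [ChartedSpace E M] (K : Set M) where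
  s : Finset M
  f : ∀ c : s, SmoothBumpFunction ℐ E (c : M)
  b : ∀ c : s, SmoothBumpFunction ℐ E (c : M)
  tsupport_subset : ∀ c, tsupport (b c) ⊆ interior {p | f c p = 1}
  exists_pos : ∀ x ∈ K, ∃ c, 0 < b c x

namespace ChartCover

variable [TopologicalSpace M] [ChartedSpace E M] {K : Set M}

/-- The space in which the manifold is placed by the charts of the cover. -/
abbrev X (A : ChartCover E K) := A.s → E

lemma exists_of_isCompact [T2Space M] (hK : IsCompact K) : Nonempty (ChartCover E K) := by
  have hb : ∀ x : M, ∃ f b : SmoothBumpFunction ℐ E x, tsupport b ⊆ interior {p | f p = 1} := by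
    intro x; obtain ⟨f⟩ := (inferInstance : Nonempty (SmoothBumpFunction ℐ E x))
    have h1 : interior {p | f p = 1} ∈ 𝓝 x := interior_mem_nhds.2 f.eventuallyEq_one
    obtain ⟨b, -, hb⟩ := (SmoothBumpFunction.nhds_basis_tsupport (I := ℐ E) x).mem_iff.1 h1
    exact ⟨f, b, hb⟩
  choose f b hfb using hb
  obtain ⟨s, -, hs⟩ := hK.elim_nhds_subcover (fun x => Function.support (b x))
    (fun x _ => (b x).support_mem_nhds)
  refine ⟨⟨s, fun c => f c, fun c => b c, fun c => hfb c, fun x hx => ?_⟩⟩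
  obtain ⟨c, hc, hxc⟩ := mem_iUnion₂.1 (hs hx)
  exact ⟨⟨c, hc⟩, lt_of_le_of_ne (b c).nonneg (Ne.symm hxc)⟩

variable (A : ChartCover E K)

/-- The chart at the centre `c`. -/
abbrev χ (c : A.s) : PartialEquiv M E := Ξ E (c : M)

/-- The set on which the chart at `c` is not modified by the cut-off. -/
def U (c : A.s) : Set M := interior {p | A.f c p = 1}

/-- The charts, cut off and put together to a map into a vector space. -/
def e (p : M) : A.X := fun c => A.f c p • A.χ c p

def total (p : M) : ℝ := ∑ c, A.b c p

/-- The weights used to glue local constructions. -/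
def h (c : A.s) (p : M) : ℝ := A.b c p / A.total p

/-- The inverse of the derivative of a chart. -/
def inv (c : A.s) (p : M) : E →L[ℝ] E := mfderiv% (A.χ c).symm (A.χ c p)

/-- The derivative of `e`. -/
def I (p : M) : E →L[ℝ] A.X := mfderiv ℐ E ℐ A.X A.e p

/-- A left inverse of the derivative of `e`. -/
def Lam (p : M) : A.X →L[ℝ] E :=
  ∑ c, A.h c p • (A.inv c p).comp (ContinuousLinearMap.proj c)

lemma isOpen_U (c : A.s) : IsOpen (A.U c) := isOpen_interior

lemma U_subset (c : A.s) : A.U c ⊆ (A.χ c).source := fun p hp => by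
  rw [extChartAt_source]; have : A.f c p = 1 := interior_subset (s := {p | A.f c p = 1}) hp
  exact (A.f c).support_subset_source (by rw [Function.mem_support, this]; exact one_ne_zero)

lemma e_apply {c : A.s} {p : M} (hp : p ∈ A.U c) : A.e p c = A.χ c p := by
  have : A.f c p = 1 := interior_subset (s := {p | A.f c p = 1}) hp; simp [e, this]

lemma total_pos {x : M} (hx : x ∈ K) : 0 < A.total x := by
  obtain ⟨c, hc⟩ := A.exists_pos x hx
  exact hc.trans_le (Finset.single_le_sum (f := fun c => A.b c x) (fun c _ => (A.b c).nonneg)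
    (Finset.mem_univ c))

lemma total_nonneg (x : M) : 0 ≤ A.total x := Finset.sum_nonneg fun c _ => (A.b c).nonneg

lemma h_nonneg (c : A.s) (p : M) : 0 ≤ A.h c p := div_nonneg (A.b c).nonneg (A.total_nonneg p)

lemma sum_h {p : M} (hp : 0 < A.total p) : ∑ c, A.h c p = 1 := by
  simp only [h, ← Finset.sum_div]; exact div_self hp.ne'

lemma h_eventually_eq_zero {c : A.s} {p : M} (hp : p ∉ A.U c) : ∀ᶠ q in 𝓝 p, A.h c q = 0 := by
  have h1 : p ∉ tsupport (A.b c) := fun h => hp (A.tsupport_subset c h)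
  filter_upwards [notMem_tsupport_iff_eventuallyEq.1 h1] with q hq
  simp [h, hq]

lemma h_eq_zero {c : A.s} {p : M} (hp : p ∉ A.U c) : A.h c p = 0 :=
  (A.h_eventually_eq_zero hp).self_of_nhds

variable [T2Space M] [IsManifold ℐ E ∞ M]

lemma contMDiff_e : ContMDiff ℐ E ℐ A.X ∞ A.e := by
  refine contMDiff_pi_space.2 fun c => ?_
  have := (A.f c).contMDiff_smul (G := E) (g := A.χ c) (by exact contMDiffOn_extChartAt); exact this

lemma continuous_total : Continuous A.total := continuous_finsetSum _ fun c _ => (A.b c).continuous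

lemma eventually_total_pos {x : M} (hx : x ∈ K) : ∀ᶠ p in 𝓝 x, 0 < A.total p :=
  A.continuous_total.continuousAt.eventually_const_lt (A.total_pos hx)

lemma contMDiffAt_h (c : A.s) {p : M} (hp : 0 < A.total p) :
    CMDiffAt ∞ (A.h c) p := by
  have h1 : CMDiff ∞ A.total := by
    have := contMDiff_finsetSum (t := Finset.univ) (f := fun c => (A.b c : M → ℝ))
      (fun c _ => (A.b c).contMDiff)
    refine this.congr fun p => ?_; simp [total]
  exact (A.b c).contMDiffAt.div₀ h1.contMDiffAt hp.ne'

/-- Derivatives of `e` and of the charts. -/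
lemma I_apply {c : A.s} {p : M} (hp : p ∈ A.U c) (w : E) :
    A.I p w c = (mfderiv% (A.χ c) p w : E) := by
  have h1 := (A.contMDiff_e.mdifferentiable (by simp) p).hasMFDerivAt
  have h2 : HasMFDerivAt ℐ A.X ℐ E (fun v : A.X => v c) (A.e p)
      (ContinuousLinearMap.proj c : A.X →L[ℝ] E) :=
    hasMFDerivAt_iff_hasFDerivAt.2 (hasFDerivAt_apply c (A.e p))
  have h3 := (h2.comp p h1).congr_of_eventuallyEq (f₁ := A.χ c) (by
    filter_upwards [(A.isOpen_U c).mem_nhds hp] with q hq using (A.e_apply hq).symm)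
  exact (congrArg (fun L : E →L[ℝ] E => L w) h3.mfderiv).symm

lemma inv_mfderiv {c : A.s} {p : M} (hp : p ∈ A.U c) (w : E) :
    A.inv c p (mfderiv% (A.χ c) p w : E) = w := by
  haveI : IsManifold ℐ E 1 M := IsManifold.of_le (n := ∞) (by norm_cast)
  have h1 := mfderivWithin_extChartAt_symm_comp_mfderiv_extChartAt' (I := ℐ E) (A.U_subset c hp)
  rw [ModelWithCorners.range_eq_univ, mfderivWithin_univ] at h1
  exact congrArg (fun L : E →L[ℝ] E => L w) h1

lemma mfderiv_inv {c : A.s} {p : M} (hp : p ∈ A.U c) (w : E) :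
    (mfderiv% (A.χ c) p (A.inv c p w : E) : E) = w := by
  haveI : IsManifold ℐ E 1 M := IsManifold.of_le (n := ∞) (by norm_cast)
  have h1 := mfderiv_extChartAt_comp_mfderivWithin_extChartAt_symm' (I := ℐ E) (A.U_subset c hp)
  rw [ModelWithCorners.range_eq_univ, mfderivWithin_univ] at h1
  exact congrArg (fun L : E →L[ℝ] E => L w) h1

lemma inv_I {c : A.s} {p : M} (hp : p ∈ A.U c) (w : E) : A.inv c p (A.I p w c) = w := by
  rw [A.I_apply hp, A.inv_mfderiv hp]

/-- Gluing a function of tangent vectors. -/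
lemma sum_h_inv_I {Y : Type*} [AddCommGroup Y] [Module ℝ Y] {p : M} (hp : 0 < A.total p) (Ψ : E → Y)
    (w : E) : ∑ c, A.h c p • Ψ (A.inv c p (A.I p w c)) = Ψ w := by
  have : ∀ c, A.h c p • Ψ (A.inv c p (A.I p w c)) = A.h c p • Ψ w := by
    intro c; by_cases hc : p ∈ A.U c
    · rw [A.inv_I hc]
    · rw [A.h_eq_zero hc, zero_smul, zero_smul]
  rw [Finset.sum_congr rfl fun c _ => this c, ← Finset.sum_smul, A.sum_h hp, one_smul]

lemma Lam_apply (p : M) (v : A.X) : A.Lam p v = ∑ c, A.h c p • A.inv c p (v c) := by simp [Lam]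

lemma Lam_I {p : M} (hp : 0 < A.total p) (w : E) : A.Lam p (A.I p w) = w := by
  rw [A.Lam_apply]; exact A.sum_h_inv_I hp id w

lemma I_injective {p : M} (hp : 0 < A.total p) : Injective (A.I p) :=
  LeftInverse.injective (A.Lam_I hp)

lemma continuousOn_inv (c : A.s) : ContinuousOn
    (fun q : M × A.X => (⟨q.1, A.inv c q.1 (q.2 c)⟩ : TangentBundle ℐ E M))
    (A.U c ×ˢ univ) := by
  have h1 : ContMDiffOn ℐ E ℐ E ∞ (A.χ c).symm (A.χ c).target := contMDiffOn_extChartAt_symm _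
  have ho : IsOpen (A.χ c).target := isOpen_extChartAt_target _
  have h2 := (h1.contMDiffOn_tangentMapWithin (m := 0) (by simp) ho.uniqueMDiffOn).continuousOn
  have h3 : ContinuousOn (fun q : M × A.X =>
      (⟨A.χ c q.1, q.2 c⟩ : TangentBundle ℐ E E)) (A.U c ×ˢ univ) := by
    have h4 : ContinuousOn (fun q : M × A.X => (A.χ c q.1, q.2 c)) (A.U c ×ˢ univ) := by
      refine ContinuousOn.prodMk ?_ (by fun_prop)
      exact ((continuousOn_extChartAt (I := ℐ E) (c : M)).mono (A.U_subset c)).comp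
        continuousOn_fst fun q hq => hq.1
    exact (tangentBundleModelSpaceHomeomorph ℐ E).symm.continuous.comp_continuousOn h4
  refine (h2.comp h3 fun q hq => (A.χ c).map_source (A.U_subset c hq.1)).congr fun q hq => ?_
  have h5 := (A.χ c).map_source (A.U_subset c hq.1); have h6 := (A.χ c).left_inv (A.U_subset c hq.1)
  simp only [comp_apply, tangentMapWithin, mfderivWithin_of_isOpen ho h5]
  have : ∀ (a b : M) (w : E), a = b → (⟨a, w⟩ : TangentBundle ℐ E M) = ⟨b, w⟩ := by
    rintro a _ w rfl; rfl
  exact this _ _ _ h6.symm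

lemma continuousOn_glue {Y : Type*} [NormedAddCommGroup Y] [NormedSpace ℝ Y]
    {Ψ : TangentBundle ℐ E M → Y} (hΨ : ContinuousOn Ψ {p | p.1 ∈ K}) :
    ContinuousOn (fun q : M × A.X =>
      ∑ c, A.h c q.1 • Ψ ⟨q.1, A.inv c q.1 (q.2 c)⟩) (K ×ˢ univ) := by
  refine continuousOn_finsetSum _ fun c _ => ?_; rintro ⟨x, v⟩ ⟨hx, -⟩; by_cases hc : x ∈ A.U c
  · refine ContinuousWithinAt.smul ?_ ?_
    · exact ((A.contMDiffAt_h c (A.total_pos hx)).continuousAt.comp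
        (f := Prod.fst) continuousAt_fst).continuousWithinAt
    · have h1 := (A.continuousOn_inv c) (x, v) ⟨hc, mem_univ _⟩
      have h2 : (A.U c ×ˢ univ : Set (M × A.X)) ∈ 𝓝 (x, v) :=
        prod_mem_nhds ((A.isOpen_U c).mem_nhds hc) univ_mem
      have h3 := (h1.continuousAt h2).continuousWithinAt (s := K ×ˢ univ)
      exact (hΨ ⟨x, A.inv c x (v c)⟩ hx).comp (f := fun q : M × A.X =>
        (⟨q.1, A.inv c q.1 (q.2 c)⟩ : TangentBundle ℐ E M)) h3 fun q hq => hq.1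
  · have h1 : ∀ᶠ q : M × A.X in 𝓝 (x, v), A.h c q.1 = 0 :=
      continuousAt_fst.eventually (A.h_eventually_eq_zero hc)
    have h2 : (fun q : M × A.X => A.h c q.1 • Ψ ⟨q.1, A.inv c q.1 (q.2 c)⟩) =ᶠ[𝓝 (x, v)]
        fun _ => 0 := by
      filter_upwards [h1] with q hq
      rw [hq, zero_smul]
    exact (continuousAt_const.congr h2.symm).continuousWithinAt

end ChartCover

/-! ### The Riemannian distance in charts -/

section Riemannian

open MeasureTheory ENNReal NNReal

attribute [local instance] normedAddCommGroupTangentSpaceVectorSpace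
attribute [local instance] normedSpaceTangentSpaceVectorSpace

variable [EMetricSpace M] [ChartedSpace E M] [IsManifold ℐ E 1 M]
  [Bundle.RiemannianBundle (fun x : M => TangentSpace ℐ E x)]
  [IsContinuousRiemannianBundle E (fun x : M => TangentSpace ℐ E x)]
  [IsRiemannianManifold ℐ E M]

lemma enorm_le_of_norm_le {X Y : Type*} [SeminormedAddCommGroup X] [SeminormedAddCommGroup Y]
    {C : ℝ≥0} {a : X} {b : Y} (h : ‖a‖ ≤ C * ‖b‖) : ‖a‖ₑ ≤ C * ‖b‖ₑ := by
  simp only [enorm]; have : ‖a‖₊ ≤ C * ‖b‖₊ := h; exact_mod_cast this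

lemma eventually_enorm_mfderiv_extChartAt_le (x : M) : ∃ C : ℝ≥0, 0 < C ∧ ∀ᶠ y in 𝓝 x,
    ∀ v : TangentSpace ℐ E y, ‖(mfderiv% (Ξ E x) y v : E)‖ₑ ≤ C * ‖v‖ₑ := by
  obtain ⟨C, hC0, hC⟩ := eventually_norm_mfderiv_extChartAt_lt ℐ E x
  refine ⟨⟨C, hC0.le⟩, hC0, hC.mono fun y hy v => ?_⟩
  have h1 : ‖(mfderiv% (Ξ E x) y v : E)‖ ≤ C * ‖v‖ :=
    @le_of_opNorm_le _ _ _ _ _ _ _ _ _ _ _ _ _ _ hy.le v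
  exact enorm_le_of_norm_le (C := ⟨C, hC0.le⟩) h1

lemma eventually_enorm_mfderiv_extChartAt_symm_le (x : M) : ∃ C : ℝ≥0, 0 < C ∧
    ∀ᶠ y in 𝓝 (Ξ E x x), ∀ v : E,
      ‖mfderiv% (Ξ E x).symm y v‖ₑ ≤ C * ‖v‖ₑ := by
  obtain ⟨C, hC0, hC⟩ := eventually_norm_mfderivWithin_symm_extChartAt_lt ℐ E x
  simp only [ModelWithCorners.range_eq_univ, mfderivWithin_univ, nhdsWithin_univ] at hC
  refine ⟨⟨C, hC0.le⟩, hC0, hC.mono fun y hy v => ?_⟩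
  have h1 : ‖mfderiv% (Ξ E x).symm y v‖ ≤ C * ‖v‖ :=
    @le_of_opNorm_le _ _ _ _ _ _ _ _ _ _ _ _ _ _ hy.le v
  exact enorm_le_of_norm_le (C := ⟨C, hC0.le⟩) h1

lemma enorm_sub_le_pathELength {φ : M → E} {γ : ℝ → M} {C : ℝ≥0} {N : Set M} (hN : IsOpen N)
    (hφ : CMDiff[N] 1 φ)
    (hC : ∀ y ∈ N, ∀ v : TangentSpace ℐ E y, ‖(mfderiv% φ y v : E)‖ₑ ≤ C * ‖v‖ₑ)
    (hγ : CMDiff 1 γ) (hγN : ∀ t ∈ Icc (0 : ℝ) 1, γ t ∈ N) :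
    ‖φ (γ 1) - φ (γ 0)‖ₑ ≤ C * pathELength ℐ E γ 0 1 := by
  have hγ' : ContMDiffOn ℐ ℝ ℐ E 1 (φ ∘ γ) (Icc 0 1) := hφ.comp hγ.contMDiffOn hγN
  calc ‖φ (γ 1) - φ (γ 0)‖ₑ
    _ ≤ ∫⁻ t' in Icc (0 : ℝ) 1, ‖derivWithin (φ ∘ γ) (Icc 0 1) t'‖ₑ := by
      apply enorm_sub_le_lintegral_derivWithin_Icc_of_contDiffOn_Icc _ zero_le_one
      rwa [← contMDiffOn_iff_contDiffOn]
    _ = ∫⁻ t' in Icc (0 : ℝ) 1, ‖mfderivWithin ℐ ℝ ℐ E (φ ∘ γ) (Icc 0 1) t' (1 : ℝ)‖ₑ := by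
      simp_rw [← fderivWithin_derivWithin, mfderivWithin_eq_fderivWithin]
      rfl
    _ ≤ ∫⁻ t' in Icc (0 : ℝ) 1, C * ‖mfderivWithin ℐ ℝ ℐ E γ (Icc 0 1) t' (1 : ℝ)‖ₑ := by
      apply setLIntegral_mono' measurableSet_Icc (fun t' ht' ↦ ?_)
      have : mfderivWithin ℐ ℝ ℐ E (φ ∘ γ) (Icc 0 1) t' = (mfderiv% φ (γ t')) ∘L
            (mfderivWithin ℐ ℝ ℐ E γ (Icc 0 1) t') := by
        apply mfderiv_comp_mfderivWithin
        · exact (hφ.contMDiffAt (hN.mem_nhds (hγN t' ht'))).mdifferentiableAt (by simp)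
        · exact (hγ.mdifferentiable one_ne_zero).mdifferentiableOn _ ht'
        · rw [uniqueMDiffWithinAt_iff_uniqueDiffWithinAt]; exact uniqueDiffOn_Icc zero_lt_one _ ht'
      have : mfderivWithin ℐ ℝ ℐ E (φ ∘ γ) (Icc 0 1) t' (1 : ℝ) = (mfderiv% φ (γ t'))
            (mfderivWithin ℐ ℝ ℐ E γ (Icc 0 1) t' (1 : ℝ)) := DFunLike.congr_fun this _
      rw [this]; exact hC _ (hγN t' ht') _
    _ = C * pathELength ℐ E γ 0 1 := by
      rw [lintegral_const_mul' _ _ ENNReal.coe_ne_top, pathELength_eq_lintegral_mfderivWithin_Icc]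
      rfl

/-- The charts are Lipschitz for the Riemannian distance. -/
lemma exists_edist_extChartAt_le (x : M) : ∃ C : ℝ≥0, ∃ N ∈ 𝓝 x, ∀ p ∈ N, ∀ p' ∈ N,
    edist (Ξ E x p) (Ξ E x p') ≤ C * edist p p' := by
  obtain ⟨C, hC0, hC⟩ := eventually_enorm_mfderiv_extChartAt_le (E := E) x
  have h1 := hC.and (chart_source_mem_nhds E x)
  obtain ⟨N, hNsub, hNo, hxN⟩ := eventually_nhds_iff.1 h1
  obtain ⟨ε, hε, hball⟩ := EMetric.mem_nhds_iff.1 (hNo.mem_nhds hxN)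
  refine ⟨C, eball x (ε / 3), eball_mem_nhds _ (ENNReal.div_pos hε.ne' (by simp)),
    fun p hp p' hp' => ?_⟩
  have hpp : edist p p' < 2 * (ε / 3) := by
    refine (edist_triangle_right p p' x).trans_lt ?_; rw [two_mul]; exact ENNReal.add_lt_add hp hp'
  have key : ∀ L, edist p p' < L → L ≤ 2 * (ε / 3) →
      edist (Ξ E x p) (Ξ E x p') ≤ C * L := by
    intro L hL hL2; have hd := hL; rw [IsRiemannianManifold.out (I := ℐ E) p p'] at hd
    obtain ⟨γ, h0, h1, hγ, hlen, -⟩ := exists_lt_locally_constant_of_riemannianEDist_lt hd zero_lt_one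
    have hγN : ∀ t ∈ Icc (0 : ℝ) 1, γ t ∈ N := by
      intro t ht; apply hball
      have h2 : edist p (γ t) ≤ pathELength ℐ E γ 0 1 := by
        rw [IsRiemannianManifold.out (I := ℐ E) p (γ t)]
        exact (riemannianEDist_le_pathELength hγ.contMDiffOn h0 rfl ht.1).trans
          (pathELength_mono le_rfl ht.2)
      rw [Metric.mem_eball]
      calc edist (γ t) x ≤ edist p (γ t) + edist p x := edist_triangle_left _ _ _
        _ < 2 * (ε / 3) + ε / 3 := ENNReal.add_lt_add (h2.trans_lt (hlen.trans_le hL2)) hp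
        _ = 3 * (ε / 3) := by ring
        _ = ε := ENNReal.mul_div_cancel (by simp) (by simp)
    have := enorm_sub_le_pathELength (φ := Ξ E x) (γ := γ) (C := C) hNo
      (contMDiffOn_extChartAt.mono fun y hy => (hNsub y hy).2)
      (fun y hy => (hNsub y hy).1) hγ hγN
    rw [h0, h1, ← edist_eq_enorm_sub, edist_comm] at this; exact this.trans (by gcongr)
  by_contra! hcon
  have h3 : edist p p' < edist (Ξ E x p) (Ξ E x p') / C := by
    rw [ENNReal.lt_div_iff_mul_lt (by simp [hC0.ne']) (by simp), mul_comm]; exact hcon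
  obtain ⟨L, hL1, hL2⟩ := exists_between (lt_min h3 hpp)
  have h4 := key L hL1 (hL2.le.trans (min_le_right _ _)); have h5 := hL2.trans_le (min_le_left _ _)
  rw [ENNReal.lt_div_iff_mul_lt (by simp [hC0.ne']) (by simp), mul_comm] at h5
  exact absurd h5 (not_lt.2 h4)

/-- The inverses of the charts are Lipschitz for the Riemannian distance. -/
lemma exists_edist_le_extChartAt (x : M) : ∃ C : ℝ≥0, ∃ N ∈ 𝓝 x, ∀ p ∈ N, ∀ p' ∈ N,
    edist p p' ≤ C * edist (Ξ E x p) (Ξ E x p') := by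
  set φ := Ξ E x; obtain ⟨C, hC0, hC⟩ := eventually_enorm_mfderiv_extChartAt_symm_le (E := E) x
  obtain ⟨r, hr, hball⟩ := Metric.mem_nhds_iff.1 (inter_mem (extChartAt_target_mem_nhds (I := ℐ E) x) hC)
  refine ⟨C, φ.source ∩ φ ⁻¹' ball (φ x) r, inter_mem (extChartAt_source_mem_nhds x)
    ((continuousAt_extChartAt x).preimage_mem_nhds (ball_mem_nhds _ hr)), ?_⟩
  rintro p ⟨hp, hpb⟩ p' ⟨hp', hpb'⟩; let η := ContinuousAffineMap.lineMap (R := ℝ) (φ p) (φ p')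
  set γ := φ.symm ∘ η
  have hη : Icc 0 1 ⊆ ⇑η ⁻¹' (φ.target ∩ {y | ∀ v : E, ‖mfderiv% φ.symm y v‖ₑ ≤ C * ‖v‖ₑ}) := by
    simp only [← image_subset_iff, ContinuousAffineMap.coe_lineMap_eq,
     ← segment_eq_image_lineMap, η]
    exact Subset.trans ((convex_ball _ _).segment_subset hpb hpb') hball
  simp only [preimage_inter, subset_inter_iff] at hη
  have η_smooth : ContMDiffOn ℐ ℝ ℐ E 1 η (Icc 0 1) := by
    apply ContMDiff.contMDiffOn; rw [contMDiff_iff_contDiff]; exact ContinuousAffineMap.contDiff _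
  have : edist p p' ≤ pathELength ℐ E γ 0 1 := by
    rw [IsRiemannianManifold.out (I := ℐ E) p p']
    apply riemannianEDist_le_pathELength _ _ _ zero_le_one
    · exact (contMDiffOn_extChartAt_symm x).comp η_smooth hη.1
    · simp [γ, η, ContinuousAffineMap.coe_lineMap_eq, φ.left_inv hp]
    · simp [γ, η, ContinuousAffineMap.coe_lineMap_eq, φ.left_inv hp']
  apply this.trans
  rw [← lintegral_fderiv_lineMap_eq_edist, pathELength_eq_lintegral_mfderivWithin_Icc,
    ← lintegral_const_mul' _ _ ENNReal.coe_ne_top]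
  apply setLIntegral_mono' measurableSet_Icc (fun t ht ↦ ?_)
  have hd : MDiffAt φ.symm (η t) :=
    ((contMDiffOn_extChartAt_symm (n := 1) x).contMDiffAt
      ((isOpen_extChartAt_target x).mem_nhds (hη.1 ht))).mdifferentiableAt (by simp)
  have : mfderivWithin ℐ ℝ ℐ E γ (Icc 0 1) t =
      (mfderiv% φ.symm (η t)) ∘L (mfderivWithin ℐ ℝ ℐ E η (Icc 0 1) t) := by
    apply mfderiv_comp_mfderivWithin
    · exact hd
    · exact η_smooth.mdifferentiableOn one_ne_zero t ht
    · rw [uniqueMDiffWithinAt_iff_uniqueDiffWithinAt]; exact uniqueDiffOn_Icc zero_lt_one t ht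
  have : mfderivWithin ℐ ℝ ℐ E γ (Icc 0 1) t (1 : ℝ) = (mfderiv% φ.symm (η t))
        (mfderivWithin ℐ ℝ ℐ E η (Icc 0 1) t (1 : ℝ)) := DFunLike.congr_fun this _
  refine (le_of_eq (congrArg (fun w : TangentSpace ℐ E (γ t) => ‖w‖ₑ) this)).trans ?_
  refine (hη.2 ht _).trans ?_; gcongr
  · simp only [mfderivWithin_eq_fderivWithin]; exact le_of_eq rfl

end Riemannian

/-! ### Estimates uniform along a compact set -/

section Uniform

/-- Local estimates along a compact set are uniform. -/
lemma eventually_uniform [EMetricSpace M] {K : Set M} (hK : IsCompact K) {Q : M → ℝ → Set M → Prop}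
    (mono : ∀ x C C' s s', C ≤ C' → s' ⊆ s → Q x C s → Q x C' s')
    (hloc : ∀ x₀ ∈ K, ∃ C, ∃ N ∈ 𝓝 x₀, ∀ x ∈ N, x ∈ K → Q x C N) :
    ∀ᶠ C in atTop, ∀ᶠ r in 𝓝[>] (0 : ℝ), ∀ x ∈ K, Q x C (eball x (ofReal r)) := by
  suffices h : ∃ C, ∃ r > 0, ∀ x ∈ K, x ∈ K → Q x C (eball x (ofReal r)) by
    obtain ⟨C, r, hr, h⟩ := h; filter_upwards [eventually_ge_atTop C] with C' hC'
    filter_upwards [Ioc_mem_nhdsGT hr] with r' hr' x hx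
    exact mono _ _ _ _ _ hC' (Metric.eball_subset_eball (ofReal_le_ofReal hr'.2)) (h x hx hx)
  refine hK.induction_on (p := fun s => ∃ C, ∃ r > 0, ∀ x ∈ s, x ∈ K →
    Q x C (eball x (ofReal r))) ⟨0, 1, one_pos, fun x hx => hx.elim⟩ ?_ ?_ ?_
  · rintro s t hst ⟨C, r, hr, h⟩; exact ⟨C, r, hr, fun x hx => h x (hst hx)⟩
  · rintro s t ⟨C, r, hr, h⟩ ⟨C', r', hr', h'⟩
    refine ⟨max C C', min r r', lt_min hr hr', fun x hx hxK => ?_⟩; rcases hx with hx | hx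
    · exact mono _ _ _ _ _ (le_max_left _ _)
        (Metric.eball_subset_eball (ofReal_le_ofReal (min_le_left _ _))) (h x hx hxK)
    · exact mono _ _ _ _ _ (le_max_right _ _)
        (Metric.eball_subset_eball (ofReal_le_ofReal (min_le_right _ _))) (h' x hx hxK)
  · intro x₀ hx₀; obtain ⟨C, N, hN, h⟩ := hloc x₀ hx₀
    obtain ⟨ε, hε, hb⟩ := EMetric.mem_nhds_iff.1 hN
    have h0 : min ε 1 ≠ 0 := (lt_min hε one_pos).ne'
    have h1 : min ε 1 ≠ ⊤ := ((min_le_right _ _).trans_lt ENNReal.one_lt_top).ne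
    have hr : 0 < (min ε 1).toReal / 2 := half_pos (ENNReal.toReal_pos h0 h1)
    have hadd : ofReal ((min ε 1).toReal / 2) + ofReal ((min ε 1).toReal / 2) ≤ ε := by
      rw [← ENNReal.ofReal_add hr.le hr.le, add_halves, ofReal_toReal h1]; exact min_le_left _ _
    refine ⟨eball x₀ (ofReal ((min ε 1).toReal / 2)),
      mem_nhdsWithin_of_mem_nhds (eball_mem_nhds _ (ofReal_pos.2 hr)), C, _, hr,
      fun x hx hxK => ?_⟩
    have hsub : eball x (ofReal ((min ε 1).toReal / 2)) ⊆ N := by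
      intro p hp; apply hb; rw [Metric.mem_eball] at hp hx ⊢
      exact ((edist_triangle p x x₀).trans_lt (ENNReal.add_lt_add hp hx)).trans_le hadd
    exact mono _ _ _ _ _ le_rfl hsub (h x (hsub (Metric.mem_eball_self (ofReal_pos.2 hr))) hxK)

/-- How far a `C²` map is from commuting with parallel transport of a difference vector. -/
lemma exists_four_point {G : E → W} {z : E} (hG : ContDiffAt ℝ 2 G z) :
    ∃ C ≥ 0, ∃ N ∈ 𝓝 z, ∀ a ∈ N, ∀ a' ∈ N, ∀ b ∈ N, ∀ b' ∈ N,
      ‖((G a' - G a) - (G b' - G b)) - fderiv ℝ G b ((a' - a) - (b' - b))‖ ≤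
        C * ‖b' - b‖ * ‖(a' - a) - (b' - b)‖ + C * (‖a - b‖ + ‖a' - b'‖) * ‖a' - a‖ := by
  obtain ⟨L, N, hN, hL⟩ := (hG.fderiv_right (m := 1) (by norm_num)).exists_lipschitzOnWith
  have hd : ∀ᶠ u in 𝓝 z, DifferentiableAt ℝ G u :=
    (hG.eventually (by simp)).mono fun u hu => hu.differentiableAt (by simp)
  obtain ⟨ρ, hρ, hb⟩ := Metric.mem_nhds_iff.1 (inter_mem hN hd)
  refine ⟨L, L.2, ball z ρ, ball_mem_nhds _ hρ, fun a ha a' ha' b hb₁ b' hb₁' => ?_⟩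
  set δ := (a' - a) - (b' - b) with hδ
  have hseg : ∀ {u v : E}, u ∈ ball z ρ → v ∈ ball z ρ → ∀ t ∈ Icc (0 : ℝ) 1,
      u + t • (v - u) ∈ ball z ρ := fun hu hv t ht =>
    (convex_ball z ρ).add_smul_sub_mem hu hv ht
  have hdl : ∀ (u v : E) (t : ℝ), HasDerivAt (fun t : ℝ => u + t • (v - u)) (v - u) t := by
    intro u v t; simpa using ((hasDerivAt_id t).smul_const (v - u)).const_add u
  let g : ℝ → W := fun t => G (a + t • (a' - a)) - G (b + t • (b' - b)) - t • fderiv ℝ G b δ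
  have hg : ∀ t ∈ Icc (0 : ℝ) 1, HasDerivWithinAt g (fderiv ℝ G (a + t • (a' - a)) (a' - a) -
      fderiv ℝ G (b + t • (b' - b)) (b' - b) - fderiv ℝ G b δ) (Icc 0 1) t := by
    intro t ht; have h1 := (hb (hseg ha ha' t ht)).2.hasFDerivAt.comp_hasDerivAt t (hdl a a' t)
    have h2 := (hb (hseg hb₁ hb₁' t ht)).2.hasFDerivAt.comp_hasDerivAt t (hdl b b' t)
    have h3 := (hasDerivAt_id t).smul_const (fderiv ℝ G b δ); rw [one_smul] at h3
    exact ((h1.sub h2).sub h3).hasDerivWithinAt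
  have hbd : ∀ t ∈ Ico (0 : ℝ) 1, ‖fderiv ℝ G (a + t • (a' - a)) (a' - a) -
      fderiv ℝ G (b + t • (b' - b)) (b' - b) - fderiv ℝ G b δ‖ ≤
      L * ‖b' - b‖ * ‖δ‖ + L * (‖a - b‖ + ‖a' - b'‖) * ‖a' - a‖ := by
    intro t ht; have ht' : t ∈ Icc (0 : ℝ) 1 := Ico_subset_Icc_self ht; set at' := a + t • (a' - a)
    set bt := b + t • (b' - b)
    have e1 : fderiv ℝ G at' (a' - a) - fderiv ℝ G bt (b' - b) - fderiv ℝ G b δ =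
        (fderiv ℝ G bt - fderiv ℝ G b) δ + (fderiv ℝ G at' - fderiv ℝ G bt) (a' - a) := by
      simp only [sub_apply, hδ, map_sub]; abel
    have e2 : ‖fderiv ℝ G bt - fderiv ℝ G b‖ ≤ L * ‖b' - b‖ := by
      refine (hL.norm_sub_le (hb (hseg hb₁ hb₁' t ht')).1 (hb hb₁).1).trans ?_; gcongr
      simp only [bt, add_sub_cancel_left, norm_smul, Real.norm_of_nonneg ht'.1]
      exact mul_le_of_le_one_left (norm_nonneg _) ht'.2
    have e3 : ‖fderiv ℝ G at' - fderiv ℝ G bt‖ ≤ L * (‖a - b‖ + ‖a' - b'‖) := by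
      refine (hL.norm_sub_le (hb (hseg ha ha' t ht')).1 (hb (hseg hb₁ hb₁' t ht')).1).trans ?_
      gcongr
      have : at' - bt = (1 - t) • (a - b) + t • (a' - b') := by
        simp only [at', bt, sub_smul, one_smul, smul_sub]; abel
      rw [this]
      refine (norm_add_le _ _).trans (add_le_add ?_ ?_) <;> rw [norm_smul, Real.norm_of_nonneg]
      · exact mul_le_of_le_one_left (norm_nonneg _) (by linarith [ht'.1])
      · linarith [ht'.2]
      · exact mul_le_of_le_one_left (norm_nonneg _) ht'.2
      · exact ht'.1
    rw [e1]; refine (norm_add_le _ _).trans (add_le_add ?_ ?_)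
    · exact (le_of_opNorm_le _ e2 _)
    · exact (le_of_opNorm_le _ e3 _)
  have := norm_image_sub_le_of_norm_deriv_le_segment_01' hg hbd
  have e : g 1 - g 0 = ((G a' - G a) - (G b' - G b)) - fderiv ℝ G b δ := by
    simp only [g, one_smul, zero_smul, add_zero, add_sub_cancel]; abel
  rwa [e] at this

end Uniform

/-- The derivative at `x` of a map into a vector space, as a map between the model spaces. -/
def der {E W M : Type*} [NormedAddCommGroup E] [NormedSpace ℝ E]
    [NormedAddCommGroup W] [NormedSpace ℝ W] [TopologicalSpace M] [ChartedSpace E M]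
    (G : M → W) (x : M) : E →L[ℝ] W := mfderiv% G x

namespace ChartCover

variable [TopologicalSpace M] [ChartedSpace E M] {K : Set M}
  (A : ChartCover E K)

lemma exists_mem_U {x : M} (hx : x ∈ K) : ∃ c, x ∈ A.U c := by
  obtain ⟨c, hc⟩ := A.exists_pos x hx
  by_contra! h
  have := A.h_eq_zero (h c); exact absurd this (div_pos hc (A.total_pos hx)).ne'

variable [T2Space M] [IsManifold ℐ E ∞ M]

lemma contDiffAt_comp_symm {n : WithTop ℕ∞} (hn : n ≤ ∞) {G : M → W} {x : M} {c : M}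
    (hx : x ∈ (Ξ E c).source) (hG : CMDiffAt n G x) :
    ContDiffAt ℝ n (G ∘ (Ξ E c).symm) (Ξ E c x) := by
  rw [← contMDiffAt_iff_contDiffAt]
  have h1 : CMDiffAt n (Ξ E c).symm (Ξ E c x) :=
    ((contMDiffOn_extChartAt_symm (n := ∞) c).of_le hn).contMDiffAt
      ((isOpen_extChartAt_target c).mem_nhds ((Ξ E c).map_source hx))
  refine ContMDiffAt.comp _ ?_ h1; rwa [(Ξ E c).left_inv hx]

lemma exists_lipschitz_chart {G : M → W} {x c : M} (hx : x ∈ (Ξ E c).source)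
    (hG : CMDiffAt 1 G x) : ∃ C ≥ 0, ∃ N ∈ 𝓝 x, ∀ p ∈ N, ∀ p' ∈ N, ‖G p' - G p‖ ≤
      C * ‖Ξ E c p' - Ξ E c p‖ := by
  obtain ⟨L, N, hN, hL⟩ := (contDiffAt_comp_symm (by norm_cast) hx hG).exists_lipschitzOnWith
  refine ⟨L, L.2, (Ξ E c).source ∩ (Ξ E c) ⁻¹' N,
    inter_mem ((isOpen_extChartAt_source c).mem_nhds hx)
      ((continuousAt_extChartAt' hx).preimage_mem_nhds hN), ?_⟩
  rintro p ⟨hp, hpN⟩ p' ⟨hp', hpN'⟩; have := hL.norm_sub_le hpN' hpN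
  simpa only [comp_apply, PartialEquiv.left_inv _ hp, PartialEquiv.left_inv _ hp'] using this

/-- A `C¹` map is Lipschitz in terms of `e`. -/
lemma exists_lipschitz {G : M → W} {x : M} (hx : x ∈ K) (hG : CMDiffAt 1 G x) :
    ∃ C ≥ 0, ∃ N ∈ 𝓝 x, ∀ p ∈ N, ∀ p' ∈ N, ‖G p' - G p‖ ≤ C * ‖A.e p' - A.e p‖ := by
  obtain ⟨c, hc⟩ := A.exists_mem_U hx
  obtain ⟨C, hC, N, hN, h⟩ := exists_lipschitz_chart (A.U_subset c hc) hG
  refine ⟨C, hC, N ∩ A.U c, inter_mem hN ((A.isOpen_U c).mem_nhds hc), ?_⟩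
  rintro p ⟨hp, hpc⟩ p' ⟨hp', hpc'⟩; refine (h p hp p' hp').trans (mul_le_mul_of_nonneg_left ?_ hC)
  have := norm_le_pi_norm (A.e p' - A.e p) c
  rwa [Pi.sub_apply, A.e_apply hpc, A.e_apply hpc'] at this

lemma mfderiv_comp_inv {G : M → W} {c : A.s} {p : M} (hp : p ∈ A.U c)
    (hG : MDiffAt G p) (w : E) :
    fderiv ℝ (G ∘ (A.χ c).symm) (A.χ c p) w = der G p (A.inv c p w) := by
  have h0 := (A.χ c).left_inv (A.U_subset c hp)
  have h1 : HasMFDerivAt ℐ E ℐ E (A.χ c).symm (A.χ c p) (A.inv c p) :=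
    (mdifferentiableAt_extChartAt_symm ((A.χ c).map_source (A.U_subset c hp))).hasMFDerivAt
  have hq : ∀ q, q = p → HasMFDerivAt ℐ E ℐ W G q (der (E := E) (W := W) G p) := by
    rintro _ rfl; exact hG.hasMFDerivAt
  have hG' := hq _ h0
  have h2 : HasFDerivAt (G ∘ (A.χ c).symm) ((der G p).comp (A.inv c p)) (A.χ c p) :=
    hasMFDerivAt_iff_hasFDerivAt.1 (hG'.comp _ h1)
  rw [h2.fderiv]
  rfl

lemma exists_four {G : M → W} {x₀ : M} (hx₀ : x₀ ∈ K) (hG : CMDiffAt 2 G x₀) :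
    ∃ C ≥ 0, ∃ N ∈ 𝓝 x₀, ∀ x ∈ N, ∀ p ∈ N, ∀ p' ∈ N, ∀ x' ∈ N,
      ‖((G p' - G p) - (G x' - G x)) - der G x (A.Lam x ((A.e p' - A.e p) - (A.e x' - A.e x)))‖ ≤
      C * ‖A.e x' - A.e x‖ * ‖(A.e p' - A.e p) - (A.e x' - A.e x)‖
        + C * (‖A.e p - A.e x‖ + ‖A.e p' - A.e x'‖) * ‖A.e p' - A.e p‖ := by
  have hloc : ∀ c : A.s, ∃ C ≥ 0, ∃ N ∈ 𝓝 x₀, ∀ x ∈ N, ∀ p ∈ N, ∀ p' ∈ N, ∀ x' ∈ N,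
      A.h c x ≠ 0 → ‖((G p' - G p) - (G x' - G x)) - der G x
        (A.inv c x (((A.e p' - A.e p) - (A.e x' - A.e x)) c))‖ ≤
      C * ‖A.e x' - A.e x‖ * ‖(A.e p' - A.e p) - (A.e x' - A.e x)‖
        + C * (‖A.e p - A.e x‖ + ‖A.e p' - A.e x'‖) * ‖A.e p' - A.e p‖ := by
    intro c; by_cases hc : x₀ ∈ A.U c; swap
    · exact ⟨0, le_rfl, _, A.h_eventually_eq_zero hc, fun x hx _ _ _ _ _ _ h => absurd hx h⟩
    have hs := A.U_subset c hc
    obtain ⟨C, hC, N, hN, h⟩ := exists_four_point (contDiffAt_comp_symm (by norm_cast) hs hG)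
    have hd : ∀ᶠ p in 𝓝 x₀, MDiffAt G p :=
      ((contMDiffAt_iff_contMDiffAt_nhds (by simp)).1 hG).mono fun p hp => hp.mdifferentiableAt (by simp)
    refine ⟨C, hC, A.U c ∩ (A.χ c) ⁻¹' N ∩ {p | MDiffAt G p},
      inter_mem (inter_mem ((A.isOpen_U c).mem_nhds hc)
        ((continuousAt_extChartAt' hs).preimage_mem_nhds hN)) hd, ?_⟩
    rintro x ⟨⟨hx, hxN⟩, hxd⟩ p ⟨⟨hp, hpN⟩, -⟩ p' ⟨⟨hp', hpN'⟩, -⟩ x' ⟨⟨hx', hxN'⟩, -⟩ -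
    have h1 := h _ hpN _ hpN' _ hxN _ hxN'; rw [A.mfderiv_comp_inv hx hxd] at h1
    simp only [comp_apply, PartialEquiv.left_inv _ (A.U_subset c hx),
      PartialEquiv.left_inv _ (A.U_subset c hp), PartialEquiv.left_inv _ (A.U_subset c hp'),
      PartialEquiv.left_inv _ (A.U_subset c hx')] at h1
    simp only [← A.e_apply hx, ← A.e_apply hx', ← A.e_apply hp, ← A.e_apply hp',
      ← Pi.sub_apply] at h1
    refine h1.trans ?_; gcongr <;> exact norm_le_pi_norm _ c
  choose C hC N hN h using hloc
  have hsum : 0 ≤ ∑ c, C c := Finset.sum_nonneg fun c _ => hC c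
  refine ⟨∑ c, C c, hsum, (⋂ c, N c) ∩ {x | 0 < A.total x}, inter_mem (iInter_mem.2 hN)
    (A.eventually_total_pos hx₀), ?_⟩
  rintro x ⟨hx, hxt⟩ p ⟨hp, -⟩ p' ⟨hp', -⟩ x' ⟨hx', -⟩; rw [mem_iInter] at hx hp hp' hx'
  set Δ := (A.e p' - A.e p) - (A.e x' - A.e x); set R := (G p' - G p) - (G x' - G x)
  let L : E →L[ℝ] W := der G x
  have e1 : R - L (A.Lam x Δ) = ∑ c, A.h c x • (R - L (A.inv c x (Δ c))) := by
    simp only [smul_sub, Finset.sum_sub_distrib, ← Finset.sum_smul, A.sum_h hxt, one_smul,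
      A.Lam_apply, map_sum, map_smul]
  change ‖R - L (A.Lam x Δ)‖ ≤ _; rw [e1]
  calc ‖∑ c, A.h c x • (R - L (A.inv c x (Δ c)))‖
      ≤ ∑ c, A.h c x * ((∑ c, C c) * ‖A.e x' - A.e x‖ * ‖Δ‖
        + (∑ c, C c) * (‖A.e p - A.e x‖ + ‖A.e p' - A.e x'‖) * ‖A.e p' - A.e p‖) := by
        refine norm_sum_le_of_le _ fun c _ => ?_
        rw [norm_smul, Real.norm_of_nonneg (A.h_nonneg c x)]; by_cases h0 : A.h c x = 0
        · rw [h0, zero_mul, zero_mul]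
        refine mul_le_mul_of_nonneg_left ((h c x (hx c) p (hp c) p' (hp' c) x' (hx' c) h0).trans ?_)
          (A.h_nonneg c x)
        have : C c ≤ ∑ c, C c := Finset.single_le_sum (fun c _ => hC c) (Finset.mem_univ c); gcongr
    _ = _ := by rw [← Finset.sum_mul, A.sum_h hxt, one_mul]

end ChartCover

/-! ### Splittings and compactness -/

lemma exists_projections [FiniteDimensional ℝ W] {P Q R : Submodule ℝ W} (h : IsDirectSum₃ P Q R) :
    ∃ a b c : W →L[ℝ] W, (∀ w, a w ∈ P) ∧ (∀ w, b w ∈ Q) ∧ (∀ w, c w ∈ R) ∧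
      (∀ w, a w + b w + c w = w) ∧
      ∀ p ∈ P, ∀ q ∈ Q, ∀ r ∈ R, a (p + q + r) = p ∧ b (p + q + r) = q ∧ c (p + q + r) = r := by
  let S : (P × Q × R) →ₗ[ℝ] W := P.subtype.coprod (Q.subtype.coprod R.subtype)
  have hS : ∀ z, S z = z.1 + z.2.1 + z.2.2 := fun z => by simp [S, add_assoc]
  have hinj : Injective S := by
    rw [← ker_eq_bot, LinearMap.ker_eq_bot']; rintro ⟨⟨p, hp⟩, ⟨q, hq⟩, ⟨r, hr⟩⟩ hz; rw [hS] at hz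
    simp only at hz; have hpq : p + q ∈ P ⊔ Q := Submodule.add_mem_sup hp hq
    have h1 : p + q = 0 := by
      refine (Submodule.disjoint_def.1 h.2.disjoint) _ hpq ?_
      rw [eq_neg_of_add_eq_zero_left hz]; exact R.neg_mem hr
    have h2 : p = 0 := by
      refine (Submodule.disjoint_def.1 h.1) _ hp ?_
      rw [eq_neg_of_add_eq_zero_left h1]; exact Q.neg_mem hq
    have h3 : q = 0 := by simpa [h2] using h1
    have h4 : r = 0 := by simpa [h2, h3] using hz
    simp [h2, h3, h4]
  have hsurj : Function.Surjective S := by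
    intro w; have hw : w ∈ (P ⊔ Q) ⊔ R := by rw [h.2.codisjoint.eq_top]; trivial
    obtain ⟨y, hy, r, hr, rfl⟩ := Submodule.mem_sup.1 hw
    obtain ⟨p, hp, q, hq, rfl⟩ := Submodule.mem_sup.1 hy
    exact ⟨(⟨p, hp⟩, ⟨q, hq⟩, ⟨r, hr⟩), by rw [hS]⟩
  let Se := LinearEquiv.ofBijective S ⟨hinj, hsurj⟩
  have hSe : ∀ (p : P) (q : Q) (r : R), Se.symm (p + q + r) = (p, q, r) := by
    intro p q r; rw [LinearEquiv.symm_apply_eq]; exact (hS (p, q, r)).symm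
  refine ⟨(P.subtype ∘ₗ LinearMap.fst ℝ P (Q × R) ∘ₗ Se.symm.toLinearMap).toContinuousLinearMap,
    (Q.subtype ∘ₗ LinearMap.fst ℝ Q R ∘ₗ LinearMap.snd ℝ P (Q × R) ∘ₗ
      Se.symm.toLinearMap).toContinuousLinearMap,
    (R.subtype ∘ₗ LinearMap.snd ℝ Q R ∘ₗ LinearMap.snd ℝ P (Q × R) ∘ₗ
      Se.symm.toLinearMap).toContinuousLinearMap,
    fun w => (Se.symm w).1.2, fun w => (Se.symm w).2.1.2, fun w => (Se.symm w).2.2.2, fun w => ?_,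
    fun p hp q hq r hr => ?_⟩
  · have := Se.apply_symm_apply w; exact (hS (Se.symm w)).symm.trans this
  · have h1 := hSe ⟨p, hp⟩ ⟨q, hq⟩ ⟨r, hr⟩; simp only at h1; simp [h1]

/-- The projections of a splitting are continuous if each of the summands is locally spanned by
the values of a continuous family of linear maps. -/
lemma continuousOn_projections {ι X V : Type*} [Fintype ι] [TopologicalSpace X]
    [NormedAddCommGroup V] [NormedSpace ℝ V] [CompleteSpace V] {s : Set X} {q : ι → X → V →L[ℝ] V}
    (hsum : ∀ x ∈ s, ∑ i, q i x = 1) (hqq : ∀ x ∈ s, ∀ i j v, i ≠ j → q j x (q i x v) = 0)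
    (hp : ∀ x₀ ∈ s, ∀ i, ∃ p : X → V →L[ℝ] V, ContinuousWithinAt p s x₀ ∧ (∀ x ∈ s, ∀ v, q i x (p x v) = p x v) ∧ ∀ v, p x₀ (q i x₀ v) = q i x₀ v)
    (i : ι) : ContinuousOn (q i) s := by
  intro x₀ hx₀
  choose p hpc hpq hp0 using hp x₀ hx₀
  let m : X → V →L[ℝ] V := fun x => ∑ j, p j x * q j x₀
  have hm : ContinuousWithinAt m s x₀ :=
    tendsto_finsetSum _ fun j _ => (hpc j).mul continuousWithinAt_const
  have hm0 : m x₀ = 1 := by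
    rw [← hsum x₀ hx₀]; refine Finset.sum_congr rfl fun j _ => ?_; ext v; exact hp0 j v
  have hqm : ∀ x ∈ s, q i x * m x = p i x * q i x₀ := by
    intro x hx; rw [Finset.mul_sum, Finset.sum_eq_single i]
    · ext v; exact hpq i x hx _
    · intro j _ hji; ext v; change q i x (p j x (q j x₀ v)) = 0
      rw [← hpq j x hx, hqq x hx j i _ hji]
    · simp
  have hinv : ContinuousWithinAt (fun x => Ring.inverse (m x)) s x₀ := by
    have h1 : ContinuousAt Ring.inverse (m x₀) := by
      rw [hm0]; exact NormedRing.inverse_continuousAt (1 : (V →L[ℝ] V)ˣ)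
    exact h1.comp_continuousWithinAt hm
  have hunit : ∀ᶠ x in 𝓝[s] x₀, IsUnit (m x) := by
    have : {a : V →L[ℝ] V | IsUnit a} ∈ 𝓝 (m x₀) :=
      Units.isOpen.mem_nhds (by rw [hm0]; exact isUnit_one)
    exact hm this
  have h2 : ∀ᶠ x in 𝓝[s] x₀, q i x = p i x * q i x₀ * Ring.inverse (m x) := by
    filter_upwards [hunit, self_mem_nhdsWithin] with x hx hxs
    rw [← hqm x hxs, mul_assoc, Ring.mul_inverse_cancel _ hx, mul_one]
  have h3 : ContinuousWithinAt (fun x => p i x * q i x₀ * Ring.inverse (m x)) s x₀ :=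
    ((hpc i).mul continuousWithinAt_const).mul hinv
  exact h3.congr_of_eventuallyEq h2 (h2.self_of_nhdsWithin hx₀)

section Bounds

variable [TopologicalSpace M] {K : Set M}

lemma eventually_le_const_of_continuousOn (hK : IsCompact K) {f : M → V →L[ℝ] W}
    (hf : ContinuousOn f K) : ∀ᶠ C in atTop, ∀ x ∈ K, ∀ v, ‖f x v‖ ≤ C * ‖v‖ := by
  obtain ⟨C, hC⟩ := hK.exists_bound_of_continuousOn hf
  filter_upwards [eventually_ge_atTop C] with C' hC' x hx v
  exact (f x).le_of_opNorm_le ((hC x hx).trans hC') v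

lemma forall_le_of_homogeneous {f g : V → ℝ} {P : V → Prop}
    (hf : ∀ (t : ℝ) v, f (t • v) = |t| * f v) (hg : ∀ (t : ℝ) v, g (t • v) = |t| * g v)
    (hP : ∀ (t : ℝ) v, P v → P (t • v)) (h : ∀ v, ‖v‖ = 1 → P v → f v ≤ g v) {v : V} (hv : P v) :
    f v ≤ g v := by
  rcases eq_or_ne v 0 with rfl | h0
  · have h1 := hf 0 0; have h2 := hg 0 0; simp only [zero_smul, abs_zero, zero_mul] at h1 h2
    rw [h1, h2]
  · have h1 := h (‖v‖⁻¹ • v) (by rw [norm_smul, norm_inv, norm_norm, inv_mul_cancel₀ (norm_ne_zero_iff.2 h0)])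
      (hP _ _ hv)
    rw [hf, hg] at h1
    exact le_of_mul_le_mul_left h1 (abs_pos.2 (inv_ne_zero (norm_ne_zero_iff.2 h0)))

lemma eventually_seminorm_le (hK : IsCompact K) {ν : M → Seminorm ℝ V}
    (hν : ContinuousOn (fun p : M × V => ν p.1 p.2) (K ×ˢ univ)) :
    ∀ᶠ C in atTop, ∀ x ∈ K, ∀ v, ν x v ≤ C * ‖v‖ := by
  haveI := FiniteDimensional.proper_real V
  obtain ⟨C, hC⟩ := (hK.prod (isCompact_sphere (0 : V) 1)).exists_bound_of_continuousOn
    (hν.mono (prod_mono le_rfl (subset_univ _)))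
  filter_upwards [eventually_ge_atTop C] with C' hC' x hx v
  refine forall_le_of_homogeneous (P := fun _ => True) (fun t v => map_smul_eq_mul _ _ _)
    (g := fun v => C' * ‖v‖) (fun t v => ?_) (fun _ _ _ => trivial) (fun v hv _ => ?_) trivial
  · rw [norm_smul, Real.norm_eq_abs]; ring
  · rw [hv, mul_one]; exact ((le_abs_self _).trans (hC (x, v) ⟨hx, by simpa using hv⟩)).trans hC'

lemma eventually_norm_le_seminorm (hK : IsCompact K) {ν : M → Seminorm ℝ V}
    (hν : ContinuousOn (fun p : M × V => ν p.1 p.2) (K ×ˢ univ))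
    (hpos : ∀ x ∈ K, ∀ v, ν x v = 0 → v = 0) : ∀ᶠ C in atTop, ∀ x ∈ K, ∀ v, ‖v‖ ≤ C * ν x v := by
  haveI := FiniteDimensional.proper_real V
  have hne : ∀ p ∈ K ×ˢ sphere (0 : V) 1, ν p.1 p.2 ≠ 0 := by
    rintro ⟨x, v⟩ ⟨hx, hv⟩ h0; have := hpos x hx v h0; simp [this] at hv
  obtain ⟨C, hC⟩ := (hK.prod (isCompact_sphere (0 : V) 1)).exists_bound_of_continuousOn
    ((hν.mono (prod_mono le_rfl (subset_univ _))).inv₀ hne)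
  filter_upwards [eventually_ge_atTop C] with C' hC' x hx v
  refine forall_le_of_homogeneous (P := fun _ => True) (f := fun v => ‖v‖) (fun t v => norm_smul _ _)
    (g := fun v => C' * ν x v) (fun t v => ?_) (fun _ _ _ => trivial) (fun v hv _ => ?_) trivial
  · rw [map_smul_eq_mul, Real.norm_eq_abs]; ring
  · have hm : ((x, v) : M × V) ∈ K ×ˢ sphere (0 : V) 1 := ⟨hx, by simpa using hv⟩
    have h1 := ((le_abs_self _).trans (hC (x, v) hm)).trans hC'
    have h2 : 0 < ν x v := lt_of_le_of_ne (apply_nonneg _ _) (Ne.symm (hne _ hm)); rw [hv]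
    exact (inv_le_iff_one_le_mul₀ h2).1 h1

/-- A strict inequality on a closed family of cones over a compact set is uniformly strict. -/
lemma eventually_le_mul_of_lt (hK : IsCompact K) {ν ν' : M → Seminorm ℝ V} {q : M → V →L[ℝ] V}
    (hν : ContinuousOn (fun p : M × V => ν p.1 p.2) (K ×ˢ univ))
    (hν' : ContinuousOn (fun p : M × V => ν' p.1 p.2) (K ×ˢ univ)) (hq : ContinuousOn q K) {lam : ℝ}
    (hlam : 0 < lam) (h : ∀ x ∈ K, ∀ v, q x v = v → v ≠ 0 → ν x v < lam * ν' x v) :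
    ∀ᶠ l in 𝓝[<] lam, ∀ x ∈ K, ∀ v, q x v = v → ν x v ≤ l * ν' x v := by
  haveI := FiniteDimensional.proper_real V
  have hKS : IsCompact (K ×ˢ sphere (0 : V) 1) := hK.prod (isCompact_sphere _ _)
  have hqc : ContinuousOn (fun p : M × V => q p.1 p.2 - p.2) (K ×ˢ sphere (0 : V) 1) :=
    ((hq.comp continuousOn_fst fun p hp => hp.1).clm_apply continuousOn_snd).sub continuousOn_snd
  let Z : Set (M × V) := {p ∈ K ×ˢ sphere (0 : V) 1 | q p.1 p.2 - p.2 = 0}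
  have hZ : IsCompact Z := by
    obtain ⟨u, hu, hZu⟩ := (continuousOn_iff_isClosed.1 hqc) {0} isClosed_singleton
    have : Z = u ∩ K ×ˢ sphere (0 : V) 1 := by
      rw [← hZu]; ext p; simp only [Z, mem_ofPred_eq, mem_inter_iff, mem_preimage, mem_singleton_iff]
      exact and_comm
    rw [this]; exact hKS.inter_left hu
  have hsub : Z ⊆ K ×ˢ univ := fun p hp => ⟨hp.1.1, trivial⟩
  have hlt : ∀ p ∈ Z, ν p.1 p.2 < lam * ν' p.1 p.2 := by
    rintro ⟨x, v⟩ ⟨⟨hx, hv⟩, hqv⟩; refine h x hx v (sub_eq_zero.1 hqv) ?_; rintro rfl; simp at hv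
  have hpos : ∀ p ∈ Z, 0 < ν' p.1 p.2 := fun p hp =>
    pos_of_mul_pos_right ((apply_nonneg _ _).trans_lt (hlt p hp)) hlam.le
  have hex : ∃ l < lam, ∀ p ∈ Z, ν p.1 p.2 / ν' p.1 p.2 ≤ l := by
    rcases Z.eq_empty_or_nonempty with he | hne
    · exact ⟨lam - 1, by linarith, fun p hp => by rw [he] at hp; exact hp.elim⟩
    · obtain ⟨p, hp, hmax⟩ := hZ.exists_isMaxOn hne
        ((hν.mono hsub).div (hν'.mono hsub) fun p hp => (hpos p hp).ne')
      exact ⟨ν p.1 p.2 / ν' p.1 p.2, (div_lt_iff₀ (hpos p hp)).2 (hlt p hp), fun p' hp' => hmax hp'⟩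
  obtain ⟨l, hl, hle⟩ := hex; filter_upwards [Ico_mem_nhdsLT hl] with l' hl' x hx v hv
  refine forall_le_of_homogeneous (P := fun v => q x v = v) (fun t v => map_smul_eq_mul _ _ _)
    (g := fun v => l' * ν' x v) (fun t v => ?_) (fun t v hv => by rw [map_smul, hv])
    (fun v hv1 hqv => ?_) hv
  · rw [map_smul_eq_mul, Real.norm_eq_abs]; ring
  · have hm : ((x, v) : M × V) ∈ Z := ⟨⟨hx, by simpa using hv1⟩, sub_eq_zero.2 hqv⟩
    rw [← div_le_iff₀ (hpos _ hm)]; exact (hle _ hm).trans hl'.1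

end Bounds

variable {HA N : Type*} [TopologicalSpace HA] [TopologicalSpace N] [ChartedSpace HA N]
  {J : ModelWithCorners ℝ EA HA}

/-! ### Immersed manifolds with boundary -/

section Frames

/-- The derivative of a map of a manifold with boundary into a vector space, as a map between the
model spaces. -/
def bder {EA HA N V : Type*} [NormedAddCommGroup EA] [NormedSpace ℝ EA]
    [TopologicalSpace HA] (J : ModelWithCorners ℝ EA HA) [TopologicalSpace N] [ChartedSpace HA N]
    [NormedAddCommGroup V] [NormedSpace ℝ V] (f : N → V) (a : N) : EA →L[ℝ] V :=
  mfderiv J ℐ V f a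

variable [IsManifold J 1 N]

lemma hasFDerivWithinAt_written {f : N → V} (hf : ContMDiff J ℐ V 2 f) (a₀ : N) {a : N}
    (ha : a ∈ (extChartAt J a₀).source) :
    ∃ F : EA →L[ℝ] EA, HasFDerivWithinAt (f ∘ (extChartAt J a₀).symm)
      ((bder J f a).comp F) (range J) (extChartAt J a₀ a) := by
  have h1 := (mdifferentiableWithinAt_extChartAt_symm (I := J)
    ((extChartAt J a₀).map_source ha)).hasMFDerivWithinAt
  have hq : ∀ q, q = a → HasMFDerivAt J ℐ V f q (bder (EA := EA) (V := V) J f a) := by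
    rintro _ rfl; exact (hf.mdifferentiable (by simp) _).hasMFDerivAt
  have h2 := (hq _ ((extChartAt J a₀).left_inv ha)).comp_hasMFDerivWithinAt _ h1
  exact ⟨_, hasMFDerivWithinAt_iff_hasFDerivWithinAt.1 h2⟩

lemma contDiffWithinAt_written {f : N → V} (hf : ContMDiff J ℐ V 2 f) (a₀ : N) :
    ContDiffWithinAt ℝ 2 (f ∘ (extChartAt J a₀).symm) (range J) (extChartAt J a₀ a₀) := by
  exact (contMDiffAt_iff.1 (hf a₀)).2

lemma continuousWithinAt_fderivWithin_written {f : N → V} (hf : ContMDiff J ℐ V 2 f) (a₀ : N) :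
    ContinuousWithinAt (fderivWithin ℝ (f ∘ (extChartAt J a₀).symm) (range J)) (range J)
      (extChartAt J a₀ a₀) :=
  ((contDiffWithinAt_written hf a₀).fderivWithin_right (m := 1) J.uniqueDiffOn (by norm_num)
    (mem_range_self _)).continuousWithinAt

lemma fderivWithin_written {f : N → V} (hf : ContMDiff J ℐ V 2 f) (a₀ : N) :
    fderivWithin ℝ (f ∘ (extChartAt J a₀).symm) (range J) (extChartAt J a₀ a₀) = bder J f a₀ :=
  (((hf.mdifferentiable (by simp) a₀).mfderiv)).symm

/-- Differences of nearby points of an immersed manifold are almost tangent to it. -/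
lemma exists_strict_estimate {f : N → V} (hf : ContMDiff J ℐ V 2 f) (a₀ : N) {η : ℝ}
    (hη : 0 < η) :
    ∃ U ∈ 𝓝 a₀, ∀ a ∈ U, ∀ a' ∈ U, ∃ u : EA, ‖f a' - f a - bder J f a₀ u‖ ≤ η * ‖u‖ := by
  set φ := extChartAt J a₀; set L₀ : EA →L[ℝ] V := bder J f a₀
  have hc := continuousWithinAt_fderivWithin_written hf a₀
  have h1 : ∀ᶠ u in 𝓝[range J] (φ a₀), ‖fderivWithin ℝ (f ∘ φ.symm) (range J) u - L₀‖ ≤ η := by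
    have h2 := hc.sub (continuousWithinAt_const (b := L₀)); have h3 := h2.norm
    have h4 : fderivWithin ℝ (f ∘ φ.symm) (range J) (φ a₀) - L₀ = 0 :=
      sub_eq_zero.2 (fderivWithin_written hf a₀)
    rw [ContinuousWithinAt, Pi.sub_apply, h4, norm_zero] at h3
    exact (h3.eventually_lt_const hη).mono fun u hu => hu.le
  have h2 : φ.target ∈ 𝓝[range J] (φ a₀) := extChartAt_target_mem_nhdsWithin a₀
  obtain ⟨ρ, hρ, hb⟩ := Metric.mem_nhdsWithin_iff.1 (inter_mem h2 h1)
  have hconv : Convex ℝ (ball (φ a₀) ρ ∩ range J) := (convex_ball _ _).inter J.convex_range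
  have hder : ∀ u ∈ ball (φ a₀) ρ ∩ range J, HasFDerivWithinAt (f ∘ φ.symm)
      (fderivWithin ℝ (f ∘ φ.symm) (range J) u) (ball (φ a₀) ρ ∩ range J) u := by
    intro u hu; obtain ⟨F, hF⟩ := hasFDerivWithinAt_written hf a₀ (φ.map_target (hb hu).1)
    rw [φ.right_inv (hb hu).1] at hF
    exact hF.differentiableWithinAt.hasFDerivWithinAt.mono inter_subset_right
  refine ⟨φ.source ∩ φ ⁻¹' ball (φ a₀) ρ, inter_mem (extChartAt_source_mem_nhds a₀)
    ((continuousAt_extChartAt a₀).preimage_mem_nhds (ball_mem_nhds _ hρ)), ?_⟩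
  rintro a ⟨ha, hab⟩ a' ⟨ha', hab'⟩
  have hr : ∀ {b}, b ∈ φ.source → φ b ∈ range J := fun hb =>
    extChartAt_target_subset_range a₀ (φ.map_source hb)
  have := hconv.norm_image_sub_le_of_norm_hasFDerivWithin_le' hder (fun u hu => (hb hu).2)
    ⟨hab, hr ha⟩ ⟨hab', hr ha'⟩
  simp only [comp_apply, φ.left_inv ha, φ.left_inv ha'] at this; exact ⟨_, this⟩

/-- The tangent spaces of an immersed manifold depend continuously on the base point. -/
lemma exists_frame [TopologicalSpace M] {ι : N → M} (hι : IsEmbedding ι) {f : N → V}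
    (hf : ContMDiff J ℐ V 2 f) (a₀ : N) (himm : Injective (bder J f a₀)) :
    ∃ p : M → V →L[ℝ] V, ContinuousWithinAt p (range ι) (ι a₀) ∧
      (∀ a v, ∃ w : EA, bder J f a w = p (ι a) v) ∧
      ∀ w : EA, p (ι a₀) (bder J f a₀ w) = bder J f a₀ w := by
  classical
  set φ := extChartAt J a₀; set L₀ : EA →L[ℝ] V := bder J f a₀
  let L : N → EA →L[ℝ] V := fun a =>
    if a ∈ φ.source then fderivWithin ℝ (f ∘ φ.symm) (range J) (φ a) else 0
  have hL : ContinuousAt L a₀ := by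
    have h1 : Tendsto φ (𝓝 a₀) (𝓝[range J] (φ a₀)) := (map_extChartAt_nhds (I := J) a₀).le
    have h2 : ContinuousAt (fun a => fderivWithin ℝ (f ∘ φ.symm) (range J) (φ a)) a₀ :=
      (continuousWithinAt_fderivWithin_written hf a₀).tendsto.comp h1
    refine h2.congr ?_; filter_upwards [extChartAt_source_mem_nhds (I := J) a₀] with a ha
    simp only [L]; rw [if_pos ha]
  have hL0 : L a₀ = L₀ := by
    simp only [L]; rw [if_pos (mem_extChartAt_source a₀)]; exact fderivWithin_written hf a₀
  have hLr : ∀ a w, ∃ w' : EA, bder J f a w' = L a w := by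
    intro a w; by_cases ha : a ∈ φ.source
    · obtain ⟨F, hF⟩ := hasFDerivWithinAt_written hf a₀ ha; refine ⟨F w, ?_⟩; simp only [L]
      rw [if_pos ha, hF.fderivWithin (J.uniqueDiffOn _
        (extChartAt_target_subset_range a₀ (φ.map_source ha)))]
      rfl
    · refine ⟨0, ?_⟩; simp only [L]; rw [if_neg ha, map_zero, zero_apply]
  obtain ⟨R, hR⟩ := LinearMap.exists_leftInverse_of_injective L₀.toLinearMap (ker_eq_bot.2 himm)
  let σ : M → N := fun x => if h : ∃ a, ι a = x then h.choose else a₀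
  have hσ : ∀ a, σ (ι a) = a := by
    intro a; have h : ∃ b, ι b = ι a := ⟨a, rfl⟩; simp only [σ]; rw [dif_pos h]
    exact hι.injective h.choose_spec
  refine ⟨fun x => (L (σ x)).comp R.toContinuousLinearMap, ?_, fun a v => ?_, fun w => ?_⟩
  · rw [ContinuousWithinAt, ← hι.isInducing.map_nhds_eq, tendsto_map'_iff]
    have h1 : ContinuousAt (fun a => (L a).comp R.toContinuousLinearMap) a₀ :=
      hL.clm_comp continuousAt_const
    have h2 := h1.tendsto; simp only [Function.comp_def, hσ]; exact h2
  · simp only [hσ]; exact hLr a _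
  · simp only [hσ]; rw [hL0]; have := congrArg (fun l : EA →ₗ[ℝ] EA => l w) hR
    exact congrArg L₀ this

/-- Linear maps that vanish on the tangent spaces of an immersed manifold almost vanish on the
differences of its points. -/
lemma exists_tangency [EMetricSpace M] {ι : N → M} (hι : IsEmbedding ι) (hK : IsCompact (range ι))
    {e : M → V} (hf : ContMDiff J ℐ V 2 (fun a => e (ι a)))
    (himm : ∀ a, Injective (bder J (fun a => e (ι a)) a)) {q : M → V →L[ℝ] V}
    (hq : ContinuousOn q (range ι))
    (hq0 : ∀ a, ∀ w : EA, q (ι a) (bder J (fun a => e (ι a)) a w) = 0) {η : ℝ} (hη : 0 < η) :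
    ∀ᶠ r in 𝓝[>] (0 : ℝ), ∀ x ∈ range ι, ∀ x' ∈ range ι, edist x' x < ofReal r →
      ‖q x (e x' - e x)‖ ≤ η * ‖e x' - e x‖ := by
  have := eventually_uniform hK (Q := fun x _ s => ∀ x' ∈ s, x' ∈ range ι →
    ‖q x (e x' - e x)‖ ≤ η * ‖e x' - e x‖) (fun x _ _ _ _ _ hs h x' hx' => h x' (hs hx')) ?_
  · obtain ⟨C, hC⟩ := this.exists; exact hC.mono fun r hr x hx x' hx' hd => hr x hx x' hd hx'
  rintro _ ⟨a₀, rfl⟩; set L₀ : EA →L[ℝ] V := bder J (fun a => e (ι a)) a₀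
  obtain ⟨κ, hκ, hanti⟩ := L₀.toLinearMap.exists_antilipschitzWith (ker_eq_bot.2 (himm a₀))
  have hκ' : ∀ w, ‖w‖ ≤ κ * ‖L₀ w‖ := fun w => hanti.le_mul_norm (map_zero L₀) w
  set B := ‖q (ι a₀)‖ + 1 with hB; have hB0 : 0 < B := by positivity
  have hκ0 : (0 : ℝ) < κ := hκ; let η₁ : ℝ := min (1 / (2 * κ)) (η / (2 * κ * (B + 1)))
  have hη₁ : 0 < η₁ := lt_min (by positivity) (by positivity)
  have hκη : κ * η₁ ≤ 1 / 2 := by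
    calc κ * η₁ ≤ κ * (1 / (2 * κ)) := by gcongr; exact min_le_left _ _
      _ = 1 / 2 := by field_simp
  have hηη : (B + 1) * η₁ * (2 * κ) ≤ η := by
    calc (B + 1) * η₁ * (2 * κ) ≤ (B + 1) * (η / (2 * κ * (B + 1))) * (2 * κ) := by
          gcongr; exact min_le_right _ _
      _ = η := by field_simp
  obtain ⟨U, hU, hest⟩ := exists_strict_estimate hf a₀ hη₁
  have hqc := hq (ι a₀) (mem_range_self a₀)
  have h1 : ∀ᶠ x in 𝓝[range ι] (ι a₀), ‖q x‖ < B :=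
    hqc.norm.eventually_lt_const (by rw [hB]; linarith)
  have h2 : ∀ᶠ x in 𝓝[range ι] (ι a₀), ‖(q x).comp L₀‖ < η₁ := by
    have h3 : ContinuousWithinAt (fun x => ‖(q x).comp L₀‖) (range ι) (ι a₀) :=
      (hqc.clm_comp continuousWithinAt_const).norm
    refine h3.eventually_lt_const ?_; have : (q (ι a₀)).comp L₀ = 0 := by ext w; exact hq0 a₀ w
    simpa only [this, norm_zero] using hη₁
  have h3 : ∀ᶠ x in 𝓝[range ι] (ι a₀), ∃ a ∈ U, ι a = x := by
    rw [← hι.isInducing.map_nhds_eq]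
    exact eventually_map.2 (mem_of_superset hU fun a ha => ⟨a, ha, rfl⟩)
  obtain ⟨S, hS, hSs⟩ := mem_nhdsWithin_iff_exists_mem_nhds_inter.1 (h1.and (h2.and h3))
  refine ⟨0, S, hS, fun x hx hxK x' hx' hxK' => ?_⟩; obtain ⟨hqB, hqL, a, ha, rfl⟩ := hSs ⟨hx, hxK⟩
  obtain ⟨-, -, a', ha', rfl⟩ := hSs ⟨hx', hxK'⟩; obtain ⟨u, hu⟩ := hest a ha a' ha'
  set Δ := e (ι a') - e (ι a); change ‖Δ - L₀ u‖ ≤ _ at hu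
  have hun : ‖u‖ ≤ 2 * κ * ‖Δ‖ := by
    have h4 : ‖L₀ u‖ ≤ ‖Δ‖ + η₁ * ‖u‖ := by
      have : L₀ u = Δ - (Δ - L₀ u) := by abel
      rw [this]; exact (norm_sub_le _ _).trans (by linarith)
    have h5 := hκ' u; have h6 : κ * ‖L₀ u‖ ≤ κ * (‖Δ‖ + η₁ * ‖u‖) := by gcongr
    have h7 : κ * η₁ * ‖u‖ ≤ 1 / 2 * ‖u‖ := by gcongr
    nlinarith
  calc ‖q (ι a) Δ‖ = ‖q (ι a) (Δ - L₀ u) + ((q (ι a)).comp L₀) u‖ := by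
        rw [ContinuousLinearMap.comp_apply, ← map_add]; congr 2; abel
    _ ≤ B * (η₁ * ‖u‖) + η₁ * ‖u‖ := by
        refine (norm_add_le _ _).trans (add_le_add ?_ (le_of_opNorm_le _ hqL.le _))
        exact (le_of_opNorm_le _ hqB.le _).trans (by gcongr)
    _ = (B + 1) * η₁ * ‖u‖ := by ring
    _ ≤ (B + 1) * η₁ * (2 * κ * ‖Δ‖) := by gcongr
    _ = (B + 1) * η₁ * (2 * κ) * ‖Δ‖ := by ring
    _ ≤ η * ‖Δ‖ := by gcongr

end Frames

/-! ### Geometry of the coordinates along a compact set -/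

namespace ChartCover

section Continuity

variable [TopologicalSpace M] [ChartedSpace E M] {K : Set M}
  (A : ChartCover E K)

/-- The projection onto a complement of the image of the derivative of `e`. -/
def nn (x : M) : A.X →L[ℝ] A.X := 1 - (A.I x).comp (A.Lam x)

lemma nn_apply (x : M) (v : A.X) : A.nn x v = v - A.I x (A.Lam x v) := rfl

variable [T2Space M] [IsManifold ℐ E ∞ M]

lemma Lam_nn {x : M} (hx : x ∈ K) (v : A.X) : A.Lam x (A.nn x v) = 0 := by
  rw [A.nn_apply, map_sub, A.Lam_I (A.total_pos hx), sub_self]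

lemma nn_I {x : M} (hx : x ∈ K) (w : E) : A.nn x (A.I x w) = 0 := by
  rw [A.nn_apply, A.Lam_I (A.total_pos hx), sub_self]

lemma continuousOn_der {G : M → W} {O : Set M} (hO : IsOpen O) (hG : CMDiff[O] ∞ G) :
    ContinuousOn (fun p : TangentBundle ℐ E M => der (E := E) G p.1 p.2) {p | p.1 ∈ O} := by
  haveI : IsManifold ℐ E 1 M := IsManifold.of_le (n := ∞) (by norm_cast)
  have h1 := hG.continuousOn_tangentMapWithin (by simp) hO.uniqueMDiffOn
  have h2 := (tangentBundleModelSpaceHomeomorph ℐ W).continuous.comp_continuousOn h1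
  refine (continuous_snd.comp_continuousOn h2).congr fun p hp => ?_
  change der (E := E) G p.1 p.2 = mfderivWithin ℐ E ℐ W G O p.1 p.2
  rw [mfderivWithin_of_isOpen hO hp]
  rfl

/-- Continuity of linear maps obtained from maps of tangent spaces. -/
lemma continuousOn_of_glue {f : M → A.X →L[ℝ] W} {L : M → E →L[ℝ] W}
    (hL : ContinuousOn (fun p : TangentBundle ℐ E M => L p.1 p.2) {p | p.1 ∈ K})
    (hf : ∀ x ∈ K, ∀ v, f x v = L x (A.Lam x v)) : ContinuousOn f K := by
  refine continuousOn_clm_apply.2 fun v => ?_; have h1 := A.continuousOn_glue hL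
  have h2 : ContinuousOn (fun x : M => ((x, v) : M × A.X)) K := by fun_prop
  refine (h1.comp h2 fun x hx => ⟨hx, trivial⟩).congr fun x hx => ?_
  simp only [comp_apply, hf x hx, A.Lam_apply, map_sum, map_smul]

lemma continuousOn_der_Lam {G : M → W} {O : Set M} (hO : IsOpen O) (hKO : K ⊆ O)
    (hG : CMDiff[O] ∞ G) : ContinuousOn (fun x => (der G x).comp (A.Lam x)) K :=
  A.continuousOn_of_glue ((continuousOn_der hO hG).mono fun p hp => hKO hp) fun _ _ _ => rfl

lemma continuousOn_nn : ContinuousOn A.nn K := continuousOn_const.sub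
    (A.continuousOn_der_Lam isOpen_univ (subset_univ _) A.contMDiff_e.contMDiffOn)

/-- A norm on the tangent spaces, extended to the ambient vector space by gluing. -/
def glueSeminorm (ν : M → Seminorm ℝ E) (x : M) : Seminorm ℝ A.X :=
  ∑ c, (A.h c x).toNNReal • (ν x).comp ((A.inv c x).toLinearMap ∘ₗ LinearMap.proj c)

lemma glueSeminorm_apply (ν : M → Seminorm ℝ E) (x : M) (v : A.X) :
    A.glueSeminorm ν x v = ∑ c, A.h c x • ν x (A.inv c x (v c)) := by
  have h1 : ∀ (t : Finset A.s) (p : A.s → Seminorm ℝ A.X) (v : A.X),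
      (∑ c ∈ t, p c) v = ∑ c ∈ t, p c v := by
    classical
    intro t p v; induction t using Finset.induction_on with
    | empty => simp
    | insert c t hc ih => rw [Finset.sum_insert hc, Finset.sum_insert hc, add_apply, ih]
  rw [glueSeminorm, h1]; refine Finset.sum_congr rfl fun c _ => ?_
  simp only [smul_apply, NNReal.smul_def, Real.coe_toNNReal _ (A.h_nonneg c x)]
  rfl

lemma glueSeminorm_I (ν : M → Seminorm ℝ E) {x : M} (hx : x ∈ K) (w : E) :
    A.glueSeminorm ν x (A.I x w) = ν x w := by
  rw [A.glueSeminorm_apply]; exact A.sum_h_inv_I (A.total_pos hx) (ν x) w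

lemma continuousOn_glueSeminorm {ν : M → Seminorm ℝ E}
    (hν : ContinuousOn (fun p : TangentBundle ℐ E M => ν p.1 p.2) {p | p.1 ∈ K}) :
    ContinuousOn (fun q : M × A.X => A.glueSeminorm ν q.1 q.2) (K ×ˢ univ) :=
  (A.continuousOn_glue hν).congr fun q _ => A.glueSeminorm_apply ν q.1 q.2

end Continuity

section Metric

variable [EMetricSpace M] [ChartedSpace E M] [IsManifold ℐ E ∞ M]
  {K : Set M} (A : ChartCover E K)

lemma eventually_four (hK : IsCompact K) {G : M → W} {O : Set M} (hO : IsOpen O) (hKO : K ⊆ O)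
    (hG : CMDiff[O] ∞ G) :
    ∀ᶠ C in atTop, ∀ᶠ r in 𝓝[>] (0 : ℝ), ∀ x ∈ K, ∀ p p' x', edist p x < ofReal r →
      edist p' x < ofReal r → edist x' x < ofReal r →
      ‖((G p' - G p) - (G x' - G x)) - der G x (A.Lam x ((A.e p' - A.e p) - (A.e x' - A.e x)))‖ ≤
        C * ‖A.e x' - A.e x‖ * ‖(A.e p' - A.e p) - (A.e x' - A.e x)‖
          + C * (‖A.e p - A.e x‖ + ‖A.e p' - A.e x'‖) * ‖A.e p' - A.e p‖ := by
  have := eventually_uniform hK (Q := fun x C s => ∀ p ∈ s, ∀ p' ∈ s, ∀ x' ∈ s,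
      ‖((G p' - G p) - (G x' - G x)) - der G x (A.Lam x ((A.e p' - A.e p) - (A.e x' - A.e x)))‖ ≤
        C * ‖A.e x' - A.e x‖ * ‖(A.e p' - A.e p) - (A.e x' - A.e x)‖
          + C * (‖A.e p - A.e x‖ + ‖A.e p' - A.e x'‖) * ‖A.e p' - A.e p‖) ?_ ?_
  · filter_upwards [this] with C hC
    filter_upwards [hC] with r hr x hx p p' x' hp hp' hx'
    exact hr x hx p hp p' hp' x' hx'
  · intro x C C' s s' hC hs h p hp p' hp' x' hx'
    refine (h p (hs hp) p' (hs hp') x' (hs hx')).trans ?_; gcongr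
  · intro x₀ hx₀
    obtain ⟨C, -, N, hN, h⟩ := A.exists_four hx₀
      ((hG.contMDiffAt (hO.mem_nhds (hKO hx₀))).of_le (by norm_cast))
    exact ⟨C, N, hN, fun x hx _ p hp p' hp' x' hx' => h x hx p hp p' hp' x' hx'⟩

lemma eventually_normal (hK : IsCompact K) :
    ∀ᶠ C in atTop, ∀ᶠ r in 𝓝[>] (0 : ℝ), ∀ x ∈ K, ∀ p p', edist p x < ofReal r →
      edist p' x < ofReal r →
      ‖A.nn x (A.e p' - A.e p)‖ ≤ C * (‖A.e p - A.e x‖ + ‖A.e p' - A.e x‖) * ‖A.e p' - A.e p‖ := by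
  filter_upwards [A.eventually_four hK isOpen_univ (subset_univ _) A.contMDiff_e.contMDiffOn]
    with C hC
  filter_upwards [hC, self_mem_nhdsWithin] with r hr hr0 x hx p p' hp hp'
  have := hr x hx p p' x hp hp' (by rw [edist_self]; exact ofReal_pos.2 hr0)
  simp only [sub_self, norm_zero, mul_zero, zero_mul, zero_add, sub_zero] at this; exact this

section Unif

variable [EMetricSpace M] {K : Set M} {T : OpenPartialHomeomorph M M}

lemma eventually_near_source (hK : IsCompact K) (hKT : K ⊆ T.source) :
    ∀ᶠ r in 𝓝[>] (0 : ℝ), ∀ x ∈ K, ∀ p, edist p x < ofReal r → p ∈ T.source := by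
  have := eventually_uniform hK (Q := fun _ _ s => s ⊆ T.source)
    (fun _ _ _ _ _ _ hs h => hs.trans h)
    fun x hx => ⟨0, _, T.open_source.mem_nhds (hKT hx), fun _ _ _ => le_rfl⟩
  obtain ⟨C, hC⟩ := this.exists; exact hC

lemma exists_unif (hK : IsCompact K) (hKT : K ⊆ T.source) {ε : ℝ} (hε : 0 < ε) :
    ∃ ρ > 0, ∀ x ∈ K, ∀ p, edist p x < ofReal ρ → p ∈ T.source ∧ edist (T p) (T x) < ofReal ε := by
  have := eventually_uniform hK
    (Q := fun x _ s => ∀ p ∈ s, p ∈ T.source ∧ edist (T p) (T x) < ofReal ε)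
    (fun _ _ _ _ _ _ hs h p hp => h p (hs hp)) ?_
  · obtain ⟨C, hC⟩ := this.exists; obtain ⟨r, hr, hr0⟩ := (hC.and self_mem_nhdsWithin).exists
    exact ⟨r, hr0, fun x hx p hp => hr x hx p hp⟩
  intro x₀ hx₀
  have hb : eball (T x₀) (ofReal (ε / 2)) ∈ 𝓝 (T x₀) :=
    eball_mem_nhds _ (ofReal_pos.2 (half_pos hε))
  refine ⟨0, T.source ∩ T ⁻¹' eball (T x₀) (ofReal (ε / 2)),
    inter_mem (T.open_source.mem_nhds (hKT hx₀)) ((T.continuousAt (hKT hx₀)).preimage_mem_nhds hb),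
    ?_⟩
  rintro x ⟨-, hx⟩ - p ⟨hp, hpb⟩; refine ⟨hp, (edist_triangle_right _ _ (T x₀)).trans_lt ?_⟩
  rw [← add_halves ε, ENNReal.ofReal_add (half_pos hε).le (half_pos hε).le]
  exact ENNReal.add_lt_add hpb hx

variable (E) in
lemma eventually_near_compact [ChartedSpace E M] (hK : IsCompact K) :
    ∃ L : Set M, IsCompact L ∧ ∀ᶠ r in 𝓝[>] (0 : ℝ), ∀ x ∈ K, ∀ p,
    edist p x < ofReal r → p ∈ L := by
  haveI : LocallyCompactSpace M := Manifold.locallyCompact_of_finiteDimensional (M := M) ℐ E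
  obtain ⟨L, hL, hKL⟩ := exists_compact_superset hK
  have := eventually_uniform hK (Q := fun _ _ s => s ⊆ L) (fun _ _ _ _ _ _ hs h => hs.trans h)
    fun x hx => ⟨0, _, mem_interior_iff_mem_nhds.1 (hKL hx), fun _ _ _ => le_rfl⟩
  obtain ⟨C, hC⟩ := this.exists; exact ⟨L, hL, hC⟩

end Unif

lemma eventually_injective (hK : IsCompact K) :
    ∀ᶠ r in 𝓝[>] (0 : ℝ), ∀ x ∈ K, ∀ p, edist p x < ofReal r → Injective (A.I p) := by
  have := eventually_uniform hK (Q := fun _ _ s => ∀ p ∈ s, Injective (A.I p))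
    (fun _ _ _ _ _ _ hs h p hp => h p (hs hp))
    fun x hx => ⟨0, _, A.eventually_total_pos hx, fun _ _ _ p hp => A.I_injective hp⟩
  obtain ⟨C, hC⟩ := this.exists; exact hC

variable [Bundle.RiemannianBundle (fun x : M => TangentSpace ℐ E x)]
  [IsContinuousRiemannianBundle E (fun x : M => TangentSpace ℐ E x)]
  [IsRiemannianManifold ℐ E M]

lemma exists_edist_le {x₀ : M} (hx₀ : x₀ ∈ K) :
    ∃ C ≥ 0, ∃ N ∈ 𝓝 x₀, ∀ p ∈ N, ∀ p' ∈ N, edist p p' ≤ ofReal (C * ‖A.e p' - A.e p‖) := by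
  obtain ⟨C, N, hN, h⟩ := exists_edist_le_extChartAt (E := E) x₀
  obtain ⟨C', hC', N', hN', h'⟩ := A.exists_lipschitz (G := Ξ E x₀) hx₀
    (contMDiffAt_extChartAt (n := 1))
  refine ⟨C * C', by positivity, N ∩ N', inter_mem hN hN', fun p hp p' hp' => ?_⟩
  refine (h p hp.1 p' hp'.1).trans ?_
  rw [edist_comm, edist_dist, dist_eq_norm, mul_assoc,
    ENNReal.ofReal_mul (p := (C : ℝ)) C.2, ENNReal.ofReal_coe_nnreal]
  gcongr; exact h' p hp.2 p' hp'.2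

lemma eventually_edist_le (hK : IsCompact K) :
    ∀ᶠ C in atTop, ∀ᶠ r in 𝓝[>] (0 : ℝ), ∀ x ∈ K, ∀ p p', edist p x < ofReal r →
      edist p' x < ofReal r → edist p p' ≤ ofReal (C * ‖A.e p' - A.e p‖) := by
  have := eventually_uniform hK (Q := fun x C s => ∀ p ∈ s, ∀ p' ∈ s,
      edist p p' ≤ ofReal (C * ‖A.e p' - A.e p‖)) ?_ ?_
  · filter_upwards [this] with C hC
    filter_upwards [hC] with r hr x hx p p' hp hp'
    exact hr x hx p hp p' hp'
  · intro x C C' s s' hC hs h p hp p' hp'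
    refine (h p (hs hp) p' (hs hp')).trans (ofReal_le_ofReal ?_); gcongr
  · intro x₀ hx₀; obtain ⟨C, -, N, hN, h⟩ := A.exists_edist_le hx₀
    exact ⟨C, N, hN, fun x _ _ p hp p' hp' => h p hp p' hp'⟩

lemma eventually_le_edist (hK : IsCompact K) :
    ∀ᶠ C in atTop, ∀ᶠ r in 𝓝[>] (0 : ℝ), ∀ x ∈ K, ∀ p p', edist p x < ofReal r →
      edist p' x < ofReal r → ∀ t, 0 ≤ t → edist p p' ≤ ofReal t →
      ‖A.e p' - A.e p‖ ≤ C * t := by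
  have := eventually_uniform hK (Q := fun x C s => ∀ p ∈ s, ∀ p' ∈ s, ∀ t, 0 ≤ t →
      edist p p' ≤ ofReal t → ‖A.e p' - A.e p‖ ≤ C * t) ?_ ?_
  · filter_upwards [this] with C hC
    filter_upwards [hC] with r hr x hx p p' hp hp'
    exact hr x hx p hp p' hp'
  · intro x C C' s s' hC hs h p hp p' hp' t ht htd
    exact (h p (hs hp) p' (hs hp') t ht htd).trans (by gcongr)
  · intro x₀ hx₀; obtain ⟨C, N, hN, h⟩ := exists_edist_extChartAt_le (E := E) x₀
    obtain ⟨C', hC', N', hN', h'⟩ := exists_lipschitz_chart (G := A.e)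
      (mem_extChartAt_source (I := ℐ E) x₀) ((A.contMDiff_e x₀).of_le (by norm_cast))
    refine ⟨C' * C, N ∩ N', inter_mem hN hN', fun x _ _ p hp p' hp' t ht htd => ?_⟩
    refine (h' p hp.2 p' hp'.2).trans ?_; rw [mul_assoc]; gcongr
    have h1 : edist (Ξ E x₀ p) (Ξ E x₀ p') ≤ ofReal (C * t) := by
      refine (h p hp.1 p' hp'.1).trans ?_
      rw [ENNReal.ofReal_mul (p := (C : ℝ)) C.2, ENNReal.ofReal_coe_nnreal]; gcongr
    rw [edist_comm, edist_dist, dist_eq_norm] at h1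
    exact (ENNReal.ofReal_le_ofReal_iff (mul_nonneg C.2 ht)).1 h1

end Metric

end ChartCover

/-- The value of a one-form, as a linear form on the model space. -/
def OneForm.cov {E M : Type*} [NormedAddCommGroup E] [NormedSpace ℝ E]
    [TopologicalSpace M] [ChartedSpace E M] (θ : OneForm E M) (x : M) : E →L[ℝ] ℝ := θ x

namespace ChartCover

variable [EMetricSpace M] [ChartedSpace E M] [IsManifold ℐ E ∞ M]
  {K : Set M} (A : ChartCover E K)

/-- The coefficients of a one-form with respect to the coordinates `e`. -/
def coeff (θ : OneForm E M) (p : M) : A.X →L[ℝ] ℝ := (θ.cov p).comp (A.Lam p)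

lemma coeff_I (θ : OneForm E M) {p : M} (hp : 0 < A.total p) (w : E) :
    A.coeff θ p (A.I p w) = θ.cov p w := by
  rw [coeff, ContinuousLinearMap.comp_apply, A.Lam_I hp]

lemma contMDiffAt_coeff {θ : OneForm E M} (hθ : θ.IsSmooth) {p : M} (hp : 0 < A.total p) :
    CMDiffAt 1 (A.coeff θ) p := by
  have e1 : A.coeff θ = fun q => ∑ c, A.h c q • ((θ.cov q).comp (A.inv c q)).comp
      (ContinuousLinearMap.proj c) := by
    funext q; ext v; simp [coeff, A.Lam_apply, map_sum, sum_apply]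
  have hterm : ∀ c : A.s, ContMDiffAt ℐ E 𝓘(ℝ, A.X →L[ℝ] ℝ) 1
      (fun q => A.h c q • ((θ.cov q).comp (A.inv c q)).comp
        (ContinuousLinearMap.proj c : A.X →L[ℝ] E)) p := by
    intro c; by_cases hc : p ∈ A.U c; swap
    · refine contMDiffAt_const (c := (0 : A.X →L[ℝ] ℝ)) |>.congr_of_eventuallyEq ?_
      filter_upwards [A.h_eventually_eq_zero hc] with q hq
      rw [hq, zero_smul]
    have hs := A.U_subset c hc
    have h1 : ContDiffOn ℝ ∞ (θ.pull (A.χ c).symm) (A.χ c).target :=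
      contDiffOn_pull hθ (isOpen_extChartAt_target _) (contMDiffOn_extChartAt_symm _)
    have h2 : CMDiffAt 1 (fun q => θ.pull (A.χ c).symm (A.χ c q)) p := by
      have h3 : CMDiffAt 1 (θ.pull (A.χ c).symm) (A.χ c p) :=
        ((h1.contDiffAt ((isOpen_extChartAt_target _).mem_nhds
          ((A.χ c).map_source hs))).of_le (by norm_cast)).contMDiffAt
      exact h3.comp p (contMDiffAt_extChartAt' (by rwa [← extChartAt_source ℐ E]))
    have h4 : CMDiffAt 1 (fun q => (θ.cov q).comp (A.inv c q)) p := by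
      refine h2.congr_of_eventuallyEq ?_; filter_upwards [(A.isOpen_U c).mem_nhds hc] with q hq
      have h5 := (A.χ c).left_inv (A.U_subset c hq)
      have h6 : ∀ q' : M, q' = q → θ.cov q = θ.cov q' := by rintro _ rfl; rfl
      rw [h6 _ h5]
      rfl
    have h7 : CMDiffAt 1 (fun q => ((θ.cov q).comp (A.inv c q)).comp
        (ContinuousLinearMap.proj c : A.X →L[ℝ] E)) p :=
      h4.clm_comp contMDiffAt_const
    exact ((A.contMDiffAt_h c hp).of_le (by norm_cast)).smul h7
  rw [e1]; have := contMDiffAt_finsetSum (t := Finset.univ) (fun c _ => hterm c)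
  refine this.congr_of_eventuallyEq (Eventually.of_forall fun q => ?_); simp

lemma eventually_coeff (hK : IsCompact K) {θ : OneForm E M} (hθ : θ.IsSmooth) :
    ∃ L r : ℝ, 0 < r ∧ ∀ x ∈ K, ∀ p, edist p x < ofReal r →
      CMDiffAt 1 (A.coeff θ) p ∧
      (∀ w : E, θ.cov p w = A.coeff θ p (A.I p w)) ∧
      ‖A.coeff θ p - A.coeff θ x‖ ≤ L * ‖A.e p - A.e x‖ := by
  have := eventually_uniform hK (Q := fun x L s => ∀ p ∈ s,
      CMDiffAt 1 (A.coeff θ) p ∧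
      (∀ w : E, θ.cov p w = A.coeff θ p (A.I p w)) ∧
      ‖A.coeff θ p - A.coeff θ x‖ ≤ L * ‖A.e p - A.e x‖) ?_ ?_
  · obtain ⟨L, hL⟩ := this.exists; obtain ⟨r, hr, hr0⟩ := (hL.and self_mem_nhdsWithin).exists
    exact ⟨L, r, hr0, hr⟩
  · intro x C C' s s' hC hs h p hp; obtain ⟨h1, h2, h3⟩ := h p (hs hp)
    exact ⟨h1, h2, h3.trans (by gcongr)⟩
  · intro x₀ hx₀
    obtain ⟨L, hL, N, hN, h⟩ := A.exists_lipschitz hx₀ (A.contMDiffAt_coeff hθ (A.total_pos hx₀))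
    refine ⟨L, N ∩ {p | 0 < A.total p}, inter_mem hN (A.eventually_total_pos hx₀), ?_⟩
    rintro x ⟨hx, -⟩ - p ⟨hp, hpt⟩
    exact ⟨A.contMDiffAt_coeff hθ hpt, fun w => (A.coeff_I θ hpt w).symm, h x hx p hp⟩

variable [Bundle.RiemannianBundle (fun x : M => TangentSpace ℐ E x)]
  [IsContinuousRiemannianBundle E (fun x : M => TangentSpace ℐ E x)]
  [IsRiemannianManifold ℐ E M]

/-- Small tangent vectors are the tangential parts of differences of points. -/
lemma exists_param {x₀ : M} (hx₀ : x₀ ∈ K) : ∃ C, ∃ N ∈ 𝓝 x₀, ∀ x ∈ N, x ∈ K →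
    ∀ v, A.nn x v = 0 → ‖v‖ * C ≤ 1 → ∃ p, edist p x ≤ ofReal (C * ‖v‖) ∧
      (A.e p - A.e x) - A.nn x (A.e p - A.e x) = v := by
  obtain ⟨c, hc⟩ := A.exists_mem_U hx₀; have hs := A.U_subset c hc; set u₀ := A.χ c x₀ with hu₀
  set e' := A.e ∘ (A.χ c).symm with he'
  have hcd : ContDiffAt ℝ 1 e' u₀ :=
    contDiffAt_comp_symm (by norm_cast) hs ((A.contMDiff_e x₀).of_le (by norm_cast))
  set L₀ := fderiv ℝ e' u₀
  have hL₀w : ∀ w, L₀ w = A.I x₀ (A.inv c x₀ w) := fun w =>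
    A.mfderiv_comp_inv hc (A.contMDiff_e.mdifferentiable (by simp) x₀) w
  let Jx : M → A.X →L[ℝ] E := fun x =>
    (ContinuousLinearMap.proj c : A.X →L[ℝ] E).comp ((A.I x).comp (A.Lam x))
  have hJ : ContinuousOn Jx K := continuousOn_const.clm_comp
    (A.continuousOn_der_Lam isOpen_univ (subset_univ _) A.contMDiff_e.contMDiffOn)
  have hJL : (Jx x₀).comp L₀ = ContinuousLinearMap.id ℝ E := by
    ext w; change A.I x₀ (A.Lam x₀ (L₀ w)) c = w
    rw [hL₀w, A.Lam_I (A.total_pos hx₀), A.I_apply hc, A.mfderiv_inv hc]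
  set B := ‖Jx x₀‖ + 1 with hB; have hB0 : 0 < B := by positivity
  set η : ℝ := 1 / (4 * B) with hη; have hη0 : 0 < η := by positivity
  have hJc := hJ x₀ hx₀
  have h1 : ∀ᶠ x in 𝓝[K] x₀, ‖Jx x‖ < B := hJc.norm.eventually_lt_const (by rw [hB]; linarith)
  have h2 : ∀ᶠ x in 𝓝[K] x₀, ‖(Jx x).comp L₀ - ContinuousLinearMap.id ℝ E‖ < 1 / 4 := by
    have h3 : ContinuousWithinAt (fun x => ‖(Jx x).comp L₀ - ContinuousLinearMap.id ℝ E‖) K x₀ :=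
      ((hJc.clm_comp continuousWithinAt_const).sub continuousWithinAt_const).norm
    refine h3.eventually_lt_const ?_; simp only [hJL, sub_self, norm_zero]; norm_num
  obtain ⟨S, hS, hSs⟩ := mem_nhdsWithin_iff_exists_mem_nhds_inter.1 (h1.and h2)
  obtain ⟨C₀, hC₀, N₀, hN₀, hd⟩ := A.exists_edist_le hx₀
  have hstrict : ∀ᶠ z : E × E in 𝓝 (u₀, u₀), ‖e' z.1 - e' z.2 - L₀ (z.1 - z.2)‖ ≤ η * ‖z.1 - z.2‖ :=
    (hasStrictFDerivAt_iff_isLittleO.1 (hcd.hasStrictFDerivAt (by simp))).def hη0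
  obtain ⟨R, hR, hRs⟩ : ∃ R ∈ 𝓝 u₀, ∀ u ∈ R, ∀ u' ∈ R,
      ‖e' u - e' u' - L₀ (u - u')‖ ≤ η * ‖u - u'‖ := by
    rw [nhds_prod_eq] at hstrict; obtain ⟨R, hR, h⟩ := (eventually_prod_self_iff' ).1 hstrict
    exact ⟨R, hR, fun u hu u' hu' => h u hu u' hu'⟩
  have hsymm : ContinuousAt (A.χ c).symm u₀ := continuousAt_extChartAt_symm'' ((A.χ c).map_source hs)
  have hN₀' : (A.χ c).symm ⁻¹' N₀ ∈ 𝓝 u₀ := hsymm.preimage_mem_nhds (by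
    rwa [hu₀, (A.χ c).left_inv hs])
  obtain ⟨ρ, hρ, hball⟩ := Metric.mem_nhds_iff.1 (inter_mem hR hN₀')
  have hLip : ∀ u ∈ ball u₀ ρ, ∀ u' ∈ ball u₀ ρ, ‖e' u - e' u'‖ ≤ (‖L₀‖ + η) * ‖u - u'‖ := by
    intro u hu u' hu'
    have h3 : e' u - e' u' = (e' u - e' u' - L₀ (u - u')) + L₀ (u - u') := by abel
    rw [h3]
    exact (norm_add_le _ _).trans ((add_le_add (hRs u (hball hu).1 u' (hball hu').1)
      (L₀.le_opNorm _)).trans (le_of_eq (by ring)))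
  refine ⟨max (C₀ * ((‖L₀‖ + η) * 2)) (8 / ρ), S ∩ (A.U c ∩ A.χ c ⁻¹' ball u₀ (ρ / 2)),
    inter_mem hS (inter_mem ((A.isOpen_U c).mem_nhds hc)
      ((continuousAt_extChartAt' hs).preimage_mem_nhds (ball_mem_nhds _ (half_pos hρ)))), ?_⟩
  rintro x ⟨hxS, hxc, hxρ⟩ hxK v hv hvC; obtain ⟨hxB, hx4⟩ := hSs ⟨hxS, hxK⟩
  have hxs := A.U_subset c hxc
  have hvρ : 2 * ‖v‖ < ρ / 2 := by
    have h3 : ‖v‖ * (8 / ρ) ≤ 1 := le_trans (by gcongr; exact le_max_right _ _) hvC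
    rw [mul_div_assoc', div_le_one hρ] at h3; linarith
  have hsub : closedBall (A.χ c x) (2 * ‖v‖) ⊆ ball u₀ ρ := by
    intro u hu; rw [Metric.mem_closedBall] at hu; rw [mem_ball]; have := mem_ball.1 hxρ
    linarith [dist_triangle u (A.χ c x) u₀]
  let F : E → E := fun u => Jx x (e' u)
  have hF : ApproximatesLinearOn F (ContinuousLinearMap.id ℝ E) (ball u₀ ρ) (1 / 2) := by
    intro u hu u' hu'
    have h3 : F u - F u' - (u - u') = Jx x (e' u - e' u' - L₀ (u - u')) +
        ((Jx x).comp L₀ - ContinuousLinearMap.id ℝ E) (u - u') := by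
      simp only [F, map_sub, sub_apply, ContinuousLinearMap.comp_apply, ContinuousLinearMap.id_apply]
      abel
    change ‖F u - F u' - (u - u')‖ ≤ _; rw [h3]
    calc _ ≤ B * (η * ‖u - u'‖) + 1 / 4 * ‖u - u'‖ := by
          refine (norm_add_le _ _).trans (add_le_add ?_ (le_of_opNorm_le _ hx4.le _))
          exact (le_of_opNorm_le _ hxB.le _).trans
            (by gcongr; exact hRs u (hball hu).1 u' (hball hu').1)
      _ = 1 / 2 * ‖u - u'‖ := by rw [hη]; field_simp; ring
      _ = _ := by simp
  let inv' : (ContinuousLinearMap.id ℝ E).NonlinearRightInverse :=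
    { toFun := id, nnnorm := 1, bound' := fun y => by simp, right_inv' := fun y => rfl }
  have hsurj := hF.surjOn_closedBall_of_nonlinearRightInverse inv' (by positivity) hsub
  have hmem : F (A.χ c x) + v c ∈ closedBall (F (A.χ c x))
      ((((inv'.nnnorm : ℝ))⁻¹ - ((1 / 2 : NNReal) : ℝ)) * (2 * ‖v‖)) := by
    rw [Metric.mem_closedBall, dist_self_add_left]
    have h3 : ((((inv'.nnnorm : ℝ))⁻¹ - ((1 / 2 : NNReal) : ℝ)) * (2 * ‖v‖)) = ‖v‖ := by
      simp only [inv', NNReal.coe_one, inv_one, NNReal.coe_div, NNReal.coe_ofNat]; ring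
    rw [h3]; exact norm_le_pi_norm v c
  obtain ⟨u, hu, hFu⟩ := hsurj hmem
  have hxe : e' (A.χ c x) = A.e x := by simp only [he', comp_apply, (A.χ c).left_inv hxs]
  have hxb : A.χ c x ∈ ball u₀ ρ := hsub (Metric.mem_closedBall_self (by positivity))
  refine ⟨(A.χ c).symm u, ?_, ?_⟩
  · have h3 := hd _ (hball (hsub hu)).2 x (by
      have := (hball hxb).2; rwa [mem_preimage, (A.χ c).left_inv hxs] at this)
    refine h3.trans (ofReal_le_ofReal ?_); have h4 := hLip _ hxb _ (hsub hu); rw [hxe] at h4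
    have h5 : ‖A.χ c x - u‖ ≤ 2 * ‖v‖ := by
      rw [← dist_eq_norm, dist_comm]; exact Metric.mem_closedBall.1 hu
    calc C₀ * ‖A.e x - A.e ((A.χ c).symm u)‖ ≤ C₀ * ((‖L₀‖ + η) * (2 * ‖v‖)) := by
          gcongr; exact h4.trans (by gcongr)
      _ = C₀ * ((‖L₀‖ + η) * 2) * ‖v‖ := by ring
      _ ≤ _ := by gcongr; exact le_max_left _ _
  · set Δ := A.e ((A.χ c).symm u) - A.e x with hΔ
    have hvI : A.I x (A.Lam x v) = v := by rw [A.nn_apply, sub_eq_zero] at hv; exact hv.symm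
    have h3 : Jx x Δ = v c := by
      have h4 : F u = Jx x (A.e ((A.χ c).symm u)) := rfl
      have h5 : F (A.χ c x) = Jx x (A.e x) := congrArg (Jx x) hxe
      rw [hΔ, map_sub, ← h4, hFu, ← h5, add_sub_cancel_left]
    have h6 : A.Lam x Δ = A.Lam x v := by
      have h7 : A.I x (A.Lam x Δ) c = A.I x (A.Lam x v) c := by rw [hvI]; exact h3
      rw [← A.inv_I hxc (A.Lam x Δ), h7, A.inv_I hxc]
    rw [A.nn_apply, h6, hvI, sub_sub_cancel]

lemma eventually_param (hK : IsCompact K) :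
    ∀ᶠ C in atTop, ∀ᶠ r in 𝓝[>] (0 : ℝ), ∀ x ∈ K, ∀ v, A.nn x v = 0 → ‖v‖ ≤ r →
      ∃ p, edist p x ≤ ofReal (C * ‖v‖) ∧ (A.e p - A.e x) - A.nn x (A.e p - A.e x) = v := by
  have := eventually_uniform hK (Q := fun x C _ =>
    ∀ v, A.nn x v = 0 → ‖v‖ * C ≤ 1 → ∃ p, edist p x ≤ ofReal (C * ‖v‖) ∧
      (A.e p - A.e x) - A.nn x (A.e p - A.e x) = v) ?_ fun x₀ hx₀ => A.exists_param hx₀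
  · filter_upwards [this, eventually_gt_atTop 0] with C hC hC0
    filter_upwards [hC, Ioc_mem_nhdsGT (inv_pos.2 hC0)] with r hr hrC x hx v hv hvr
    refine hr x hx v hv ?_
    calc ‖v‖ * C ≤ C⁻¹ * C := by gcongr; exact hvr.trans hrC.2
      _ = 1 := inv_mul_cancel₀ hC0.ne'
  · intro x C C' _ _ hC _ h v hv hvC; obtain ⟨p, hp, hpv⟩ := h v hv (le_trans (by gcongr) hvC)
    exact ⟨p, hp.trans (ofReal_le_ofReal (by gcongr)), hpv⟩

end ChartCover

/-! ### The invariant splitting -/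

/-- A `C¹` map with values in an immersed manifold, continuous as a map into it, has its
derivatives tangent to it. -/
lemma exists_bder_eq [IsManifold J 1 N] {f f₁ : N → V} (hf : ContMDiff J ℐ V 2 f) {g : N → N} {a₀ : N}
    (hf₁ : MDifferentiableAt J ℐ V f₁ a₀) (hg : ContinuousAt g a₀) (hfg : ∀ a, f₁ a = f (g a))
    (himm : Injective (bder J f (g a₀))) (w : EA) : ∃ w', bder J f (g a₀) w' = bder J f₁ a₀ w := by
  set L₀ := bder J f (g a₀)
  obtain ⟨R, hR⟩ := LinearMap.exists_leftInverse_of_injective L₀.toLinearMap (ker_eq_bot.2 himm)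
  have hRL : ∀ w, R (L₀ w) = w := fun w => congrArg (fun l : EA →ₗ[ℝ] EA => l w) hR
  let q : V →L[ℝ] V := 1 - L₀.comp R.toContinuousLinearMap
  have hq : ∀ v, q v = v - L₀ (R v) := fun v => rfl
  have hqL : ∀ w, q (L₀ w) = 0 := fun w => by rw [hq, hRL, sub_self]
  set κ := ‖R.toContinuousLinearMap‖ + 1; have hκ0 : 0 < κ := by positivity
  have hκ' : ∀ w, ‖w‖ ≤ κ * ‖L₀ w‖ := fun w => by
    simpa [hRL] using R.toContinuousLinearMap.le_of_opNorm_le (lt_add_one _).le (L₀ w)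
  set φ := extChartAt J a₀
  have hd : HasFDerivWithinAt (f₁ ∘ φ.symm) (bder J f₁ a₀) (range J) (φ a₀) := hf₁.hasMFDerivAt.2
  have hsymm : Tendsto φ.symm (𝓝[range J] (φ a₀)) (𝓝 a₀) := by
    have := (continuousAt_extChartAt_symm (I := J) a₀).tendsto; rw [extChartAt_to_inv] at this
    exact this.mono_left nhdsWithin_le_nhds
  have hzero : HasFDerivWithinAt (q ∘ f₁ ∘ φ.symm) (0 : EA →L[ℝ] V) (range J) (φ a₀) := by
    obtain ⟨L, hL⟩ := hd.isBigO_sub.bound; rw [hasFDerivWithinAt_iff_isLittleO]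
    refine Asymptotics.isLittleO_iff.2 fun ε hε => ?_; set B := ‖q‖ + 1; set L' := |L| + 1 with hL'
    let η : ℝ := min (1 / (2 * κ)) (ε / (2 * κ * B * L'))
    obtain ⟨U, hU, hest⟩ := exists_strict_estimate hf (g a₀)
      (show 0 < η from lt_min (by positivity) (by positivity))
    have hκη : κ * η ≤ 1 / 2 := by
      calc κ * η ≤ κ * (1 / (2 * κ)) := by gcongr; exact min_le_left _ _
        _ = 1 / 2 := by field_simp
    filter_upwards [hL, hsymm (hg.preimage_mem_nhds hU)] with v hv hvU
    have h0 : φ.symm (φ a₀) = a₀ := extChartAt_to_inv a₀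
    obtain ⟨u, hu⟩ := hest (g a₀) (mem_of_mem_nhds hU) (g (φ.symm v)) hvU; rw [← hfg, ← hfg] at hu
    simp only [comp_apply, h0] at hv ⊢; set Δ := f₁ (φ.symm v) - f₁ a₀ with hΔ
    change ‖Δ - L₀ u‖ ≤ _ at hu
    have hun : ‖u‖ ≤ 2 * κ * ‖Δ‖ := by
      have h4 : ‖L₀ u‖ ≤ ‖Δ‖ + η * ‖u‖ := by linarith [norm_le_insert Δ (L₀ u)]
      have h5 := hκ' u; have h6 : κ * ‖L₀ u‖ ≤ κ * (‖Δ‖ + η * ‖u‖) := by gcongr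
      have h7 : κ * η * ‖u‖ ≤ 1 / 2 * ‖u‖ := by gcongr
      nlinarith
    have e1 : q (f₁ (φ.symm v)) - q (f₁ a₀) - (0 : EA →L[ℝ] V) (v - φ a₀) = q (Δ - L₀ u) := by
      rw [map_sub q Δ, hqL, hΔ, map_sub q, zero_apply, sub_zero]
    rw [e1]
    have hLv : ‖Δ‖ ≤ L' * ‖v - φ a₀‖ := hv.trans (by gcongr; rw [hL']; linarith [le_abs_self L])
    calc ‖q (Δ - L₀ u)‖ ≤ B * (η * ‖u‖) :=
          (q.le_of_opNorm_le (lt_add_one _).le _).trans (by gcongr)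
      _ ≤ B * (η * (2 * κ * (L' * ‖v - φ a₀‖))) := by gcongr; exact hun.trans (by gcongr)
      _ = (2 * κ * B * L') * η * ‖v - φ a₀‖ := by ring
      _ ≤ (2 * κ * B * L') * (ε / (2 * κ * B * L')) * ‖v - φ a₀‖ := by
          gcongr; exact min_le_right _ _
      _ = ε * ‖v - φ a₀‖ := by rw [mul_div_cancel₀ _ (by positivity)]
  have h1 : HasFDerivWithinAt (q ∘ f₁ ∘ φ.symm) (q.comp (bder J f₁ a₀)) (range J) (φ a₀) :=
    q.hasFDerivAt.comp_hasFDerivWithinAt _ hd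
  have hu : UniqueDiffWithinAt ℝ (range J) (φ a₀) := J.uniqueDiffOn _ (mem_range_self _)
  have h2 : q (bder J f₁ a₀ w) = 0 := congrArg (fun l : EA →L[ℝ] V => l w) (hu.eq h1 hzero)
  exact ⟨R (bder J f₁ a₀ w), by rw [hq, sub_eq_zero] at h2; exact h2.symm⟩

/-- The derivative of a map between manifolds, as a map between the model spaces. -/
def tder {EA HA N E M : Type*} [NormedAddCommGroup EA] [NormedSpace ℝ EA]
    [TopologicalSpace HA] (J : ModelWithCorners ℝ EA HA) [TopologicalSpace N] [ChartedSpace HA N]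
    [NormedAddCommGroup E] [NormedSpace ℝ E] [TopologicalSpace M] [ChartedSpace E M]
    (f : N → M) (a : N) : EA →L[ℝ] E := mfderiv J ℐ E f a

section

variable [EMetricSpace M] [ChartedSpace E M] [IsManifold ℐ E ∞ M]
  {T : OpenPartialHomeomorph M M} {ι : N → M} {α lam : ℝ}

/-- The projections `s`, `c`, `u` onto the contracted, the centre and the expanded subspace along
an invariant manifold, with the norms for which the rates hold. -/
structure Splitting (E : Type*) [NormedAddCommGroup E] [NormedSpace ℝ E]
    {M : Type*} [TopologicalSpace M] [ChartedSpace E M] [IsManifold ℐ E ∞ M]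
    {EA HA N : Type*} [NormedAddCommGroup EA] [NormedSpace ℝ EA]
    [TopologicalSpace HA] [TopologicalSpace N] [ChartedSpace HA N]
    (J : ModelWithCorners ℝ EA HA) (T : OpenPartialHomeomorph M M) (ι : N → M) (α lam : ℝ) where
  s : M → E →L[ℝ] E
  c : M → E →L[ℝ] E
  u : M → E →L[ℝ] E
  ν : M → Seminorm ℝ E
  one_lt : 1 < α
  lam_pos : 0 < lam
  gap : α ^ 2 * lam < 1
  source : range ι ⊆ T.source
  image : T '' range ι = range ι
  add : ∀ x ∈ range ι, ∀ w, s x w + c x w + u x w = w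
  s_apply : ∀ x ∈ range ι, ∀ a b d, s x (s x a + c x b + u x d) = s x a
  c_apply : ∀ x ∈ range ι, ∀ a b d, c x (s x a + c x b + u x d) = c x b
  u_apply : ∀ x ∈ range ι, ∀ a b d, u x (s x a + c x b + u x d) = u x d
  s_T : ∀ x ∈ range ι, ∀ w, s (T x) (tder ℐ E T x w) = tder ℐ E T x (s x w)
  c_T : ∀ x ∈ range ι, ∀ w, c (T x) (tder ℐ E T x w) = tder ℐ E T x (c x w)
  u_T : ∀ x ∈ range ι, ∀ w, u (T x) (tder ℐ E T x w) = tder ℐ E T x (u x w)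
  ν_pos : ∀ x ∈ range ι, ∀ w, ν x w = 0 → w = 0
  ν_cont : ContinuousOn (fun p : TangentBundle ℐ E M => ν p.1 p.2) {p | p.1 ∈ range ι}
  s_rate : ∀ x ∈ range ι, ∀ w, s x w = w → w ≠ 0 → ν (T x) (tder ℐ E T x w) < lam * ν x w
  c_rate : ∀ x ∈ range ι, ∀ w, c x w = w → ν (T x) (tder ℐ E T x w) ≤ α * ν x w
  c_rate' : ∀ x ∈ range ι, ∀ w, c x w = w → ν x w ≤ α * ν (T x) (tder ℐ E T x w)
  u_rate : ∀ x ∈ range ι, ∀ w, u x w = w → w ≠ 0 → ν x w < lam * ν (T x) (tder ℐ E T x w)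
  c_ι : ∀ a w, c (ι a) (tder J ι a w) = tder J ι a w
  exists_ι : ∀ a w, ∃ w', tder J ι a w' = c (ι a) w
  exists_s : ∃ P : M → E →L[ℝ] E, ContinuousOn
    (fun p : TangentBundle ℐ E M => (⟨p.1, P p.1 p.2⟩ : TangentBundle ℐ E M))
      {p | p.1 ∈ range ι} ∧
    ∀ x ∈ range ι, (∀ w, s x (P x w) = P x w) ∧ ∀ w, P x (s x w) = s x w
  exists_u : ∃ P : M → E →L[ℝ] E, ContinuousOn
    (fun p : TangentBundle ℐ E M => (⟨p.1, P p.1 p.2⟩ : TangentBundle ℐ E M))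
      {p | p.1 ∈ range ι} ∧
    ∀ x ∈ range ι, (∀ w, u x (P x w) = P x w) ∧ ∀ w, P x (u x w) = u x w

namespace Splitting

lemma tder_symm_tder (hT : IsSmoothDiffeo (E := E) T) {x : M} (hx : x ∈ T.source) (w : E) :
    tder ℐ E T.symm (T x) (tder ℐ E T x w) = w := by
  have h1 : MDiffAt T x :=
    (hT.1.contMDiffAt (T.open_source.mem_nhds hx)).mdifferentiableAt (by simp)
  have h2 : MDiffAt T.symm (T x) :=
    (hT.2.contMDiffAt (T.open_target.mem_nhds (T.map_source hx))).mdifferentiableAt (by simp)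
  have h3 := (h2.hasMFDerivAt.comp x h1.hasMFDerivAt).mfderiv
  exact congrArg (fun L : E →L[ℝ] E => L w) (h3.symm.trans
    ((EventuallyEq.mfderiv_eq (f := id) (T.eventually_left_inverse hx)).trans
    (mfderiv_id (I := ℐ E) (x := x))))

lemma tder_tder_symm (hT : IsSmoothDiffeo (E := E) T) {x : M} (hx : x ∈ T.source) (w : E) :
    tder ℐ E T x (tder ℐ E T.symm (T x) w) = w := by
  have h := tder_symm_tder (E := E) (T := T.symm) ⟨hT.2, hT.1⟩ (T.map_source hx) w
  simp only [OpenPartialHomeomorph.symm_symm, T.left_inv hx] at h; exact h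

/-- The splitting for the inverse map. -/
def symm (S : Splitting E J T ι α lam) (hT : IsSmoothDiffeo (E := E) T) :
    Splitting E J T.symm ι α lam := by
  have r : ∀ a b d : E, a + b + d = d + b + a := fun _ _ _ => by abel
  have hsurj : ∀ y ∈ range ι, ∃ x ∈ range ι, T x = y := fun y hy => by
    rw [← S.image] at hy; exact hy
  have key : ∀ {q : M → E →L[ℝ] E}, (∀ x ∈ range ι, ∀ w, q (T x) (tder ℐ E T x w) =
      tder ℐ E T x (q x w)) → ∀ y ∈ range ι, ∀ w,
      q (T.symm y) (tder ℐ E T.symm y w) = tder ℐ E T.symm y (q y w) := by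
    rintro q hq y hy w; obtain ⟨x, hx, rfl⟩ := hsurj y hy; have hxs := S.source hx
    have h1 := hq x hx (tder ℐ E T.symm (T x) w); rw [tder_tder_symm hT hxs] at h1
    rw [h1, tder_symm_tder hT hxs, T.left_inv hxs]
  have rate : ∀ {q : M → E →L[ℝ] E} {P : ℝ → ℝ → Prop}, (∀ x ∈ range ι, ∀ w,
      q (T x) (tder ℐ E T x w) = tder ℐ E T x (q x w)) →
      (∀ x ∈ range ι, ∀ w, q x w = w → w ≠ 0 → P (S.ν x w) (S.ν (T x) (tder ℐ E T x w))) →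
      ∀ y ∈ range ι, ∀ w, q y w = w → w ≠ 0 →
        P (S.ν (T.symm y) (tder ℐ E T.symm y w)) (S.ν y w) := by
    rintro q P hq h y hy w hw h0; obtain ⟨x, hx, rfl⟩ := hsurj y hy; have hxs := S.source hx
    have h1 := key hq (T x) hy w; rw [hw, T.left_inv hxs] at h1
    have h2 := h x hx _ h1 (fun h => h0 (by
      have := tder_tder_symm hT hxs w; rw [h, map_zero] at this; exact this.symm))
    rw [tder_tder_symm hT hxs] at h2; rwa [T.left_inv hxs]
  refine
  { s := S.u, c := S.c, u := S.s, ν := S.ν, one_lt := S.one_lt, lam_pos := S.lam_pos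
    gap := S.gap, source := fun y hy => ?_
    image := ?_
    add := fun x hx w => by rw [r]; exact S.add x hx w
    s_apply := fun x hx a b d => by rw [r]; exact S.u_apply x hx d b a
    c_apply := fun x hx a b d => by rw [r]; exact S.c_apply x hx d b a
    u_apply := fun x hx a b d => by rw [r]; exact S.s_apply x hx d b a
    s_T := key S.u_T, c_T := key S.c_T, u_T := key S.s_T
    ν_pos := S.ν_pos, ν_cont := S.ν_cont
    s_rate := rate (P := fun a b => a < lam * b) S.u_T S.u_rate
    c_rate := fun y hy w hw => ?_
    c_rate' := fun y hy w hw => ?_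
    u_rate := rate (P := fun a b => b < lam * a) S.s_T S.s_rate
    c_ι := S.c_ι, exists_ι := S.exists_ι, exists_s := S.exists_u, exists_u := S.exists_s }
  · obtain ⟨x, hx, rfl⟩ := hsurj y hy; exact T.map_source (S.source hx)
  · ext y; constructor
    · rintro ⟨z, hz, rfl⟩; obtain ⟨x, hx, rfl⟩ := hsurj z hz; rwa [T.left_inv (S.source hx)]
    · intro hy; refine ⟨T y, ?_, T.left_inv (S.source hy)⟩
      rw [← S.image]; exact mem_image_of_mem _ hy
  · exact (eq_or_ne w 0).elim (by rintro rfl; simp) (rate (P := fun a b => a ≤ α * b) S.c_T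
      (fun x hx w hw _ => S.c_rate' x hx w hw) y hy w hw)
  · exact (eq_or_ne w 0).elim (by rintro rfl; simp) (rate (P := fun a b => b ≤ α * a) S.c_T
      (fun x hx w hw _ => S.c_rate x hx w hw) y hy w hw)

lemma maps (S : Splitting E J T ι α lam) {x : M} (hx : x ∈ range ι) : T x ∈ range ι := by
  rw [← S.image]; exact mem_image_of_mem _ hx

end Splitting

lemma bder_comp {G : M → W} {f : N → M} {a : N} (hG : MDiffAt G (f a))
    (hf : MDifferentiableAt J ℐ E f a) (w : EA) :
    bder J (fun b => G (f b)) a w = der G (f a) (tder (E := E) J f a w) := by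
  exact congrArg (fun L : EA →L[ℝ] W => L w) (hG.hasMFDerivAt.comp a hf.hasMFDerivAt).mfderiv

lemma tder_comp {f : N → M} {a : N} (hT : MDiffAt T (f a))
    (hf : MDifferentiableAt J ℐ E f a) (w : EA) :
    tder (E := E) J (fun b => T (f b)) a w = tder ℐ E T (f a) (tder (E := E) J f a w) := by
  exact congrArg (fun L : EA →L[ℝ] E => L w) (hT.hasMFDerivAt.comp a hf.hasMFDerivAt).mfderiv

/-- The tangent spaces of an invariant manifold are invariant. -/
lemma exists_tder_eq [IsManifold J 1 N] [CompactSpace N] (hT : IsSmoothDiffeo (E := E) T)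
    (hι : ContMDiff J ℐ E 2 ι) (hemb : IsEmbedding ι) (himm : ∀ a, Injective (tder (E := E) J ι a))
    (hsource : range ι ⊆ T.source) (himage : T '' range ι = range ι) (a : N) (w : EA) :
    ∃ b, ι b = T (ι a) ∧ ∃ w', tder (E := E) J ι b w' = tder ℐ E T (ι a) (tder (E := E) J ι a w) := by
  obtain ⟨A⟩ := ChartCover.exists_of_isCompact (E := E) (isCompact_range hemb.continuous)
  choose g hg using fun b => himage.le (mem_image_of_mem T (mem_range_self b))
  have hgc : Continuous g := by
    rw [hemb.isInducing.continuous_iff]; rw [show ι ∘ g = T ∘ ι from funext hg]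
    exact T.continuousOn.comp_continuous hemb.continuous fun b => hsource (mem_range_self b)
  have he : ∀ p, MDifferentiableAt ℐ E ℐ A.X A.e p := A.contMDiff_e.mdifferentiable (by simp)
  have hιd : ∀ b, MDifferentiableAt J ℐ E ι b := hι.mdifferentiable (by simp)
  have hTd : MDiffAt T (ι a) :=
    (hT.1.contMDiffAt (T.open_source.mem_nhds (hsource (mem_range_self a)))).mdifferentiableAt
      (by simp)
  have hTι : MDifferentiableAt J ℐ E (fun b => T (ι b)) a := hTd.comp a (hιd a)
  have hpos : ∀ b, 0 < A.total (ι b) := fun b => A.total_pos (mem_range_self b)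
  have hf : ContMDiff J ℐ A.X 2 (fun b => A.e (ι b)) :=
    (A.contMDiff_e.of_le (by norm_cast)).comp hι
  have hbd : ∀ b w, bder J (fun b => A.e (ι b)) b w = A.I (ι b) (tder (E := E) J ι b w) :=
    fun b => bder_comp (he _) (hιd b)
  obtain ⟨w', hw'⟩ := exists_bder_eq (f₁ := fun b => A.e (T (ι b))) (a₀ := a) hf
    ((he _).comp a hTι) hgc.continuousAt (fun b => by rw [hg])
    (fun v w h => himm _ (A.I_injective (hpos _) (by rwa [hbd, hbd] at h))) w
  refine ⟨g a, hg a, w', ?_⟩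
  have h1 : bder J (fun b => A.e (T (ι b))) a w = A.I (T (ι a)) (tder (E := E) J (fun b => T (ι b)) a w) :=
    bder_comp (f := fun b => T (ι b)) (he _) hTι w
  rw [hbd, h1, tder_comp hTd (hιd a), hg] at hw'; refine A.I_injective ?_ hw'
  rw [← hg]; exact hpos _

/-- A symmetrically normally hyperbolic manifold has an invariant splitting. -/
lemma exists_splitting [IsManifold J 1 N] [CompactSpace N] (hT : IsSmoothDiffeo (E := E) T)
    (hι : ContMDiff J ℐ E 2 ι) (hemb : IsEmbedding ι) (himm : ∀ a, Injective (tder (E := E) J ι a))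
    (h : IsSymmetricallyNormallyHyperbolic (E := E) J T ι α lam) :
    Nonempty (Splitting E J T ι α lam) := by
  obtain ⟨h1α, hlam, -, hgap, hsource, himage, Ns', Nu', ν', hNs, hNu, hν, hsum', hinv, hc, hs, hu⟩ := h
  let Ns : M → Submodule ℝ E := Ns'; let Nu : M → Submodule ℝ E := Nu'
  let ν : M → Seminorm ℝ E := ν'
  have hsum : ∀ a, IsDirectSum₃ (Ns (ι a)) (Nu (ι a)) (tder (E := E) J ι a).range :=
    fun a => (hsum' a).1
  choose s₀ u₀ c₀ hs₀ hu₀ hc₀ hadd hproj using fun a => exists_projections (hsum a)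
  have hinj := hemb.injective; let s : M → E →L[ℝ] E := Function.extend ι s₀ 0
  let u : M → E →L[ℝ] E := Function.extend ι u₀ 0; let c : M → E →L[ℝ] E := Function.extend ι c₀ 0
  have es : ∀ a, s (ι a) = s₀ a := hinj.extend_apply s₀ 0
  have eu : ∀ a, u (ι a) = u₀ a := hinj.extend_apply u₀ 0
  have ec : ∀ a, c (ι a) = c₀ a := hinj.extend_apply c₀ 0
  have hsT : ∀ a, ∀ w ∈ Ns (ι a), tder ℐ E T (ι a) w ∈ Ns (T (ι a)) := fun a w hw =>
    (hinv (ι a) (mem_range_self a)).1.le (Submodule.mem_map_of_mem hw)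
  have huT : ∀ a, ∀ w ∈ Nu (ι a), tder ℐ E T (ι a) w ∈ Nu (T (ι a)) := fun a w hw =>
    (hinv (ι a) (mem_range_self a)).2.le (Submodule.mem_map_of_mem hw)
  have hs' : ∀ a, ∀ w ∈ Ns (ι a), s₀ a w = w := fun a w hw => by
    simpa using (hproj a w hw 0 (zero_mem _) 0 (zero_mem _)).1
  have hu' : ∀ a, ∀ w ∈ Nu (ι a), u₀ a w = w := fun a w hw => by
    simpa using (hproj a 0 (zero_mem _) w hw 0 (zero_mem _)).2.1
  have hc' : ∀ a, ∀ w ∈ (tder (E := E) J ι a).range, c₀ a w = w := fun a w hw => by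
    simpa using (hproj a 0 (zero_mem _) 0 (zero_mem _) w hw).2.2
  have hp : ∀ a w₁ w₂ w₃, s₀ a (s₀ a w₁ + c₀ a w₂ + u₀ a w₃) = s₀ a w₁ ∧
      u₀ a (s₀ a w₁ + c₀ a w₂ + u₀ a w₃) = u₀ a w₃ ∧
      c₀ a (s₀ a w₁ + c₀ a w₂ + u₀ a w₃) = c₀ a w₂ := fun a w₁ w₂ w₃ => by
    rw [add_right_comm]; exact hproj a _ (hs₀ a _) _ (hu₀ a _) _ (hc₀ a _)
  have hT' : ∀ a w, s (T (ι a)) (tder ℐ E T (ι a) w) = tder ℐ E T (ι a) (s (ι a) w) ∧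
      u (T (ι a)) (tder ℐ E T (ι a) w) = tder ℐ E T (ι a) (u (ι a) w) ∧
      c (T (ι a)) (tder ℐ E T (ι a) w) = tder ℐ E T (ι a) (c (ι a) w) := by
    intro a w; obtain ⟨z, hz⟩ := hc₀ a w
    obtain ⟨b, hb, z', hz'⟩ := exists_tder_eq hT hι hemb himm hsource himage a z
    have h1 := hsT a _ (hs₀ a w); have h2 := huT a _ (hu₀ a w)
    have h3 : tder ℐ E T (ι a) (c₀ a w) ∈ (tder (E := E) J ι b).range :=
      ⟨z', hz'.trans (congrArg _ hz)⟩
    rw [← hb] at h1 h2; have h4 := hproj b _ h1 _ h2 _ h3; rw [← map_add, ← map_add, hadd] at h4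
    rw [← hb, es, eu, ec, es, eu, ec]; exact h4
  obtain ⟨Ps', hPs, hPs'⟩ := hNs; obtain ⟨Pu', hPu, hPu'⟩ := hNu; let Ps : M → E →L[ℝ] E := Ps'
  let Pu : M → E →L[ℝ] E := Pu'
  refine ⟨
  { s, c, u, ν, one_lt := h1α, lam_pos := hlam, gap := hgap, source := hsource, image := himage,
    add := ?_, s_apply := ?_, c_apply := ?_, u_apply := ?_,
    s_T := ?_, c_T := ?_, u_T := ?_,
    ν_pos := hν.2, ν_cont := hν.1,
    s_rate := ?_, c_rate := ?_, c_rate' := ?_, u_rate := ?_,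
    c_ι := fun a w => by rw [ec]; exact hc' a _ ⟨w, rfl⟩,
    exists_ι := fun a w => by rw [ec]; exact hc₀ a w,
    exists_s := ⟨Ps, hPs, ?_⟩, exists_u := ⟨Pu, hPu, ?_⟩ }⟩
  all_goals rintro _ ⟨a, rfl⟩
  · intro w; rw [es, eu, ec, add_right_comm]; exact hadd a w
  · rw [es, eu, ec]; exact fun w₁ w₂ w₃ => (hp a w₁ w₂ w₃).1
  · rw [es, eu, ec]; exact fun w₁ w₂ w₃ => (hp a w₁ w₂ w₃).2.2
  · rw [es, eu, ec]; exact fun w₁ w₂ w₃ => (hp a w₁ w₂ w₃).2.1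
  · exact fun w => (hT' a w).1
  · exact fun w => (hT' a w).2.2
  · exact fun w => (hT' a w).2.1
  · rw [es]; exact fun w hw => hs _ (mem_range_self a) w (hw ▸ hs₀ a w)
  · rw [ec]; exact fun w hw => (eq_or_ne w 0).elim (by rintro rfl; simp) fun h0 =>
      (hc a w (hw ▸ hc₀ a w) h0).1.le
  · rw [ec]; exact fun w hw => (eq_or_ne w 0).elim (by rintro rfl; simp) fun h0 =>
      (hc a w (hw ▸ hc₀ a w) h0).2.le
  · rw [eu]; exact fun w hw => hu _ (mem_range_self a) w (hw ▸ hu₀ a w)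
  · rw [es]
    exact ⟨fun w => hs' a _ ((hPs' _ (mem_range_self a)).1 w),
      fun w => (hPs' _ (mem_range_self a)).2 _ (hs₀ a w)⟩
  · rw [eu]
    exact ⟨fun w => hu' a _ ((hPu' _ (mem_range_self a)).1 w),
      fun w => (hPu' _ (mem_range_self a)).2 _ (hu₀ a w)⟩

/-! ### From the splitting to a hyperbolic system in linear coordinates -/

/-- A field of endomorphisms of the tangent spaces, extended to the ambient vector space. -/
def ChartCover.lift {E : Type*} [NormedAddCommGroup E] [NormedSpace ℝ E]
    [FiniteDimensional ℝ E] {M : Type*} [TopologicalSpace M] [ChartedSpace E M] {K : Set M}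
    (A : ChartCover E K) (q : M → E →L[ℝ] E) (x : M) : A.X →L[ℝ] A.X :=
  (A.I x).comp ((q x).comp (A.Lam x))

namespace Splitting

lemma s_s (S : Splitting E J T ι α lam) {x : M} (hx : x ∈ range ι) (w : E) :
    S.s x (S.s x w) = S.s x w := by simpa using S.s_apply x hx w 0 0

lemma c_c (S : Splitting E J T ι α lam) {x : M} (hx : x ∈ range ι) (w : E) :
    S.c x (S.c x w) = S.c x w := by simpa using S.c_apply x hx 0 w 0

lemma u_u (S : Splitting E J T ι α lam) {x : M} (hx : x ∈ range ι) (w : E) :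
    S.u x (S.u x w) = S.u x w := by simpa using S.u_apply x hx 0 0 w

lemma s_c (S : Splitting E J T ι α lam) {x : M} (hx : x ∈ range ι) (w : E) :
    S.s x (S.c x w) = 0 := by simpa using S.s_apply x hx 0 w 0

lemma s_u (S : Splitting E J T ι α lam) {x : M} (hx : x ∈ range ι) (w : E) :
    S.s x (S.u x w) = 0 := by simpa using S.s_apply x hx 0 0 w

lemma c_s (S : Splitting E J T ι α lam) {x : M} (hx : x ∈ range ι) (w : E) :
    S.c x (S.s x w) = 0 := by simpa using S.c_apply x hx w 0 0

lemma c_u (S : Splitting E J T ι α lam) {x : M} (hx : x ∈ range ι) (w : E) :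
    S.c x (S.u x w) = 0 := by simpa using S.c_apply x hx 0 0 w

lemma u_s (S : Splitting E J T ι α lam) {x : M} (hx : x ∈ range ι) (w : E) :
    S.u x (S.s x w) = 0 := by simpa using S.u_apply x hx w 0 0

lemma u_c (S : Splitting E J T ι α lam) {x : M} (hx : x ∈ range ι) (w : E) :
    S.u x (S.c x w) = 0 := by simpa using S.u_apply x hx 0 w 0

end Splitting

namespace ChartCover

variable {K : Set M} (A : ChartCover E K) {q : M → E →L[ℝ] E} {x : M}

lemma lift_apply (v : A.X) : A.lift q x v = A.I x (q x (A.Lam x v)) := rfl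

lemma lift_I (hx : x ∈ K) (w : E) : A.lift q x (A.I x w) = A.I x (q x w) := by
  rw [A.lift_apply, A.Lam_I (A.total_pos hx)]

lemma Lam_lift (hx : x ∈ K) (v : A.X) : A.Lam x (A.lift q x v) = q x (A.Lam x v) := by
  rw [A.lift_apply, A.Lam_I (A.total_pos hx)]

lemma nn_lift (hx : x ∈ K) (v : A.X) : A.nn x (A.lift q x v) = 0 := A.nn_I hx _

lemma lift_nn (hx : x ∈ K) (v : A.X) : A.lift q x (A.nn x v) = 0 := by
  rw [A.lift_apply, A.Lam_nn hx, map_zero, map_zero]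

set_option maxHeartbeats 400000 in
lemma continuousOn_lift
    (hq : ContinuousOn (fun p : TangentBundle ℐ E M => (⟨p.1, q p.1 p.2⟩ : TangentBundle ℐ E M))
      {p | p.1 ∈ K}) :
    ContinuousOn (A.lift q) K :=
  A.continuousOn_of_glue (L := fun x => (A.I x).comp (q x))
    ((continuousOn_der isOpen_univ A.contMDiff_e.contMDiffOn).comp hq fun _ _ => trivial)
    fun _ _ _ => rfl

end ChartCover

namespace Splitting

variable (S : Splitting E J T ι α lam) (A : ChartCover E (range ι))

lemma bder_e (hι : ContMDiff J ℐ E 2 ι) (a : N) (w : EA) :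
    bder J (fun b => A.e (ι b)) a w = A.I (ι a) (tder (E := E) J ι a w) :=
  bder_comp (A.contMDiff_e.mdifferentiable (by simp) _) (hι.mdifferentiable (by simp) _) w

lemma injective_bder_e (hι : ContMDiff J ℐ E 2 ι) (himm : ∀ a, Injective (tder (E := E) J ι a))
    (a : N) : Injective (bder J (fun b => A.e (ι b)) a) := fun v w h => by
  rw [bder_e A hι, bder_e A hι] at h
  exact himm _ (A.I_injective (A.total_pos (mem_range_self a)) h)

lemma contMDiff_e_comp (hι : ContMDiff J ℐ E 2 ι) :
    ContMDiff J ℐ A.X 2 (fun b => A.e (ι b)) :=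
  (A.contMDiff_e.of_le (by norm_cast)).comp hι

/-- The projections of the splitting, in the coordinates. -/
lemma continuousOn_lift [IsManifold J 1 N] (hι : ContMDiff J ℐ E 2 ι) (hemb : IsEmbedding ι)
    (himm : ∀ a, Injective (tder (E := E) J ι a)) :
    ContinuousOn (A.lift S.s) (range ι) ∧ ContinuousOn (A.lift S.c) (range ι) ∧
      ContinuousOn (A.lift S.u) (range ι) := by
  let q : Fin 4 → M → A.X →L[ℝ] A.X := ![A.lift S.s, A.lift S.c, A.lift S.u, A.nn]
  have key := continuousOn_projections (s := range ι) (q := q) ?_ ?_ ?_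
  · exact ⟨key 0, key 1, key 2⟩
  · intro x hx; rw [Fin.sum_univ_four]
    ext1 v
    change A.lift S.s x v + A.lift S.c x v + A.lift S.u x v + A.nn x v = v
    rw [A.lift_apply, A.lift_apply, A.lift_apply, ← map_add, ← map_add, S.add x hx, A.nn_apply,
      add_sub_cancel]
  · intro x hx i j v hij
    have h0 : ∀ {p p' : M → E →L[ℝ] E}, (∀ w, p x (p' x w) = 0) →
        A.lift p x (A.lift p' x v) = 0 := by
      intro p p' h; rw [A.lift_apply, A.Lam_lift hx, h, map_zero]
    fin_cases i <;> fin_cases j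
    · exact absurd rfl hij
    · exact h0 (p := S.c) (p' := S.s) (S.c_s hx)
    · exact h0 (p := S.u) (p' := S.s) (S.u_s hx)
    · exact A.nn_lift hx v
    · exact h0 (p := S.s) (p' := S.c) (S.s_c hx)
    · exact absurd rfl hij
    · exact h0 (p := S.u) (p' := S.c) (S.u_c hx)
    · exact A.nn_lift hx v
    · exact h0 (p := S.s) (p' := S.u) (S.s_u hx)
    · exact h0 (p := S.c) (p' := S.u) (S.c_u hx)
    · exact absurd rfl hij
    · exact A.nn_lift hx v
    · exact A.lift_nn hx v
    · exact A.lift_nn hx v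
    · exact A.lift_nn hx v
    · exact absurd rfl hij
  · have hlift : ∀ {p : M → E →L[ℝ] E} (x₀ : M), x₀ ∈ range ι → (∃ P : M → E →L[ℝ] E, ContinuousOn
        (fun p : TangentBundle ℐ E M => (⟨p.1, P p.1 p.2⟩ : TangentBundle ℐ E M))
          {p | p.1 ∈ range ι} ∧
        ∀ x ∈ range ι, (∀ w, p x (P x w) = P x w) ∧ ∀ w, P x (p x w) = p x w) →
        ∃ P' : M → A.X →L[ℝ] A.X, ContinuousWithinAt P' (range ι) x₀ ∧
          (∀ x ∈ range ι, ∀ v, A.lift p x (P' x v) = P' x v) ∧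
          ∀ v, P' x₀ (A.lift p x₀ v) = A.lift p x₀ v := by
      rintro p x₀ hx₀ ⟨P, hP, hPp⟩
      refine ⟨A.lift P, A.continuousOn_lift hP x₀ hx₀, fun x hx v => ?_, fun v => ?_⟩
      · rw [A.lift_apply (q := p), A.Lam_lift hx, (hPp x hx).1, A.lift_apply]
      · rw [A.lift_apply (q := P), A.Lam_lift hx₀, (hPp x₀ hx₀).2, A.lift_apply]
    rintro _ ⟨a₀, rfl⟩ i; have hx₀ : ι a₀ ∈ range ι := mem_range_self a₀
    have h1 := hlift (ι a₀) hx₀ S.exists_s; have h3 := hlift (ι a₀) hx₀ S.exists_u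
    have h2 : ∃ P' : M → A.X →L[ℝ] A.X, ContinuousWithinAt P' (range ι) (ι a₀) ∧
          (∀ x ∈ range ι, ∀ v, A.lift S.c x (P' x v) = P' x v) ∧
          ∀ v, P' (ι a₀) (A.lift S.c (ι a₀) v) = A.lift S.c (ι a₀) v := by
      obtain ⟨p, hp, hpr, hp0⟩ := exists_frame hemb (contMDiff_e_comp A hι) a₀
        (injective_bder_e A hι himm a₀)
      refine ⟨p, hp, ?_, fun v => ?_⟩
      · rintro _ ⟨a, rfl⟩ v; obtain ⟨w, hw⟩ := hpr a v
        rw [← hw, bder_e A hι, A.lift_I (mem_range_self a), S.c_ι]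
      · obtain ⟨w, hw⟩ := S.exists_ι a₀ (A.Lam (ι a₀) v)
        rw [A.lift_apply, ← hw, ← bder_e A hι, hp0]
    have h4 : ∃ P' : M → A.X →L[ℝ] A.X, ContinuousWithinAt P' (range ι) (ι a₀) ∧
          (∀ x ∈ range ι, ∀ v, A.nn x (P' x v) = P' x v) ∧
          ∀ v, P' (ι a₀) (A.nn (ι a₀) v) = A.nn (ι a₀) v := by
      have hnn : ∀ x ∈ range ι, ∀ v, A.nn x (A.nn x v) = A.nn x v := fun x hx v => by
        rw [A.nn_apply (v := A.nn x v), A.Lam_nn hx, map_zero, sub_zero]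
      exact ⟨A.nn, A.continuousOn_nn (ι a₀) hx₀, hnn, hnn _ hx₀⟩
    fin_cases i
    · exact h1
    · exact h2
    · exact h3
    · exact h4

/-- The derivative of `T` along the invariant manifold, in the coordinates. -/
def D (T : OpenPartialHomeomorph M M) (x : M) : A.X →L[ℝ] A.X :=
  (der (fun p => A.e (T p)) x).comp (A.Lam x)

lemma contMDiffOn_e_comp (hT : IsSmoothDiffeo (E := E) T) :
    ContMDiffOn ℐ E ℐ A.X ∞ (fun p => A.e (T p)) T.source :=
  A.contMDiff_e.comp_contMDiffOn hT.1

lemma D_apply (hT : IsSmoothDiffeo (E := E) T) {x : M} (hx : x ∈ T.source) (v : A.X) :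
    D A T x v = A.I (T x) (tder ℐ E T x (A.Lam x v)) := by
  have hTd : MDiffAt T x :=
    (hT.1.contMDiffAt (T.open_source.mem_nhds hx)).mdifferentiableAt (by simp)
  exact bder_comp (J := ℐ E) (f := T) (G := A.e) (A.contMDiff_e.mdifferentiable (by simp) _) hTd _

lemma continuousOn_D (hT : IsSmoothDiffeo (E := E) T) (hs : range ι ⊆ T.source) :
    ContinuousOn (D A T) (range ι) :=
  A.continuousOn_der_Lam T.open_source hs (contMDiffOn_e_comp A hT)

/-- The size of a component of a vector. -/
def size (q : M → E →L[ℝ] E) (x : M) : Seminorm ℝ A.X :=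
  (A.glueSeminorm S.ν x).comp (A.lift q x).toLinearMap

/-- The size of the contracted component and of the normal component of a vector. -/
def sizeS (x : M) : Seminorm ℝ A.X :=
  S.size A S.s x + (normSeminorm ℝ A.X).comp (A.nn x).toLinearMap

lemma sizeS_apply (x : M) (v : A.X) : S.sizeS A x v = S.size A S.s x v + ‖A.nn x v‖ := rfl

lemma size_lift {q : M → E →L[ℝ] E} {x : M} (hx : x ∈ range ι) (v : A.X) :
    S.size A q x v = S.ν x (q x (A.Lam x v)) :=
  A.glueSeminorm_I S.ν hx _

lemma continuousOn_ν :
    ContinuousOn (fun p : M × A.X => A.glueSeminorm S.ν p.1 p.2) (range ι ×ˢ univ) := A.continuousOn_glueSeminorm S.ν_cont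

lemma continuousOn_size {q : M → E →L[ℝ] E} (hq : ContinuousOn (A.lift q) (range ι)) :
    ContinuousOn (fun p : M × A.X => S.size A q p.1 p.2) (range ι ×ˢ univ) := by
  have h1 : ContinuousOn (fun p : M × A.X => ((p.1, A.lift q p.1 p.2) : M × A.X))
      (range ι ×ˢ univ) :=
    continuousOn_fst.prodMk ((hq.comp continuousOn_fst fun p hp => hp.1).clm_apply continuousOn_snd)
  exact (S.continuousOn_ν A).comp h1 fun p hp => ⟨hp.1, trivial⟩

lemma continuousOn_sizeS (hs : ContinuousOn (A.lift S.s) (range ι)) :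
    ContinuousOn (fun p : M × A.X => S.sizeS A p.1 p.2) (range ι ×ˢ univ) := by
  have h1 : ContinuousOn (fun p : M × A.X => ‖A.nn p.1 p.2‖) (range ι ×ˢ univ) :=
    ((A.continuousOn_nn.comp continuousOn_fst fun p hp => hp.1).clm_apply continuousOn_snd).norm
  exact (S.continuousOn_size A hs).add h1

lemma lift_D (S : Splitting E J T ι α lam) (hT : IsSmoothDiffeo (E := E) T) {q : M → E →L[ℝ] E}
    {x : M} (hx : x ∈ range ι) (hq : ∀ w, q (T x) (tder ℐ E T x w) = tder ℐ E T x (q x w))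
    (v : A.X) : A.lift q (T x) (D A T x v) = D A T x (A.lift q x v) := by
  rw [D_apply A hT (S.source hx), D_apply A hT (S.source hx), A.lift_I (S.maps hx), hq, A.Lam_lift hx]

lemma nn_D (S : Splitting E J T ι α lam) (hT : IsSmoothDiffeo (E := E) T) {x : M} (hx : x ∈ range ι)
    (v : A.X) : A.nn (T x) (D A T x v) = 0 := by
  rw [D_apply A hT (S.source hx), A.nn_I (S.maps hx)]

lemma size_D (hT : IsSmoothDiffeo (E := E) T) {q : M → E →L[ℝ] E} {x : M} (hx : x ∈ range ι)
    (hq : ∀ w, q (T x) (tder ℐ E T x w) = tder ℐ E T x (q x w)) (v : A.X) :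
    S.size A q (T x) (D A T x v) = S.ν (T x) (tder ℐ E T x (q x (A.Lam x v))) := by
  rw [S.size_lift A (S.maps hx), D_apply A hT (S.source hx), A.Lam_I (A.total_pos (S.maps hx)), hq]

/-- The size of the image of a vector under the derivative. -/
def sizeT (x : M) : Seminorm ℝ A.X :=
  (A.glueSeminorm S.ν (T x)).comp (D A T x).toLinearMap

lemma sizeT_apply (x : M) (v : A.X) : S.sizeT A x v = A.glueSeminorm S.ν (T x) (D A T x v) := rfl

lemma continuousOn_sizeT (hT : IsSmoothDiffeo (E := E) T) :
    ContinuousOn (fun p : M × A.X => S.sizeT A p.1 p.2) (range ι ×ˢ univ) := by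
  have hTc : ContinuousOn T (range ι) := T.continuousOn.mono S.source
  have h2 : ContinuousOn (fun p : M × A.X => ((T p.1, D A T p.1 p.2) : M × A.X))
      (range ι ×ˢ univ) :=
    (hTc.comp continuousOn_fst fun p hp => hp.1).prodMk
      (((continuousOn_D A hT S.source).comp continuousOn_fst fun p hp => hp.1).clm_apply
        continuousOn_snd)
  have h3 := (S.continuousOn_ν A).comp h2 fun p hp => ⟨S.maps hp.1, trivial⟩
  exact h3.congr fun p _ => S.sizeT_apply A p.1 p.2

/-- The rates of contraction and of expansion, with a strict and uniform bound. -/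
lemma eventually_rate (hK : IsCompact (range ι)) (hT : IsSmoothDiffeo (E := E) T)
    (hs : ContinuousOn (A.lift S.s) (range ι)) (hu : ContinuousOn (A.lift S.u) (range ι)) :
    ∀ᶠ l in 𝓝[<] lam, ∀ x ∈ range ι, ∀ v,
      S.size A S.s (T x) (D A T x v) ≤ l * S.size A S.s x v ∧
      S.size A S.u x v ≤ l * S.size A S.u (T x) (D A T x v) := by
  let ν₀ : M → Seminorm ℝ A.X := fun x => A.glueSeminorm S.ν x
  let ν₁ : M → Seminorm ℝ A.X := fun x => S.sizeT A x; have h0 := S.continuousOn_ν A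
  have h1 := S.continuousOn_sizeT A hT
  have hv : ∀ {q : M → E →L[ℝ] E} {x : M}, x ∈ range ι → ∀ v, A.lift q x v = v →
      v = A.I x (q x (A.Lam x v)) ∧ ν₀ x v = S.ν x (q x (A.Lam x v)) ∧
      ν₁ x v = S.ν (T x) (tder ℐ E T x (q x (A.Lam x v))) ∧
      q x (q x (A.Lam x v)) = q x (A.Lam x v) := by
    intro q x hx v hqv; have e1 : v = A.I x (q x (A.Lam x v)) := hqv.symm
    have e2 : A.Lam x v = q x (A.Lam x v) := by
      conv_lhs => rw [← hqv]
      rw [A.Lam_lift hx]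
    refine ⟨e1, ?_, ?_, congrArg (q x) e2.symm⟩
    · conv_lhs => rw [e1]
      exact A.glueSeminorm_I S.ν hx _
    · change S.sizeT A x v = _
      rw [S.sizeT_apply, D_apply A hT (S.source hx), A.glueSeminorm_I S.ν (S.maps hx), ← e2]
  have hne : ∀ {x : M} {v : A.X} {w : E}, v = A.I x w → v ≠ 0 → w ≠ 0 := by
    rintro x v w rfl hv rfl; exact hv (map_zero _)
  have hS := eventually_le_mul_of_lt hK h1 h0 hs S.lam_pos (fun x hx v hqv hv0 => by
    obtain ⟨e1, e2, e3, e4⟩ := hv hx v hqv; change ν₁ x v < lam * ν₀ x v; rw [e2, e3]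
    exact S.s_rate x hx _ e4 (hne e1 hv0))
  have hU := eventually_le_mul_of_lt hK h0 h1 hu S.lam_pos (fun x hx v hqv hv0 => by
    obtain ⟨e1, e2, e3, e4⟩ := hv hx v hqv; change ν₀ x v < lam * ν₁ x v; rw [e2, e3]
    exact S.u_rate x hx _ e4 (hne e1 hv0))
  filter_upwards [hS, hU] with l hlS hlU x hx v
  have hself : ∀ {q : M → E →L[ℝ] E}, (∀ w, q x (q x w) = q x w) →
      A.lift q x (A.lift q x v) = A.lift q x v := by
    intro q hq; rw [A.lift_apply (v := A.lift q x v), A.Lam_lift hx, hq, ← A.lift_apply]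
  constructor
  · have := hlS x hx _ (hself (S.s_s hx)); rw [S.size_D A hT hx (S.s_T x hx), S.size_lift A hx]
    obtain ⟨-, e2, e3, -⟩ := hv hx _ (hself (S.s_s hx))
    rw [e2, e3, A.Lam_lift hx, S.s_s hx] at this; exact this
  · have := hlU x hx _ (hself (S.u_u hx)); rw [S.size_D A hT hx (S.u_T x hx), S.size_lift A hx]
    obtain ⟨-, e2, e3, -⟩ := hv hx _ (hself (S.u_u hx))
    rw [e2, e3, A.Lam_lift hx, S.u_u hx] at this; exact this

lemma eventually_norm_le (hK : IsCompact (range ι)) (hs : ContinuousOn (A.lift S.s) (range ι))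
    (hc : ContinuousOn (A.lift S.c) (range ι)) (hu : ContinuousOn (A.lift S.u) (range ι)) :
    ∀ᶠ C in atTop, ∀ x ∈ range ι, ∀ v, ‖v‖ ≤ C * (S.sizeS A x v + S.size A S.c x v +
      S.size A S.u x v) := by
  refine eventually_norm_le_seminorm hK
    (ν := fun x => S.sizeS A x + S.size A S.c x + S.size A S.u x)
    (((S.continuousOn_sizeS A hs).add (S.continuousOn_size A hc)).add (S.continuousOn_size A hu))
    fun x hx v h0 => ?_
  change S.size A S.s x v + ‖A.nn x v‖ + S.size A S.c x v +
    S.size A S.u x v = 0 at h0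
  have n1 : 0 ≤ S.size A S.s x v := apply_nonneg _ _
  have n2 : 0 ≤ S.size A S.c x v := apply_nonneg _ _
  have n3 : 0 ≤ S.size A S.u x v := apply_nonneg _ _; have n4 := norm_nonneg (A.nn x v)
  have z : ∀ {q : M → E →L[ℝ] E}, S.size A q x v = 0 → q x (A.Lam x v) = 0 := by
    intro q hq; rw [S.size_lift A hx] at hq; exact S.ν_pos x hx _ hq
  have h1 : A.Lam x v = 0 := by
    rw [← S.add x hx (A.Lam x v), z (q := S.s) (by linarith), z (q := S.c) (by linarith),
      z (q := S.u) (by linarith)]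
    simp
  have h2 : A.nn x v = 0 := norm_eq_zero.1 (by linarith)
  rw [A.nn_apply, h1, map_zero, sub_zero] at h2; exact h2

lemma eventually_norm_le_D (S : Splitting E J T ι α lam) (hK : IsCompact (range ι))
    (hT : IsSmoothDiffeo (E := E) T) :
    ∀ᶠ C in atTop, ∀ x ∈ range ι, ∀ v, ‖v‖ ≤ C * (‖D A T x v‖ + ‖A.nn x v‖) := by
  have hT' : IsSmoothDiffeo (E := E) T.symm := ⟨hT.2, hT.1⟩
  filter_upwards [eventually_le_const_of_continuousOn hK
    (continuousOn_D A hT' (S.symm hT).source), eventually_ge_atTop 1] with C hC hC1 x hx v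
  have h1 := hC (T x) (S.maps hx) (D A T x v); have hxs := S.source hx
  rw [D_apply A hT' ((S.symm hT).source (S.maps hx)), D_apply A hT hxs,
    A.Lam_I (A.total_pos (S.maps hx)), tder_symm_tder hT hxs, T.left_inv hxs,
    ← D_apply A hT hxs] at h1
  calc ‖v‖ = ‖A.I x (A.Lam x v) + A.nn x v‖ := by rw [A.nn_apply, add_sub_cancel]
    _ ≤ C * ‖D A T x v‖ + C * ‖A.nn x v‖ :=
        (norm_add_le _ _).trans (add_le_add h1 (le_mul_of_one_le_left (norm_nonneg _) hC1))
    _ = _ := by ring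

variable [CompactSpace N] [IsManifold J 1 N]

/-- Points of the invariant manifold differ by almost tangent vectors. -/
lemma exists_size_tangency (hT : IsSmoothDiffeo (E := E) T) (hι : ContMDiff J ℐ E 2 ι)
    (hemb : IsEmbedding ι) (himm : ∀ a, Injective (tder (E := E) J ι a)) {ε : ℝ} (hε : 0 < ε) :
    ∃ ρ > 0, ∀ x ∈ range ι, ∀ x' ∈ range ι, edist x' x < ofReal ρ →
      S.sizeS A x (A.e x' - A.e x) ≤ ε * ‖A.e x' - A.e x‖ ∧
      S.size A S.u x (A.e x' - A.e x) ≤ ε * ‖A.e x' - A.e x‖ := by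
  have hK : IsCompact (range ι) := isCompact_range hemb.continuous
  obtain ⟨hs, hc, hu⟩ := S.continuousOn_lift A hι hemb himm
  obtain ⟨C, hC, hC0⟩ := ((eventually_seminorm_le hK (S.continuousOn_ν A)).and
    (eventually_ge_atTop 1)).exists
  have hη : 0 < ε / (2 * C) := by positivity
  have h0 : ∀ {q : M → E →L[ℝ] E}, (∀ x ∈ range ι, ∀ w, q x (S.c x w) = 0) → ∀ a, ∀ w : EA,
      A.lift q (ι a) (bder J (fun a => A.e (ι a)) a w) = 0 := by
    intro q hq a w
    rw [bder_e A hι, A.lift_I (mem_range_self a), ← S.c_ι, hq _ (mem_range_self a), map_zero]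
  have h1 := exists_tangency hemb hK (contMDiff_e_comp A hι) (injective_bder_e A hι himm) hs
    (h0 fun x hx => S.s_c hx) hη
  have h2 := exists_tangency hemb hK (contMDiff_e_comp A hι) (injective_bder_e A hι himm) hu
    (h0 fun x hx => S.u_c hx) hη
  have h3 := exists_tangency hemb hK (contMDiff_e_comp A hι) (injective_bder_e A hι himm)
    A.continuousOn_nn (fun a w => by rw [bder_e A hι, A.nn_I (mem_range_self a)]) hη
  obtain ⟨ρ, ⟨⟨hρ1, hρ2⟩, hρ3⟩, hρ0⟩ := (((h1.and h2).and h3).and self_mem_nhdsWithin).exists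
  refine ⟨ρ, hρ0, fun x hx x' hx' hd => ?_⟩
  have hν : ∀ {v : A.X}, ‖v‖ ≤ ε / (2 * C) * ‖A.e x' - A.e x‖ →
      A.glueSeminorm S.ν x v ≤ ε / 2 * ‖A.e x' - A.e x‖ := by
    intro v hv; refine (hC x hx v).trans ?_
    calc C * ‖v‖ ≤ C * (ε / (2 * C) * ‖A.e x' - A.e x‖) := by gcongr
      _ = ε / 2 * ‖A.e x' - A.e x‖ := by field_simp
  have hn := norm_nonneg (A.e x' - A.e x); constructor
  · have h4 := hν (hρ1 x hx x' hx' hd); have h5 := hρ3 x hx x' hx' hd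
    have h6 : ε / (2 * C) ≤ ε / 2 := by
      apply div_le_div_of_nonneg_left hε.le (by norm_num); linarith
    have h7 : ε / (2 * C) * ‖A.e x' - A.e x‖ ≤ ε / 2 * ‖A.e x' - A.e x‖ := by gcongr
    rw [S.sizeS_apply]; change A.glueSeminorm S.ν x (A.lift S.s x (A.e x' - A.e x)) + _ ≤ _
    linarith
  · have h4 := hν (hρ2 x hx x' hx' hd)
    change A.glueSeminorm S.ν x (A.lift S.u x (A.e x' - A.e x)) ≤ _; nlinarith

lemma finrank_lift {q : M → E →L[ℝ] E} {x : M} (hx : x ∈ range ι) :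
    finrank ℝ (A.lift q x).range = finrank ℝ (q x).range := by
  have h1 : (A.lift q x).range = (q x).range.map (A.I x).toLinearMap := by
    ext v; constructor
    · rintro ⟨w, rfl⟩; exact ⟨q x (A.Lam x w), ⟨_, rfl⟩, rfl⟩
    · rintro ⟨_, ⟨w, rfl⟩, rfl⟩; exact ⟨A.I x w, A.lift_I hx w⟩
  rw [h1]
  exact (Submodule.equivMapOfInjective _ (A.I_injective (A.total_pos hx)) _).finrank_eq.symm

lemma finrank_c (himm : ∀ a, Injective (tder (E := E) J ι a)) {x : M} (hx : x ∈ range ι) :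
    finrank ℝ (S.c x).range = finrank ℝ EA := by
  obtain ⟨a, rfl⟩ := hx
  have h1 : (S.c (ι a)).range = (tder (E := E) J ι a).range := by
    ext v; constructor
    · rintro ⟨w, rfl⟩; exact S.exists_ι a w
    · rintro ⟨w, rfl⟩; exact ⟨tder J ι a w, S.c_ι a w⟩
  rw [h1]; exact LinearMap.finrank_range_of_inj (himm a)

variable [Bundle.RiemannianBundle (fun x : M => TangentSpace ℐ E x)]
  [IsContinuousRiemannianBundle E (fun x : M => TangentSpace ℐ E x)]
  [IsRiemannianManifold ℐ E M]

/-- The hyperbolic system of a splitting. -/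
theorem exists_hypSys (hT : IsSmoothDiffeo (E := E) T) (hι : ContMDiff J ℐ E 2 ι)
    (hemb : IsEmbedding ι) (himm : ∀ a, Injective (tder (E := E) J ι a)) :
    ∃ H : HypSys M A.X, H.T = T ∧ H.K = range ι ∧ H.lam = lam ∧ H.e = A.e ∧
      H.qk = A.lift S.s ∧ H.qc = A.lift S.c ∧
      ∀ x ∈ range ι, ∀ p, edist p x < ofReal H.r → Injective (A.I p) := by
  have hK : IsCompact (range ι) := isCompact_range hemb.continuous; have hsm := S.symm hT
  obtain ⟨hs, hc, hu⟩ := S.continuousOn_lift A hι hemb himm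
  obtain ⟨L, hL, hLr⟩ := ChartCover.eventually_near_compact E hK
  obtain ⟨lk, hrate, hlk⟩ := ((S.eventually_rate A hK hT hs hu).and
    (Ioo_mem_nhdsLT S.lam_pos)).exists
  obtain ⟨α₁, hα₁, hgap⟩ : ∃ α₁, α < α₁ ∧ α₁ ^ 2 * lam < 1 := by
    have h1 : ∀ᶠ a in 𝓝[>] α, a ^ 2 * lam < 1 := by
      have : ContinuousAt (fun a : ℝ => a ^ 2 * lam) α := by fun_prop
      exact (this.eventually_lt_const S.gap).filter_mono nhdsWithin_le_nhds
    obtain ⟨a, ha, ha'⟩ := (h1.and self_mem_nhdsWithin).exists; exact ⟨a, ha', ha⟩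
  have hC : ∀ᶠ C in atTop, (1 ≤ C ∧
      (∀ x ∈ range ι, ∀ v, ‖v‖ ≤ C * (S.sizeS A x v + S.size A S.c x v +
        S.size A S.u x v)) ∧
      (∀ x ∈ range ι, ∀ v, S.sizeS A x v ≤ C * ‖v‖) ∧
      (∀ x ∈ range ι, ∀ v, S.size A S.c x v ≤ C * ‖v‖) ∧
      (∀ x ∈ range ι, ∀ v, S.size A S.u x v ≤ C * ‖v‖)) ∧
      (∀ x ∈ range ι, ∀ v, ‖D A T x v‖ ≤ C * ‖v‖) ∧
      (∀ x ∈ range ι, ∀ v, ‖v‖ ≤ C * (‖D A T x v‖ + ‖A.nn x v‖)) ∧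
      (∀ x ∈ range ι, ∀ v, A.glueSeminorm S.ν x v ≤ C * ‖v‖) ∧
      (∀ x ∈ range ι, ∀ v, ‖A.lift S.s x v‖ ≤ C * ‖v‖) ∧
      (∀ x ∈ range ι, ∀ v, ‖A.lift S.c x v‖ ≤ C * ‖v‖) := by
    filter_upwards [eventually_ge_atTop 1, S.eventually_norm_le A hK hs hc hu,
      eventually_seminorm_le hK (S.continuousOn_sizeS A hs),
      eventually_seminorm_le hK (S.continuousOn_size A hc),
      eventually_seminorm_le hK (S.continuousOn_size A hu),
      eventually_le_const_of_continuousOn hK (continuousOn_D A hT S.source),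
      S.eventually_norm_le_D A hK hT, eventually_seminorm_le hK (S.continuousOn_ν A),
      eventually_le_const_of_continuousOn hK hs, eventually_le_const_of_continuousOn hK hc]
      with C h1 h2 h3 h4 h5 h6 h7 h8 h9 h10
    exact ⟨⟨h1, h2, h3, h4, h5⟩, h6, h7, h8, h9, h10⟩
  obtain ⟨C, ⟨⟨hC1, hnorm, hpk, hpc, hpe⟩, hD, hD', hν, hqk, hqc⟩, hrad⟩ :=
    (hC.and ((A.eventually_edist_le hK).and ((A.eventually_le_edist hK).and
    ((A.eventually_four hK T.open_source S.source (contMDiffOn_e_comp A hT)).and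
      ((A.eventually_normal hK).and (A.eventually_param hK)))))).exists
  obtain ⟨hr1, hr2, hr3, hr4, hr5⟩ := hrad
  obtain ⟨r, ⟨hr1, hr2, hr3, hr4, hr5⟩, hr6, hr7, hr8, hr0⟩ :=
    ((hr1.and (hr2.and (hr3.and (hr4.and hr5)))).and
      ((ChartCover.eventually_near_source hK S.source).and (hLr.and
        ((A.eventually_injective hK).and self_mem_nhdsWithin)))).exists
  refine ⟨
  { T, K := range ι, e := A.e, D := D A T, pk := S.sizeS A, pc := S.size A S.c,
    pe := S.size A S.u, qk := A.lift S.s, qc := A.lift S.c, qe := A.lift S.u, nn := A.nn,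
    lk, lam, α, α₁, C, r, lk_pos := hlk.1, lk_lt := hlk.2, one_lt_α := S.one_lt, α_lt := hα₁,
    gap := hgap, one_le_C := hC1, r_pos := hr0, isCompact_K := hK, maps_K := fun x hx => S.maps hx,
    near_source := hr6, norm_le := hnorm, pk_le := hpk, pc_le := hpc, pe_le := hpe, norm_D_le := hD,
    pk_D := fun x hx v => ?_, pc_D := fun x hx v => ?_, pc_D' := fun x hx v => ?_,
    pe_D := fun x hx v => (hrate x hx v).2, edist_le := hr1, le_edist := hr2,
    unif := fun ε hε => ?_, four := hr3,
    tangency := fun ε hε => S.exists_size_tangency A hT hι hemb himm hε, normal := hr4,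
    q_sum := fun x hx v => ?_, qk_apply := fun x hx a b c d => ?_,
    qc_apply := fun x hx a b c d => ?_, qe_apply := fun x hx a b c d => ?_,
    qk_D := fun x hx v => S.lift_D A hT hx (S.s_T x hx) v, norm_le_D := hD',
    pk_le_q := fun x hx v => ?_, pc_le_q := fun x hx v => hν x hx _,
    pe_le_q := fun x hx v => hν x hx _, norm_qk_le := hqk, norm_qc_le := hqc,
    continuousOn_pk := S.continuousOn_sizeS A hs, continuousOn_pc := S.continuousOn_size A hc,
    continuousOn_pe := S.continuousOn_size A hu, continuousOn_qk := hs, continuousOn_qc := hc,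
    unif_symm := fun ε hε => ?_, param := hr5, near_compact := ⟨L, hL, hr7⟩ }, rfl, rfl, rfl, rfl, rfl, rfl, hr8⟩
  · have h1 := (hrate x hx v).1
    rw [S.sizeS_apply, S.nn_D A hT hx, norm_zero, add_zero, S.sizeS_apply]
    have h2 : 0 ≤ lk * ‖A.nn x v‖ := mul_nonneg hlk.1.le (norm_nonneg _); rw [mul_add]; linarith
  · rw [S.size_D A hT hx (S.c_T x hx), S.size_lift A hx]; exact S.c_rate x hx _ (S.c_c hx _)
  · rw [S.size_D A hT hx (S.c_T x hx), S.size_lift A hx]; exact S.c_rate' x hx _ (S.c_c hx _)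
  · obtain ⟨ρ, hρ, h⟩ := ChartCover.exists_unif hK S.source hε
    exact ⟨ρ, hρ, fun x hx p hp => (h x hx p hp).2⟩
  · rw [A.lift_apply, A.lift_apply, A.lift_apply, ← map_add, ← map_add, S.add x hx, A.nn_apply,
      add_sub_cancel]
  · simp only [map_add, A.Lam_nn hx, A.lift_apply, A.Lam_I (A.total_pos hx), S.s_s hx, S.s_c hx,
      S.s_u hx, map_zero, add_zero]
  · simp only [map_add, A.Lam_nn hx, A.lift_apply, A.Lam_I (A.total_pos hx), S.c_c hx, S.c_s hx,
      S.c_u hx, map_zero, add_zero, zero_add]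
  · simp only [map_add, A.Lam_nn hx, A.lift_apply, A.Lam_I (A.total_pos hx), S.u_u hx, S.u_s hx,
      S.u_c hx, map_zero, add_zero, zero_add]
  · rw [S.sizeS_apply, mul_add]
    exact add_le_add (hν x hx _) (le_mul_of_one_le_left (norm_nonneg _) hC1)
  · obtain ⟨ρ, hρ, h⟩ := ChartCover.exists_unif (T := T.symm) hK hsm.source hε
    refine ⟨ρ, hρ, fun x hx p hp => ?_⟩; have := h (T x) (S.maps hx) p hp
    rwa [T.left_inv (S.source hx)] at this

/-- The hyperbolic system of a splitting is smooth, and smooth one-forms can be expressed in its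
coordinates. -/
theorem exists_smooth_hypSys (hT : IsSmoothDiffeo (E := E) T) (hι : ContMDiff J ℐ E 2 ι)
    (hemb : IsEmbedding ι) (himm : ∀ a, Injective (tder (E := E) J ι a)) {n : ℕ}
    (hn : ∀ x ∈ range ι, finrank ℝ (S.s x).range = n) {θ : OneForm E M} (hθ : θ.IsSmooth) :
    ∃ (A : ChartCover E (range ι)) (H : HypSys M A.X), H.T = T ∧ H.K = range ι ∧
      H.lam = lam ∧ H.IsSmooth E n (finrank ℝ EA) ∧ ∃ a, H.Represents θ a := by
  have hK : IsCompact (range ι) := isCompact_range hemb.continuous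
  obtain ⟨A⟩ := ChartCover.exists_of_isCompact (E := E) hK
  obtain ⟨H, hHT, hHK, hHl, hHe, hHqk, hHqc, hHI⟩ := S.exists_hypSys A hT hι hemb himm
  have he : ContMDiff ℐ E ℐ A.X 1 H.e := by
    rw [hHe]; exact A.contMDiff_e.of_le (by norm_cast)
  refine ⟨A, H, hHT, hHK, hHl, ⟨?_, he, ?_, ?_, ?_⟩, A.coeff θ, he, ?_⟩
  · rw [hHT]; exact hT
  · rw [hHK, hHe]; exact hHI
  · rw [hHK, hHqk]; exact fun x hx => (finrank_lift A hx).trans (hn x hx)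
  · rw [hHK, hHqc]; exact fun x hx => (finrank_lift A hx).trans (S.finrank_c himm hx)
  · rw [hHK, hHe]; exact A.eventually_coeff hK hθ

end Splitting

/-! ### Dimensions of the symplectic splitting -/

/-- The exterior derivative of a one-form, as a bilinear form on the model space. -/
def OneForm.dB {E M : Type*} [NormedAddCommGroup E] [NormedSpace ℝ E]
    [TopologicalSpace M] [ChartedSpace E M] (θ : OneForm E M) (x : M) : E →ₗ[ℝ] E →ₗ[ℝ] ℝ :=
  let f : E →L[ℝ] E →L[ℝ] ℝ := fderiv ℝ (θ.inChart x) (Ξ E x x)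
  let L : E →L[ℝ] E := mfderiv% (Ξ E x) x
  LinearMap.mk₂ ℝ (fun v w => f (L v) (L w) - f (L w) (L v))
    (fun v v' w => by simp only [map_add, add_apply]; ring)
    (fun t v w => by simp only [map_smul, smul_apply, smul_eq_mul]; ring)
    (fun v w w' => by simp only [map_add, add_apply]; ring)
    (fun t v w => by simp only [map_smul, smul_apply, smul_eq_mul]; ring)

lemma ChartCover.exists_dB_le {K : Set M} (A : ChartCover E K) (hK : IsCompact K) {θ : OneForm E M}
    (hθ : θ.IsSmooth) :
    ∃ C, 0 ≤ C ∧ ∀ x ∈ K, ∀ v w, |θ.dB x v w| ≤ C * (‖A.I x v‖ * ‖A.I x w‖) := by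
  have := eventually_uniform hK
    (Q := fun x C _ => ∀ v w, |θ.dB x v w| ≤ C * (‖A.I x v‖ * ‖A.I x w‖))
    (fun x C C' _ _ hC _ h v w => (h v w).trans (by gcongr)) ?_
  · obtain ⟨C, hC, hC0⟩ := (this.and (eventually_ge_atTop 0)).exists; obtain ⟨r, hr⟩ := hC.exists
    exact ⟨C, hC0, hr⟩
  intro x₀ hx₀; obtain ⟨c, hc⟩ := A.exists_mem_U hx₀; have hs := A.U_subset c hc
  have ho := isOpen_extChartAt_target (I := ℐ E) (c : M); set f := fderiv ℝ (θ.pull (A.χ c).symm)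
  have hf : ContinuousAt (fun x => ‖f (A.χ c x)‖) x₀ := by
    have h1 : ContDiffOn ℝ ∞ (θ.pull (A.χ c).symm) (A.χ c).target :=
      contDiffOn_pull hθ ho (contMDiffOn_extChartAt_symm _)
    have h2 := (h1.continuousOn_fderiv_of_isOpen ho (by simp)).continuousAt
      (ho.mem_nhds ((A.χ c).map_source hs))
    exact (h2.comp (continuousAt_extChartAt' hs)).norm
  refine ⟨2 * (‖f (A.χ c x₀)‖ + 1), A.U c ∩ {x | ‖f (A.χ c x)‖ < ‖f (A.χ c x₀)‖ + 1},
    inter_mem ((A.isOpen_U c).mem_nhds hc) (hf.eventually_lt_const (by linarith)), ?_⟩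
  rintro x ⟨hxc, hxf⟩ - v w; have hxs := A.U_subset c hxc
  have h1 := fderiv_pull_sub hθ ho (contMDiffOn_extChartAt_symm (I := ℐ E) (n := ∞) (c : M))
    ((A.χ c).map_source hxs) (A.I x v c) (A.I x w c)
  have h2 : θ.dB x v w = f (A.χ c x) (A.I x v c) (A.I x w c) - f (A.χ c x) (A.I x w c) (A.I x v c) := by
    have h3 : ∀ x', x' = x → θ.dB x v w = θ.dB x' v w := by rintro _ rfl; rfl
    rw [h3 _ ((A.χ c).left_inv hxs)]; refine Eq.trans ?_ h1.symm; have h4 := A.inv_I hxc v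
    have h5 := A.inv_I hxc w
    exact congrArg₂ (fun a b => θ.dB ((A.χ c).symm (A.χ c x)) a b) h4.symm h5.symm
  have h6 : ∀ a b : E, |f (A.χ c x) a b| ≤ (‖f (A.χ c x₀)‖ + 1) * ‖a‖ * ‖b‖ := fun a b =>
    ((f (A.χ c x)).le_opNorm₂ a b).trans (by gcongr; exact hxf.le)
  have h7 : ∀ a b : E, |f (A.χ c x) a b - f (A.χ c x) b a| ≤
      2 * (‖f (A.χ c x₀)‖ + 1) * (‖a‖ * ‖b‖) := fun a b =>
    (abs_sub _ _).trans ((add_le_add (h6 a b) (h6 b a)).trans (le_of_eq (by ring)))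
  rw [h2]; refine (h7 _ _).trans ?_; gcongr <;> exact norm_le_pi_norm _ c

namespace Splitting

lemma finrank_add (S : Splitting E J T ι α lam) {x : M} (hx : x ∈ range ι) :
    finrank ℝ (S.s x).range + finrank ℝ (S.c x).range + finrank ℝ (S.u x).range = finrank ℝ E := by
  let L := (S.s x).toLinearMap.rangeRestrict.prod
    ((S.c x).toLinearMap.rangeRestrict.prod (S.u x).toLinearMap.rangeRestrict)
  have hbij : Function.Bijective L := by
    constructor
    · intro v w h; have h1 : S.s x v = S.s x w := congrArg (fun z => (z.1 : E)) h
      have h2 : S.c x v = S.c x w := congrArg (fun z => (z.2.1 : E)) h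
      have h3 : S.u x v = S.u x w := congrArg (fun z => (z.2.2 : E)) h
      rw [← S.add x hx v, ← S.add x hx w, h1, h2, h3]
    · rintro ⟨⟨_, a, rfl⟩, ⟨_, b, rfl⟩, ⟨_, d, rfl⟩⟩
      exact ⟨S.s x a + S.c x b + S.u x d, Prod.ext (Subtype.ext (S.s_apply x hx a b d))
        (Prod.ext (Subtype.ext (S.c_apply x hx a b d)) (Subtype.ext (S.u_apply x hx a b d)))⟩
  have h := (LinearEquiv.ofBijective L hbij).finrank_eq
  rw [h, Module.finrank_prod, Module.finrank_prod, add_assoc]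

/-- The contracted subspace is isotropic, and orthogonal to the centre subspace: the form of
two vectors, one of which is contracted and the other one expanded at most at the rate `α`, is
invariant and decays. -/
lemma dB_eq_zero (S : Splitting E J T ι α lam) (A : ChartCover E (range ι))
    (hK : IsCompact (range ι)) (hs : ContinuousOn (A.lift S.s) (range ι))
    (hc : ContinuousOn (A.lift S.c) (range ι)) (hu : ContinuousOn (A.lift S.u) (range ι))
    {θ : OneForm E M} (hθ : θ.IsSmooth) (hTθ : Preserves T θ) {x : M} (hx : x ∈ range ι) {v w : E}
    (hv : S.s x v = v) (hw : S.s x w = w ∨ S.c x w = w) : θ.dB x v w = 0 := by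
  obtain ⟨C₁, hC₁, h₁⟩ := A.exists_dB_le hK hθ
  obtain ⟨C₂, h₂, hC₂⟩ := ((S.eventually_norm_le A hK hs hc hu).and (eventually_ge_atTop 0)).exists
  have hα := S.one_lt; have hl := S.lam_pos
  have hlα : lam * α < 1 := by nlinarith [S.gap, mul_pos hl (by linarith : 0 < α)]
  have hI : ∀ x ∈ range ι, ∀ w, S.s x w = w ∨ S.c x w = w → ‖A.I x w‖ ≤ C₂ * S.ν x w := by
    intro x hx w hw; have h := h₂ x hx (A.I x w)
    rw [S.sizeS_apply, A.nn_I hx, S.size_lift A hx, S.size_lift A hx, S.size_lift A hx,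
      A.Lam_I (A.total_pos hx)] at h
    rcases hw with hw | hw <;> rw [← hw] at h ⊢
    · simpa [S.s_s hx, S.c_s hx, S.u_s hx] using h
    · simpa [S.c_c hx, S.s_c hx, S.u_c hx] using h
  have hsν : ∀ x ∈ range ι, ∀ w, S.s x w = w → S.ν (T x) (tder ℐ E T x w) ≤ lam * S.ν x w := by
    intro x hx w hw; rcases eq_or_ne w 0 with rfl | h0
    · simp
    · exact (S.s_rate x hx w hw h0).le
  have key : ∀ m : ℕ, ∀ x ∈ range ι, ∀ v w, S.s x v = v → S.s x w = w ∨ S.c x w = w →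
      |θ.dB x v w| ≤ C₁ * (C₂ * C₂) * (lam * α) ^ m * (S.ν x v * S.ν x w) := by
    intro m; induction m with
    | zero =>
      intro x hx v w hv hw; refine (h₁ x hx v w).trans ?_
      calc _ ≤ C₁ * ((C₂ * S.ν x v) * (C₂ * S.ν x w)) :=
            mul_le_mul_of_nonneg_left (mul_le_mul (hI x hx v (Or.inl hv)) (hI x hx w hw)
              (norm_nonneg _) (mul_nonneg hC₂ (apply_nonneg (S.ν x) v))) hC₁
        _ = _ := by ring
    | succ m ih =>
      intro x hx v w hv hw
      have h3 : θ.dB (T x) (tder ℐ E T x v) (tder ℐ E T x w) = θ.dB x v w := hTθ x (S.source hx) v w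
      have h4 := ih (T x) (S.maps hx) _ _ (by rw [S.s_T x hx, hv])
        (hw.imp (fun h => by rw [S.s_T x hx, h]) (fun h => by rw [S.c_T x hx, h]))
      rw [h3] at h4; refine h4.trans ?_
      have h5 : S.ν (T x) (tder ℐ E T x w) ≤ α * S.ν x w := by
        rcases hw with hw | hw
        · refine (hsν x hx w hw).trans ?_; gcongr; nlinarith
        · exact S.c_rate x hx w hw
      calc _ ≤ C₁ * (C₂ * C₂) * (lam * α) ^ m * ((lam * S.ν x v) * (α * S.ν x w)) :=
            mul_le_mul_of_nonneg_left (mul_le_mul (hsν x hx v hv) h5 (apply_nonneg _ _)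
              (mul_nonneg hl.le (apply_nonneg (S.ν x) v))) (by positivity)
        _ = _ := by ring
  have hlim : Tendsto (fun m : ℕ => C₁ * (C₂ * C₂) * (lam * α) ^ m * (S.ν x v * S.ν x w)) atTop
      (𝓝 0) := by
    have := tendsto_pow_atTop_nhds_zero_of_lt_one (by positivity) hlα
    simpa using (this.const_mul (C₁ * (C₂ * C₂))).mul_const (S.ν x v * S.ν x w)
  exact abs_eq_zero.1 (le_antisymm (ge_of_tendsto' hlim fun m => key m x hx v w hv hw)
    (abs_nonneg _))

variable [CompactSpace N] [IsManifold J 1 N]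

lemma finrank_s_le (S : Splitting E J T ι α lam) (hι : ContMDiff J ℐ E 2 ι) (hemb : IsEmbedding ι)
    (himm : ∀ a, Injective (tder (E := E) J ι a)) {θ : OneForm E M} (hθ : θ.IsSmooth)
    (hΩ : θ.IsSymplecticPotential) (hTθ : Preserves T θ) {x : M} (hx : x ∈ range ι) :
    finrank ℝ (S.s x).range ≤ finrank ℝ (S.u x).range := by
  have hK : IsCompact (range ι) := isCompact_range hemb.continuous
  obtain ⟨A⟩ := ChartCover.exists_of_isCompact (E := E) hK
  obtain ⟨hs, hc, hu⟩ := S.continuousOn_lift A hι hemb himm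
  let L : (S.s x).range →ₗ[ℝ] Module.Dual ℝ (S.u x).range :=
    (Submodule.dualRestrict (S.u x).range) ∘ₗ (θ.dB x) ∘ₗ (S.s x).range.subtype
  have hL : Injective L := by
    rw [← ker_eq_bot, LinearMap.ker_eq_bot']; rintro ⟨_, v, rfl⟩ h
    have h1 := hΩ x (S.s x v) fun w => ?_
    · exact Subtype.ext h1
    have h2 : θ.dB x (S.s x v) (S.u x w) = 0 :=
      congrArg (fun l : Module.Dual ℝ (S.u x).range => l ⟨S.u x w, w, rfl⟩) h
    change θ.dB x (S.s x v) w = 0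
    rw [← S.add x hx w, map_add, map_add, h2,
      S.dB_eq_zero A hK hs hc hu hθ hTθ hx (S.s_s hx v) (Or.inl (S.s_s hx w)),
      S.dB_eq_zero A hK hs hc hu hθ hTθ hx (S.s_s hx v) (Or.inr (S.c_c hx w)), add_zero, add_zero]
  have := LinearMap.finrank_le_finrank_of_injective hL; rwa [Subspace.dual_finrank_eq] at this

/-- The contracted and the expanded subspaces have the same dimension. -/
theorem two_mul_finrank_s (S : Splitting E J T ι α lam) (hT : IsSmoothDiffeo (E := E) T)
    (hι : ContMDiff J ℐ E 2 ι) (hemb : IsEmbedding ι) (himm : ∀ a, Injective (tder (E := E) J ι a))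
    {θ : OneForm E M} (hθ : θ.IsSmooth) (hΩ : θ.IsSymplecticPotential) (hTθ : Preserves T θ)
    (hTθ' : Preserves T.symm θ) {x : M} (hx : x ∈ range ι) :
    2 * finrank ℝ (S.s x).range + finrank ℝ EA = finrank ℝ E := by
  have h1 := S.finrank_s_le hι hemb himm hθ hΩ hTθ hx
  have h2 : finrank ℝ (S.u x).range ≤ finrank ℝ (S.s x).range :=
    (S.symm hT).finrank_s_le hι hemb himm hθ hΩ hTθ' hx
  have h3 := S.finrank_add hx; rw [S.finrank_c himm hx] at h3; omega

lemma preserves_symm (hT : IsSmoothDiffeo (E := E) T) {θ : OneForm E M} (hTθ : Preserves T θ) :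
    Preserves T.symm θ := by
  intro y hy v w
  obtain ⟨x, hx, rfl⟩ : ∃ x ∈ T.source, T x = y := ⟨T.symm y, T.map_target hy, T.right_inv hy⟩
  have h1 : ∀ x', x' = x → ∀ v w : E, θ.dB x' v w = θ.dB x v w := by rintro _ rfl _ _; rfl
  let v' : E := tder ℐ E T.symm (T x) v; let w' : E := tder ℐ E T.symm (T x) w
  have h2 := hTθ x hx v' w'
  have h3 := congrArg₂ (fun a b : E => θ.dB (T x) a b) (tder_tder_symm hT hx v) (tder_tder_symm hT hx w)
  exact (h1 _ (T.left_inv hx) _ _).trans (h2.symm.trans h3)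

end Splitting
end

/-! ### Exactness of the scattering map -/

namespace HypSys

variable {V' : Type*} [EMetricSpace M] [ChartedSpace E M] [IsManifold ℐ E ∞ M]
  [NormedAddCommGroup V'] [NormedSpace ℝ V'] [FiniteDimensional ℝ V'] {S : HypSys M V}
  {S' : HypSys M V'} {n k : ℕ} {j : B → M}

lemma rateSpace_lam_le (S : HypSys M V) (Dm : ℕ → E →L[ℝ] V) :
    rateSpace Dm S.lam ≤ rateSpace Dm S.α₁ := by
  rintro w ⟨b, hb⟩; have h0 : 0 ≤ b := by simpa using (norm_nonneg _).trans (hb 0)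
  have h1 := S.lam_pos; refine ⟨b, fun m => (hb m).trans ?_⟩; gcongr
  exact (S.lam_lt_one.trans S.one_lt_α₁).le

lemma IsSmooth.mfderiv_mem_rateSpace (h : S.IsSmooth E n k) {b : B}
    (hj : MDiffAt j b)
    (hst : ∃ C, ∀ᶠ b' in 𝓝 b, ∃ x ∈ S.K, j b' ∈ S.piece C x) (w : EB) :
    (tder (E := E) ℐ EB j b w) ∈ rateSpace (S.orbitDeriv E (j b)) S.α₁ := by
  obtain ⟨C, hC⟩ := hst; have hb := (Ξ EB b).left_inv (mem_extChartAt_source b)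
  have h2 : ∀ b', b' = b → HasMFDerivAt ℐ EB ℐ E j b' (tder (E := E) ℐ EB j b) := by
    rintro _ rfl; exact hj.hasMFDerivAt
  have h1 : HasMFDerivAt ℐ EB ℐ E (fun v => j ((Ξ EB b).symm v))
      (Ξ EB b b) (tder (E := E) ℐ EB j b) :=
    ((h2 _ hb).comp (Ξ EB b b) (hasMFDerivAt_extChartAt_symm b))
  have hc : Tendsto (Ξ EB b).symm (𝓝 (Ξ EB b b)) (𝓝 b) := by
    have := (continuousAt_extChartAt_symm (I := ℐ EB) b).tendsto; rwa [hb] at this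
  have := h.mem_rateSpace_α₁ h1 (hc.eventually hC) w; rwa [hb] at this

/-- At a strongly transverse homoclinic point the manifold `B` has the dimension of the centre
bundle, and no tangent vector of `B` is contracted at the strong rate in either time direction. -/
lemma IsSmooth.transverse (h : S.IsSmooth E n k) (h' : S'.IsSmooth E n k)
    (hE : finrank ℝ E = 2 * n + k) {b : B} (hj : MDiffAt j b)
    (himm : Injective (tder (E := E) ℐ EB j b))
    (hst : ∃ C, ∀ᶠ b' in 𝓝 b, ∃ x ∈ S.K, j b' ∈ S.piece C x)
    (hst' : ∃ C, ∀ᶠ b' in 𝓝 b, ∃ x ∈ S'.K, j b' ∈ S'.piece C x) {x x' : M} (hx : x ∈ S.K)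
    (hx' : x' ∈ S'.K) (hy : j b ∈ leaf S.T S.lam x) (hy' : j b ∈ leaf S'.T S'.lam x')
    (hsum : IsDirectSum₃ (leafTangent (E := E) S.T S.lam x (j b))
      (leafTangent (E := E) S'.T S'.lam x' (j b)) (mfderiv% j b).range) :
    finrank ℝ EB = k ∧
      (∀ w, tder (E := E) ℐ EB j b w ∈ rateSpace (S.orbitDeriv E (j b)) S.lam → w = 0) ∧
      ∀ w, tder (E := E) ℐ EB j b w ∈ rateSpace (S'.orbitDeriv E (j b)) S'.lam → w = 0 := by
  let P : Submodule ℝ E := leafTangent (E := E) S.T S.lam x (j b)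
  let Q : Submodule ℝ E := leafTangent (E := E) S'.T S'.lam x' (j b)
  let R : Submodule ℝ E := (tder (E := E) ℐ EB j b).range; have hsum' : IsDirectSum₃ P Q R := hsum
  obtain ⟨d1, d2⟩ := h.finrank_rateSpace_le hx hy
  obtain ⟨d1', d2'⟩ := h'.finrank_rateSpace_le hx' hy'
  have hP : P ≤ rateSpace (S.orbitDeriv E (j b)) S.lam := fun w hw => h.leafTangent_le hx hw
  have hQ : Q ≤ rateSpace (S'.orbitDeriv E (j b)) S'.lam := fun w hw => h'.leafTangent_le hx' hw
  have hR : R ≤ rateSpace (S.orbitDeriv E (j b)) S.α₁ := by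
    rintro _ ⟨w, rfl⟩; exact h.mfderiv_mem_rateSpace hj hst w
  have hR' : R ≤ rateSpace (S'.orbitDeriv E (j b)) S'.α₁ := by
    rintro _ ⟨w, rfl⟩; exact h'.mfderiv_mem_rateSpace hj hst' w
  obtain ⟨f1, f2, f3⟩ := finrank_eq_of_isDirectSum₃ hsum' hP hQ (sup_le (hP.trans (S.rateSpace_lam_le _)) hR)
    (sup_le (hQ.trans (S'.rateSpace_lam_le _)) hR') d1 d1' d2 d2' hE
  have hz : ∀ {Z : Submodule ℝ E}, Disjoint R Z → ∀ w, tder (E := E) ℐ EB j b w ∈ Z → w = 0 :=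
    fun hd w hw => himm (((Submodule.disjoint_def.1 hd) _ ⟨w, rfl⟩ hw).trans (map_zero _).symm)
  exact ⟨(LinearMap.finrank_range_of_inj himm).symm.trans f1, hz f2, hz f3⟩

/-- The loop of the points of `B` in the leaves of the points of a loop in `K` has the same
integral. -/
theorem IsSmooth.loopIntegral_eq_of_section (h : S.IsSmooth E n k) {θ : OneForm E M}
    (hθ : θ.IsSmooth) {a : M → V →L[ℝ] ℝ} (hrep : S.Represents θ a) (hTθ : Preserves S.T θ)
    (hdom : (∀ x ∈ S.K, leaf S.T S.lam x ⊆ S.T.target) ∨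
      ∀ c : ℝ → M, CMDiff 1 c → Periodic c 1 → (∀ t, c t ∈ S.T.source) →
      θ.loopIntegral c = θ.loopIntegral fun t => S.T (c t))
    (hj : CMDiff 1 j) (himm : ∀ b, Injective (mfderiv% j b))
    (hst : ∀ b, ∃ C, ∀ᶠ b' in 𝓝 b, ∃ x ∈ S.K, j b' ∈ S.piece C x) (hdim : finrank ℝ EB = k)
    (hrate : ∀ b, ∀ w, (mfderiv% j b w : E) ∈ rateSpace (S.orbitDeriv E (j b)) S.lam → w = 0)
    {x : ℝ → M} (hx : CMDiff 1 x) (hx1 : Periodic x 1) (hxK : ∀ t, x t ∈ S.K)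
    {β : ℝ → B} (hβ : ∀ t, j (β t) ∈ leaf S.T S.lam (x t))
    (huniq : ∀ t b, j b ∈ leaf S.T S.lam (x t) → b = β t) :
    θ.loopIntegral x = θ.loopIntegral fun t => j (β t) := by
  obtain ⟨hβc, hpiece⟩ := contMDiff_section h hj himm hst hdim hrate hx hxK hβ huniq
  have hβ1 : Periodic β 1 := fun t => huniq t _ (by rw [← hx1 t]; exact hβ (t + 1))
  have hj1 : Periodic (fun t => j (β t)) 1 := fun t => by simp only [hβ1 t]
  obtain ⟨C, hC⟩ := exists_uniform_piece S.lam_pos.le hx1 hj1 hpiece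
  exact loopIntegral_eq hθ hrep h.diffeo.1 hTθ hdom hx (hj.comp hβc) hx1 hj1 hxK hC

end HypSys

end ScatteringMap

theorem proposition4
    -- the ambient manifold `M`, with an auxiliary Riemannian distance
    {E : Type*} [NormedAddCommGroup E] [NormedSpace ℝ E] [FiniteDimensional ℝ E]
    {M : Type*} [EMetricSpace M] [ChartedSpace E M] [IsManifold 𝓘(ℝ, E) ∞ M]
    [Bundle.RiemannianBundle (fun x : M => TangentSpace 𝓘(ℝ, E) x)]
    [IsContinuousRiemannianBundle E (fun x : M => TangentSpace 𝓘(ℝ, E) x)]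
    [IsRiemannianManifold 𝓘(ℝ, E) M]
    -- the exact symplectic form `Ω = dθ`
    (θ : ScatteringMap.OneForm E M) (hθ : θ.IsSmooth) (hΩ : θ.IsSymplecticPotential)
    -- the symplectic diffeomorphism `Φ`
    (Φ : OpenPartialHomeomorph M M) (hΦ : ScatteringMap.IsSmoothDiffeo (E := E) Φ)
    (hΦΩ : ScatteringMap.Preserves Φ θ)
    -- the compact invariant manifold `A`, possibly with boundary
    {EA : Type*} [NormedAddCommGroup EA] [NormedSpace ℝ EA] [FiniteDimensional ℝ EA]
    {HA : Type*} [TopologicalSpace HA] (J : ModelWithCorners ℝ EA HA)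
    {A : Type*} [TopologicalSpace A] [ChartedSpace HA A] [IsManifold J 2 A] [CompactSpace A]
    (ι : A → M) (hι : ContMDiff J 𝓘(ℝ, E) 2 ι) (hι_inj : Function.Injective ι)
    (hι_imm : ∀ a, Function.Injective (mfderiv J 𝓘(ℝ, E) ι a))
    (α lam : ℝ)
    (hA : ScatteringMap.IsSymmetricallyNormallyHyperbolic (E := E) J Φ ι α lam)
    -- either all iterates are defined along the invariant manifolds, or `Φ` is itself exact
    (hdom : ((∀ a, ScatteringMap.Euu Φ lam (ι a) ⊆ Φ.source) ∧
        (∀ a, ScatteringMap.Ess Φ lam (ι a) ⊆ Φ.target)) ∨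
      θ.IsExactOn 𝓘(ℝ, E) (id : M → M) Φ Φ.source)
    -- the manifold `B` of strongly transverse homoclinic points
    {EB : Type*} [NormedAddCommGroup EB] [NormedSpace ℝ EB] [FiniteDimensional ℝ EB]
    {B : Type*} [TopologicalSpace B] [ChartedSpace EB B] [IsManifold 𝓘(ℝ, EB) 1 B]
    (j : B → M)
    (hB : ScatteringMap.IsStronglyTransverseHomoclinic (E := E) 𝓘(ℝ, EB) Φ lam ι j)
    -- the scattering map on `A'`
    (A' : Set A) (F : A → A)
    (hF : ScatteringMap.IsScatteringMapOn Φ lam ι j F A')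
    (hF_diffeo : ScatteringMap.IsDiffeoOnto J F A')
    (hu : ∀ a ∈ A', ∃! b : B, j b ∈ ScatteringMap.Euu Φ lam (ι a))
    (hs : ∀ a ∈ A', ∃! b : B, j b ∈ ScatteringMap.Ess Φ lam (ι (F a))) :
    θ.IsExactOn J ι F A' := by
  haveI : IsManifold J 1 A := IsManifold.of_le (n := 2) (by norm_cast)
  have hemb : Topology.IsEmbedding ι := (hι.continuous.isClosedEmbedding hι_inj).isEmbedding
  have himm : ∀ a, Function.Injective (ScatteringMap.tder (E := E) J ι a) := hι_imm
  obtain ⟨S⟩ := ScatteringMap.exists_splitting hΦ hι hemb himm hA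
  have hΦ' : ScatteringMap.IsSmoothDiffeo (E := E) Φ.symm := ⟨hΦ.2, hΦ.1⟩
  have hΦΩ' := ScatteringMap.Splitting.preserves_symm hΦ hΦΩ
  have hd : ∀ x ∈ range ι, _ := fun x hx => S.two_mul_finrank_s hΦ hι hemb himm hθ hΩ hΦΩ hΦΩ' hx
  have hd' : ∀ x ∈ range ι, _ := fun x hx =>
    (S.symm hΦ).two_mul_finrank_s hΦ' hι hemb himm hθ hΩ hΦΩ' hΦΩ hx
  obtain ⟨n, hn⟩ : ∃ n, n = (Module.finrank ℝ E - Module.finrank ℝ EA) / 2 := ⟨_, rfl⟩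
  obtain ⟨_, H₁, hT₁, hK₁, hl₁, hs₁, a₁, hrep₁⟩ := S.exists_smooth_hypSys (n := n) hΦ hι hemb himm
    (fun x hx => by have := hd x hx; omega) hθ
  obtain ⟨_, H₂, hT₂, hK₂, hl₂, hs₂, a₂, hrep₂⟩ := (S.symm hΦ).exists_smooth_hypSys (n := n) hΦ' hι
    hemb himm (fun x hx => by have := hd' x hx; omega) hθ
  intro γ hγ hγ1 hγA
  have hE : Module.finrank ℝ E = 2 * n + Module.finrank ℝ EA := by
    have := hd _ (mem_range_self (γ 0)); omega
  have hst₁ : ∀ b, ∃ C, ∀ᶠ b' in 𝓝 b, ∃ x ∈ H₁.K, j b' ∈ ScatteringMap.leafPiece H₁.T H₁.lam C x := by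
    intro b
    obtain ⟨C, hC⟩ := hB.stable b
    rw [hT₁, hK₁, hl₁]
    exact ⟨C, hC.mono fun b' ⟨a, ha⟩ => ⟨_, mem_range_self a, ha⟩⟩
  have hst₂ : ∀ b, ∃ C, ∀ᶠ b' in 𝓝 b, ∃ x ∈ H₂.K, j b' ∈ ScatteringMap.leafPiece H₂.T H₂.lam C x := by
    intro b
    obtain ⟨C, hC⟩ := hB.unstable b
    rw [hT₂, hK₂, hl₂]
    exact ⟨C, hC.mono fun b' ⟨a, ha⟩ => ⟨_, mem_range_self a, ha⟩⟩
  have hp₁ : ∀ b, ∃ p, j b ∈ ScatteringMap.Ess Φ lam (ι p) := fun b => by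
    obtain ⟨C, hC⟩ := hB.stable b
    exact hC.self_of_nhds.imp fun p hp => ⟨C, hp⟩
  have hp₂ : ∀ b, ∃ p, j b ∈ ScatteringMap.Euu Φ lam (ι p) := fun b => by
    obtain ⟨C, hC⟩ := hB.unstable b
    exact hC.self_of_nhds.imp fun p hp => ⟨C, hp⟩
  choose p₁ hp₁ using hp₁
  choose p₂ hp₂ using hp₂
  have htr := fun b => hs₁.transverse (x := ι (p₁ b)) (x' := ι (p₂ b)) hs₂ hE
    (hB.contMDiff.mdifferentiable (by simp) b) (hB.immersion b) (hst₁ b) (hst₂ b)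
    (by rw [hK₁]; exact mem_range_self _) (by rw [hK₂]; exact mem_range_self _) (by rw [hT₁, hl₁]; exact hp₁ b)
    (by rw [hT₂, hl₂]; exact hp₂ b)
    (by rw [hT₁, hl₁, hT₂, hl₂]; exact hB.transverse b _ _ (hp₂ b) (hp₁ b))
  -- the points of `B` in the leaves along the loop
  choose β hβ using fun t => hu (γ t) (hγA t)
  have hβs : ∀ t, j (β t) ∈ ScatteringMap.Ess Φ lam (ι (F (γ t))) := by
    intro t
    obtain ⟨b, hb, hb'⟩ := (hF (γ t) (hγA t) (F (γ t))).2 rfl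
    rwa [← (hβ t).2 b hb]
  have e₁ := hs₁.loopIntegral_eq_of_section hθ hrep₁ (by rw [hT₁]; exact hΦΩ) (by
      rw [hT₁, hK₁, hl₁]
      refine hdom.imp (fun h => ?_) fun h c hc hc1 hcs => h c hc hc1 hcs
      rintro _ ⟨a, rfl⟩
      exact h.2 a) hB.contMDiff hB.immersion hst₁ (htr (β 0)).1 (fun b => (htr b).2.1)
    (x := fun t => ι (F (γ t)))
    ((hι.of_le (by norm_cast)).comp (hF_diffeo.1.comp_contMDiff hγ hγA))
    (fun t => by simp only [hγ1 t]) (by rw [hK₁]; exact fun t => mem_range_self _) (β := β)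
    (by rw [hT₁, hl₁]; exact hβs)
    (by rw [hT₁, hl₁]; exact fun t b hb => (hs (γ t) (hγA t)).unique hb (hβs t))
  have e₂ := hs₂.loopIntegral_eq_of_section hθ hrep₂ (by rw [hT₂]; exact hΦΩ') (by
      rw [hT₂, hK₂, hl₂]
      refine hdom.imp (fun h => ?_) fun h c hc hc1 hcs => ?_
      · rintro _ ⟨a, rfl⟩
        exact h.1 a
      · have h1 : ContMDiff 𝓘(ℝ, ℝ) 𝓘(ℝ, E) 1 fun t => Φ.symm (c t) :=
          (hΦ.2.of_le (by norm_cast)).comp_contMDiff hc hcs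
        have h2 := h _ h1 (fun t => by simp only [hc1 t]) fun t => Φ.map_target (hcs t)
        simp only [id, Φ.right_inv (hcs _)] at h2
        exact h2.symm) hB.contMDiff hB.immersion hst₂ (htr (β 0)).1 (fun b => (htr b).2.2)
    (x := fun t => ι (γ t)) ((hι.of_le (by norm_cast)).comp hγ)
    (fun t => by simp only [hγ1 t]) (by rw [hK₂]; exact fun t => mem_range_self _) (β := β)
    (by rw [hT₂, hl₂]; exact fun t => (hβ t).1)
    (by rw [hT₂, hl₂]; exact fun t b hb => (hβ t).2 b hb)
  exact e₂.trans e₁.symm
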